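/- Conventions. For each $n\in\mathbb N$ let $|\psi_n\rangle$ be a normalized $n$-qubit state. An $n$-bit string $x=(x_0,\dots,x_{n-1})$ is identified with the integer $\sum_j x_j2^j\in\mathbb Z_{2^n}$. Algorithms are programs for a randomized random-access machine on integers with fair coin flips, where an operation costs one plus the bit length of its operands (logarithmic cost); running times are worst-case, over all coin flips. Real or complex parameters of an algorithm are given to it by arbitrary binary approximations: a query for a parameter $z$ to $m$ binary digits costs at least $m$ and returns integers $a,b$ with $|(a+b\,i)/2^m-z|\le 2^{-m}$. The family $(|\psi_n\rangle)_n$ is *computationally tractable* (CT) if (i) there is a randomized classical algorithm which, on input $(n,m)$, samples in time $\mathrm{poly}(n,m)$ from a distribution at $\ell_1$-distance at most $2^{-m}$ from $\{|\langle x|\psi_n\rangle|^2\}_x$ on the set of $n$-bit strings (strictly: $\sum_x|\Pr[\text{output}=x]-|\langle x|\psi_n\rangle|^2|\le 2^{-m}$), and (ii) there is a classical algorithm which, on input $(n,x,m)$, computes $\langle x|\psi_n\rangle$ up to an error $2^{-m}$ in time $\mathrm{poly}(n,m)$. The Fourier basis is $|F_x\rangle=2^{-n/2}\sum_{y}e^{2\pi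 i xy/2^n}|y\rangle$, where $x$ and $y$ are $n$-bit strings. **Theorem.** Let $(|\psi_n\rangle)_n$ be a CT family, and write $|\psi_n\rangle=\sum_x\hat\psi_x|F_x\rangle$. (1) There is a randomized classical algorithm which, for all $n$, all real $\theta>0$ and all $0<\pi\le1$, on input $n$ and with parameters $1/\theta$ and $1/\pi$, runs in time $\mathrm{poly}(n,\frac1\theta,\log\frac1\pi)$ and always outputs a list $L$ of at most $2/\theta$ strings of $n$ bits, such that with probability at least $1-\pi$ both of the following hold: (a) every $x\in L$ satisfies $|\hat\psi_x|^2\ge\theta/2$; (b) every $n$-bit string $x$ with $|\hat\psi_x|^2\ge\theta$ belongs to $L$. (2) There is a randomized classical algorithm which, for all $n$, all $n$-bit strings $x$, all real $\varepsilon>0$ and all $0<\delta\le1$, on input $(n,x)$ and with parameters $1/\varepsilon$ and $1/\delta$, runs in time $\mathrm{poly}(n,\frac1\varepsilon,\log\frac1\delta)$ and outputs, with probability at least $1-\delta$, a complex number at distance at most $\varepsilon$ from $\hat\psi_x$. (3) Both (1) and (2) hold with the Fourier basis replaced by the product basis $\{U|x\rangle\}_x$, where $U=U_1\otimes\cdots\otimes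 U_n$ is an arbitrary tensor product of one-qubit unitary operators, whose matrix entries are additional parameters of the algorithm; in each case one algorithm and one polynomial bound serve all $n$ and all $U$. -/

import Mathlib

/-! # A randomized random-access machine with logarithmic (bit-length) cost -/

namespace CTState

/-- The memory: one integer per address. -/
abbrev Mem := ℕ → ℤ

/-- The memory holding the integers of `l` at the addresses `0, 1, …` and `0` elsewhere. -/
def Mem.ofList (l : List ℤ) : Mem := fun i => l.getD i 0

/-- Write the integers `vs` to the addresses `rs`, one after the other. -/
def Mem.write (M : Mem) : List ℕ → List ℤ → Mem
  | r :: rs, v :: vs => Mem.write (Function.update M r v) rs vs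
  | _, _ => M

/-- The number of bits of an integer (without sign). -/
def bitLen (z : ℤ) : ℕ := Nat.size z.natAbs

/-- The total number of bits of a list of integers. -/
def bitLens (l : List ℤ) : ℕ := (l.map bitLen).sum

/-- The access of a machine to real or complex parameters: the parameter with name `idx`, asked
for to `m` binary digits, is answered by two integers `(a, b)`, which stand for
`(a + b * i) / 2 ^ m`. -/
abbrev Oracle := List ℤ → ℕ → ℤ × ℤ

/-- The complex number `(a + b * i) / 2 ^ m`. -/
noncomputable def dyadic (a b : ℤ) (m : ℕ) : ℂ := ((a : ℂ) + (b : ℂ) * Complex.I) / 2 ^ m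

/-- `O` answers every question about the parameters `z` with error at most `2 ^ (-m)`. -/
def Oracle.Approximates (O : Oracle) (z : List ℤ → ℂ) : Prop :=
  ∀ (idx : List ℤ) (m : ℕ), ‖dyadic (O idx m).1 (O idx m).2 m - z idx‖ ≤ 1 / 2 ^ m

/-- The oracle of a machine without parameters. -/
def Oracle.none : Oracle := fun _ _ => (0, 0)

/-- Deterministic instructions. Below, `[r]` is the integer stored at address `r`.
* `const r z`: `[r] := z`
* `add`, `sub`, `mul`, `div` with arguments `r a b`: `[r] := [a] + [b]`, etc., where `div` is
  the integer quotient (`0` if the divisor is `0`)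
* `load r a`: `[r] := [[a]]`, and `store a r`: `[[a]] := [r]` (indirect addressing)
* `query r s idx p`: ask the oracle for the parameter whose name is stored at the addresses `idx`,
  to `[p]` binary digits, and store the two parts of the answer at `r` and `s`. -/
inductive Instr
  | const (r : ℕ) (z : ℤ)
  | add (r a b : ℕ)
  | sub (r a b : ℕ)
  | mul (r a b : ℕ)
  | div (r a b : ℕ)
  | load (r a : ℕ)
  | store (a r : ℕ)
  | query (r s : ℕ) (idx : List ℕ) (p : ℕ)

/-- The memory after an instruction. -/
def Instr.run (O : Oracle) (M : Mem) : Instr → Mem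
  | .const r z => Function.update M r z
  | .add r a b => Function.update M r (M a + M b)
  | .sub r a b => Function.update M r (M a - M b)
  | .mul r a b => Function.update M r (M a * M b)
  | .div r a b => Function.update M r (M a / M b)
  | .load r a => Function.update M r (M (M a).toNat)
  | .store a r => Function.update M (M a).toNat (M r)
  | .query r s idx p =>
      Function.update (Function.update M r (O (idx.map M) (M p).toNat).1) s
        (O (idx.map M) (M p).toNat).2

/-- The cost of an instruction: one plus the bit lengths of the integers involved. A question to
the oracle for `m` binary digits also costs `m`. -/
def Instr.cost (O : Oracle) (M : Mem) : Instr → ℕ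
  | .const _ z => 1 + bitLen z
  | .add _ a b | .sub _ a b | .mul _ a b | .div _ a b => 1 + bitLen (M a) + bitLen (M b)
  | .load _ a => 1 + bitLen (M a) + bitLen (M (M a).toNat)
  | .store a r => 1 + bitLen (M a) + bitLen (M r)
  | .query _ _ idx p => 1 + bitLens (idx.map M) + bitLen (M p) + (M p).toNat +
      bitLen (O (idx.map M) (M p).toNat).1 + bitLen (O (idx.map M) (M p).toNat).2

/-- Programs. `flip r` stores a fair random bit at `r`; `ite r c c'` and `loop r c` (a while
loop) test whether `[r] > 0`; `call c args rets` runs `c` on a fresh memory whose first cells hold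
the integers stored at `args`, and then copies the first cells of that memory to `rets`. -/
inductive Prog
  | skip
  | instr (i : Instr)
  | flip (r : ℕ)
  | seq (c c' : Prog)
  | ite (r : ℕ) (c c' : Prog)
  | loop (r : ℕ) (c : Prog)
  | call (c : Prog) (args rets : List ℕ)

/-- Add `t` to the elapsed time of the outcome `y`. -/
def delay (t : ℕ) (y : Mem × ℕ) : Mem × ℕ := (y.1, t + y.2)

/-- The outcome of a procedure call made from memory `M`, from the outcome `y` of the callee. -/
def callReturn (M : Mem) (args rets : List ℕ) (y : Mem × ℕ) : Mem × ℕ :=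
  (M.write rets ((List.range rets.length).map y.1),
    1 + bitLens (args.map M) + y.2 + bitLens ((List.range rets.length).map y.1))

/-- `Exec O c M μ`: started on memory `M`, the program `c` halts for all outcomes of its coin
flips, and `μ` is the joint distribution of the final memory and the running time. -/
inductive Exec (O : Oracle) : Prog → Mem → PMF (Mem × ℕ) → Prop
  | skip (M : Mem) : Exec O .skip M (PMF.pure (M, 1))
  | instr (i : Instr) (M : Mem) : Exec O (.instr i) M (PMF.pure (i.run O M, i.cost O M))
  | flip (r : ℕ) (M : Mem) :
      Exec O (.flip r) M ((PMF.uniformOfFintype Bool).map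
        fun b => (Function.update M r (if b then 1 else 0), 1))
  | seq (c c' : Prog) (M : Mem) (μ : PMF (Mem × ℕ)) (κ : Mem → PMF (Mem × ℕ)) :
      Exec O c M μ → (∀ y ∈ μ.support, Exec O c' y.1 (κ y.1)) →
      Exec O (.seq c c') M (μ.bind fun y => (κ y.1).map (delay y.2))
  | ite_pos (r : ℕ) (c c' : Prog) (M : Mem) (μ : PMF (Mem × ℕ)) :
      0 < M r → Exec O c M μ → Exec O (.ite r c c') M (μ.map (delay (1 + bitLen (M r))))
  | ite_neg (r : ℕ) (c c' : Prog) (M : Mem) (μ : PMF (Mem × ℕ)) :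
      M r ≤ 0 → Exec O c' M μ → Exec O (.ite r c c') M (μ.map (delay (1 + bitLen (M r))))
  | loop_done (r : ℕ) (c : Prog) (M : Mem) :
      M r ≤ 0 → Exec O (.loop r c) M (PMF.pure (M, 1 + bitLen (M r)))
  | loop_step (r : ℕ) (c : Prog) (M : Mem) (μ : PMF (Mem × ℕ)) :
      0 < M r → Exec O (.seq c (.loop r c)) M μ →
      Exec O (.loop r c) M (μ.map (delay (1 + bitLen (M r))))
  | call (c : Prog) (args rets : List ℕ) (M : Mem) (μ : PMF (Mem × ℕ)) :
      Exec O c (Mem.ofList (args.map M)) μ →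
      Exec O (.call c args rets) M (μ.map (callReturn M args rets))

/-- The probability that the final memory satisfies `E`. -/
noncomputable def prob (μ : PMF (Mem × ℕ)) (E : Mem → Prop) : ℝ :=
  (μ.toOuterMeasure {y | E y.1}).toReal

/-! # States, bases, and computationally tractable families -/

/-- `n`-bit strings. -/
abbrev Bits (n : ℕ) := Fin n → Bool

/-- The integer with the binary digits `x`, where digit number `j` has weight `2 ^ j`. -/
def Bits.toNat {n : ℕ} (x : Bits n) : ℕ := ∑ j : Fin n, if x j then 2 ^ (j : ℕ) else 0

/-- The Hilbert space of `n` qubits, with the computational basis indexed by `n`-bit strings. -/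
abbrev QState (n : ℕ) := EuclideanSpace ℂ (Bits n)

/-- The Fourier basis vector `|F_x⟩`, which is the image of `|x⟩` under the quantum Fourier
transform over the integers modulo `2 ^ n`. -/
noncomputable def fourierVec {n : ℕ} (x : Bits n) : QState n :=
  WithLp.toLp 2 fun y => ((1 / Real.sqrt (2 ^ n) : ℝ) : ℂ) *
    Complex.exp (2 * Real.pi * Complex.I * (y.toNat * x.toNat) / 2 ^ n)

/-- The product basis vector `U |x⟩`, where `U` is the tensor product of the one-qubit unitary
operators `U j`. -/
noncomputable def productVec {n : ℕ} (U : Fin n → Matrix.unitaryGroup Bool ℂ) (x : Bits n) :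
    QState n :=
  WithLp.toLp 2 fun y => ∏ j, (U j : Matrix Bool Bool ℂ) (y j) (x j)

/-- A family of states, one for each number `n` of qubits, is computationally tractable if
* the distribution `|⟨x|ψ⟩|²` can be sampled from (with error at most `2 ^ (-m)` in `ℓ¹` distance)
  in time polynomial in `n` and `m`, and
* the coefficients `⟨x|ψ⟩` can be computed (to `m` binary digits) in time polynomial in
  `n` and `m`. -/
def IsCT (ψ : ∀ n, QState n) : Prop :=
  (∀ n, ‖ψ n‖ = 1) ∧
  (∃ (S : Prog) (C d : ℕ), ∀ n m : ℕ,
    ∃ μ, Exec Oracle.none S (Mem.ofList [(n : ℤ), (m : ℤ)]) μ ∧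
      (∀ y ∈ μ.support, y.2 ≤ C * (1 + n + m) ^ d) ∧
      ∑ x : Bits n, |prob μ (fun M => M 0 = x.toNat) - ‖ψ n x‖ ^ 2| ≤ 1 / 2 ^ m) ∧
  (∃ (Q : Prog) (C d : ℕ), ∀ (n m : ℕ) (x : Bits n),
    ∃ μ, Exec Oracle.none Q (Mem.ofList [(n : ℤ), (x.toNat : ℤ), (m : ℤ)]) μ ∧
      ∀ y ∈ μ.support, y.2 ≤ C * (1 + n + m) ^ d ∧
        ‖dyadic (y.1 0) (y.1 1) m - ψ n x‖ ≤ 1 / 2 ^ m)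

/-! # What the algorithms achieve -/

/-- Two real parameters `a`, `b`, named `[0]` and `[1]`. -/
noncomputable def realParams (a b : ℝ) : List ℤ → ℂ
  | [0] => a
  | [1] => b
  | _ => 0

/-- Two real parameters as before and the entries of the matrices `U j`, where the entry in row
`s` and column `t` of `U j` is named `[2, j, s, t]`. -/
noncomputable def productParams {n : ℕ} (a b : ℝ) (U : Fin n → Matrix.unitaryGroup Bool ℂ) :
    List ℤ → ℂ
  | [2, j, s, t] =>
      if h : 0 ≤ j ∧ j.toNat < n then
        (U ⟨j.toNat, h.2⟩ : Matrix Bool Bool ℂ) (decide (s ≠ 0)) (decide (t ≠ 0))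
      else 0
  | idx => realParams a b idx

/-- The output convention for lists of strings: the length is at address `0`, followed by the
strings. -/
def OutputsList {n : ℕ} (M : Mem) (L : List (Bits n)) : Prop :=
  M 0 = L.length ∧ ∀ (i : ℕ) (h : i < L.length), M (i + 1) = (L[i].toNat : ℤ)

/-- The program `A` always halts within time `T` with a list of at most `2 / θ` strings of `n` bits,
and with probability at least `1 - π` all strings `x` in the list have weight `‖c x‖ ^ 2 ≥ θ / 2`
and all strings of weight at least `θ` are in the list. -/
def FindsLargeWeights (O : Oracle) (A : Prog) (input : List ℤ) {n : ℕ} (c : Bits n → ℂ)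
    (θ π T : ℝ) : Prop :=
  ∃ μ, Exec O A (Mem.ofList input) μ ∧
    (∀ y ∈ μ.support, (y.2 : ℝ) ≤ T ∧
      ∃ L : List (Bits n), OutputsList y.1 L ∧ (L.length : ℝ) ≤ 2 / θ) ∧
    1 - π ≤ prob μ (fun M => ∃ L : List (Bits n), OutputsList M L ∧
      (∀ x ∈ L, θ / 2 ≤ ‖c x‖ ^ 2) ∧ (∀ x, θ ≤ ‖c x‖ ^ 2 → x ∈ L))

/-- The program `A` always halts within time `T`, and with probability at least `1 - δ` its output,
the number `([0] + [1] * i) / 2 ^ [2]`, is an `ε`-approximation of `z`. -/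
def Estimates (O : Oracle) (A : Prog) (input : List ℤ) (z : ℂ) (ε δ T : ℝ) : Prop :=
  ∃ μ, Exec O A (Mem.ofList input) μ ∧
    (∀ y ∈ μ.support, (y.2 : ℝ) ≤ T) ∧
    1 - δ ≤ prob μ (fun M => ‖dyadic (M 0) (M 1) (M 2).toNat - z‖ ≤ ε)

end CTState

/-!
Both kinds of bases consist of product vectors `⨂ j, g a j`, with amplitudes `g a j b` that can be
computed to any accuracy, and in both cases the labels are the leaves of a binary tree of depth `n`
such that the vectors below a node `a` of level `k` agree on the last `k` qubits and span, together,
everything on the other qubits (`ProductBasis`, with the instances `fourierBasis` and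
`productBasis`). The sum `wt k a` of the weights `|c x|²` below a node is therefore the squared norm
of the partial inner product of the state with one product vector on the last `k` qubits, and the
weight of a node is the sum of the weights of its two children (`wt_children`).

Each of these weights is the mean of a bounded random variable that can be sampled efficiently: a
string `y` is drawn from the state and a string `h` from the product vector of the node, and `y'` is
`y` with its last `k` bits replaced by `h`. The real part of
`ratio u v = 2 conj u * v / (|u|² + |v|²)`, applied to the products of the amplitudes of the state
at one of `y`, `y'` and of the product vector at the other, has modulus at most one and the right
expectation (`sum_ratio_pair`). In the same way, a coefficient is the mean of ratios of amplitudes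
of the state and of the basis vector (`sum_ratio_single`). The ratios are unstable where both
amplitudes are small, but this happens with a correspondingly small probability, so that amplitudes
computed to polynomially many digits suffice (`norm_ratio_sub_le`, `abs_ev_weightEst_sub_le`,
`abs_ev_coeffEst_sub_le`). With the Chernoff bound `pr_sumDist_le`, polynomially many samples give a
mean as accurate and as reliable as needed, and hence the algorithm for a coefficient
(`exists_estimateCoeff`).

For the large weights, the tree is searched from the root, and the search descends from those nodes
whose estimated weight is at least about `3 / 4 * θ`. As long as no test errs, the nodes accepted on
a level have weights at least `5 / 8 * θ` and total weight at most one, so that a list with at most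
`2 / θ` entries never overflows where it matters, and no node above a label of weight at least `θ`
is lost (`pr_treeDist_le`). The length of the lists is capped at `2 / θ` in any case, which bounds
the running time for all outcomes of the coin flips.

The rest is programming. `Runs` and `Computes` describe the effect of programs on memories and on
arguments, with a worst-case bound for the running time; all bounds are polynomials in a number `s`
that dominates the sizes of the inputs (`PolyB`). The real parameters enter through finitely many
digits (`exists_readParams`). The amplitudes of a product basis are parameters. Those of the Fourier
basis are computed from the roots of unity of order `2 ^ k`, which half-angle formulas give by
integer square roots (`norm_cosSin_sub_le`, `norm_phase_sub_le`). The programs of a computationally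
tractable family are used in the presence of parameters by removing their queries (`Exec.strip`).
-/

namespace CTState

/-! ### Running programs -/

/-- If started on the memory `M`, the program `c` always halts within time `T`, and `ν` is the
distribution of the final memory. -/
def Runs (O : Oracle) (c : Prog) (M : Mem) (ν : PMF Mem) (T : ℕ) : Prop :=
  ∃ μ, Exec O c M μ ∧ μ.map Prod.fst = ν ∧ ∀ y ∈ μ.support, y.2 ≤ T

theorem pmf_bind_congr {α β : Type*} {μ : PMF α} {f g : α → PMF β}
    (h : ∀ a ∈ μ.support, f a = g a) : μ.bind f = μ.bind g := by
  ext b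
  simp only [PMF.bind_apply]
  refine tsum_congr fun a => ?_
  by_cases ha : a ∈ μ.support
  · rw [h a ha]
  · rw [(PMF.apply_eq_zero_iff μ a).2 ha, zero_mul, zero_mul]

theorem map_delay_fst (μ : PMF (Mem × ℕ)) (t : ℕ) :
    (μ.map (delay t)).map Prod.fst = μ.map Prod.fst := by
  rw [PMF.map_comp]; rfl

namespace Runs

variable {O : Oracle} {c c' : Prog} {M : Mem} {ν : PMF Mem} {T T' : ℕ}

theorem mono (h : Runs O c M ν T) (hT : T ≤ T') : Runs O c M ν T' := by
  obtain ⟨μ, h1, h2, h3⟩ := h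
  exact ⟨μ, h1, h2, fun y hy => (h3 y hy).trans hT⟩

theorem seq {κ : Mem → PMF Mem} (h : Runs O c M ν T)
    (h' : ∀ N ∈ ν.support, Runs O c' N (κ N) T') :
    Runs O (.seq c c') M (ν.bind κ) (T + T') := by
  classical
  obtain ⟨μ, h1, h2, h3⟩ := h
  choose! F hF1 hF2 hF3 using h'
  have hsup : ∀ y ∈ μ.support, y.1 ∈ ν.support := by
    intro y hy
    rw [← h2, PMF.mem_support_map_iff]
    exact ⟨y, hy, rfl⟩
  refine ⟨_, Exec.seq c c' M μ F h1 fun y hy => hF1 _ (hsup y hy), ?_, ?_⟩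
  · rw [PMF.map_bind, ← h2, PMF.bind_map]
    refine pmf_bind_congr fun y hy => ?_
    rw [map_delay_fst]
    exact hF2 _ (hsup y hy)
  · intro y hy
    rw [PMF.mem_support_bind_iff] at hy
    obtain ⟨z, hz, hy⟩ := hy
    rw [PMF.mem_support_map_iff] at hy
    obtain ⟨w, hw, rfl⟩ := hy
    exact add_le_add (h3 z hz) (hF3 _ (hsup z hz) w hw)

theorem seq_pure {N : Mem} (h : Runs O c M (PMF.pure N) T) (h' : Runs O c' N ν T') :
    Runs O (.seq c c') M ν (T + T') := by
  have := seq (κ := fun _ => ν) h (by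
    intro N' hN'
    rw [PMF.support_pure, Set.mem_singleton_iff] at hN'
    rwa [hN'])
  rwa [PMF.pure_bind] at this

theorem instr (i : Instr) (h : i.cost O M ≤ T) :
    Runs O (.instr i) M (PMF.pure (i.run O M)) T :=
  ⟨_, Exec.instr i M, by rw [PMF.pure_map], by simpa using h⟩

theorem skip : Runs O .skip M (PMF.pure M) 1 :=
  ⟨_, Exec.skip M, by rw [PMF.pure_map], by simp⟩

theorem flip (r : ℕ) : Runs O (.flip r) M
    ((PMF.uniformOfFintype Bool).map fun b => Function.update M r (if b then 1 else 0)) 1 :=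
  ⟨_, Exec.flip r M, by rw [PMF.map_comp]; rfl, by
    intro y hy
    rw [PMF.mem_support_map_iff] at hy
    obtain ⟨b, -, rfl⟩ := hy
    exact le_rfl⟩

theorem ite {r : ℕ} (h : 0 < M r → Runs O c M ν T) (h' : ¬ 0 < M r → Runs O c' M ν T) :
    Runs O (.ite r c c') M ν (1 + bitLen (M r) + T) := by
  by_cases h0 : 0 < M r
  · obtain ⟨μ, h1, h2, h3⟩ := h h0
    refine ⟨_, Exec.ite_pos r c c' M μ h0 h1, by rw [map_delay_fst, h2], ?_⟩
    intro y hy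
    rw [PMF.mem_support_map_iff] at hy
    obtain ⟨b, hb, rfl⟩ := hy
    exact Nat.add_le_add_left (h3 b hb) _
  · obtain ⟨μ, h1, h2, h3⟩ := h' h0
    refine ⟨_, Exec.ite_neg r c c' M μ (not_lt.1 h0) h1, by rw [map_delay_fst, h2], ?_⟩
    intro y hy
    rw [PMF.mem_support_map_iff] at hy
    obtain ⟨b, hb, rfl⟩ := hy
    exact Nat.add_le_add_left (h3 b hb) _

theorem call {args rets : List ℕ} {B : ℕ} (h : Runs O c (Mem.ofList (args.map M)) ν T)
    (hB : ∀ N ∈ ν.support, bitLens ((List.range rets.length).map N) ≤ B) :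
    Runs O (.call c args rets) M
      (ν.map fun N => M.write rets ((List.range rets.length).map N))
      (1 + bitLens (args.map M) + T + B) := by
  obtain ⟨μ, h1, h2, h3⟩ := h
  refine ⟨_, Exec.call c args rets M μ h1, ?_, ?_⟩
  · rw [← h2, PMF.map_comp, PMF.map_comp]; rfl
  · intro y hy
    rw [PMF.mem_support_map_iff] at hy
    obtain ⟨z, hz, rfl⟩ := hy
    have h4 := hB z.1 (by rw [← h2, PMF.mem_support_map_iff]; exact ⟨z, hz, rfl⟩)
    have h5 := h3 z hz
    simp only [callReturn]
    omega

end Runs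

/-- The outcome of a program is determined by the memory it starts from. -/
theorem Exec.unique {O : Oracle} {c : Prog} {M : Mem} {μ μ' : PMF (Mem × ℕ)}
    (h : Exec O c M μ) (h' : Exec O c M μ') : μ = μ' := by
  induction h generalizing μ' with
  | skip M => cases h'; rfl
  | instr i M => cases h'; rfl
  | flip r M => cases h'; rfl
  | seq c c' M μ κ _ _ ih1 ih2 =>
    cases h' with
    | seq _ _ _ μ₁ κ₁ a1 a2 =>
      obtain rfl := ih1 a1
      exact pmf_bind_congr fun y hy => by rw [ih2 y hy (a2 y hy)]
  | ite_pos r c c' M μ h0 _ ih =>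
    cases h' with
    | ite_pos _ _ _ _ _ _ a => rw [ih a]
    | ite_neg _ _ _ _ _ a0 _ => omega
  | ite_neg r c c' M μ h0 _ ih =>
    cases h' with
    | ite_pos _ _ _ _ _ a0 _ => omega
    | ite_neg _ _ _ _ _ _ a => rw [ih a]
  | loop_done r c M h0 =>
    cases h' with
    | loop_done => rfl
    | loop_step _ _ _ _ a0 _ => omega
  | loop_step r c M μ h0 _ ih =>
    cases h' with
    | loop_done _ _ _ a0 => omega
    | loop_step _ _ _ _ _ a => rw [ih a]
  | call c args rets M μ _ ih =>
    cases h' with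
    | call _ _ _ _ _ a => rw [ih a]

theorem Runs.unique {O : Oracle} {c : Prog} {M : Mem} {ν ν' : PMF Mem} {T T' : ℕ}
    (h : Runs O c M ν T) (h' : Runs O c M ν' T') : ν = ν' := by
  obtain ⟨μ, h1, h2, -⟩ := h
  obtain ⟨μ', h1', h2', -⟩ := h'
  rw [← h2, ← h2', h1.unique h1']

theorem Runs.seq_map {O : Oracle} {c c' : Prog} {M : Mem} {T T' : ℕ} {σ : Type*} {p : PMF σ}
    {e : σ → Mem} {κ : σ → PMF Mem} (h : Runs O c M (p.map e) T)
    (h' : ∀ a ∈ p.support, Runs O c' (e a) (κ a) T') :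
    Runs O (.seq c c') M (p.bind κ) (T + T') := by
  have h1 : ∀ N ∈ (p.map e).support, ∃ ν, Runs O c' N ν T' := by
    intro N hN
    rw [PMF.mem_support_map_iff] at hN
    obtain ⟨a, ha, rfl⟩ := hN
    exact ⟨_, h' a ha⟩
  choose! F hF using h1
  have h2 := h.seq hF
  rw [PMF.bind_map] at h2
  have h3 : p.bind (F ∘ e) = p.bind κ := pmf_bind_congr fun a ha => (hF _ (by
    rw [PMF.mem_support_map_iff]; exact ⟨a, ha, rfl⟩)).unique (h' a ha)
  rwa [h3] at h2

/-- `r` steps of a time-dependent Markov chain with transition kernels `K i`, from time `i`. -/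
noncomputable def chainFrom {σ : Type*} (K : ℕ → σ → PMF σ) : ℕ → ℕ → σ → PMF σ
  | _, 0, s => PMF.pure s
  | i, r + 1, s => (K i s).bind (chainFrom K (i + 1) r)

/-- The distribution after `k` steps of a Markov chain with transition kernels `K i`. -/
noncomputable def chain {σ : Type*} (K : ℕ → σ → PMF σ) (s : σ) : ℕ → PMF σ
  | 0 => PMF.pure s
  | k + 1 => (chain K s k).bind (K k)

theorem chain_bind_chainFrom {σ : Type*} (K : ℕ → σ → PMF σ) (s : σ) (r i : ℕ) :
    (chain K s i).bind (chainFrom K i r) = chain K s (i + r) := by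
  induction r generalizing i with
  | zero => simp only [chainFrom, add_zero]; exact PMF.bind_pure _
  | succ r ih =>
    have := ih (i + 1)
    rw [show i + (r + 1) = i + 1 + r by ring, ← this, chain, PMF.bind_bind]
    rfl

theorem chain_support {σ : Type*} {K : ℕ → σ → PMF σ} {s : σ} {I : ℕ → σ → Prop} {k : ℕ}
    (h0 : I 0 s) (hs : ∀ i < k, ∀ a, I i a → ∀ b ∈ (K i a).support, I (i + 1) b) :
    ∀ b ∈ (chain K s k).support, I k b := by
  induction k with
  | zero => intro b hb; simp only [chain, PMF.support_pure, Set.mem_singleton_iff] at hb; rwa [hb]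
  | succ k ih =>
    intro b hb
    rw [chain, PMF.mem_support_bind_iff] at hb
    obtain ⟨a, ha, hb⟩ := hb
    exact hs k (Nat.lt_succ_self k) a (ih (fun i hi => hs i (by omega)) a ha) b hb

/-- A `loop` whose `i`-th round performs, on an encoding `e i s` of an abstract state `s`, the
`i`-th step of a Markov chain of abstract states, and whose test first fails after `k` rounds. -/
theorem Runs.loop {O : Oracle} {c : Prog} {r k R T B : ℕ} {σ : Type*} (hk : k ≤ R) (K : ℕ → σ → PMF σ)
    (e : ℕ → σ → Mem) (I : ℕ → σ → Prop) (s : σ) (h0 : I 0 s)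
    (hpos : ∀ i < k, ∀ a, I i a → 0 < e i a r) (hend : ∀ a, I k a → e k a r ≤ 0)
    (hB : ∀ i ≤ k, ∀ a, I i a → bitLen (e i a r) ≤ B)
    (hstep : ∀ i < k, ∀ a, I i a → ∀ b ∈ (K i a).support, I (i + 1) b)
    (hrun : ∀ i < k, ∀ a, I i a → Runs O c (e i a) ((K i a).map (e (i + 1))) T) :
    Runs O (.loop r c) (e 0 s) ((chain K s k).map (e k)) ((R + 1) * (1 + B + T)) := by
  have key : ∀ m i, i + m = k → ∀ a, I i a → Runs O (.loop r c) (e i a)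
      ((chainFrom K i m a).map (e k)) ((m + 1) * (1 + B + T)) := by
    intro m
    induction m with
    | zero =>
      intro i hi a ha
      have hi : i = k := by omega
      subst hi
      refine ⟨_, Exec.loop_done r c _ (hend a ha), ?_, ?_⟩
      · simp only [chainFrom, PMF.pure_map]
      · have := hB i le_rfl a ha
        simp only [PMF.support_pure, Set.mem_singleton_iff, forall_eq]
        omega
    | succ m ih =>
      intro i hi a ha
      obtain ⟨μ, g1, g2, g3⟩ := Runs.seq_map (c' := .loop r c) (hrun i (by omega) a ha)
        fun b hb => ih (i + 1) (by omega) b (hstep i (by omega) a ha b hb)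
      refine ⟨_, Exec.loop_step r c _ μ (hpos i (by omega) a ha) g1, ?_, ?_⟩
      · rw [map_delay_fst, g2, chainFrom, PMF.map_bind]
      · intro y hy
        rw [PMF.mem_support_map_iff] at hy
        obtain ⟨z, hz, rfl⟩ := hy
        have h4 := g3 z hz
        have h5 := hB i (by omega) a ha
        simp only [delay]
        linarith
  have := key k 0 (by omega) s h0
  have h2 := chain_bind_chainFrom K s k 0
  rw [chain, PMF.pure_bind, zero_add] at h2
  rw [h2] at this
  exact this.mono (Nat.mul_le_mul_right _ (by omega))

/-! ### Bit lengths -/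

theorem bitLen_le_iff {z : ℤ} {b : ℕ} : bitLen z ≤ b ↔ |z| < 2 ^ b := by
  rw [bitLen, Nat.size_le, ← Int.natCast_natAbs]
  exact_mod_cast Iff.rfl

@[simp] theorem bitLen_zero : bitLen 0 = 0 := by simp [bitLen]

@[simp] theorem bitLen_one : bitLen 1 = 1 := by simp [bitLen]

theorem abs_lt_two_pow_bitLen (z : ℤ) : |z| < 2 ^ bitLen z := bitLen_le_iff.1 le_rfl

theorem bitLen_mono {a b : ℤ} (h : |a| ≤ |b|) : bitLen a ≤ bitLen b :=
  bitLen_le_iff.2 (h.trans_lt (abs_lt_two_pow_bitLen b))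

theorem bitLen_mul (a b : ℤ) : bitLen (a * b) ≤ bitLen a + bitLen b := by
  rw [bitLen_le_iff, abs_mul, pow_add]
  exact mul_lt_mul'' (abs_lt_two_pow_bitLen a) (abs_lt_two_pow_bitLen b) (abs_nonneg _)
    (abs_nonneg _)

theorem bitLen_add_of_le {a b : ℤ} {B : ℕ} (ha : bitLen a ≤ B) (hb : bitLen b ≤ B) :
    bitLen (a + b) ≤ B + 1 := by
  rw [bitLen_le_iff] at *
  rw [pow_succ]
  linarith [abs_add_le a b]

theorem bitLen_neg (a : ℤ) : bitLen (-a) = bitLen a := by simp [bitLen]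

theorem bitLen_add (a b : ℤ) : bitLen (a + b) ≤ 1 + bitLen a + bitLen b :=
  (bitLen_add_of_le (Nat.le_add_right _ (bitLen b)) (Nat.le_add_left _ (bitLen a))).trans
    (by omega)

theorem bitLen_sub (a b : ℤ) : bitLen (a - b) ≤ 1 + bitLen a + bitLen b := by
  rw [sub_eq_add_neg, ← bitLen_neg b]; exact bitLen_add _ _

theorem bitLen_div (a b : ℤ) : bitLen (a / b) ≤ 1 + bitLen a + bitLen b := by
  have h : bitLen (a / b) ≤ bitLen a := by
    apply bitLen_mono
    rw [← Int.natCast_natAbs, ← Int.natCast_natAbs]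
    exact_mod_cast Int.natAbs_ediv_le_natAbs a b
  omega

theorem bitLen_natCast_le (k : ℕ) : bitLen (k : ℤ) ≤ k := by
  rw [bitLen, Int.natAbs_natCast, Nat.size_le]; exact Nat.lt_two_pow_self

theorem bitLens_le {l : List ℤ} {b : ℕ} (h : ∀ z ∈ l, bitLen z ≤ b) :
    bitLens l ≤ l.length * b := by
  rw [bitLens]
  refine (List.sum_le_card_nsmul _ b ?_).trans (by simp)
  simpa using h

/-- All integers in the memory have at most `b` bits. -/
def Mem.BitsLE (M : Mem) (b : ℕ) : Prop := ∀ i, bitLen (M i) ≤ b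

theorem Mem.BitsLE.mono {M : Mem} {b b' : ℕ} (h : M.BitsLE b) (hb : b ≤ b') : M.BitsLE b' :=
  fun i => (h i).trans hb

theorem Mem.bitsLE_ofList {l : List ℤ} {b : ℕ} (h : ∀ z ∈ l, bitLen z ≤ b) :
    (Mem.ofList l).BitsLE b := by
  intro i
  simp only [Mem.ofList, List.getD_eq_getElem?_getD]
  by_cases hi : i < l.length
  · simpa [List.getElem?_eq_getElem hi] using h _ (List.getElem_mem hi)
  · simp [List.getElem?_eq_none (not_lt.1 hi)]

theorem Mem.BitsLE.update {M : Mem} {b : ℕ} (h : M.BitsLE b) {r : ℕ} {z : ℤ} (hz : bitLen z ≤ b) :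
    Mem.BitsLE (Function.update M r z) b := by
  intro i
  by_cases hi : i = r
  · subst hi; simpa using hz
  · simpa [hi] using h i

theorem Mem.BitsLE.write {b : ℕ} : ∀ {M : Mem} (_ : M.BitsLE b) (rs : List ℕ) (vs : List ℤ)
    (_ : ∀ v ∈ vs, bitLen v ≤ b), Mem.BitsLE (M.write rs vs) b
  | M, h, [], vs, _ => by simpa [Mem.write] using h
  | M, h, r :: rs, [], _ => by simpa [Mem.write] using h
  | M, h, r :: rs, v :: vs, hv => by
    rw [Mem.write]
    exact Mem.BitsLE.write (h.update (hv v (by simp))) rs vs fun w hw => hv w (by simp [hw])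

theorem le_bitLens {l : List ℤ} {z : ℤ} (h : z ∈ l) : bitLen z ≤ bitLens l :=
  List.single_le_sum (by simp) _ (List.mem_map_of_mem h)

/-- Logarithmic cost bounds the size of everything that a program writes. -/
theorem Exec.bitsLE {O : Oracle} {c : Prog} {M : Mem} {μ : PMF (Mem × ℕ)} (h : Exec O c M μ) :
    ∀ b, M.BitsLE b → ∀ y ∈ μ.support, y.1.BitsLE (b + y.2) := by
  induction h with
  | skip M =>
    intro b hb y hy
    obtain rfl : y = (M, 1) := by simpa using hy
    exact hb.mono (by simp)
  | instr i M =>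
    intro b hb y hy
    obtain rfl : y = (i.run O M, i.cost O M) := by simpa using hy
    have hb' := fun t => hb.mono (Nat.le_add_right b t)
    cases i with
    | const r z => exact (hb' _).update (by simp only [Instr.cost]; omega)
    | add r u v => exact (hb' _).update ((bitLen_add _ _).trans (by simp only [Instr.cost]; omega))
    | sub r u v => exact (hb' _).update ((bitLen_sub _ _).trans (by simp only [Instr.cost]; omega))
    | mul r u v => exact (hb' _).update ((bitLen_mul _ _).trans (by simp only [Instr.cost]; omega))
    | div r u v => exact (hb' _).update ((bitLen_div _ _).trans (by simp only [Instr.cost]; omega))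
    | load r u => exact (hb' _).update (by simp only [Instr.cost]; omega)
    | store u r => exact (hb' _).update (by simp only [Instr.cost]; omega)
    | query r s idx p =>
      exact ((hb' _).update (by simp only [Instr.cost]; omega)).update
        (by simp only [Instr.cost]; omega)
  | flip r M =>
    intro b hb y hy
    rw [PMF.mem_support_map_iff] at hy
    obtain ⟨x, -, rfl⟩ := hy
    exact (hb.mono (Nat.le_add_right b 1)).update (by cases x <;> simp)
  | seq c c' M μ κ _ _ ih1 ih2 =>
    intro b hb y hy
    rw [PMF.mem_support_bind_iff] at hy
    obtain ⟨z, hz, hy⟩ := hy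
    rw [PMF.mem_support_map_iff] at hy
    obtain ⟨w, hw, rfl⟩ := hy
    exact (ih2 z hz _ (ih1 b hb z hz) w hw).mono (by simp only [delay]; omega)
  | ite_pos r c c' M μ _ _ ih | ite_neg r c c' M μ _ _ ih | loop_step r c M μ _ _ ih =>
    intro b hb y hy
    rw [PMF.mem_support_map_iff] at hy
    obtain ⟨w, hw, rfl⟩ := hy
    exact (ih b hb w hw).mono (by simp only [delay]; omega)
  | loop_done r c M _ =>
    intro b hb y hy
    obtain rfl : y = _ := by simpa using hy
    exact hb.mono (by simp)
  | call c args rets M μ _ ih =>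
    intro b hb y hy
    rw [PMF.mem_support_map_iff] at hy
    obtain ⟨w, hw, rfl⟩ := hy
    refine (hb.mono (Nat.le_add_right b _)).write _ _ fun v hv => ?_
    have := le_bitLens hv
    simp only [callReturn]
    omega

theorem Runs.bitsLE {O : Oracle} {c : Prog} {M : Mem} {ν : PMF Mem} {T b : ℕ}
    (h : Runs O c M ν T) (hM : M.BitsLE b) : ∀ N ∈ ν.support, N.BitsLE (b + T) := by
  obtain ⟨μ, h1, rfl, h3⟩ := h
  intro N hN
  rw [PMF.mem_support_map_iff] at hN
  obtain ⟨y, hy, rfl⟩ := hN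
  exact (h1.bitsLE b hM y hy).mono (by have := h3 y hy; omega)

/-! ### Procedures -/

/-- Called with the arguments `ins`, the program `A` halts within time `T`, and its first `k`
results have the joint distribution `ν`. -/
def Computes (O : Oracle) (A : Prog) (ins : List ℤ) (k : ℕ) (ν : PMF (List ℤ)) (T : ℕ) : Prop :=
  ∃ ν', Runs O A (Mem.ofList ins) ν' T ∧ ν'.map (fun M => (List.range k).map M) = ν

theorem Computes.call {O : Oracle} {A : Prog} {M : Mem} {args rets : List ℕ} {ν : PMF (List ℤ)}
    {T b : ℕ} (h : Computes O A (args.map M) rets.length ν T) (hb : M.BitsLE b) :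
    Runs O (.call A args rets) M (ν.map (M.write rets))
      ((1 + args.length + rets.length) * (1 + b + T)) := by
  obtain ⟨ν', h1, rfl⟩ := h
  have h2 := h1.bitsLE (b := b) (Mem.bitsLE_ofList (by simpa using fun i _ => hb i))
  refine Runs.mono (T := 1 + bitLens (args.map M) + T + rets.length * (b + T)) ?_ ?_
  · rw [PMF.map_comp]
    refine h1.call fun N hN => (bitLens_le (b := b + T) ?_).trans (by simp)
    simpa using fun i _ => h2 N hN i
  · have := bitLens_le (l := args.map M) (b := b) (by simpa using fun i _ => hb i)
    rw [List.length_map] at this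
    nlinarith [Nat.zero_le (args.length * T), Nat.zero_le (args.length), Nat.zero_le rets.length]

/-- A program whose queries are replaced by the answers `(0, 0)` of the trivial oracle. -/
def Prog.strip : Prog → Prog
  | .instr (.query r s _ _) => .seq (.instr (.const r 0)) (.instr (.const s 0))
  | .seq c c' => .seq c.strip c'.strip
  | .ite r c c' => .ite r c.strip c'.strip
  | .loop r c => .loop r c.strip
  | .call c args rets => .call c.strip args rets
  | c => c

/-- Programs run with the trivial oracle can be simulated, with the same distribution of the final
memory and at most twice the running time, in the presence of any other oracle. -/
theorem Exec.strip {O : Oracle} {c : Prog} {M : Mem} {μ : PMF (Mem × ℕ)}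
    (h : Exec Oracle.none c M μ) : ∃ μ', Exec O c.strip M μ' ∧ μ'.map Prod.fst = μ.map Prod.fst ∧
      ∀ y' ∈ μ'.support, ∃ y ∈ μ.support, y.1 = y'.1 ∧ y'.2 ≤ 2 * y.2 := by
  have key : ∀ {μ μ' : PMF (Mem × ℕ)} (t : ℕ), μ'.map Prod.fst = μ.map Prod.fst →
      (∀ y' ∈ μ'.support, ∃ y ∈ μ.support, y.1 = y'.1 ∧ y'.2 ≤ 2 * y.2) →
      (μ'.map (delay t)).map Prod.fst = (μ.map (delay t)).map Prod.fst ∧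
      ∀ y' ∈ (μ'.map (delay t)).support, ∃ y ∈ (μ.map (delay t)).support,
        y.1 = y'.1 ∧ y'.2 ≤ 2 * y.2 := by
    intro μ μ' t h1 h2
    refine ⟨by rw [map_delay_fst, map_delay_fst, h1], fun y' hy' => ?_⟩
    rw [PMF.mem_support_map_iff] at hy'
    obtain ⟨z, hz, rfl⟩ := hy'
    obtain ⟨y, hy, h3, h4⟩ := h2 z hz
    exact ⟨delay t y, by rw [PMF.mem_support_map_iff]; exact ⟨y, hy, rfl⟩, h3, by
      simp only [delay]; omega⟩
  induction h with
  | skip M => exact ⟨_, .skip M, rfl, fun y hy => ⟨y, hy, rfl, by omega⟩⟩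
  | instr i M =>
    cases i with
    | query r s idx p =>
      refine ⟨_, .seq _ _ M _ (fun N => PMF.pure (Instr.run O N (.const s 0),
        Instr.cost O N (.const s 0))) (.instr _ M) fun y _ => .instr _ y.1, ?_, ?_⟩
      · simp [PMF.pure_map, Instr.run, Oracle.none, delay]
      · simp [PMF.pure_map, Instr.run, Oracle.none, delay, Instr.cost]
        omega
    | _ => exact ⟨_, .instr _ M, by simp [PMF.pure_map, Instr.run], by
        simp [Instr.run, Instr.cost]; try omega⟩
  | flip r M => exact ⟨_, .flip r M, rfl, fun y hy => ⟨y, hy, rfl, by omega⟩⟩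
  | seq c c' M μ κ _ _ ih1 ih2 =>
    obtain ⟨μ', a1, a2, a3⟩ := ih1
    choose! F hF using fun (N : Mem) (hN : ∃ y ∈ μ.support, y.1 = N) =>
      (show ∃ μ', Exec O c'.strip N μ' ∧ μ'.map Prod.fst = (κ N).map Prod.fst ∧
        ∀ y' ∈ μ'.support, ∃ y ∈ (κ N).support, y.1 = y'.1 ∧ y'.2 ≤ 2 * y.2 by
        obtain ⟨y, hy, rfl⟩ := hN
        exact ih2 y hy)
    have hs : ∀ y' ∈ μ'.support, ∃ y ∈ μ.support, y.1 = y'.1 := fun y' hy' =>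
      let ⟨y, h1, h2, _⟩ := a3 y' hy'
      ⟨y, h1, h2⟩
    refine ⟨_, .seq _ _ M μ' F a1 fun y hy => (hF _ (hs y hy)).1, ?_, ?_⟩
    · have e1 : ∀ (p : PMF (Mem × ℕ)) (G : Mem → PMF (Mem × ℕ)),
          (p.bind fun y => (G y.1).map (delay y.2)).map Prod.fst =
          (p.map Prod.fst).bind fun N => (G N).map Prod.fst := by
        intro p G
        rw [PMF.map_bind, PMF.bind_map]
        simp only [map_delay_fst]
        rfl
      rw [e1, e1, a2]
      refine pmf_bind_congr fun N hN => (hF N ?_).2.1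
      rw [PMF.mem_support_map_iff] at hN
      exact hN
    · intro y' hy'
      rw [PMF.mem_support_bind_iff] at hy'
      obtain ⟨z', hz', hy'⟩ := hy'
      rw [PMF.mem_support_map_iff] at hy'
      obtain ⟨w', hw', rfl⟩ := hy'
      obtain ⟨z, hz, b1, b2⟩ := a3 z' hz'
      obtain ⟨w, hw, b3, b4⟩ := (hF _ (hs z' hz')).2.2 w' hw'
      refine ⟨delay z.2 w, ?_, b3, by simp only [delay]; omega⟩
      rw [PMF.mem_support_bind_iff]
      refine ⟨z, hz, ?_⟩
      rw [PMF.mem_support_map_iff]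
      exact ⟨w, by rwa [b1], rfl⟩
  | ite_pos r c c' M μ h0 _ ih =>
    obtain ⟨μ', a1, a2, a3⟩ := ih
    exact ⟨_, .ite_pos r _ _ M μ' h0 a1, key _ a2 a3⟩
  | ite_neg r c c' M μ h0 _ ih =>
    obtain ⟨μ', a1, a2, a3⟩ := ih
    exact ⟨_, .ite_neg r _ _ M μ' h0 a1, key _ a2 a3⟩
  | loop_done r c M h0 =>
    exact ⟨_, .loop_done r _ M h0, rfl, fun y hy => ⟨y, hy, rfl, by omega⟩⟩
  | loop_step r c M μ h0 _ ih =>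
    obtain ⟨μ', a1, a2, a3⟩ := ih
    exact ⟨_, .loop_step r _ M μ' h0 a1, key _ a2 a3⟩
  | call c args rets M μ _ ih =>
    obtain ⟨μ', a1, a2, a3⟩ := ih
    refine ⟨_, .call _ args rets M μ' a1, ?_, ?_⟩
    · have e1 : ∀ p : PMF (Mem × ℕ), (p.map (callReturn M args rets)).map Prod.fst =
          (p.map Prod.fst).map fun N => M.write rets ((List.range rets.length).map N) := by
        intro p
        rw [PMF.map_comp, PMF.map_comp]; rfl
      rw [e1, e1, a2]
    · intro y' hy'
      rw [PMF.mem_support_map_iff] at hy'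
      obtain ⟨z', hz', rfl⟩ := hy'
      obtain ⟨z, hz, b1, b2⟩ := a3 z' hz'
      refine ⟨callReturn M args rets z, ?_, ?_, ?_⟩
      · rw [PMF.mem_support_map_iff]; exact ⟨z, hz, rfl⟩
      · simp only [callReturn, b1]
      · simp only [callReturn, b1]; omega

theorem Runs.of_strip {O : Oracle} {c : Prog} {M : Mem} {μ : PMF (Mem × ℕ)} {T : ℕ}
    (h : Exec Oracle.none c M μ) (hT : ∀ y ∈ μ.support, y.2 ≤ T) :
    Runs O c.strip M (μ.map Prod.fst) (2 * T) := by
  obtain ⟨μ', h1, h2, h3⟩ := h.strip (O := O)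
  refine ⟨μ', h1, h2, fun y' hy' => ?_⟩
  obtain ⟨y, hy, -, h4⟩ := h3 y' hy'
  have := hT y hy
  omega

/-! ### Integer expressions and blocks of assignments -/

/-- Integer expressions in the contents of the memory; `ite a b c` is `b` if `a > 0`, and `c`
otherwise. -/
inductive Ex
  | var (i : ℕ)
  | lit (z : ℤ)
  | add (a b : Ex)
  | sub (a b : Ex)
  | mul (a b : Ex)
  | div (a b : Ex)
  | ite (a b c : Ex)

namespace Ex

instance : Add Ex := ⟨add⟩
instance : Sub Ex := ⟨sub⟩
instance : Mul Ex := ⟨mul⟩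
instance : Div Ex := ⟨div⟩
instance (n : ℕ) : OfNat Ex n := ⟨lit n⟩

/-- The value of an expression. -/
def eval (M : Mem) : Ex → ℤ
  | var i => M i
  | lit z => z
  | add a b => a.eval M + b.eval M
  | sub a b => a.eval M - b.eval M
  | mul a b => a.eval M * b.eval M
  | div a b => a.eval M / b.eval M
  | ite a b c => if 0 < a.eval M then b.eval M else c.eval M

@[simp] theorem eval_var (M : Mem) (i : ℕ) : (var i).eval M = M i := rfl
@[simp] theorem eval_lit (M : Mem) (z : ℤ) : (lit z).eval M = z := rfl
@[simp] theorem eval_ofNat (M : Mem) (n : ℕ) [n.AtLeastTwo] :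
    eval M (no_index (OfNat.ofNat n : Ex)) = (n : ℤ) := rfl
@[simp] theorem eval_zero (M : Mem) : eval M (0 : Ex) = 0 := rfl
@[simp] theorem eval_one (M : Mem) : eval M (1 : Ex) = 1 := rfl
@[simp] theorem eval_add (M : Mem) (a b : Ex) : (a + b).eval M = a.eval M + b.eval M := rfl
@[simp] theorem eval_sub (M : Mem) (a b : Ex) : (a - b).eval M = a.eval M - b.eval M := rfl
@[simp] theorem eval_mul (M : Mem) (a b : Ex) : (a * b).eval M = a.eval M * b.eval M := rfl
@[simp] theorem eval_div (M : Mem) (a b : Ex) : (a / b).eval M = a.eval M / b.eval M := rfl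
@[simp] theorem eval_ite (M : Mem) (a b c : Ex) :
    (ite a b c).eval M = if 0 < a.eval M then b.eval M else c.eval M := rfl

/-- A bound for the addresses that occur in an expression. -/
def bd : Ex → ℕ
  | var i => i + 1
  | lit _ => 0
  | add a b | sub a b | mul a b | div a b => max a.bd b.bd
  | ite a b c => max a.bd (max b.bd c.bd)

/-- A program which stores the value of the expression at the address `t`, and writes to no
address below `t`. -/
def code : Ex → ℕ → Prog
  | var i, t => .seq (.instr (.const t 0)) (.instr (.add t t i))
  | lit z, t => .instr (.const t z)
  | add a b, t => .seq (a.code t) (.seq (b.code (t + 1)) (.instr (.add t t (t + 1))))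
  | sub a b, t => .seq (a.code t) (.seq (b.code (t + 1)) (.instr (.sub t t (t + 1))))
  | mul a b, t => .seq (a.code t) (.seq (b.code (t + 1)) (.instr (.mul t t (t + 1))))
  | div a b, t => .seq (a.code t) (.seq (b.code (t + 1)) (.instr (.div t t (t + 1))))
  | ite a b c, t => .seq (a.code t) (.ite t (b.code t) (c.code t))

/-- The running time of the program for an expression, per bit of the integers in the memory. -/
def time : Ex → ℕ
  | var _ => 2
  | lit z => 1 + bitLen z
  | add a b | sub a b | mul a b | div a b => 2 * (a.time + b.time) + 1
  | ite a b c => 2 * a.time + b.time + c.time + 1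

theorem eval_congr {M N : Mem} {e : Ex} {t : ℕ} (h : ∀ i < t, M i = N i) (ht : e.bd ≤ t) :
    e.eval M = e.eval N := by
  induction e with
  | var i => exact h i ht
  | lit z => rfl
  | add a b iha ihb | sub a b iha ihb | mul a b iha ihb | div a b iha ihb =>
    simp only [bd, max_le_iff] at ht
    simp only [eval, iha ht.1, ihb ht.2]
  | ite a b c iha ihb ihc =>
    simp only [bd, max_le_iff] at ht
    simp only [eval, iha ht.1, ihb ht.2.1, ihc ht.2.2]

theorem bitLen_eval {M : Mem} {b : ℕ} {t : ℕ} (h : ∀ i < t, bitLen (M i) ≤ b) {e : Ex}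
    (ht : e.bd ≤ t) : bitLen (e.eval M) ≤ e.time * (1 + b) := by
  induction e with
  | var i => have := h i ht; simp only [eval, time]; omega
  | lit z => simp only [eval, time]; nlinarith [Nat.zero_le (bitLen z * b)]
  | add u v ihu ihv =>
    simp only [bd, max_le_iff] at ht
    have := bitLen_add (u.eval M) (v.eval M)
    have := ihu ht.1; have := ihv ht.2
    simp only [eval, time]; linarith
  | sub u v ihu ihv =>
    simp only [bd, max_le_iff] at ht
    have := bitLen_sub (u.eval M) (v.eval M)
    have := ihu ht.1; have := ihv ht.2
    simp only [eval, time]; linarith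
  | mul u v ihu ihv =>
    simp only [bd, max_le_iff] at ht
    have := bitLen_mul (u.eval M) (v.eval M)
    have := ihu ht.1; have := ihv ht.2
    simp only [eval, time]; linarith
  | div u v ihu ihv =>
    simp only [bd, max_le_iff] at ht
    have := bitLen_div (u.eval M) (v.eval M)
    have := ihu ht.1; have := ihv ht.2
    simp only [eval, time]; linarith
  | ite u v w ihu ihv ihw =>
    simp only [bd, max_le_iff] at ht
    have := ihv ht.2.1; have := ihw ht.2.2
    simp only [eval, time]
    split_ifs <;> linarith [Nat.zero_le (u.time * (1 + b)), Nat.zero_le (v.time * (1 + b)),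
      Nat.zero_le (w.time * (1 + b))]

theorem runs_binary {O : Oracle} {a b : Ex} {s t B : ℕ} {op : ℤ → ℤ → ℤ} {i : Instr}
    (hi : ∀ N : Mem, i.run O N = Function.update N t (op (N t) (N (t + 1))))
    (hc : ∀ N : Mem, i.cost O N = 1 + bitLen (N t) + bitLen (N (t + 1)))
    (ha : a.bd ≤ s) (hb : b.bd ≤ s) (hs : s ≤ t)
    (iha : ∀ {M : Mem}, (∀ i < s, bitLen (M i) ≤ B) → ∃ N,
      Runs O (a.code t) M (PMF.pure N) (a.time * (1 + B)) ∧ N t = a.eval M ∧ ∀ j < t, N j = M j)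
    (ihb : ∀ {M : Mem}, (∀ i < s, bitLen (M i) ≤ B) → ∃ N,
      Runs O (b.code (t + 1)) M (PMF.pure N) (b.time * (1 + B)) ∧ N (t + 1) = b.eval M ∧
      ∀ j < t + 1, N j = M j) {M : Mem} (hB : ∀ i < s, bitLen (M i) ≤ B) :
    ∃ N, Runs O (.seq (a.code t) (.seq (b.code (t + 1)) (.instr i))) M (PMF.pure N)
        ((2 * (a.time + b.time) + 1) * (1 + B)) ∧ N t = op (a.eval M) (b.eval M) ∧
      ∀ j < t, N j = M j := by
  obtain ⟨N, h1, h2, h3⟩ := iha hB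
  obtain ⟨N', h1', h2', h3'⟩ := ihb (M := N) fun i hi => by
    rw [h3 i (by omega)]; exact hB i hi
  have e1 : N' t = a.eval M := by rw [h3' t (Nat.lt_succ_self t), h2]
  have e2 : N' (t + 1) = b.eval M := by
    rw [h2', eval_congr (fun j hj => h3 j (by omega)) hb]
  refine ⟨i.run O N', (h1.seq_pure (h1'.seq_pure (.instr i le_rfl))).mono ?_, ?_, ?_⟩
  · have := bitLen_eval hB ha
    have := bitLen_eval hB hb
    rw [hc, e1, e2]; linarith
  · rw [hi, e1, e2]; simp
  · intro j hj
    rw [hi, Function.update_of_ne hj.ne, h3' j (by omega), h3 j hj]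

theorem runs_code {O : Oracle} {e : Ex} {t s B : ℕ} (hs : s ≤ t) (ht : e.bd ≤ s) {M : Mem}
    (hB : ∀ i < s, bitLen (M i) ≤ B) :
    ∃ N, Runs O (e.code t) M (PMF.pure N) (e.time * (1 + B)) ∧ N t = e.eval M ∧
      ∀ j < t, N j = M j := by
  induction e generalizing t M with
  | var i =>
    have hi : i < s := ht
    refine ⟨_, ((Runs.instr (.const t 0) le_rfl).seq_pure
      (.instr (.add t t i) le_rfl)).mono ?_, ?_, ?_⟩
    · have := hB i hi
      simp only [Instr.cost, Instr.run, time, Function.update_self,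
        Function.update_of_ne (show i ≠ t by omega), bitLen_zero]
      omega
    · simp [Instr.run, eval, Function.update_of_ne (show i ≠ t by omega)]
    · intro j hj
      simp [Instr.run, Function.update_of_ne hj.ne]
  | lit z =>
    refine ⟨_, (Runs.instr (.const t z) le_rfl).mono ?_, ?_, ?_⟩
    · simp only [Instr.cost, time]; nlinarith [Nat.zero_le (bitLen z * B)]
    · simp [Instr.run, eval]
    · intro j hj
      simp [Instr.run, Function.update_of_ne hj.ne]
  | add a b iha ihb =>
    simp only [bd, max_le_iff] at ht
    exact runs_binary (i := .add t t (t + 1)) (fun _ => rfl) (fun _ => rfl) ht.1 ht.2 hs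
      (iha hs ht.1) (ihb (by omega) ht.2) hB
  | sub a b iha ihb =>
    simp only [bd, max_le_iff] at ht
    exact runs_binary (i := .sub t t (t + 1)) (fun _ => rfl) (fun _ => rfl) ht.1 ht.2 hs
      (iha hs ht.1) (ihb (by omega) ht.2) hB
  | mul a b iha ihb =>
    simp only [bd, max_le_iff] at ht
    exact runs_binary (i := .mul t t (t + 1)) (fun _ => rfl) (fun _ => rfl) ht.1 ht.2 hs
      (iha hs ht.1) (ihb (by omega) ht.2) hB
  | div a b iha ihb =>
    simp only [bd, max_le_iff] at ht
    exact runs_binary (i := .div t t (t + 1)) (fun _ => rfl) (fun _ => rfl) ht.1 ht.2 hs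
      (iha hs ht.1) (ihb (by omega) ht.2) hB
  | ite a b c iha ihb ihc =>
    simp only [bd, max_le_iff] at ht
    obtain ⟨N, h1, h2, h3⟩ := iha hs ht.1 hB
    have hN : ∀ i < s, bitLen (N i) ≤ B := fun i hi => by rw [h3 i (by omega)]; exact hB i hi
    obtain ⟨N₁, b1, b2, b3⟩ := ihb hs ht.2.1 hN
    obtain ⟨N₂, c1, c2, c3⟩ := ihc hs ht.2.2 hN
    have eb := eval_congr (fun j hj => h3 j (by omega : j < t)) ht.2.1
    have ec := eval_congr (fun j hj => h3 j (by omega : j < t)) ht.2.2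
    refine ⟨if 0 < a.eval M then N₁ else N₂, (h1.seq_pure (Runs.ite (T := (b.time + c.time) *
      (1 + B)) (fun h => ?_) fun h => ?_)).mono ?_, ?_, ?_⟩
    · rw [h2] at h; rw [if_pos h]; exact b1.mono (Nat.mul_le_mul_right _ (by omega))
    · rw [h2] at h; rw [if_neg h]; exact c1.mono (Nat.mul_le_mul_right _ (by omega))
    · have := bitLen_eval hB ht.1
      rw [h2]; simp only [time]; linarith
    · simp only [eval]
      split_ifs
      · rw [b2, eb]
      · rw [c2, ec]
    · intro j hj
      split_ifs
      · rw [b3 j hj, h3 j hj]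
      · rw [c3 j hj, h3 j hj]

end Ex

/-- The assignment `[r] := e`. It is evaluated in a fresh memory, so that no other address is
changed. -/
def Prog.set (r : ℕ) (e : Ex) : Prog :=
  .call (.seq (e.code (e.bd + 1)) (.seq (.instr (.const 0 0)) (.instr (.add 0 0 (e.bd + 1)))))
    (List.range e.bd) [r]

/-- The running time of an assignment, per bit of the integers in the memory. -/
def Ex.setTime (e : Ex) : ℕ := 3 * e.time + e.bd + 5

theorem Runs.set {O : Oracle} {M : Mem} {b : ℕ} (hM : M.BitsLE b) (r : ℕ) (e : Ex) :
    Runs O (.set r e) M (PMF.pure (Function.update M r (e.eval M))) (e.setTime * (1 + b)) := by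
  have hM' : ∀ i < e.bd, Mem.ofList ((List.range e.bd).map M) i = M i := by
    intro i hi
    simp [Mem.ofList, hi]
  obtain ⟨N, h1, h2, -⟩ := Ex.runs_code (O := O) (t := e.bd + 1) (B := b) (Nat.le_succ _) le_rfl
    (M := Mem.ofList ((List.range e.bd).map M)) fun i hi => by rw [hM' i hi]; exact hM i
  rw [Ex.eval_congr hM' le_rfl] at h2
  have hb : bitLen (e.eval M) ≤ e.time * (1 + b) := Ex.bitLen_eval (fun i _ => hM i) le_rfl
  have h4 := h1.seq_pure ((Runs.instr (.const 0 0) le_rfl).seq_pure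
    (.instr (.add 0 0 (e.bd + 1)) le_rfl))
  have h5 := Runs.call (rets := [r]) (B := bitLen (e.eval M)) h4 (by
    simp [Instr.run, bitLens, h2])
  have h6 := bitLens_le (l := (List.range e.bd).map M) (b := b) (by simpa using fun i _ => hM i)
  rw [List.length_map, List.length_range] at h6
  rw [PMF.pure_map] at h5
  simp only [Instr.run, Instr.cost, h2, List.length_singleton, List.range_one, List.map_cons,
    List.map_nil, Function.update_self, ne_eq, Nat.add_eq_zero_iff, one_ne_zero, and_false,
    not_false_eq_true, Function.update_of_ne, zero_add, Mem.write, bitLen_zero] at h5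
  refine h5.mono ?_
  rw [Ex.setTime]
  linarith

/-- A sequence of assignments. -/
def Prog.blk : List (ℕ × Ex) → Prog
  | [] => .skip
  | (r, e) :: l => .seq (.set r e) (.blk l)

/-- The memory after a sequence of assignments. -/
def Mem.blk (M : Mem) : List (ℕ × Ex) → Mem
  | [] => M
  | (r, e) :: l => Mem.blk (Function.update M r (e.eval M)) l

@[simp] theorem Mem.blk_nil (M : Mem) : M.blk [] = M := rfl

@[simp] theorem Mem.blk_cons (M : Mem) (r : ℕ) (e : Ex) (l : List (ℕ × Ex)) :
    M.blk ((r, e) :: l) = Mem.blk (Function.update M r (e.eval M)) l := rfl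

/-- The running time of a sequence of assignments, per bit of the integers in the memory. -/
def blkTime : List (ℕ × Ex) → ℕ
  | [] => 1
  | (_, e) :: l => e.setTime + blkTime l * (1 + e.time)

theorem Runs.blk {O : Oracle} (l : List (ℕ × Ex)) {M : Mem} {b : ℕ} (hM : M.BitsLE b) :
    Runs O (.blk l) M (PMF.pure (M.blk l)) (blkTime l * (1 + b)) := by
  induction l generalizing M b with
  | nil => exact Runs.skip.mono (by simp [blkTime])
  | cons x l ih =>
    have h1 : bitLen (x.2.eval M) ≤ x.2.time * (1 + b) :=
      Ex.bitLen_eval (fun i _ => hM i) le_rfl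
    refine ((Runs.set hM x.1 x.2).seq_pure (ih (b := b + x.2.time * (1 + b))
      ((hM.mono (by omega)).update (by omega)))).mono ?_
    simp only [blkTime]
    linarith

/-! ### Polynomial bounds -/

/-- `f` is bounded by a polynomial. -/
@[fun_prop] def PolyB (f : ℕ → ℕ) : Prop := ∃ C d, ∀ s, f s ≤ C * (1 + s) ^ d

namespace PolyB

@[fun_prop] theorem const (c : ℕ) : PolyB fun _ => c := ⟨c, 0, by simp⟩

@[fun_prop] theorem id : PolyB fun s => s := ⟨1, 1, fun s => by simp⟩

@[fun_prop] theorem add {f g : ℕ → ℕ} (hf : PolyB f) (hg : PolyB g) : PolyB fun s => f s + g s := by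
  obtain ⟨C, d, h⟩ := hf
  obtain ⟨C', d', h'⟩ := hg
  refine ⟨C + C', d + d', fun s => ?_⟩
  have h1 : (1 + s) ^ d ≤ (1 + s) ^ (d + d') := Nat.pow_le_pow_right (by omega) (by omega)
  have h2 : (1 + s) ^ d' ≤ (1 + s) ^ (d + d') := Nat.pow_le_pow_right (by omega) (by omega)
  calc f s + g s ≤ C * (1 + s) ^ d + C' * (1 + s) ^ d' := add_le_add (h s) (h' s)
    _ ≤ C * (1 + s) ^ (d + d') + C' * (1 + s) ^ (d + d') := by gcongr
    _ = _ := by ring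

@[fun_prop] theorem mul {f g : ℕ → ℕ} (hf : PolyB f) (hg : PolyB g) : PolyB fun s => f s * g s := by
  obtain ⟨C, d, h⟩ := hf
  obtain ⟨C', d', h'⟩ := hg
  refine ⟨C * C', d + d', fun s => (Nat.mul_le_mul (h s) (h' s)).trans_eq (by ring)⟩

@[fun_prop] theorem comp {f g : ℕ → ℕ} (hf : PolyB f) (hg : PolyB g) : PolyB fun s => f (g s) := by
  obtain ⟨C, d, h⟩ := hf
  obtain ⟨C', d', h'⟩ := hg
  refine ⟨C * (1 + C') ^ d, d' * d, fun s => (h _).trans ?_⟩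
  have h1 : 1 + g s ≤ (1 + C') * (1 + s) ^ d' := by
    have := h' s
    have h2 : 1 ≤ (1 + s) ^ d' := Nat.one_le_pow _ _ (by omega)
    linarith
  calc C * (1 + g s) ^ d ≤ C * ((1 + C') * (1 + s) ^ d') ^ d := by gcongr
    _ = _ := by rw [mul_pow, pow_mul]; ring

@[fun_prop] theorem pow {f : ℕ → ℕ} (hf : PolyB f) (k : ℕ) : PolyB fun s => f s ^ k :=
  (show PolyB fun s => s ^ k from ⟨1, k, fun s => by
    rw [one_mul]; exact Nat.pow_le_pow_left (by omega) k⟩).comp hf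

end PolyB

theorem Mem.ofList_pad (l : List ℤ) (m : ℕ) :
    Mem.ofList (l ++ List.replicate m 0) = Mem.ofList l := by
  funext i
  simp only [Mem.ofList, List.getD_eq_getElem?_getD, List.getElem?_append]
  split_ifs with h
  · rfl
  · rw [List.getElem?_replicate, List.getElem?_eq_none (not_lt.1 h)]
    split_ifs <;> rfl

@[simp] theorem Mem.update_ofList {l : List ℤ} {i : ℕ} (h : i < l.length) (v : ℤ) :
    Function.update (Mem.ofList l) i v = Mem.ofList (l.set i v) := by
  funext j
  by_cases hj : j = i
  · subst hj
    simp [Mem.ofList, h]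
  · simp [Mem.ofList, hj, Ne.symm hj]

@[simp] theorem Mem.ofList_cons_zero (a : ℤ) (l : List ℤ) : Mem.ofList (a :: l) 0 = a := rfl

@[simp] theorem Mem.ofList_cons_succ (a : ℤ) (l : List ℤ) (i : ℕ) :
    Mem.ofList (a :: l) (i + 1) = Mem.ofList l i := rfl

theorem Computes.mono {O : Oracle} {A : Prog} {ins : List ℤ} {k : ℕ} {ν : PMF (List ℤ)}
    {T T' : ℕ} (h : Computes O A ins k ν T) (hT : T ≤ T') : Computes O A ins k ν T' :=
  let ⟨ν', h1, h2⟩ := h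
  ⟨ν', h1.mono hT, h2⟩

theorem Runs.computes_pure {O : Oracle} {A : Prog} {ins : List ℤ} {k : ℕ} {N : Mem} {v : List ℤ}
    {T : ℕ} {ins' : List ℤ} (h : Runs O A (Mem.ofList ins') (PMF.pure N) T)
    (hm : ins' = ins ++ List.replicate (ins'.length - ins.length) 0)
    (hv : (List.range k).map N = v) : Computes O A ins k (PMF.pure v) T :=
  ⟨_, by rwa [hm, Mem.ofList_pad] at h, by rw [PMF.pure_map, hv]⟩

theorem Computes.call_pure {O : Oracle} {A : Prog} {M : Mem} {args rets : List ℕ} {v : List ℤ}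
    {T b : ℕ} (h : Computes O A (args.map M) rets.length (PMF.pure v) T) (hb : M.BitsLE b) :
    Runs O (.call A args rets) M (PMF.pure (M.write rets v))
      ((1 + args.length + rets.length) * (1 + b + T)) := by
  have := h.call hb
  rwa [PMF.pure_map] at this

/-- A `loop` whose rounds are deterministic. -/
theorem Runs.loop_pure {O : Oracle} {c : Prog} {r k R T B : ℕ} (hk : k ≤ R) (e : ℕ → Mem)
    (hpos : ∀ i < k, 0 < e i r) (hend : e k r ≤ 0) (hB : ∀ i ≤ k, bitLen (e i r) ≤ B)
    (hrun : ∀ i < k, Runs O c (e i) (PMF.pure (e (i + 1))) T) :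
    Runs O (.loop r c) (e 0) (PMF.pure (e k)) ((R + 1) * (1 + B + T)) := by
  have h := Runs.loop (σ := Unit) (O := O) (c := c) (r := r) (T := T) (B := B) hk
    (fun _ s => PMF.pure s) (fun i _ => e i) (fun _ _ => True) ()
    trivial (fun i hi _ _ => hpos i hi) (fun _ _ => hend) (fun i hi _ _ => hB i hi)
    (fun _ _ _ _ _ _ => trivial) (fun i hi _ _ => by rw [PMF.pure_map]; exact hrun i hi)
  have h2 : ∀ k, (chain (fun _ (s : Unit) => PMF.pure s) () k).map (fun _ => e k) =
      PMF.pure (e k) := fun k => PMF.map_const _ _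
  rwa [h2] at h

theorem bitLen_two_pow (k : ℕ) : bitLen (2 ^ k) ≤ k + 1 := by
  rw [bitLen_le_iff, abs_of_pos (by positivity)]
  exact pow_lt_pow_right₀ (by norm_num) (by omega)

theorem bitLen_natCast_le_of_le {k b : ℕ} (h : k ≤ b) : bitLen (k : ℤ) ≤ b :=
  (bitLen_natCast_le k).trans h

open Ex Prog in
/-- Powers of two. -/
theorem exists_pow2 : ∃ (A : Prog) (T : ℕ → ℕ), PolyB T ∧ ∀ (O : Oracle) (s k : ℕ), k ≤ s →
    Computes O A [(k : ℤ)] 1 (PMF.pure [2 ^ k]) (T s) := by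
  refine ⟨.seq (blk [(1, 1)]) (.seq
    (.loop 0 (blk [(1, 2 * var 1), (0, var 0 - 1)])) (blk [(0, var 1)])), ?_⟩
  constructor
  refine ⟨?_, fun O s k hk => ?_⟩
  rotate_left
  · have hb : ∀ i ≤ k, (Mem.ofList [(k : ℤ) - i, 2 ^ i]).BitsLE (s + 1) := by
      intro i hi
      have h1 := bitLen_natCast_le_of_le (k := k - i) (b := s + 1) (by omega)
      have h2 := (bitLen_two_pow i).trans (by omega : _ ≤ s + 1)
      rw [Nat.cast_sub hi] at h1
      exact Mem.bitsLE_ofList (by simp [h1, h2])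
    have h1 := Runs.blk (O := O) (b := s) [(1, 1)] (M := Mem.ofList [(k : ℤ), 0])
      (Mem.bitsLE_ofList (by simpa using bitLen_natCast_le_of_le hk))
    have h2 := Runs.loop_pure (O := O) (r := 0) hk (fun i => Mem.ofList [(k : ℤ) - i, 2 ^ i])
      (by simp) (by simp) (fun i hi => hb i hi 0) fun i hi => (by
        have := Runs.blk (O := O) [(1, 2 * var 1), (0, var 0 - 1)] (hb i hi.le)
        simpa [pow_succ', sub_sub] using this)
    have h3 := Runs.blk (O := O) [(0, var 1)] (hb k le_rfl)
    simp at h1 h2 h3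
    exact ((h1.seq_pure (h2.seq_pure h3)).computes_pure rfl (by simp)).mono le_rfl
  · fun_prop

/-! ### Expectations and probabilities -/

section Expectation

variable {α β : Type*}

/-- The expectation of a real random variable. -/
noncomputable def ev (μ : PMF α) (f : α → ℝ) : ℝ := ∑' a, (μ a).toReal * f a

theorem summable_toReal (μ : PMF α) : Summable fun a => (μ a).toReal :=
  ENNReal.summable_toReal (by rw [μ.tsum_coe]; exact ENNReal.one_ne_top)

theorem tsum_toReal (μ : PMF α) : ∑' a, (μ a).toReal = 1 := by
  rw [← ENNReal.tsum_toReal_eq (fun a => μ.apply_ne_top a), μ.tsum_coe, ENNReal.toReal_one]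

theorem ev_congr {μ : PMF α} {f g : α → ℝ} (h : ∀ a ∈ μ.support, f a = g a) :
    ev μ f = ev μ g := by
  refine tsum_congr fun a => ?_
  by_cases ha : a ∈ μ.support
  · rw [h a ha]
  · simp [(PMF.apply_eq_zero_iff μ a).2 ha]

theorem summable_ev {μ : PMF α} {f : α → ℝ} {B : ℝ} (h : ∀ a ∈ μ.support, |f a| ≤ B) :
    Summable fun a => (μ a).toReal * f a := by
  refine Summable.of_norm_bounded ((summable_toReal μ).mul_right B) fun a => ?_
  rw [Real.norm_eq_abs, abs_mul, abs_of_nonneg ENNReal.toReal_nonneg]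
  by_cases ha : a ∈ μ.support
  · exact mul_le_mul_of_nonneg_left (h a ha) ENNReal.toReal_nonneg
  · simp [(PMF.apply_eq_zero_iff μ a).2 ha]

theorem ev_const (μ : PMF α) (c : ℝ) : ev μ (fun _ => c) = c := by
  rw [ev, tsum_mul_right, tsum_toReal, one_mul]

theorem ev_mono {μ : PMF α} {f g : α → ℝ} {B B' : ℝ} (hf : ∀ a ∈ μ.support, |f a| ≤ B)
    (hg : ∀ a ∈ μ.support, |g a| ≤ B') (h : ∀ a ∈ μ.support, f a ≤ g a) : ev μ f ≤ ev μ g := by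
  refine (summable_ev hf).tsum_le_tsum (fun a => ?_) (summable_ev hg)
  by_cases ha : a ∈ μ.support
  · exact mul_le_mul_of_nonneg_left (h a ha) ENNReal.toReal_nonneg
  · simp [(PMF.apply_eq_zero_iff μ a).2 ha]

theorem ev_add {μ : PMF α} {f g : α → ℝ} {B B' : ℝ} (hf : ∀ a ∈ μ.support, |f a| ≤ B)
    (hg : ∀ a ∈ μ.support, |g a| ≤ B') : ev μ (fun a => f a + g a) = ev μ f + ev μ g := by
  rw [ev, ev, ev, ← (summable_ev hf).tsum_add (summable_ev hg)]
  exact tsum_congr fun a => mul_add _ _ _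

theorem ev_const_mul (μ : PMF α) (c : ℝ) (f : α → ℝ) :
    ev μ (fun a => c * f a) = c * ev μ f := by
  rw [ev, ev, ← tsum_mul_left]
  exact tsum_congr fun a => by ring

theorem ev_sub {μ : PMF α} {f g : α → ℝ} {B B' : ℝ} (hf : ∀ a ∈ μ.support, |f a| ≤ B)
    (hg : ∀ a ∈ μ.support, |g a| ≤ B') : ev μ (fun a => f a - g a) = ev μ f - ev μ g := by
  have := ev_add (g := fun a => -1 * g a) (B' := B') hf (by simpa using hg)
  rw [ev_const_mul] at this
  simpa [sub_eq_add_neg] using this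

theorem abs_ev_le {μ : PMF α} {f : α → ℝ} {B : ℝ} (hf : ∀ a ∈ μ.support, |f a| ≤ B) :
    |ev μ f| ≤ B := by
  rw [abs_le]
  constructor
  · rw [← ev_const μ (-B)]
    exact ev_mono (fun _ _ => le_rfl) hf fun a ha => (abs_le.1 (hf a ha)).1
  · rw [← ev_const μ B]
    exact ev_mono hf (fun _ _ => le_rfl) fun a ha => (abs_le.1 (hf a ha)).2

theorem ev_nonneg {μ : PMF α} {f : α → ℝ} (h : ∀ a, 0 ≤ f a) : 0 ≤ ev μ f :=
  tsum_nonneg fun a => mul_nonneg ENNReal.toReal_nonneg (h a)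

theorem ev_bind {μ : PMF α} {κ : α → PMF β} {f : β → ℝ} {B : ℝ}
    (hf : ∀ b ∈ (μ.bind κ).support, |f b| ≤ B) :
    ev (μ.bind κ) f = ev μ fun a => ev (κ a) f := by
  have h1 : ∀ b, ((μ.bind κ) b).toReal = ∑' a, (μ a).toReal * (κ a b).toReal := by
    intro b
    rw [PMF.bind_apply, ENNReal.tsum_toReal_eq fun a =>
      ENNReal.mul_ne_top (μ.apply_ne_top a) ((κ a).apply_ne_top b)]
    simp only [ENNReal.toReal_mul]
  have hs : Summable fun x : α × β => (μ x.1).toReal * (κ x.1 x.2).toReal := by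
    have h0 : (0 : α × β → ℝ) ≤ fun x => (μ x.1).toReal * (κ x.1 x.2).toReal := fun x =>
      mul_nonneg ENNReal.toReal_nonneg ENNReal.toReal_nonneg
    have h2 : ∀ a, ∑' b, (μ a).toReal * (κ a b).toReal = (μ a).toReal := fun a => by
      rw [tsum_mul_left, tsum_toReal, mul_one]
    have h3 : ∀ a, Summable fun b => (μ a).toReal * (κ a b).toReal := fun a =>
      (summable_toReal (κ a)).mul_left ((μ a).toReal)
    have h4 : Summable fun a => ∑' b, (μ a).toReal * (κ a b).toReal := by
      rw [funext h2]
      exact summable_toReal μ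
    exact (summable_prod_of_nonneg h0).2 ⟨h3, h4⟩
  have hs' : Summable fun x : α × β => (μ x.1).toReal * (κ x.1 x.2).toReal * f x.2 := by
    refine Summable.of_norm_bounded (hs.mul_right B) fun x => ?_
    rw [Real.norm_eq_abs, abs_mul, abs_of_nonneg (mul_nonneg ENNReal.toReal_nonneg
      ENNReal.toReal_nonneg)]
    by_cases hx : x.1 ∈ μ.support ∧ x.2 ∈ (κ x.1).support
    · exact mul_le_mul_of_nonneg_left (hf _ ((PMF.mem_support_bind_iff _ _ _).2 ⟨x.1, hx⟩))
        (mul_nonneg ENNReal.toReal_nonneg ENNReal.toReal_nonneg)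
    · rw [not_and_or] at hx
      rcases hx with hx | hx
      · simp [(PMF.apply_eq_zero_iff _ _).2 hx]
      · simp [(PMF.apply_eq_zero_iff _ _).2 hx]
  calc ev (μ.bind κ) f = ∑' b, ∑' a, (μ a).toReal * (κ a b).toReal * f b :=
        tsum_congr fun b => by rw [h1, tsum_mul_right]
    _ = ∑' a, ∑' b, (μ a).toReal * (κ a b).toReal * f b := 
        Summable.tsum_comm (f := fun a b => (μ a).toReal * (κ a b).toReal * f b) hs'
    _ = ev μ fun a => ev (κ a) f := tsum_congr fun a => by
        change _ = (μ a).toReal * ∑' b, (κ a b).toReal * f b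
        rw [← tsum_mul_left]
        exact tsum_congr fun b => by ring

theorem ev_pure (a : α) (f : α → ℝ) : ev (PMF.pure a) f = f a := by
  rw [ev, tsum_eq_single a]
  · simp
  · intro b hb
    simp [PMF.pure_apply, hb]

theorem ev_map {μ : PMF α} {g : α → β} {f : β → ℝ} {B : ℝ}
    (hf : ∀ a ∈ μ.support, |f (g a)| ≤ B) : ev (μ.map g) f = ev μ fun a => f (g a) := by
  rw [PMF.map, ev_bind (B := B)]
  · simp only [Function.comp, ev_pure]
  · intro b hb
    rw [← PMF.map, PMF.mem_support_map_iff] at hb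
    obtain ⟨a, ha, rfl⟩ := hb
    exact hf a ha

open Classical in
/-- The indicator of a proposition. -/
noncomputable def ind (p : Prop) : ℝ := if p then 1 else 0

theorem ind_of {p : Prop} (h : p) : ind p = 1 := if_pos h

theorem ind_of_not {p : Prop} (h : ¬ p) : ind p = 0 := if_neg h

theorem ind_nonneg (p : Prop) : 0 ≤ ind p := by rw [ind]; split_ifs <;> norm_num

theorem ind_le_one (p : Prop) : ind p ≤ 1 := by rw [ind]; split_ifs <;> norm_num

theorem abs_ind_le_one (p : Prop) : |ind p| ≤ 1 :=
  (abs_of_nonneg (ind_nonneg p)).trans_le (ind_le_one p)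

theorem ind_mono {p q : Prop} (h : p → q) : ind p ≤ ind q := by
  by_cases hp : p
  · rw [ind_of hp, ind_of (h hp)]
  · rw [ind_of_not hp]; exact ind_nonneg q

/-- The probability of an event. -/
noncomputable def pr (μ : PMF α) (E : α → Prop) : ℝ := ev μ fun a => ind (E a)

theorem pr_nonneg (μ : PMF α) (E : α → Prop) : 0 ≤ pr μ E := ev_nonneg fun _ => ind_nonneg _

theorem pr_mono {μ : PMF α} {E F : α → Prop} (h : ∀ a ∈ μ.support, E a → F a) :
    pr μ E ≤ pr μ F :=
  ev_mono (fun _ _ => abs_ind_le_one _) (fun _ _ => abs_ind_le_one _) fun a ha =>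
    ind_mono (h a ha)

theorem pr_le_one (μ : PMF α) (E : α → Prop) : pr μ E ≤ 1 :=
  (le_abs_self _).trans (abs_ev_le fun _ _ => abs_ind_le_one _)

theorem pr_not (μ : PMF α) (E : α → Prop) : pr μ (fun a => ¬ E a) = 1 - pr μ E := by
  have h1 := ev_sub (μ := μ) (f := fun _ => 1) (B := 1) (by simp)
    (fun a _ => abs_ind_le_one (E a))
  rw [ev_const] at h1
  rw [pr, pr, ← h1]
  refine ev_congr fun a _ => ?_
  by_cases h : E a
  · rw [ind_of h, ind_of_not (not_not.2 h), sub_self]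
  · rw [ind_of h, ind_of_not h, sub_zero]

theorem pr_or (μ : PMF α) (E F : α → Prop) : pr μ (fun a => E a ∨ F a) ≤ pr μ E + pr μ F := by
  rw [pr, pr, pr, ← ev_add (fun _ _ => abs_ind_le_one _) (fun _ _ => abs_ind_le_one _)]
  refine ev_mono (B := 1) (B' := 2) (fun _ _ => abs_ind_le_one _) (fun a _ => ?_) fun a _ => ?_
  · exact (abs_add_le _ _).trans (by linarith [abs_ind_le_one (E a), abs_ind_le_one (F a)])
  · by_cases h : E a
    · rw [ind_of h, ind_of (Or.inl h)]; linarith [ind_nonneg (F a)]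
    · have := ind_nonneg (E a)
      exact (ind_mono fun h' => h'.resolve_left h).trans (by linarith)

theorem pr_map (μ : PMF α) (g : α → β) (E : β → Prop) :
    pr (μ.map g) E = pr μ fun a => E (g a) :=
  ev_map fun _ _ => abs_ind_le_one _

theorem pr_bind (μ : PMF α) (κ : α → PMF β) (E : β → Prop) :
    pr (μ.bind κ) E = ev μ fun a => pr (κ a) E :=
  ev_bind fun _ _ => abs_ind_le_one _

theorem pr_eq_zero {μ : PMF α} {E : α → Prop} (h : ∀ a ∈ μ.support, ¬ E a) : pr μ E = 0 := by
  rw [pr, ev_congr (g := fun _ => 0) fun a ha => ind_of_not (h a ha), ev_const]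

theorem toReal_apply_eq_pr (μ : PMF α) (a : α) : (μ a).toReal = pr μ fun b => b = a := by
  rw [pr, ev, tsum_eq_single a]
  · rw [ind_of rfl, mul_one]
  · intro b hb
    rw [ind_of_not hb, mul_zero]

/-- If `E` fails with probability at most `p`, and `F` fails with conditional probability at most
`q` whenever `E` holds, then `F` fails with probability at most `p + q`. -/
theorem pr_bind_le {μ : PMF α} {κ : α → PMF β} {E : α → Prop} {F : β → Prop} {p q : ℝ}
    (hp : pr μ (fun a => ¬ E a) ≤ p) (hq0 : 0 ≤ q)
    (hq : ∀ a ∈ μ.support, E a → pr (κ a) (fun b => ¬ F b) ≤ q) :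
    pr (μ.bind κ) (fun b => ¬ F b) ≤ p + q := by
  have h1 := ev_add (μ := μ) (g := fun _ => q) (fun a _ => abs_ind_le_one (¬ E a))
    (fun _ _ => le_rfl)
  rw [ev_const] at h1
  rw [pr_bind]
  refine le_trans (ev_mono (B := 1) (B' := 1 + q) (fun a _ => ?_) (fun a _ => ?_) fun a ha => ?_)
    (h1.trans_le (add_le_add_left hp q))
  · rw [abs_of_nonneg (pr_nonneg _ _)]; exact pr_le_one _ _
  · rw [abs_of_nonneg (add_nonneg (ind_nonneg _) hq0)]
    linarith [ind_le_one (¬ E a)]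
  · by_cases h : E a
    · rw [ind_of_not (not_not.2 h), zero_add]; exact hq a ha h
    · rw [ind_of h]; exact (pr_le_one (κ a) _).trans (by linarith)

theorem prob_eq_pr (μ : PMF (Mem × ℕ)) (E : Mem → Prop) : prob μ E = pr (μ.map Prod.fst) E := by
  classical
  rw [pr_map, prob, PMF.toOuterMeasure_apply, pr, ev, ENNReal.tsum_toReal_eq]
  · refine tsum_congr fun a => ?_
    by_cases h : E a.1
    · rw [ind_of h]; simp [h]
    · rw [ind_of_not h]; simp [h]
  · intro a
    by_cases h : E a.1 <;> simp [h, PMF.apply_ne_top]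

theorem chain_pr_le {σ : Type*} {K : ℕ → σ → PMF σ} {s : σ} {I : ℕ → σ → Prop} {k : ℕ} {q : ℝ}
    (hq0 : 0 ≤ q) (h0 : I 0 s)
    (hs : ∀ i < k, ∀ a ∈ (chain K s i).support, I i a →
      pr (K i a) (fun b => ¬ I (i + 1) b) ≤ q) :
    pr (chain K s k) (fun b => ¬ I k b) ≤ k * q := by
  induction k with
  | zero =>
    rw [pr_eq_zero]
    · simp
    · intro a ha
      rw [chain, PMF.support_pure, Set.mem_singleton_iff] at ha
      simpa [ha] using h0
  | succ k ih =>
    rw [chain, Nat.cast_succ, add_mul, one_mul]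
    exact pr_bind_le (ih fun i hi => hs i (by omega)) hq0 (hs k (Nat.lt_succ_self k))

end Expectation

/-! ### A Chernoff bound -/

theorem exp_le_quadratic {x : ℝ} (hx : |x| ≤ 1) : Real.exp x ≤ 1 + x + x ^ 2 := by
  have := (abs_le.1 (Real.abs_exp_sub_one_sub_id_le hx)).2
  linarith

theorem ev_exp_le {α : Type*} {μ : PMF α} {X : α → ℝ} (hX : ∀ a ∈ μ.support, |X a| ≤ 1) {l p : ℝ}
    (hl0 : 0 ≤ l) (hl : l ≤ 1) (hp : ev μ X ≤ p) :
    ev μ (fun a => Real.exp (l * X a)) ≤ Real.exp (l * p + l ^ 2) := by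
  have h1 : ∀ a ∈ μ.support, |l * X a| ≤ 1 := fun a ha => by
    rw [abs_mul, abs_of_nonneg hl0]
    nlinarith [hX a ha, abs_nonneg (X a)]
  have h2 : ∀ a ∈ μ.support, |1 + l ^ 2 + l * X a| ≤ 3 := fun a ha => by
    have := abs_le.1 (h1 a ha)
    rw [abs_le]
    constructor <;> nlinarith
  calc ev μ (fun a => Real.exp (l * X a)) ≤ ev μ (fun a => 1 + l ^ 2 + l * X a) := by
        refine ev_mono (B := Real.exp 1) (fun a ha => ?_) h2 fun a ha => ?_
        · rw [abs_of_pos (Real.exp_pos _)]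
          exact Real.exp_le_exp.2 ((le_abs_self _).trans (h1 a ha))
        · have h3 : X a ^ 2 ≤ 1 := by
            rw [← sq_abs]; nlinarith [hX a ha, abs_nonneg (X a)]
          have := exp_le_quadratic (h1 a ha)
          nlinarith [sq_nonneg l]
    _ = 1 + l ^ 2 + l * ev μ X := by
        rw [ev_add (B := |1 + l ^ 2|) (fun _ _ => le_rfl) h1, ev_const, ev_const_mul]
    _ ≤ l * p + l ^ 2 + 1 := by nlinarith
    _ ≤ _ := Real.add_one_le_exp _

/-- The distribution of the sum of `N` independent random variables with distribution `μ`. -/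
noncomputable def sumDist {α : Type*} [AddCommMonoid α] (μ : PMF α) : ℕ → PMF α :=
  chain (fun _ s => μ.map fun x => s + x) 0

theorem abs_sumDist_le {α : Type*} [AddCommMonoid α] {μ : PMF α} {X : α →+ ℝ}
    (hX : ∀ a ∈ μ.support, |X a| ≤ 1) (N : ℕ) : ∀ a ∈ (sumDist μ N).support, |X a| ≤ N := by
  refine chain_support (I := fun i a => |X a| ≤ (i : ℝ)) (by simp) fun i _ a ha b hb => ?_
  rw [PMF.mem_support_map_iff] at hb
  obtain ⟨x, hx, rfl⟩ := hb
  rw [map_add]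
  push_cast
  exact (abs_add_le _ _).trans (add_le_add ha (hX x hx))

theorem ev_exp_sumDist_le {α : Type*} [AddCommMonoid α] {μ : PMF α} {X : α →+ ℝ}
    (hX : ∀ a ∈ μ.support, |X a| ≤ 1) {l p : ℝ} (hl0 : 0 ≤ l) (hl : l ≤ 1) (hp : ev μ X ≤ p)
    (N : ℕ) : ev (sumDist μ N) (fun a => Real.exp (l * X a)) ≤
      Real.exp (l * p + l ^ 2) ^ N := by
  have hb : ∀ N : ℕ, ∀ a ∈ (sumDist μ N).support, |Real.exp (l * X a)| ≤ Real.exp (l * N) := by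
    intro N a ha
    rw [abs_of_pos (Real.exp_pos _)]
    exact Real.exp_le_exp.2 (mul_le_mul_of_nonneg_left
      ((le_abs_self _).trans (abs_sumDist_le hX N a ha)) hl0)
  induction N with
  | zero => simp [sumDist, chain, ev_pure]
  | succ N ih =>
    have h1 := hb (N + 1)
    rw [sumDist, chain, ← sumDist] at h1 ⊢
    rw [ev_bind h1, pow_succ]
    have h2 : ∀ a ∈ (sumDist μ N).support,
        ev (μ.map fun x => a + x) (fun a => Real.exp (l * X a)) =
        ev μ (fun x => Real.exp (l * X x)) * Real.exp (l * X a) := by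
      intro a ha
      rw [ev_map (B := Real.exp (l * (N + 1 : ℕ))), mul_comm, ← ev_const_mul]
      · simp only [map_add, mul_add, Real.exp_add]
      · intro x hx
        exact h1 _ ((PMF.mem_support_bind_iff _ _ _).2 ⟨a, ha, by
          rw [PMF.mem_support_map_iff]; exact ⟨x, hx, rfl⟩⟩)
    rw [ev_congr h2, ev_const_mul, mul_comm]
    exact mul_le_mul ih (ev_exp_le hX hl0 hl hp) (ev_nonneg fun _ => (Real.exp_pos _).le)
      (by positivity)

theorem pr_sumDist_gt_le {α : Type*} [AddCommMonoid α] {μ : PMF α} {X : α →+ ℝ}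
    (hX : ∀ a ∈ μ.support, |X a| ≤ 1) {p t : ℝ} (ht0 : 0 ≤ t) (ht : t ≤ 2) (hp : ev μ X ≤ p)
    (N : ℕ) : pr (sumDist μ N) (fun a => N * (p + t) < X a) ≤ Real.exp (-(N * t ^ 2 / 4)) := by
  have h1 := ev_exp_sumDist_le hX (l := t / 2) (by linarith) (by linarith) hp N
  have h2 : ∀ a ∈ (sumDist μ N).support,
      |Real.exp (-(t / 2 * (N * (p + t)))) * Real.exp (t / 2 * X a)| ≤
      Real.exp (-(t / 2 * (N * (p + t)))) * Real.exp (t / 2 * N) := by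
    intro a ha
    rw [abs_of_pos (by positivity)]
    gcongr
    exact (le_abs_self _).trans (abs_sumDist_le hX N a ha)
  calc pr (sumDist μ N) (fun a => N * (p + t) < X a)
      ≤ ev (sumDist μ N) (fun a => Real.exp (-(t / 2 * (N * (p + t)))) *
          Real.exp (t / 2 * X a)) := by
        refine ev_mono (fun _ _ => abs_ind_le_one _) h2 fun a _ => ?_
        by_cases h : N * (p + t) < X a
        · rw [ind_of h, ← Real.exp_add, Real.one_le_exp_iff]
          nlinarith
        · rw [ind_of_not h]; positivity
    _ ≤ Real.exp (-(t / 2 * (N * (p + t)))) * Real.exp (t / 2 * p + (t / 2) ^ 2) ^ N := by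
        rw [ev_const_mul]
        gcongr
    _ = Real.exp (-(N * t ^ 2 / 4)) := by
        rw [← Real.exp_nat_mul, ← Real.exp_add]
        congr 1
        ring

/-- A Chernoff bound for the sum of `N` independent random variables with values in `[-1, 1]`
whose expectation is within `η` of `p`. -/
theorem pr_sumDist_le {α : Type*} [AddCommMonoid α] {μ : PMF α} {X : α →+ ℝ}
    (hX : ∀ a ∈ μ.support, |X a| ≤ 1) {p η t : ℝ} (ht0 : 0 ≤ t) (ht : t ≤ 2)
    (hp : |ev μ X - p| ≤ η) (N : ℕ) :
    pr (sumDist μ N) (fun a => ¬ |X a - N * p| ≤ N * (η + t)) ≤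
      2 * Real.exp (-(N * t ^ 2 / 4)) := by
  rw [abs_le] at hp
  have h1 := pr_sumDist_gt_le hX ht0 ht (p := p + η) (by linarith) N
  have h2 := pr_sumDist_gt_le (X := -X) (by simpa using hX) ht0 ht (p := -p + η) (by
    have : ev μ (⇑(-X)) = -1 * ev μ X := by rw [← ev_const_mul]; exact ev_congr fun a _ => by simp
    linarith) N
  refine (pr_mono (F := fun a => N * (p + η + t) < X a ∨ N * (-p + η + t) < (-X) a) ?_).trans
    ((pr_or _ _ _).trans (by linarith))
  intro a _ h
  rw [abs_le, not_and_or, not_le, not_le] at h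
  rw [AddMonoidHom.neg_apply]
  rcases h with h | h
  · right; linarith
  · left; linarith

theorem Runs.seq_map_pure {O : Oracle} {c c' : Prog} {M : Mem} {T T' : ℕ} {σ : Type*} {p : PMF σ}
    {e f : σ → Mem} (h : Runs O c M (p.map e) T)
    (h' : ∀ a ∈ p.support, Runs O c' (e a) (PMF.pure (f a)) T') :
    Runs O (.seq c c') M (p.map f) (T + T') := by
  have := h.seq_map h'
  rwa [show p.bind (fun a => PMF.pure (f a)) = p.map f from PMF.bind_pure_comp f p] at this

theorem Runs.computes {O : Oracle} {A : Prog} {ins : List ℤ} {k : ℕ} {σ : Type*} {p : PMF σ}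
    {e : σ → Mem} {T : ℕ} {ins' : List ℤ} {v : σ → List ℤ}
    (h : Runs O A (Mem.ofList ins') (p.map e) T)
    (hm : ins' = ins ++ List.replicate (ins'.length - ins.length) 0)
    (hv : ∀ a, (List.range k).map (e a) = v a) : Computes O A ins k (p.map v) T :=
  ⟨_, by rwa [hm, Mem.ofList_pad] at h, by
    rw [PMF.map_comp]; congr 1; funext a; exact hv a⟩

/-- Sequences of assignments, for memories given by lists. -/
def listBlk (l : List ℤ) : List (ℕ × Ex) → List ℤ
  | [] => l
  | (r, e) :: bl => listBlk (l.set r (e.eval (Mem.ofList l))) bl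

theorem Runs.listBlk {O : Oracle} {l l' : List ℤ} {b : ℕ} {bl : List (ℕ × Ex)}
    (hM : (Mem.ofList l).BitsLE b) (hr : ∀ x ∈ bl, x.1 < l.length) (h : listBlk l bl = l') :
    Runs O (.blk bl) (Mem.ofList l) (PMF.pure (Mem.ofList l')) (blkTime bl * (1 + b)) := by
  have key : ∀ (bl : List (ℕ × Ex)) (l : List ℤ), (∀ x ∈ bl, x.1 < l.length) →
      Mem.blk (Mem.ofList l) bl = Mem.ofList (CTState.listBlk l bl) := by
    intro bl
    induction bl with
    | nil => intro l _; rfl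
    | cons x bl ih =>
      intro l hr
      rw [Mem.blk_cons, Mem.update_ofList (hr x (by simp)), ih _ fun y hy => by
        rw [List.length_set]; exact hr y (List.mem_cons_of_mem _ hy)]
      rfl
  rw [← h, ← key bl l hr]
  exact Runs.blk bl hM

/-- Calls that return a tuple determined by the arguments, for memories given by lists. -/
theorem Computes.listCall {O : Oracle} {A : Prog} {l l' : List ℤ} {args rets : List ℕ}
    {v ins : List ℤ} {T b : ℕ} (h : Computes O A ins rets.length (PMF.pure v) T)
    (hb : (Mem.ofList l).BitsLE b) (ha : args.map (Mem.ofList l) = ins)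
    (hw : (Mem.ofList l).write rets v = Mem.ofList l') :
    Runs O (.call A args rets) (Mem.ofList l) (PMF.pure (Mem.ofList l'))
      ((1 + args.length + rets.length) * (1 + b + T)) := by
  subst ha
  rw [← hw]
  exact h.call_pure hb

theorem bitsLE_cons {a : ℤ} {l : List ℤ} {b : ℕ} :
    (Mem.ofList (a :: l)).BitsLE b ↔ bitLen a ≤ b ∧ (Mem.ofList l).BitsLE b :=
  ⟨fun h => ⟨h 0, fun i => h (i + 1)⟩, fun h i => by
    rcases i with _ | i
    · exact h.1
    · exact h.2 i⟩

theorem bitsLE_nil {b : ℕ} : (Mem.ofList []).BitsLE b := fun i => by simp [Mem.ofList]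

theorem bitLen_natCast_le_of_lt {k b : ℕ} (h : k < 2 ^ b) : bitLen (k : ℤ) ≤ b := by
  rwa [bitLen, Int.natAbs_natCast, Nat.size_le]

/-! ### Computing bit lengths and square roots -/

open Ex Prog in
theorem exists_bitLen : ∃ (A : Prog) (T : ℕ → ℕ), PolyB T ∧ ∀ (O : Oracle) (s z : ℕ),
    Nat.size z ≤ s → Computes O A [(z : ℤ)] 1 (PMF.pure [(Nat.size z : ℤ)]) (T s) := by
  refine ⟨.seq (.loop 0 (blk [(0, var 0 / 2), (1, var 1 + 1)])) (blk [(0, var 1)]), ?_⟩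
  constructor
  refine ⟨?_, fun O s z hz => ?_⟩
  rotate_left
  · have hb : ∀ i ≤ Nat.size z, (Mem.ofList [((z / 2 ^ i : ℕ) : ℤ), (i : ℤ)]).BitsLE s := by
      intro i hi
      refine bitsLE_cons.2 ⟨?_, bitsLE_cons.2 ⟨bitLen_natCast_le_of_le (hi.trans hz), bitsLE_nil⟩⟩
      rw [bitLen, Int.natAbs_natCast]
      exact (Nat.size_le_size (Nat.div_le_self _ _)).trans hz
    have h2 := Runs.loop_pure (O := O) (r := 0) hz
      (fun i => Mem.ofList [((z / 2 ^ i : ℕ) : ℤ), (i : ℤ)])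
      (fun i hi => by
        have := Nat.lt_size.1 hi
        simp only [Mem.ofList_cons_zero]
        exact_mod_cast Nat.div_pos this (by positivity))
      (by simp only [Mem.ofList_cons_zero]
          rw [Nat.div_eq_of_lt (Nat.lt_size_self z)]; simp)
      (fun i hi => hb i hi 0) fun i hi =>
        Runs.listBlk (bl := [(0, var 0 / 2), (1, var 1 + 1)]) (hb i hi.le) (by simp) (by
          rw [pow_succ, ← Nat.div_div_eq_div_mul]; rfl)
    have h3 := Runs.listBlk (O := O) (bl := [(0, var 1)]) (hb _ le_rfl) (by simp) rfl
    have h4 := h2.seq_pure h3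
    simp only [pow_zero, Nat.div_one] at h4
    exact (h4.computes_pure (ins := [(z : ℤ)]) rfl rfl).mono le_rfl
  · fun_prop

theorem sqrt_step (v q : ℕ) (hq : 0 < q) :
    (if 0 < (v : ℤ) - (((Nat.sqrt v / (2 * q) * (2 * q) : ℕ) : ℤ) + q) *
      (((Nat.sqrt v / (2 * q) * (2 * q) : ℕ) : ℤ) + q) + 1
      then ((Nat.sqrt v / (2 * q) * (2 * q) : ℕ) : ℤ) + q
      else ((Nat.sqrt v / (2 * q) * (2 * q) : ℕ) : ℤ)) = ((Nat.sqrt v / q * q : ℕ) : ℤ) := by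
  set r := Nat.sqrt v with hr
  have h1 : r / (2 * q) = r / q / 2 := by rw [mul_comm, Nat.div_div_eq_div_mul]
  set t := r / q with ht
  have hle : ∀ x : ℕ, x * x ≤ v ↔ x ≤ r := fun x => (Nat.le_sqrt).symm
  have h2 : t / 2 * (2 * q) + q ≤ r ↔ t % 2 = 1 := by
    have h3 : t / 2 * (2 * q) + q = (2 * (t / 2) + 1) * q := by ring
    rw [h3, ← Nat.le_div_iff_mul_le hq, ← ht]
    omega
  rw [h1]
  have h4 : (0 < (v : ℤ) - (((t / 2 * (2 * q) : ℕ) : ℤ) + q) * (((t / 2 * (2 * q) : ℕ) : ℤ) + q) + 1)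
      ↔ t % 2 = 1 := by
    rw [← h2, ← hle]
    zify
    constructor <;> intro h <;> linarith
  have h5 : t = 2 * (t / 2) + t % 2 := by omega
  split_ifs with h
  · rw [h4] at h
    rw [h] at h5
    have : t * q = t / 2 * (2 * q) + q := by conv_lhs => rw [h5]
                                             ring
    rw [this]; push_cast; ring
  · rw [h4] at h
    have h6 : t % 2 = 0 := by omega
    rw [h6] at h5
    have : t * q = t / 2 * (2 * q) := by conv_lhs => rw [h5]
                                         ring
    rw [this]

open Ex Prog in
/-- Integer square roots, by determining one binary digit after the other. -/
theorem exists_sqrt : ∃ (A : Prog) (T : ℕ → ℕ), PolyB T ∧ ∀ (O : Oracle) (s v B : ℕ),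
    B ≤ s → v < 2 ^ B → Computes O A [(v : ℤ), (B : ℤ)] 1 (PMF.pure [(Nat.sqrt v : ℤ)]) (T s) := by
  obtain ⟨P, TP, hTP, hP⟩ := exists_pow2
  refine ⟨.seq (.call P [1] [2]) (.seq (.loop 1 (blk [(2, var 2 / 2), (3, ite (var 0 -
    (var 3 + var 2) * (var 3 + var 2) + 1) (var 3 + var 2) (var 3)), (1, var 1 - 1)]))
    (blk [(0, var 3)])), ?_⟩
  constructor
  refine ⟨?_, fun O s v B hB hv => ?_⟩
  rotate_left
  · have hvB : Nat.sqrt v < 2 ^ B := (Nat.sqrt_le_self v).trans_lt hv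
    have hBs : (2 : ℕ) ^ B ≤ 2 ^ (s + 1) := Nat.pow_le_pow_right (by norm_num) (by omega)
    have hb : ∀ i ≤ B, (Mem.ofList [(v : ℤ), ((B - i : ℕ) : ℤ), ((2 ^ (B - i) : ℕ) : ℤ),
        ((Nat.sqrt v / 2 ^ (B - i) * 2 ^ (B - i) : ℕ) : ℤ)]).BitsLE (s + 1) := by
      intro i hi
      simp only [bitsLE_cons, bitsLE_nil, and_true]
      exact ⟨bitLen_natCast_le_of_lt (hv.trans_le hBs), bitLen_natCast_le_of_le (by omega),
        bitLen_natCast_le_of_lt (Nat.pow_lt_pow_right (by norm_num) (by omega)),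
        bitLen_natCast_le_of_lt (((Nat.div_mul_le_self _ _).trans_lt hvB).trans_le hBs)⟩
    have hb0 : (Mem.ofList [(v : ℤ), (B : ℤ), 0, 0]).BitsLE (s + 1) := by
      simp only [bitsLE_cons, bitsLE_nil, and_true, bitLen_zero]
      exact ⟨hb 0 (Nat.zero_le _) 0, bitLen_natCast_le_of_le (by omega), by omega, by omega⟩
    have h1 := (hP O s B hB).listCall (args := [1]) (rets := [2]) hb0 rfl
      (l' := [(v : ℤ), (B : ℤ), ((2 ^ B : ℕ) : ℤ), 0]) (by simp [Mem.write])
    have h2 := Runs.loop_pure (O := O) (r := 1) hB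
      (fun i => Mem.ofList [(v : ℤ), ((B - i : ℕ) : ℤ), ((2 ^ (B - i) : ℕ) : ℤ),
        ((Nat.sqrt v / 2 ^ (B - i) * 2 ^ (B - i) : ℕ) : ℤ)])
      (fun i hi => by simpa using hi) (by simp) (fun i hi => hb i hi 1) fun i hi =>
        Runs.listBlk (bl := [(2, var 2 / 2), (3, ite (var 0 -
          (var 3 + var 2) * (var 3 + var 2) + 1) (var 3 + var 2) (var 3)), (1, var 1 - 1)])
          (hb i hi.le) (by simp) (by
            have e1 : 2 ^ (B - i) = 2 * 2 ^ (B - (i + 1)) := by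
              rw [← pow_succ']; congr 1; omega
            have e2 : ((2 ^ (B - (i + 1)) : ℕ) : ℤ) = ((2 * 2 ^ (B - (i + 1)) : ℕ) : ℤ) / 2 := by
              push_cast; omega
            have e3 : ((B - (i + 1) : ℕ) : ℤ) = ((B - i : ℕ) : ℤ) - 1 := by omega
            rw [← sqrt_step v (2 ^ (B - (i + 1))) (by positivity), e3, e1, e2]
            rfl)
    have h3 := Runs.listBlk (O := O) (bl := [(0, var 3)]) (hb _ le_rfl) (by simp) rfl
    simp only [Nat.sub_zero, Nat.div_eq_of_lt hvB, zero_mul] at h2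
    exact ((h1.seq_pure (h2.seq_pure h3)).computes_pure rfl (by simp [listBlk])).mono le_rfl
  · fun_prop

/-! ### Biased coins -/

/-- The distribution of `k` fair bits, read as a number. -/
noncomputable def fairBits (k : ℕ) : PMF ℕ :=
  chain (fun _ u => (PMF.uniformOfFintype Bool).map fun b => 2 * u + b.toNat) 0 k

/-- A coin that shows `true` with probability `min 1 (c / 2 ^ k)`. -/
noncomputable def coin (k c : ℕ) : PMF Bool := (fairBits k).map fun u => decide (u < c)

theorem ev_uniform_bool (f : Bool → ℝ) :
    ev (PMF.uniformOfFintype Bool) f = (f false + f true) / 2 := by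
  rw [ev, tsum_bool]
  simp
  ring

theorem pr_fairBits_lt (k c : ℕ) :
    pr (fairBits k) (fun u => u < c) = (min c (2 ^ k) : ℕ) / 2 ^ k := by
  induction k generalizing c with
  | zero =>
    rw [fairBits, chain, pr, ev_pure]
    rcases Nat.eq_zero_or_pos c with rfl | h
    · rw [ind_of_not (lt_irrefl 0)]; simp
    · rw [ind_of h, pow_zero, min_eq_right (show 1 ≤ c from h)]; simp
  | succ k ih =>
    have h1 : ∀ u, pr ((PMF.uniformOfFintype Bool).map fun b => 2 * u + b.toNat) (fun u => u < c)
        = 1 / 2 * (ind (u < (c + 1) / 2) + ind (u < c / 2)) := by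
      intro u
      rw [pr_map, pr, ev_uniform_bool]
      rw [show (2 * u + false.toNat < c) = (u < (c + 1) / 2) by simp; omega,
        show (2 * u + true.toNat < c) = (u < c / 2) by simp; omega]
      ring
    rw [fairBits, chain, ← fairBits, pr_bind]
    simp only [h1]
    rw [ev_const_mul, ev_add (fun _ _ => abs_ind_le_one _) (fun _ _ => abs_ind_le_one _)]
    have h2 := ih ((c + 1) / 2)
    have h3 := ih (c / 2)
    rw [pr] at h2 h3
    rw [h2, h3, ← add_div, ← Nat.cast_add, show min ((c + 1) / 2) (2 ^ k) + min (c / 2) (2 ^ k) =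
      min c (2 ^ (k + 1)) by rw [pow_succ]; omega, pow_succ (2 : ℝ)]
    field_simp

theorem coin_true (k c : ℕ) : (coin k c true).toReal = min 1 ((c : ℝ) / 2 ^ k) := by
  rw [toReal_apply_eq_pr, coin, pr_map]
  simp only [decide_eq_true_eq]
  rw [pr_fairBits_lt, Nat.cast_min, ← min_div_div_right (by positivity), min_comm]
  simp

open Ex Prog in
theorem exists_coin : ∃ (A : Prog) (T : ℕ → ℕ), PolyB T ∧ ∀ (O : Oracle) (s k c : ℕ),
    k ≤ s → bitLen c ≤ s → Computes O A [(k : ℤ), (c : ℤ)] 1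
      ((coin k c).map fun b => [(b.toNat : ℤ)]) (T s) := by
  refine ⟨.seq (.loop 0 (.seq (.flip 3) (blk [(2, 2 * var 2 + var 3), (0, var 0 - 1), (3, 0)])))
    (blk [(0, ite (var 1 - var 2) 1 0)]), ?_⟩
  constructor
  refine ⟨?_, fun O s k c hk hc => ?_⟩
  rotate_left
  · have hb : ∀ i ≤ k, ∀ u : ℕ, u < 2 ^ i → ∀ b : Bool, (Mem.ofList [((k - i : ℕ) : ℤ), (c : ℤ), (u : ℤ),
        (b.toNat : ℤ)]).BitsLE (s + 1) := by
      intro i hi u hu b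
      simp only [bitsLE_cons, bitsLE_nil, and_true]
      refine ⟨bitLen_natCast_le_of_le (by omega), hc.trans (by omega),
        (bitLen_natCast_le_of_lt hu).trans (by omega), bitLen_natCast_le_of_lt ?_⟩
      have := b.toNat_lt
      exact this.trans_le (by rw [pow_succ]; have := Nat.one_le_two_pow (n := s); omega)
    have hstep : ∀ i < k, ∀ u, u < 2 ^ i → ∀ v ∈ ((PMF.uniformOfFintype Bool).map
        fun b => 2 * u + b.toNat).support, v < 2 ^ (i + 1) := fun i hi u hu v hv => by
      rw [PMF.mem_support_map_iff] at hv
      obtain ⟨b, -, rfl⟩ := hv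
      have := b.toNat_lt
      rw [pow_succ]; omega
    have h2 := Runs.loop (σ := ℕ) (O := O) (r := 0) hk
      (fun _ u => (PMF.uniformOfFintype Bool).map fun b => 2 * u + b.toNat)
      (fun i u => Mem.ofList [((k - i : ℕ) : ℤ), (c : ℤ), (u : ℤ), 0]) (fun i u => u < 2 ^ i) 0
      (by simp) (fun i hi u _ => by simpa using hi) (by simp)
      (fun i hi u hu => hb i hi u hu false 0)
      hstep fun i hi u hu => by
        have h3 := Runs.flip (O := O) (M := Mem.ofList [((k - i : ℕ) : ℤ), (c : ℤ), (u : ℤ), 0]) 3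
        rw [show (fun b : Bool => Function.update (Mem.ofList [((k - i : ℕ) : ℤ), (c : ℤ), (u : ℤ),
          0]) 3 (if b then 1 else 0)) = fun b : Bool => Mem.ofList [((k - i : ℕ) : ℤ), (c : ℤ),
          (u : ℤ), (b.toNat : ℤ)] by funext b; cases b <;> simp] at h3
        have h4 := h3.seq_map_pure (c' := blk [(2, 2 * var 2 + var 3), (0, var 0 - 1), (3, 0)])
          (f := fun b : Bool => Mem.ofList [((k - (i + 1) : ℕ) : ℤ), (c : ℤ),
            ((2 * u + b.toNat : ℕ) : ℤ), 0]) fun b _ =>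
          Runs.listBlk (hb i hi.le u hu b) (by simp) (by
            rw [show ((k - (i + 1) : ℕ) : ℤ) = ((k - i : ℕ) : ℤ) - 1 by omega]
            push_cast
            rfl)
        rw [PMF.map_comp]
        exact h4
    have h5 := h2.seq_map_pure (c' := blk [(0, ite (var 1 - var 2) 1 0)])
      (f := fun u => Mem.ofList [((decide (u < c)).toNat : ℤ), (c : ℤ), (u : ℤ), 0])
      fun u hu => Runs.listBlk (b := s + 1) (hb k le_rfl u (chain_support
        (I := fun i u => u < 2 ^ i) (by simp) hstep u hu) false) (by simp) (by
          have : (((decide (u < c)).toNat : ℕ) : ℤ) = if 0 < (c : ℤ) - u then 1 else 0 := by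
            by_cases h : u < c
            · simp [h]
            · simp [h]
          rw [this]
          simp [listBlk])
    have h6 := (h5.computes (k := 1) (ins := [(k : ℤ), (c : ℤ)]) rfl
      (v := fun u => [((decide (u < c)).toNat : ℤ)]) fun _ => rfl).mono le_rfl
    rw [coin, PMF.map_comp]
    exact h6
  · fun_prop

open Finset ComplexConjugate

/-! ### Product vectors and their marginals -/

theorem sum_range_mul {E : Type*} [AddCommMonoid E] (F : ℕ → E) (A M : ℕ) :
    ∑ y ∈ range (A * M), F y = ∑ h ∈ range M, ∑ z ∈ range A, F (z + A * h) := by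
  induction M with
  | zero => simp
  | succ M ih =>
    rw [Nat.mul_succ, Finset.sum_range_add, sum_range_succ, ih]
    simp only [add_comm]

theorem testBit_add_two_mul_zero (b : Bool) (h : ℕ) : (b.toNat + 2 * h).testBit 0 = b := by
  rw [Nat.testBit_zero]; cases b <;> simp

theorem testBit_add_two_mul_succ (b : Bool) (h i : ℕ) :
    (b.toNat + 2 * h).testBit (i + 1) = h.testBit i := by
  rw [Nat.testBit_succ]; congr 1; cases b <;> (simp; try omega)

theorem sum_range_two_pow_succ {E : Type*} [AddCommMonoid E] (F : ℕ → E) (k : ℕ) :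
    ∑ h ∈ range (2 ^ (k + 1)), F h = ∑ h ∈ range (2 ^ k), (F (false.toNat + 2 * h) +
      F (true.toNat + 2 * h)) := by
  rw [pow_succ', sum_range_mul]
  simp [sum_range_succ]

/-- The amplitude `∏ i < k, g i (h_i)` of a product vector, where `h_i` are the binary digits
of `h`. -/
def prodAmp (g : ℕ → Bool → ℂ) (k h : ℕ) : ℂ := ∏ i ∈ range k, g i (h.testBit i)

theorem prodAmp_cons (g : ℕ → Bool → ℂ) (k h : ℕ) (b : Bool) :
    prodAmp g (k + 1) (b.toNat + 2 * h) = g 0 b * prodAmp (fun i => g (i + 1)) k h := by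
  rw [prodAmp, prod_range_succ', mul_comm, testBit_add_two_mul_zero]
  simp only [testBit_add_two_mul_succ]
  rfl

theorem prodAmp_snoc (g : ℕ → Bool → ℂ) {k h : ℕ} (hh : h < 2 ^ k) (b : Bool) :
    prodAmp g (k + 1) (h + b.toNat * 2 ^ k) = prodAmp g k h * g k b := by
  have h1 : ∀ i ≤ k, (h + b.toNat * 2 ^ k).testBit i = if i = k then b else h.testBit i := by
    intro i hi
    rw [mul_comm, add_comm, Nat.testBit_two_pow_mul_add _ hh]
    rcases hi.lt_or_eq with hi | rfl
    · simp [hi, hi.ne]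
    · simp; cases b <;> simp
  rw [prodAmp, prod_range_succ, h1 k le_rfl, if_pos rfl, prodAmp]
  congr 1
  refine prod_congr rfl fun i hi => ?_
  rw [mem_range] at hi
  rw [h1 i hi.le, if_neg hi.ne]

theorem sum_prod_bits {R : Type*} [CommSemiring R] (F : ℕ → Bool → R) (k : ℕ) :
    ∑ h ∈ range (2 ^ k), ∏ i ∈ range k, F i (h.testBit i) =
      ∏ i ∈ range k, (F i false + F i true) := by
  induction k generalizing F with
  | zero => simp
  | succ k ih =>
    rw [sum_range_two_pow_succ, prod_range_succ', ← ih fun i => F (i + 1), sum_mul]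
    refine sum_congr rfl fun h _ => ?_
    simp only [prod_range_succ', testBit_add_two_mul_zero, testBit_add_two_mul_succ]
    rw [mul_add]

theorem sum_norm_prodAmp (g : ℕ → Bool → ℂ) (k : ℕ)
    (hg : ∀ i < k, ‖g i false‖ ^ 2 + ‖g i true‖ ^ 2 = 1) :
    ∑ h ∈ range (2 ^ k), ‖prodAmp g k h‖ ^ 2 = 1 := by
  have := sum_prod_bits (fun i b => ‖g i b‖ ^ 2) k
  rw [prod_eq_one fun i hi => hg i (mem_range.1 hi)] at this
  rw [← this]
  refine sum_congr rfl fun h _ => ?_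
  rw [prodAmp, norm_prod, prod_pow]

/-- An orthonormal basis of `n` qubits which consists of product vectors, together with a binary
tree that has the labels of the basis vectors as its leaves.

The vector with the label `a < 2 ^ n` has the amplitude `g a j b` for the value `b` of qubit `j`.
A node of level `k` is represented by a label; its children are `a` and `a + step k`. The labels
below a node of level `k` share the amplitudes of the last `k` qubits. -/
structure ProductBasis (n : ℕ) where
  /-- The amplitude `g a j b` of the value `b` of qubit `j`, in the vector with the label `a`. -/
  g : ℕ → ℕ → Bool → ℂ
  /-- The difference of the two children of a node of level `k`. -/
  step : ℕ → ℕ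
  /-- The nodes of level `k`. -/
  node : ℕ → ℕ → Prop
  norm_g : ∀ a j, ‖g a j false‖ ^ 2 + ‖g a j true‖ ^ 2 = 1
  node_zero : node 0 0
  node_left : ∀ {k a}, k < n → node k a → node (k + 1) a
  node_right : ∀ {k a}, k < n → node k a → node (k + 1) (a + step k)
  node_lt : ∀ {k a}, k ≤ n → node k a → a < 2 ^ n
  step_lt : ∀ {k}, k < n → step k < 2 ^ n
  g_right : ∀ {k a j}, k < n → node k a → n - k ≤ j → j < n → ∀ b, g (a + step k) j b = g a j b
  orth : ∀ {k a}, k < n → node k a →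
    conj (g a (n - k - 1) false) * g (a + step k) (n - k - 1) false +
    conj (g a (n - k - 1) true) * g (a + step k) (n - k - 1) true = 0
  exists_path : ∀ {x}, x < 2 ^ n → ∃ p : ℕ → ℕ, p 0 = 0 ∧ p n = x ∧
    ∀ k < n, p (k + 1) = p k ∨ p (k + 1) = p k + step k
  orth_vec : ∀ {x y}, x < 2 ^ n → y < 2 ^ n → x ≠ y → ∃ j < n,
    conj (g x j false) * g y j false + conj (g x j true) * g y j true = 0

namespace ProductBasis

variable {n : ℕ} (B : ProductBasis n) (ψ : ℕ → ℂ)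

/-- The common amplitudes of the last `k` qubits in all basis vectors below the node `a` of
level `k`. -/
def amp (k a h : ℕ) : ℂ := prodAmp (fun i => B.g a (n - k + i)) k h

theorem sum_norm_amp (k a : ℕ) : ∑ h ∈ range (2 ^ k), ‖B.amp k a h‖ ^ 2 = 1 :=
  sum_norm_prodAmp _ _ fun _ _ => B.norm_g _ _

/-- The inner product of the state `ψ` with the product vector of a node of level `k` on the last
`k` qubits and the basis vector `z` on the other ones. -/
def part (k a z : ℕ) : ℂ :=
  ∑ h ∈ range (2 ^ k), conj (B.amp k a h) * ψ (z + 2 ^ (n - k) * h)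

/-- The weight of the node `a` of level `k`, which is the sum of the weights of the basis vectors
below it. -/
noncomputable def wt (k a : ℕ) : ℝ := ∑ z ∈ range (2 ^ (n - k)), ‖B.part ψ k a z‖ ^ 2

theorem wt_nonneg (k a : ℕ) : 0 ≤ B.wt ψ k a := sum_nonneg fun _ _ => by positivity

theorem wt_zero (a : ℕ) : B.wt ψ 0 a = ∑ z ∈ range (2 ^ n), ‖ψ z‖ ^ 2 := by
  simp [wt, part, amp, prodAmp]

theorem wt_self (a : ℕ) : B.wt ψ n a = ‖B.part ψ n a 0‖ ^ 2 := by simp [wt]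

theorem amp_cons {k : ℕ} (hk : k < n) (a h : ℕ) (b : Bool) :
    B.amp (k + 1) a (b.toNat + 2 * h) = B.g a (n - k - 1) b * B.amp k a h := by
  rw [amp, prodAmp_cons, amp]
  congr 2
  funext i
  congr 1
  omega

theorem amp_right {k a : ℕ} (hk : k < n) (ha : B.node k a) (h : ℕ) :
    B.amp k (a + B.step k) h = B.amp k a h := by
  unfold amp prodAmp
  refine prod_congr rfl fun i hi => ?_
  rw [mem_range] at hi
  exact B.g_right hk ha (by omega) (by omega) _

theorem part_succ {k : ℕ} (hk : k < n) (a z : ℕ) :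
    B.part ψ (k + 1) a z = conj (B.g a (n - k - 1) false) *
      (∑ h ∈ range (2 ^ k), conj (B.amp k a h) * ψ (z + 2 ^ (n - k) * h)) +
      conj (B.g a (n - k - 1) true) * (∑ h ∈ range (2 ^ k), conj (B.amp k a h) *
        ψ (z + 2 ^ (n - k - 1) * 1 + 2 ^ (n - k) * h)) := by
  rw [part, sum_range_two_pow_succ, sum_add_distrib, mul_sum, mul_sum]
  have h1 : 2 ^ (n - k) = 2 ^ (n - k - 1) * 2 := by rw [← pow_succ]; congr 1; omega
  have h2 : n - (k + 1) = n - k - 1 := by omega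
  congr 1 <;> refine sum_congr rfl fun h _ => ?_
  · rw [B.amp_cons hk, map_mul, mul_assoc, h1, h2]
    congr 3
    simp [mul_assoc]
  · rw [B.amp_cons hk, map_mul, mul_assoc, h1, h2]
    congr 3
    simp only [Bool.toNat_true]
    ring

/-- Parseval's identity for an orthonormal basis of `ℂ²`. -/
theorem norm_sq_add_norm_sq_of_orth {u v u' v' : ℂ} (h : ‖u‖ ^ 2 + ‖v‖ ^ 2 = 1)
    (h' : ‖u'‖ ^ 2 + ‖v'‖ ^ 2 = 1) (ho : conj u * u' + conj v * v' = 0) (x y : ℂ) :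
    ‖conj u * x + conj v * y‖ ^ 2 + ‖conj u' * x + conj v' * y‖ ^ 2 = ‖x‖ ^ 2 + ‖y‖ ^ 2 := by
  -- A matrix with orthonormal rows also has orthonormal columns.
  have hM : !![conj u, conj v; conj u', conj v'] * !![u, u'; v, v'] = 1 := by
    have e1 : conj u * u + conj v * v = 1 := by
      rw [← Complex.normSq_eq_conj_mul_self, ← Complex.normSq_eq_conj_mul_self,
        Complex.normSq_eq_norm_sq, Complex.normSq_eq_norm_sq]
      exact_mod_cast h
    have e2 : conj u' * u' + conj v' * v' = 1 := by
      rw [← Complex.normSq_eq_conj_mul_self, ← Complex.normSq_eq_conj_mul_self,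
        Complex.normSq_eq_norm_sq, Complex.normSq_eq_norm_sq]
      exact_mod_cast h'
    have e3 : conj u' * u + conj v' * v = 0 := by
      have := congrArg conj ho
      simp only [map_add, map_mul, Complex.conj_conj, map_zero] at this
      rw [← this]; ring
    rw [Matrix.mul_fin_two, e1, e2, e3, ho, Matrix.one_fin_two]
  have hM' := mul_eq_one_comm.1 hM
  rw [Matrix.mul_fin_two, Matrix.one_fin_two] at hM'
  have f1 := congrFun (congrFun hM' 0) 0
  have f2 := congrFun (congrFun hM' 0) 1
  have f3 := congrFun (congrFun hM' 1) 0
  have f4 := congrFun (congrFun hM' 1) 1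
  simp at f1 f2 f3 f4
  have key : ∀ z : ℂ, ((‖z‖ ^ 2 : ℝ) : ℂ) = z * conj z := fun z => by
    rw [Complex.mul_conj, Complex.normSq_eq_norm_sq]
  have : ((‖conj u * x + conj v * y‖ ^ 2 + ‖conj u' * x + conj v' * y‖ ^ 2 : ℝ) : ℂ) =
      ((‖x‖ ^ 2 + ‖y‖ ^ 2 : ℝ) : ℂ) := by
    rw [Complex.ofReal_add, Complex.ofReal_add, key, key, key, key]
    simp only [map_add, map_mul, Complex.conj_conj]
    linear_combination x * conj x * f1 + y * conj x * f2 + x * conj y * f3 + y * conj y * f4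
  exact_mod_cast this

theorem wt_children {k a : ℕ} (hk : k < n) (ha : B.node k a) :
    B.wt ψ (k + 1) a + B.wt ψ (k + 1) (a + B.step k) = B.wt ψ k a := by
  have h1 : 2 ^ (n - k) = 2 ^ (n - k - 1) * 2 := by rw [← pow_succ]; congr 1; omega
  rw [wt, wt, wt, ← sum_add_distrib, show n - (k + 1) = n - k - 1 by omega, h1, sum_range_mul]
  rw [sum_range_succ, sum_range_one, ← sum_add_distrib]
  refine sum_congr rfl fun z _ => ?_
  rw [B.part_succ ψ hk, B.part_succ ψ hk]
  simp only [B.amp_right hk ha]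
  rw [norm_sq_add_norm_sq_of_orth (B.norm_g _ _) (B.norm_g _ _) (B.orth hk ha), mul_zero, add_zero]
  rfl

/-- The basis vectors are orthonormal. -/
theorem sum_conj_amp_mul_amp {x y : ℕ} (hx : x < 2 ^ n) (hy : y < 2 ^ n) :
    ∑ h ∈ range (2 ^ n), conj (B.amp n x h) * B.amp n y h = if x = y then 1 else 0 := by
  have h1 := sum_prod_bits (fun i b => conj (B.g x i b) * B.g y i b) n
  have h2 : ∀ a h, B.amp n a h = ∏ i ∈ range n, B.g a i (h.testBit i) := by
    intro a h
    simp [amp, prodAmp]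
  simp only [h2, map_prod, ← prod_mul_distrib]
  rw [h1]
  split_ifs with hxy
  · subst hxy
    refine prod_eq_one fun i _ => ?_
    rw [← Complex.normSq_eq_conj_mul_self, ← Complex.normSq_eq_conj_mul_self,
        Complex.normSq_eq_norm_sq, Complex.normSq_eq_norm_sq]
    exact_mod_cast B.norm_g x i
  · obtain ⟨j, hj, h⟩ := B.orth_vec hx hy hxy
    exact prod_eq_zero (mem_range.2 hj) h

theorem part_eq_coeff {c : ℕ → ℂ} (hc : ∀ y < 2 ^ n, ψ y = ∑ x ∈ range (2 ^ n), c x * B.amp n x y)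
    {x : ℕ} (hx : x < 2 ^ n) : B.part ψ n x 0 = c x := by
  rw [part]
  calc ∑ h ∈ range (2 ^ n), conj (B.amp n x h) * ψ (0 + 2 ^ (n - n) * h)
      = ∑ h ∈ range (2 ^ n), ∑ y ∈ range (2 ^ n), c y * (conj (B.amp n x h) * B.amp n y h) := by
        refine sum_congr rfl fun h hh => ?_
        rw [Nat.sub_self, pow_zero, one_mul, zero_add, hc h (mem_range.1 hh), mul_sum]
        exact sum_congr rfl fun y _ => by ring
    _ = ∑ y ∈ range (2 ^ n), c y * (if x = y then 1 else 0) := by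
        rw [sum_comm]
        refine sum_congr rfl fun y hy => ?_
        rw [← mul_sum, B.sum_conj_amp_mul_amp hx (mem_range.1 hy)]
    _ = c x := by simp [hx]

end ProductBasis

/-! ### Bounded unbiased estimators -/

/-- The quotient `2 conj x * y / (|x|² + |y|²)`, which has modulus at most one. -/
noncomputable def ratio (x y : ℂ) : ℂ := 2 * (conj x * y) / ((‖x‖ ^ 2 + ‖y‖ ^ 2 : ℝ) : ℂ)

theorem ratio_mul (x y : ℂ) :
    ((‖x‖ ^ 2 + ‖y‖ ^ 2 : ℝ) : ℂ) * ratio x y = 2 * (conj x * y) := by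
  rw [ratio]
  by_cases h : ((‖x‖ ^ 2 + ‖y‖ ^ 2 : ℝ) : ℂ) = 0
  · have h1 : ‖x‖ ^ 2 + ‖y‖ ^ 2 = 0 := by exact_mod_cast h
    have h2 : ‖x‖ = 0 := by nlinarith [sq_nonneg ‖x‖, sq_nonneg ‖y‖]
    rw [norm_eq_zero] at h2
    simp [h2]
  · field_simp

theorem norm_ratio_le (x y : ℂ) : ‖ratio x y‖ ≤ 1 := by
  rw [ratio, norm_div, Complex.norm_real, norm_mul, norm_mul, RCLike.norm_conj, Complex.norm_ofNat,
    Real.norm_of_nonneg (by positivity)]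
  exact div_le_one_of_le₀ (by nlinarith [sq_nonneg (‖x‖ - ‖y‖)]) (by positivity)

theorem ratio_comm (x y : ℂ) : ratio y x = conj (ratio x y) := by
  rw [ratio, ratio, map_div₀, Complex.conj_ofReal, add_comm (‖x‖ ^ 2)]
  congr 1
  simp only [map_mul, Complex.conj_conj, map_ofNat]
  ring

theorem ratio_smul (t : ℝ) (ht : t ≠ 0) (x y : ℂ) : ratio (t * x) (t * y) = ratio x y := by
  rw [ratio, ratio, norm_mul, norm_mul, map_mul, Complex.conj_ofReal, mul_pow, mul_pow, ← mul_add,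
    Complex.ofReal_mul, Complex.norm_real, Real.norm_eq_abs, sq_abs]
  have : (t : ℂ) ≠ 0 := by exact_mod_cast ht
  have h2 : ((t ^ 2 : ℝ) : ℂ) ≠ 0 := by exact_mod_cast pow_ne_zero 2 ht
  rw [show 2 * (t * conj x * (t * y)) = ((t ^ 2 : ℝ) : ℂ) * (2 * (conj x * y)) by push_cast; ring,
    mul_div_mul_left _ _ h2]

/-- For weights `x h` and `y h`, the squared modulus of `∑ conj (w h) * x h` is a mean, with
respect to the product of the distributions `|x|²` and `|w|²`, of a bounded quantity. -/
theorem sum_ratio_pair {ι : Type*} (s : Finset ι) (x w : ι → ℂ) :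
    ∑ i ∈ s, ∑ j ∈ s, ‖x i‖ ^ 2 * ‖w j‖ ^ 2 * (ratio (x i * w j) (x j * w i)).re =
      ‖∑ h ∈ s, conj (w h) * x h‖ ^ 2 := by
  set F : ι → ι → ℝ := fun i j => (ratio (x i * w j) (x j * w i)).re with hF
  have hsymm : ∀ i j, F i j = F j i := fun i j => by
    simp only [hF]; rw [ratio_comm, Complex.conj_re]
  have h1 : ∀ i j, ‖x i‖ ^ 2 * ‖w j‖ ^ 2 * F i j + ‖x j‖ ^ 2 * ‖w i‖ ^ 2 * F i j =
      2 * (conj (x i * w j) * (x j * w i)).re := fun i j => by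
    have := congrArg Complex.re (ratio_mul (x i * w j) (x j * w i))
    rw [Complex.re_ofReal_mul, ← Complex.ofReal_ofNat, Complex.re_ofReal_mul] at this
    rw [← this]
    simp only [norm_mul, mul_pow, hF]
    ring
  have h2 : ∑ i ∈ s, ∑ j ∈ s, ‖x i‖ ^ 2 * ‖w j‖ ^ 2 * F i j =
      ∑ i ∈ s, ∑ j ∈ s, ‖x j‖ ^ 2 * ‖w i‖ ^ 2 * F i j := by
    rw [sum_comm]
    exact sum_congr rfl fun i _ => sum_congr rfl fun j _ => by rw [hsymm]
  have h3 : ((‖∑ h ∈ s, conj (w h) * x h‖ ^ 2 : ℝ) : ℂ) =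
      ∑ i ∈ s, ∑ j ∈ s, conj (x i * w j) * (x j * w i) := by
    rw [← Complex.normSq_eq_norm_sq, Complex.normSq_eq_conj_mul_self, map_sum, sum_mul_sum]
    refine sum_congr rfl fun i _ => sum_congr rfl fun j _ => ?_
    simp only [map_mul, Complex.conj_conj]
    ring
  have h4 := congrArg Complex.re h3
  rw [Complex.ofReal_re, Complex.re_sum] at h4
  simp only [Complex.re_sum] at h4
  have h5 : 2 * ∑ i ∈ s, ∑ j ∈ s, ‖x i‖ ^ 2 * ‖w j‖ ^ 2 * F i j =
      2 * ‖∑ h ∈ s, conj (w h) * x h‖ ^ 2 := by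
    rw [h4, two_mul, mul_sum]
    conv_lhs => rw [h2]
    conv_lhs => lhs; rw [← h2]
    rw [← sum_add_distrib]
    refine sum_congr rfl fun i _ => ?_
    rw [← sum_add_distrib, mul_sum]
    exact sum_congr rfl fun j _ => h1 i j
  linarith

/-- An inner product of unit vectors is a mean, with respect to the average of the two
distributions that they define, of a bounded quantity. -/
theorem sum_ratio_single {ι : Type*} (s : Finset ι) (x w : ι → ℂ) (hx : ∑ i ∈ s, ‖x i‖ ^ 2 = 1)
    (hw : ∑ i ∈ s, ‖w i‖ ^ 2 = 1) :
    ∑ i ∈ s, ∑ j ∈ s, ((‖x i‖ ^ 2 * ‖w j‖ ^ 2 : ℝ) : ℂ) *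
      ((ratio (w i) (x i) + ratio (w j) (x j)) / 2) = ∑ h ∈ s, conj (w h) * x h := by
  have h1 : ∑ i ∈ s, ((‖x i‖ ^ 2 : ℝ) : ℂ) * ratio (w i) (x i) +
      ∑ j ∈ s, ((‖w j‖ ^ 2 : ℝ) : ℂ) * ratio (w j) (x j) = 2 * ∑ h ∈ s, conj (w h) * x h := by
    rw [← sum_add_distrib, mul_sum]
    refine sum_congr rfl fun i _ => ?_
    rw [← ratio_mul, ← add_mul, ← Complex.ofReal_add, add_comm (‖x i‖ ^ 2)]
  have hx' : ∑ i ∈ s, ((‖x i‖ ^ 2 : ℝ) : ℂ) = 1 := by exact_mod_cast congrArg Complex.ofReal hx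
  have hw' : ∑ i ∈ s, ((‖w i‖ ^ 2 : ℝ) : ℂ) = 1 := by exact_mod_cast congrArg Complex.ofReal hw
  calc _ = ((∑ i ∈ s, ((‖x i‖ ^ 2 : ℝ) : ℂ) * ratio (w i) (x i)) *
        (∑ j ∈ s, ((‖w j‖ ^ 2 : ℝ) : ℂ)) + (∑ i ∈ s, ((‖x i‖ ^ 2 : ℝ) : ℂ)) *
        ∑ j ∈ s, ((‖w j‖ ^ 2 : ℝ) : ℂ) * ratio (w j) (x j)) / 2 := by
        rw [sum_mul_sum, sum_mul_sum, ← sum_add_distrib, sum_div]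
        refine sum_congr rfl fun i _ => ?_
        rw [← sum_add_distrib, sum_div]
        refine sum_congr rfl fun j _ => ?_
        push_cast
        ring
    _ = _ := by rw [hx', hw', mul_one, one_mul, h1]; ring

/-- A quotient as in `ratio` is insensitive to perturbations where it matters: the perturbation is
multiplied by the denominator. -/
theorem norm_ratio_sub_le {x y x' y' : ℂ} {e : ℝ} (hx : ‖x' - x‖ ≤ e) (hy : ‖y' - y‖ ≤ e)
    (hx1 : ‖x‖ ≤ 1) (hy1 : ‖y‖ ≤ 1) (he : e ≤ 1) :
    (‖x‖ ^ 2 + ‖y‖ ^ 2) * ‖ratio x' y' - ratio x y‖ ≤ 12 * e := by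
  have h1 := ratio_mul x y
  have h2 := ratio_mul x' y'
  set r := ratio x y
  set r' := ratio x' y'
  have hr : ‖r'‖ ≤ 1 := norm_ratio_le x' y'
  have he0 : 0 ≤ e := (norm_nonneg _).trans hx
  have hx' : ‖x'‖ ≤ 2 := by
    have := norm_add_le (x' - x) x
    rw [sub_add_cancel] at this; linarith
  have hy' : ‖y'‖ ≤ 2 := by
    have := norm_add_le (y' - y) y
    rw [sub_add_cancel] at this; linarith
  have k1 : |‖x'‖ ^ 2 - ‖x‖ ^ 2| ≤ 3 * e := by
    rw [sq_sub_sq, abs_mul, abs_of_nonneg (by positivity)]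
    have := (abs_norm_sub_norm_le x' x).trans hx
    exact mul_le_mul (by linarith) this (abs_nonneg _) (by norm_num)
  have k2 : |‖y'‖ ^ 2 - ‖y‖ ^ 2| ≤ 3 * e := by
    rw [sq_sub_sq, abs_mul, abs_of_nonneg (by positivity)]
    have := (abs_norm_sub_norm_le y' y).trans hy
    exact mul_le_mul (by linarith) this (abs_nonneg _) (by norm_num)
  have k3 : ‖conj x' * y' - conj x * y‖ ≤ 3 * e := by
    rw [show conj x' * y' - conj x * y = conj (x' - x) * y' + conj x * (y' - y) by
      rw [map_sub]; ring]
    refine (norm_add_le _ _).trans ?_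
    rw [norm_mul, norm_mul, RCLike.norm_conj, RCLike.norm_conj]
    have := mul_le_mul hx hy' (norm_nonneg _) he0
    have := mul_le_mul hx1 hy (norm_nonneg _) zero_le_one
    linarith
  have e1 : ((‖x‖ ^ 2 + ‖y‖ ^ 2 : ℝ) : ℂ) * (r' - r) = 2 * (conj x' * y' - conj x * y) -
      (((‖x'‖ ^ 2 - ‖x‖ ^ 2) + (‖y'‖ ^ 2 - ‖y‖ ^ 2) : ℝ) : ℂ) * r' := by
    have : (((‖x'‖ ^ 2 - ‖x‖ ^ 2) + (‖y'‖ ^ 2 - ‖y‖ ^ 2) : ℝ) : ℂ) =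
      ((‖x'‖ ^ 2 + ‖y'‖ ^ 2 : ℝ) : ℂ) - ((‖x‖ ^ 2 + ‖y‖ ^ 2 : ℝ) : ℂ) := by push_cast; ring
    rw [this, mul_sub, sub_mul, h1, h2]; ring
  have e2 := congrArg norm e1
  rw [norm_mul, Complex.norm_real, Real.norm_of_nonneg (by positivity)] at e2
  rw [e2]
  refine (norm_sub_le _ _).trans ?_
  rw [norm_mul, norm_mul, Complex.norm_ofNat, Complex.norm_real, Real.norm_eq_abs]
  have := mul_le_mul ((abs_add_le _ _).trans (add_le_add k1 k2)) hr (norm_nonneg _) (by linarith)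
  linarith

/-! ### Bit strings and numbers -/

/-- The string of the `n` lowest binary digits of a number. -/
def bitsOf (n y : ℕ) : Bits n := fun j => y.testBit j

theorem Bits.toNat_eq {n : ℕ} (x : Bits n) : x.toNat = ∑ j : Fin n, (x j).toNat * 2 ^ (j : ℕ) := by
  refine sum_congr rfl fun j _ => ?_
  cases x j <;> simp

theorem Bits.toNat_lt {n : ℕ} (x : Bits n) : x.toNat < 2 ^ n := by
  induction n with
  | zero => simp [Bits.toNat]
  | succ n ih =>
    have := ih fun j => x j.castSucc
    rw [Bits.toNat_eq] at *
    rw [Fin.sum_univ_castSucc, pow_succ]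
    have h2 : (x (Fin.last n)).toNat * 2 ^ n ≤ 1 * 2 ^ n :=
      Nat.mul_le_mul_right _ (by have := (x (Fin.last n)).toNat_lt; omega)
    simp only [Fin.val_castSucc, Fin.val_last]
    omega

theorem Bits.testBit_toNat {n : ℕ} (x : Bits n) (j : Fin n) : x.toNat.testBit j = x j := by
  induction n with
  | zero => exact j.elim0
  | succ n ih =>
    have h1 := Bits.toNat_lt fun j : Fin n => x j.castSucc
    have h2 : x.toNat = 2 ^ n * (x (Fin.last n)).toNat +
        Bits.toNat fun j : Fin n => x j.castSucc := by
      rw [Bits.toNat_eq, Bits.toNat_eq, Fin.sum_univ_castSucc]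
      simp only [Fin.val_castSucc, Fin.val_last]
      ring
    rw [h2, Nat.testBit_two_pow_mul_add _ h1]
    refine Fin.lastCases ?_ (fun j => ?_) j
    · simp; cases x (Fin.last n) <;> simp
    · simpa using ih (fun j : Fin n => x j.castSucc) j

theorem bitsOf_toNat {n : ℕ} (x : Bits n) : bitsOf n x.toNat = x :=
  funext fun j => x.testBit_toNat j

theorem toNat_bitsOf {n y : ℕ} (hy : y < 2 ^ n) : (bitsOf n y).toNat = y := by
  refine Nat.eq_of_testBit_eq fun i => ?_
  by_cases hi : i < n
  · exact Bits.testBit_toNat (bitsOf n y) ⟨i, hi⟩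
  · rw [Nat.testBit_eq_false_of_lt, Nat.testBit_eq_false_of_lt]
    · exact hy.trans_le (Nat.pow_le_pow_right (by norm_num) (not_lt.1 hi))
    · exact (Bits.toNat_lt _).trans_le (Nat.pow_le_pow_right (by norm_num) (not_lt.1 hi))

theorem sum_bits {E : Type*} [AddCommMonoid E] {n : ℕ} (F : Bits n → E) :
    ∑ x, F x = ∑ y ∈ range (2 ^ n), F (bitsOf n y) :=
  sum_nbij' (fun x => x.toNat) (fun y => bitsOf n y)
    (fun x _ => mem_range.2 x.toNat_lt) (fun _ _ => mem_univ _) (fun x _ => bitsOf_toNat x)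
    (fun y hy => toNat_bitsOf (mem_range.1 hy)) fun x _ => by rw [bitsOf_toNat]

/-! ### Computationally tractable states -/

/-- `S` samples numbers `y < 2 ^ n` with distribution `sd m`, approximately `|φ y|²`, and `Q`
approximates the amplitudes `φ y`, with results distributed as `qd y m`. As for all procedures here,
the running time is bounded by `T s`, where `s` bounds the numbers of qubits and of digits. -/
structure TractableBy (S Q : Prog) (T : ℕ → ℕ) (n : ℕ) (φ : ℕ → ℂ) (sd : ℕ → PMF ℕ)
    (qd : ℕ → ℕ → PMF (ℤ × ℤ)) : Prop where
  sum_sq : ∑ y ∈ range (2 ^ n), ‖φ y‖ ^ 2 = 1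
  lt_of_mem : ∀ m, ∀ y ∈ (sd m).support, y < 2 ^ n
  ev_sub_le : ∀ (m : ℕ) (F : ℕ → ℝ), (∀ y, |F y| ≤ 1) →
    |ev (sd m) F - ∑ y ∈ range (2 ^ n), ‖φ y‖ ^ 2 * F y| ≤ 2 / 2 ^ m
  dyadic_sub_le : ∀ y < 2 ^ n, ∀ m, ∀ v ∈ (qd y m).support, ‖dyadic v.1 v.2 m - φ y‖ ≤ 1 / 2 ^ m
  computes_sample : ∀ (O : Oracle) (s m : ℕ), n ≤ s → m ≤ s →
    Computes O S [(n : ℤ), (m : ℤ)] 1 ((sd m).map fun y : ℕ => [(y : ℤ)]) (T s)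
  computes_amplitude : ∀ (O : Oracle) (s m y : ℕ), n ≤ s → m ≤ s → y < 2 ^ n →
    Computes O Q [(n : ℤ), (y : ℤ), (m : ℤ)] 2 ((qd y m).map fun v => [v.1, v.2]) (T s)

/-- The effect on expectations of reducing samples modulo `A` is at most the distance of the
distribution of the samples from a distribution on `{0, …, A - 1}`. -/
theorem abs_ev_emod_sub_le {μ : PMF ℤ} {A : ℕ} {q : ℕ → ℝ} {δ : ℝ}
    (hq : ∑ y ∈ range A, q y = 1) (h : ∑ y ∈ range A, |(μ (y : ℤ)).toReal - q y| ≤ δ) {F : ℕ → ℝ}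
    (hF : ∀ y, |F y| ≤ 1) :
    |ev (μ.map fun v : ℤ => (v % (A : ℤ)).toNat) F - ∑ y ∈ range A, q y * F y| ≤ 2 * δ := by
  rw [ev_map (B := 1) fun a _ => hF _]
  set G : ℤ → ℝ := fun v => F (v % A).toNat
  set R : ℤ → Prop := fun v => ∃ y ∈ range A, v = (y : ℤ) with hR
  have hG : ∀ v, |G v| ≤ 1 := fun v => hF _
  have hRG : ∀ v, |ind (R v) * G v| ≤ 1 := fun v => by
    rw [abs_mul]
    exact mul_le_one₀ (abs_ind_le_one _) (abs_nonneg _) (hG v)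
  have hsum : ∀ H : ℤ → ℝ, ev μ (fun v => ind (R v) * H v) =
      ∑ y ∈ range A, (μ (y : ℤ)).toReal * H y := by
    intro H
    rw [ev, tsum_eq_sum (s := (range A).map Nat.castEmbedding), sum_map]
    · refine sum_congr rfl fun y hy => ?_
      rw [Nat.castEmbedding_apply, ind_of (p := R y) ⟨y, hy, rfl⟩, one_mul]
    · intro v hv
      rw [ind_of_not, zero_mul, mul_zero]
      rintro ⟨y, hy, rfl⟩
      exact hv (mem_map.2 ⟨y, hy, rfl⟩)
  have h1 : ev μ G - ∑ y ∈ range A, q y * F y = ev μ (fun v => G v - ind (R v) * G v) +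
      ∑ y ∈ range A, ((μ (y : ℤ)).toReal - q y) * F y := by
    rw [ev_sub (fun v _ => hG v) (fun v _ => hRG v), hsum]
    have : ∑ y ∈ range A, (μ (y : ℤ)).toReal * G y =
        ∑ y ∈ range A, (μ (y : ℤ)).toReal * F y := sum_congr rfl fun y hy => by
      simp only [G]
      rw [Int.emod_eq_of_lt (by omega) (by rw [mem_range] at hy; omega), Int.toNat_natCast]
    simp only [sub_mul, sum_sub_distrib, this]
    ring
  have h2 : |∑ y ∈ range A, ((μ (y : ℤ)).toReal - q y) * F y| ≤ δ := by
    refine (abs_sum_le_sum_abs _ _).trans ((sum_le_sum fun y _ => ?_).trans h)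
    rw [abs_mul]
    exact mul_le_of_le_one_right (abs_nonneg _) (hF y)
  have h3 : |ev μ (fun v => G v - ind (R v) * G v)| ≤ δ := by
    have h4 : ∀ v, |G v - ind (R v) * G v| ≤ 1 - ind (R v) := fun v => by
      by_cases hv : R v
      · rw [ind_of hv]; simp
      · rw [ind_of_not hv]; simpa using hG v
    have h6 : ∀ v, |1 - ind (R v)| ≤ 1 := fun v => by
      rw [abs_le]; constructor <;> linarith [ind_nonneg (R v), ind_le_one (R v)]
    have h5 : ev μ (fun v => 1 - ind (R v)) ≤ δ := by
      have h7 := hsum fun _ => 1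
      simp only [mul_one] at h7
      rw [ev_sub (B := 1) (B' := 1) (by simp) (fun v _ => abs_ind_le_one _), ev_const, h7, ← hq,
        ← sum_sub_distrib]
      refine (sum_le_sum fun y _ => ?_).trans h
      rw [abs_sub_comm]; exact le_abs_self _
    rw [abs_le]
    constructor
    · have := ev_mono (μ := μ) (f := fun v => -1 * (1 - ind (R v)))
        (g := fun v => G v - ind (R v) * G v) (B := 1) (B' := 1)
        (fun v _ => by rw [abs_mul]; simpa using h6 v)
        (fun v _ => (h4 v).trans ((le_abs_self _).trans (h6 v)))
        fun v _ => by linarith [neg_abs_le (G v - ind (R v) * G v), h4 v]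
      rw [ev_const_mul] at this
      linarith
    · exact (ev_mono (B := 1) (B' := 1) (fun v _ => (h4 v).trans ((le_abs_self _).trans (h6 v)))
        (fun v _ => h6 v) fun v _ => (le_abs_self _).trans (h4 v)).trans h5
  rw [h1]
  exact (abs_add_le _ _).trans (by linarith)

open Ex Prog in
/-- The programs of a computationally tractable family, made independent of the oracle. The
samples are reduced modulo `2 ^ n`, since a sampling program may, with small probability, return
something that is not an `n`-bit string. -/
theorem exists_tractableBy {ψ : ∀ n, QState n} (hψ : IsCT ψ) :
    ∃ (S Q : Prog) (T : ℕ → ℕ), PolyB T ∧ ∀ n, ∃ sd qd,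
      TractableBy S Q T n (fun y => ψ n (bitsOf n y)) sd qd := by
  obtain ⟨hnorm, ⟨S, C, d, hS⟩, ⟨Q, C', d', hQ⟩⟩ := hψ
  obtain ⟨P, TP, hTP, hP⟩ := exists_pow2
  choose μ hμ1 hμ2 hμ3 using hS
  choose ν hν1 hν2 using hQ
  set T1 : ℕ → ℕ := fun s => 2 * (C * (1 + (s + s)) ^ d) with hT1
  set T2 : ℕ → ℕ := fun s => 2 * (C' * (1 + (s + s)) ^ d') with hT2
  have hsum : ∀ n, ∑ y ∈ range (2 ^ n), ‖ψ n (bitsOf n y)‖ ^ 2 = 1 := fun n => by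
    rw [← sum_bits fun x => ‖ψ n x‖ ^ 2, ← EuclideanSpace.norm_sq_eq, hnorm, one_pow]
  have key : ∃ (A : Prog) (T : ℕ → ℕ), PolyB T ∧ ∀ (O : Oracle) (s n m : ℕ), n ≤ s → m ≤ s →
      Computes O A [(n : ℤ), (m : ℤ)] 1 (((((μ n m).map Prod.fst).map fun M => M 0).map
        fun v : ℤ => (v % ((2 ^ n : ℕ) : ℤ)).toNat).map fun y : ℕ => [(y : ℤ)]) (T s) := by
    refine ⟨.seq (.call S.strip [0, 1] [2]) (.seq (.call P [0] [3])
      (blk [(0, var 2 - var 2 / var 3 * var 3)])), ?_⟩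
    constructor
    refine ⟨?_, fun O s n m hn hm => ?_⟩
    rotate_left
    · have hs : (Mem.ofList [(n : ℤ), (m : ℤ)]).BitsLE s := by
        simp only [bitsLE_cons, bitsLE_nil, and_true]
        exact ⟨bitLen_natCast_le_of_le hn, bitLen_natCast_le_of_le hm⟩
      have hs' : (Mem.ofList [(n : ℤ), (m : ℤ), 0, 0]).BitsLE s := by
        simp only [bitsLE_cons, bitsLE_nil, and_true, bitLen_zero] at hs ⊢
        exact ⟨hs.1, hs.2, by omega, by omega⟩
      have h1 : Runs O S.strip (Mem.ofList [(n : ℤ), (m : ℤ)]) ((μ n m).map Prod.fst) (T1 s) :=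
        Runs.of_strip (hμ1 n m) fun y hy => (hμ2 n m y hy).trans
          (Nat.mul_le_mul_left _ (Nat.pow_le_pow_left (by omega) _))
      have hb := h1.bitsLE hs
      have h2 := Computes.call (rets := [2]) (args := [0, 1])
        (M := Mem.ofList [(n : ℤ), (m : ℤ), 0, 0]) (ν := ((μ n m).map Prod.fst).map fun M => [M 0])
        ⟨_, h1, rfl⟩ hs'
      have e1 : (((μ n m).map Prod.fst).map fun M => [M 0]).map
          ((Mem.ofList [(n : ℤ), (m : ℤ), 0, 0]).write [2]) =
          ((μ n m).map Prod.fst).map fun M => Mem.ofList [(n : ℤ), (m : ℤ), M 0, 0] := by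
        rw [PMF.map_comp]
        congr 1
        funext M
        simp [Mem.write]
      rw [e1] at h2
      have h3 := h2.seq_map_pure (c' := .seq (.call P [0] [3])
        (blk [(0, var 2 - var 2 / var 3 * var 3)]))
        (f := fun M : Mem => Mem.ofList [(((M 0 % ((2 ^ n : ℕ) : ℤ)).toNat : ℕ) : ℤ), (m : ℤ), M 0,
          ((2 ^ n : ℕ) : ℤ)]) fun M hM => by
        have b1 : (Mem.ofList [(n : ℤ), (m : ℤ), M 0, 0]).BitsLE (s + T1 s + 1) := by
          simp only [bitsLE_cons, bitsLE_nil, and_true, bitLen_zero] at hs ⊢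
          exact ⟨by omega, by omega, (hb M hM 0).trans (by omega), by omega⟩
        have b2 : (Mem.ofList [(n : ℤ), (m : ℤ), M 0, ((2 ^ n : ℕ) : ℤ)]).BitsLE
            (s + T1 s + 1) := by
          simp only [bitsLE_cons, bitsLE_nil, and_true] at b1 ⊢
          refine ⟨b1.1, b1.2.1, b1.2.2.1, ?_⟩
          push_cast
          exact (bitLen_two_pow n).trans (by omega)
        have k1 := (hP O s n hn).listCall (args := [0]) (rets := [3]) b1 rfl
          (l' := [(n : ℤ), (m : ℤ), M 0, ((2 ^ n : ℕ) : ℤ)]) (by simp [Mem.write])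
        have k2 := Runs.listBlk (O := O) (bl := [(0, var 2 - var 2 / var 3 * var 3)]) b2
          (by simp) (l' := [(((M 0 % ((2 ^ n : ℕ) : ℤ)).toNat : ℕ) : ℤ), (m : ℤ), M 0,
          ((2 ^ n : ℕ) : ℤ)]) (by
            rw [Int.toNat_of_nonneg (Int.emod_nonneg _ (by positivity)), Int.emod_def, mul_comm]
            rfl)
        exact k1.seq_pure k2
      have h4 := (h3.computes (k := 1) (ins := [(n : ℤ), (m : ℤ)]) rfl
        (v := fun M : Mem => [(((M 0 % ((2 ^ n : ℕ) : ℤ)).toNat : ℕ) : ℤ)]) fun _ => rfl).mono le_rfl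
      simp only [PMF.map_comp] at h4 ⊢
      exact h4
    · fun_prop
  obtain ⟨A, TA, hTA, hA⟩ := key
  refine ⟨A, Q.strip, fun s => TA s + T2 s, by fun_prop, fun n =>
    ⟨fun m => (((μ n m).map Prod.fst).map fun M => M 0).map fun v : ℤ => (v % ((2 ^ n : ℕ) : ℤ)).toNat,
    fun y m => ((ν n m (bitsOf n y)).map Prod.fst).map fun M => (M 0, M 1), ?_⟩⟩
  constructor
  · exact hsum n
  · intro m y hy
    rw [PMF.mem_support_map_iff] at hy
    obtain ⟨v, -, rfl⟩ := hy
    have := Int.emod_lt_of_pos v (show (0 : ℤ) < (2 ^ n : ℕ) by positivity)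
    have := Int.emod_nonneg v (show ((2 ^ n : ℕ) : ℤ) ≠ 0 by positivity)
    omega
  · intro m F hF
    have := abs_ev_emod_sub_le (μ := ((μ n m).map Prod.fst).map fun M => M 0) (A := 2 ^ n)
      (q := fun y => ‖ψ n (bitsOf n y)‖ ^ 2) (δ := 1 / 2 ^ m) (hsum n) (by
        refine le_trans (le_of_eq ?_) (hμ3 n m)
        rw [sum_bits]
        refine sum_congr rfl fun y hy => ?_
        rw [toNat_bitsOf (mem_range.1 hy), toReal_apply_eq_pr, pr_map, prob_eq_pr]) hF
    rw [mul_one_div] at this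
    exact this
  · intro y hy m v hv
    simp only [PMF.mem_support_map_iff] at hv
    obtain ⟨M, ⟨z, hz, rfl⟩, rfl⟩ := hv
    exact (hν2 n m (bitsOf n y) z hz).2
  · intro O s m hn hm
    exact (hA O s n m hn hm).mono (by simp)
  · intro O s m y hn hm hy
    have h1 := hν1 n m (bitsOf n y)
    rw [toNat_bitsOf hy] at h1
    refine Computes.mono ⟨_, Runs.of_strip h1 fun z hz => ((hν2 n m _ z hz).1).trans
      (Nat.mul_le_mul_left _ (Nat.pow_le_pow_left (by omega : 1 + n + m ≤ 1 + (s + s)) _)),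
      ?_⟩ (Nat.le_add_left _ _)
    rw [PMF.map_comp, PMF.map_comp, PMF.map_comp]
    rfl

theorem Computes.listCallMap {O : Oracle} {A : Prog} {l : List ℤ} {args rets : List ℕ}
    {σ : Type*} {p : PMF σ} {v : σ → List ℤ} {l' : σ → List ℤ} {ins : List ℤ} {T b : ℕ}
    (h : Computes O A ins rets.length (p.map v) T)
    (hb : (Mem.ofList l).BitsLE b) (ha : args.map (Mem.ofList l) = ins)
    (hw : ∀ a, (Mem.ofList l).write rets (v a) = Mem.ofList (l' a)) :
    Runs O (.call A args rets) (Mem.ofList l) (p.map fun a => Mem.ofList (l' a))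
      ((1 + args.length + rets.length) * (1 + b + T)) := by
  subst ha
  have := h.call hb
  rwa [PMF.map_comp, show (Mem.ofList l).write rets ∘ v = fun a => Mem.ofList (l' a) from
    funext hw] at this

/-! ### Gaussian integers -/

theorem dyadic_eq (a b : ℤ) (m : ℕ) :
    dyadic a b m = ((a / 2 ^ m : ℝ) : ℂ) + ((b / 2 ^ m : ℝ) : ℂ) * Complex.I := by
  rw [dyadic]; push_cast; ring

theorem dyadic_re (a b : ℤ) (m : ℕ) : (dyadic a b m).re = a / 2 ^ m := by
  rw [dyadic_eq]; simp only [Complex.add_re, Complex.ofReal_re, Complex.re_ofReal_mul,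
    Complex.I_re, mul_zero, add_zero]

theorem dyadic_im (a b : ℤ) (m : ℕ) : (dyadic a b m).im = b / 2 ^ m := by
  rw [dyadic_eq]; simp only [Complex.add_im, Complex.ofReal_im, Complex.im_ofReal_mul,
    Complex.I_im, mul_one, zero_add]

theorem bitLen_of_abs_div_sub_le {a : ℤ} {m : ℕ} {x : ℝ} (h : |a / 2 ^ m - x| ≤ 1 / 2 ^ m)
    (hx : |x| ≤ 1) : bitLen a ≤ m + 2 := by
  rw [bitLen_le_iff]
  have h1 : |(a : ℝ)| ≤ 1 + 2 ^ m := by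
    have h2 : |(a : ℝ) / 2 ^ m| ≤ 1 / 2 ^ m + 1 := by
      have := abs_add_le (a / 2 ^ m - x) x
      rw [sub_add_cancel] at this
      linarith
    rw [abs_div, abs_of_pos (by positivity : (0 : ℝ) < 2 ^ m), div_add_one (by positivity)] at h2
    exact (div_le_div_iff_of_pos_right (by positivity)).1 h2
  have h3 : (1 : ℝ) ≤ 2 ^ m := one_le_pow₀ (by norm_num)
  have h4 : |(a : ℝ)| < 2 ^ (m + 2) := by rw [pow_add]; linarith
  exact_mod_cast h4

theorem bitLen_of_dyadic_sub_le {a b : ℤ} {m : ℕ} {z : ℂ} (h : ‖dyadic a b m - z‖ ≤ 1 / 2 ^ m)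
    (hz : ‖z‖ ≤ 1) : bitLen a ≤ m + 2 ∧ bitLen b ≤ m + 2 := by
  constructor
  · refine bitLen_of_abs_div_sub_le (x := z.re) ?_ ((Complex.abs_re_le_norm z).trans hz)
    rw [← dyadic_re a b, ← Complex.sub_re]
    exact (Complex.abs_re_le_norm _).trans h
  · refine bitLen_of_abs_div_sub_le (x := z.im) ?_ ((Complex.abs_im_le_norm z).trans hz)
    rw [← dyadic_im a b, ← Complex.sub_im]
    exact (Complex.abs_im_le_norm _).trans h

/-- The product of two Gaussian integers. -/
def gmul (x y : ℤ × ℤ) : ℤ × ℤ := (x.1 * y.1 - x.2 * y.2, x.1 * y.2 + x.2 * y.1)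

theorem dyadic_gmul (x y : ℤ × ℤ) (m m' : ℕ) : dyadic (gmul x y).1 (gmul x y).2 (m + m') =
    dyadic x.1 x.2 m * dyadic y.1 y.2 m' := by
  rw [dyadic, dyadic, dyadic, gmul, pow_add, div_mul_div_comm]
  congr 1
  push_cast
  linear_combination -(x.2 : ℂ) * y.2 * Complex.I_sq

theorem bitLen_gmul {x y : ℤ × ℤ} {b b' : ℕ} (h1 : bitLen x.1 ≤ b) (h2 : bitLen x.2 ≤ b)
    (h3 : bitLen y.1 ≤ b') (h4 : bitLen y.2 ≤ b') :
    bitLen (gmul x y).1 ≤ b + b' + 1 ∧ bitLen (gmul x y).2 ≤ b + b' + 1 := by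
  constructor
  · rw [gmul, sub_eq_add_neg]
    refine bitLen_add_of_le ?_ ?_
    · exact (bitLen_mul _ _).trans (by omega)
    · rw [bitLen_neg]; exact (bitLen_mul _ _).trans (by omega)
  · exact bitLen_add_of_le ((bitLen_mul _ _).trans (by omega)) ((bitLen_mul _ _).trans (by omega))

/-- The product of the Gaussian integers `f i (h_i)`, `i < k`, where `h_i` are the binary digits
of `h`. -/
def intProd (f : ℕ → Bool → ℤ × ℤ) : ℕ → ℕ → ℤ × ℤ
  | 0, _ => (1, 0)
  | i + 1, h => gmul (intProd f i h) (f i (h.testBit i))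

theorem dyadic_intProd (f : ℕ → Bool → ℤ × ℤ) (m k h : ℕ) :
    dyadic (intProd f k h).1 (intProd f k h).2 (m * k) =
      prodAmp (fun i b => dyadic (f i b).1 (f i b).2 m) k h := by
  induction k with
  | zero => simp [intProd, prodAmp, dyadic]
  | succ k ih =>
    rw [intProd, Nat.mul_succ, dyadic_gmul, ih, prodAmp, prodAmp, prod_range_succ]

theorem intProd_congr {f : ℕ → Bool → ℤ × ℤ} {k h h' : ℕ}
    (H : ∀ i < k, h.testBit i = h'.testBit i) : intProd f k h = intProd f k h' := by
  induction k with
  | zero => rfl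
  | succ k ih =>
    rw [intProd, intProd, ih fun i hi => H i (by omega), H k (Nat.lt_succ_self k)]

theorem intProd_snoc (f : ℕ → Bool → ℤ × ℤ) {k h : ℕ} (hh : h < 2 ^ k) (b : Bool) :
    intProd f (k + 1) (h + b.toNat * 2 ^ k) = gmul (intProd f k h) (f k b) := by
  have h1 : ∀ i ≤ k, (h + b.toNat * 2 ^ k).testBit i = if i = k then b else h.testBit i := by
    intro i hi
    rw [mul_comm, add_comm, Nat.testBit_two_pow_mul_add _ hh]
    rcases hi.lt_or_eq with hi | rfl
    · simp [hi, hi.ne]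
    · simp; cases b <;> simp
  rw [intProd, h1 k le_rfl, if_pos rfl, intProd_congr (h' := h)]
  intro i hi
  rw [h1 i hi.le, if_neg hi.ne]

theorem bitLen_intProd {f : ℕ → Bool → ℤ × ℤ} {m k : ℕ}
    (hf : ∀ i < k, ∀ b, bitLen (f i b).1 ≤ m ∧ bitLen (f i b).2 ≤ m) (h : ℕ) :
    bitLen (intProd f k h).1 ≤ k * (m + 1) + 1 ∧ bitLen (intProd f k h).2 ≤ k * (m + 1) + 1 := by
  induction k with
  | zero => simp [intProd]
  | succ k ih =>
    have h1 := ih fun i hi => hf i (by omega)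
    have h2 := hf k (Nat.lt_succ_self k) (h.testBit k)
    have h3 := bitLen_gmul h1.1 h1.2 h2.1 h2.2
    rw [intProd, Nat.succ_mul]
    exact ⟨h3.1.trans (by omega), h3.2.trans (by omega)⟩

/-! ### Sampling from a product vector -/

/-- `loc a j b m` is an approximation to `m` binary digits of the amplitude `B.g a j b`, computed
by the program `L`. -/
structure LocalBy (L : Prog) (T : ℕ → ℕ) {n : ℕ} (O : Oracle) (B : ProductBasis n)
    (loc : ℕ → ℕ → Bool → ℕ → ℤ × ℤ) : Prop where
  dyadic_sub_le : ∀ a < 2 ^ n, ∀ j < n, ∀ b m,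
    ‖dyadic (loc a j b m).1 (loc a j b m).2 m - B.g a j b‖ ≤ 1 / 2 ^ m
  computes : ∀ (s a j : ℕ) (b : Bool) (m : ℕ), n ≤ s → m ≤ s → a < 2 ^ n → j < n →
    Computes O L [(n : ℤ), (a : ℤ), (j : ℤ), (b.toNat : ℤ), (m : ℤ)] 2
      (PMF.pure [(loc a j b m).1, (loc a j b m).2]) (T s)

theorem ProductBasis.norm_g_le {n : ℕ} (B : ProductBasis n) (a j : ℕ) (b : Bool) :
    ‖B.g a j b‖ ≤ 1 := by
  have := B.norm_g a j
  cases b <;> nlinarith [sq_nonneg ‖B.g a j false‖, sq_nonneg ‖B.g a j true‖,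
    norm_nonneg (B.g a j false), norm_nonneg (B.g a j true)]

theorem LocalBy.bitLen_le {L : Prog} {T : ℕ → ℕ} {n : ℕ} {O : Oracle} {B : ProductBasis n}
    {loc : ℕ → ℕ → Bool → ℕ → ℤ × ℤ} (h : LocalBy L T O B loc) {a j : ℕ} (ha : a < 2 ^ n)
    (hj : j < n) (b : Bool) (m : ℕ) :
    bitLen (loc a j b m).1 ≤ m + 2 ∧ bitLen (loc a j b m).2 ≤ m + 2 :=
  bitLen_of_dyadic_sub_le (h.dyadic_sub_le a ha j hj b m) (B.norm_g_le a j b)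

/-- The squared modulus of a Gaussian integer. -/
def gnorm (x : ℤ × ℤ) : ℕ := (x.1 * x.1 + x.2 * x.2).toNat

theorem natCast_gnorm (x : ℤ × ℤ) : (gnorm x : ℤ) = x.1 * x.1 + x.2 * x.2 :=
  Int.toNat_of_nonneg (by nlinarith [mul_self_nonneg x.1, mul_self_nonneg x.2])

theorem bitLen_bool (b : Bool) : bitLen (b.toNat : ℤ) ≤ 1 := by cases b <;> simp

open Ex Prog in
/-- Measuring one qubit of a product vector: a bit is drawn with the probabilities given by the
amplitudes, and returned together with its amplitude and the amplitude of a second, given bit. -/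
theorem exists_measureQubit (L : Prog) {T : ℕ → ℕ} (hT : PolyB T) :
    ∃ (A : Prog) (T' : ℕ → ℕ), PolyB T' ∧ ∀ (n : ℕ) (O : Oracle) (B : ProductBasis n)
      (loc : ℕ → ℕ → Bool → ℕ → ℤ × ℤ), LocalBy L T O B loc →
      ∀ (s a j m : ℕ) (t : Bool), n ≤ s → m ≤ s → a < 2 ^ n → j < n →
      Computes O A [(n : ℤ), (a : ℤ), (j : ℤ), (m : ℤ), (t.toNat : ℤ)] 5
        ((coin (2 * m) (gnorm (loc a j true m))).map fun b =>
          [(b.toNat : ℤ), (loc a j b m).1, (loc a j b m).2, (loc a j t m).1, (loc a j t m).2])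
        (T' s) := by
  obtain ⟨P, TP, hTP, hP⟩ := exists_coin
  -- Registers: 5, 6 the values `0`, `1` of a bit; 7, 8 and 9, 10 the amplitudes of these values;
  -- 11 and 12 the numerator and the number of digits of the probability of `1`; 13 the new bit.
  refine ⟨.seq (blk [(6, 1), (12, 2 * var 3)]) (.seq (.call L [0, 1, 2, 5, 3] [7, 8])
    (.seq (.call L [0, 1, 2, 6, 3] [9, 10]) (.seq (blk [(11, var 9 * var 9 + var 10 * var 10)])
    (.seq (.call P [12, 11] [13]) (blk [(0, var 13), (1, ite (var 13) (var 9) (var 7)),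
      (2, ite (var 13) (var 10) (var 8)), (5, ite (var 4) (var 9) (var 7)),
      (6, ite (var 4) (var 10) (var 8)), (3, var 5), (4, var 6)]))))), ?_⟩
  constructor
  refine ⟨?_, fun n O B loc hL s a j m t hn hm ha hj => ?_⟩
  rotate_left
  · set f := loc a j false m with hf
    set g := loc a j true m with hg
    have bf : bitLen f.1 ≤ m + 2 ∧ bitLen f.2 ≤ m + 2 := hL.bitLen_le ha hj false m
    have bg : bitLen g.1 ≤ m + 2 ∧ bitLen g.2 ≤ m + 2 := hL.bitLen_le ha hj true m
    have bn := bitLen_natCast_le_of_le hn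
    have bm := bitLen_natCast_le_of_le hm
    have ba := bitLen_natCast_le_of_lt ha
    have bj := bitLen_natCast_le_of_le (hj.le.trans hn)
    have bt := bitLen_bool t
    have bm2 := bitLen_natCast_le_of_le (show 2 * m ≤ s + s by omega)
    have bG : bitLen (gnorm g : ℤ) ≤ 2 * s + 5 := by
      rw [natCast_gnorm]
      exact bitLen_add_of_le ((bitLen_mul _ _).trans (by omega : _ ≤ 2 * s + 4))
        ((bitLen_mul _ _).trans (by omega))
    have l0 : (Mem.ofList [(n : ℤ), a, j, m, t.toNat, 0, 0, 0, 0, 0, 0, 0, 0, 0]).BitsLE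
        (2 * s + 5) := by
      simp only [bitsLE_cons, bitsLE_nil, bitLen_zero, and_true]
      omega
    have l1 : (Mem.ofList [(n : ℤ), a, j, m, t.toNat, 0, 1, 0, 0, 0, 0, 0, (2 * m : ℕ), 0]).BitsLE
        (2 * s + 5) := by
      simp only [bitsLE_cons, bitsLE_nil, bitLen_zero, bitLen_one, and_true] at l0 ⊢
      omega
    have l2 : (Mem.ofList [(n : ℤ), a, j, m, t.toNat, 0, 1, f.1, f.2, 0, 0, 0, (2 * m : ℕ),
        0]).BitsLE (2 * s + 5) := by
      simp only [bitsLE_cons, bitsLE_nil, bitLen_zero, bitLen_one, and_true] at l1 ⊢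
      omega
    have l3 : (Mem.ofList [(n : ℤ), a, j, m, t.toNat, 0, 1, f.1, f.2, g.1, g.2, 0, (2 * m : ℕ),
        0]).BitsLE (2 * s + 5) := by
      simp only [bitsLE_cons, bitsLE_nil, bitLen_zero, bitLen_one, and_true] at l2 ⊢
      omega
    have l4 : ∀ b : Bool, (Mem.ofList [(n : ℤ), a, j, m, t.toNat, 0, 1, f.1, f.2, g.1, g.2,
        gnorm g, (2 * m : ℕ), b.toNat]).BitsLE (2 * s + 5) := by
      intro b
      have := bitLen_bool b
      simp only [bitsLE_cons, bitsLE_nil, bitLen_one, and_true] at l3 ⊢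
      omega
    have r0 := Runs.listBlk (O := O) (bl := [(6, 1), (12, 2 * var 3)]) l0 (by simp)
      (l' := [(n : ℤ), a, j, m, t.toNat, 0, 1, 0, 0, 0, 0, 0, (2 * m : ℕ), 0]) (by
        push_cast; rfl)
    have r1 := (hL.computes s a j false m hn hm ha hj).listCall (args := [0, 1, 2, 5, 3])
      (rets := [7, 8]) l1 rfl (l' := [(n : ℤ), a, j, m, t.toNat, 0, 1, f.1, f.2, 0, 0, 0,
        (2 * m : ℕ), 0]) (by simp [Mem.write, hf])
    have r2 := (hL.computes s a j true m hn hm ha hj).listCall (args := [0, 1, 2, 6, 3])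
      (rets := [9, 10]) l2 rfl (l' := [(n : ℤ), a, j, m, t.toNat, 0, 1, f.1, f.2, g.1, g.2, 0,
        (2 * m : ℕ), 0]) (by simp [Mem.write, hg])
    have r3 := Runs.listBlk (O := O) (bl := [(11, var 9 * var 9 + var 10 * var 10)]) l3 (by simp)
      (l' := [(n : ℤ), a, j, m, t.toNat, 0, 1, f.1, f.2, g.1, g.2, gnorm g, (2 * m : ℕ), 0]) (by
        rw [natCast_gnorm]; rfl)
    have r4 := (hP O (2 * s + 5) (2 * m) (gnorm g) (by omega) bG).listCallMap (args := [12, 11])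
      (rets := [13]) (l4 false) rfl (l' := fun b => [(n : ℤ), a, j, m, t.toNat, 0, 1, f.1, f.2,
        g.1, g.2, gnorm g, (2 * m : ℕ), b.toNat]) (by simp [Mem.write])
    have r5 := r4.seq_map_pure (c' := blk [(0, var 13), (1, ite (var 13) (var 9) (var 7)),
      (2, ite (var 13) (var 10) (var 8)), (5, ite (var 4) (var 9) (var 7)),
      (6, ite (var 4) (var 10) (var 8)), (3, var 5), (4, var 6)]) fun b _ =>
      Runs.listBlk (l4 b) (by simp) rfl
    have r6 := (r0.seq_pure (r1.seq_pure (r2.seq_pure (r3.seq_pure r5)))).computes (k := 5)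
      (ins := [(n : ℤ), a, j, m, t.toNat]) rfl (v := fun b =>
          [(b.toNat : ℤ), (loc a j b m).1, (loc a j b m).2, (loc a j t m).1, (loc a j t m).2])
      fun b => by
        cases b <;> cases t <;> simp [listBlk, Ex.eval, hf, hg, List.range_succ]
    exact r6.mono le_rfl
  · fun_prop

/-- The `i`-th step of the measurement of a register of qubits in a product state with the
amplitudes `f i b`, given to `m` binary digits: the bit number `i` is appended to `h`. -/
noncomputable def measureStep (f : ℕ → Bool → ℤ × ℤ) (m i h : ℕ) : PMF ℕ :=
  (coin (2 * m) (gnorm (f i true))).map fun b => h + b.toNat * 2 ^ i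

theorem measureStep_lt {f : ℕ → Bool → ℤ × ℤ} {m i h : ℕ} (hh : h < 2 ^ i) :
    ∀ h' ∈ (measureStep f m i h).support, h' < 2 ^ (i + 1) := by
  intro h' h1
  rw [measureStep, PMF.mem_support_map_iff] at h1
  obtain ⟨b, -, rfl⟩ := h1
  rw [pow_succ]
  cases b <;> simp <;> omega

theorem lt_of_mem_chain_measureStep {f : ℕ → Bool → ℤ × ℤ} {m k : ℕ} :
    ∀ h ∈ (chain (measureStep f m) 0 k).support, h < 2 ^ k :=
  chain_support (I := fun i h => h < 2 ^ i) (by simp) fun _ _ _ ha _ hb => measureStep_lt ha _ hb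

/-- The integer amplitudes of the last `k` qubits of the basis vector `a`. -/
def highAmp (loc : ℕ → ℕ → Bool → ℕ → ℤ × ℤ) (n k a m i : ℕ) (b : Bool) : ℤ × ℤ :=
  loc a (n - k + i) b m

open Ex Prog in
/-- The bookkeeping after the measurement of one qubit, see `exists_resample`. -/
def resampleBlk : List (ℕ × Ex) :=
  [(12, var 7 * var 16 - var 8 * var 17), (8, var 7 * var 17 + var 8 * var 16),
    (7, var 12), (12, var 9 * var 14 - var 10 * var 15),
    (10, var 9 * var 15 + var 10 * var 14), (9, var 12), (5, var 5 + var 6 * var 13),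
    (6, 2 * var 6), (4, var 4 / 2), (11, var 11 + 1), (1, var 1 - 1), (12, 0), (13, 0),
    (14, 0), (15, 0), (16, 0), (17, 0)]

theorem listBlk_resampleBlk (n c a m t : ℤ) (q y p j : ℕ) (b : Bool) (w w' u u' : ℤ × ℤ) :
    listBlk [n, c, a, m, (q : ℤ), (y : ℤ), (p : ℤ), w.1, w.2, w'.1, w'.2, (j : ℤ), t,
      (b.toNat : ℤ), u.1, u.2, u'.1, u'.2] resampleBlk =
    [n, c - 1, a, m, ((q / 2 : ℕ) : ℤ), ((y + p * b.toNat : ℕ) : ℤ), ((2 * p : ℕ) : ℤ),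
      (gmul w u').1, (gmul w u').2, (gmul w' u).1, (gmul w' u).2, ((j + 1 : ℕ) : ℤ),
      0, 0, 0, 0, 0, 0] := by
  simp only [resampleBlk, listBlk, Ex.eval_add, Ex.eval_sub, Ex.eval_mul, Ex.eval_div, Ex.eval_var,
    Ex.eval_ofNat, Ex.eval_zero, Ex.eval_one, Mem.ofList, List.getD_cons_zero, List.getD_cons_succ,
    List.set_cons_zero, List.set_cons_succ]
  push_cast
  rfl

open Ex Prog in
/-- Replacing the last `k` bits of a string `y` by the result of a measurement of the product
vector of the node `a` of level `k`. Besides the new string, the amplitudes of that product vector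
at the old and at the new bits are returned. -/
theorem exists_resample (L : Prog) {T : ℕ → ℕ} (hT : PolyB T) :
    ∃ (A : Prog) (T' : ℕ → ℕ), PolyB T' ∧ ∀ (n : ℕ) (O : Oracle) (B : ProductBasis n)
      (loc : ℕ → ℕ → Bool → ℕ → ℤ × ℤ), LocalBy L T O B loc →
      ∀ (s k a m y : ℕ), n ≤ s → m ≤ s → k ≤ n → a < 2 ^ n → y < 2 ^ n →
      Computes O A [(n : ℤ), (k : ℤ), (a : ℤ), (m : ℤ), (y : ℤ)] 5
        ((chain (measureStep (highAmp loc n k a m) m) 0 k).map fun h : ℕ =>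
          [((y % 2 ^ (n - k) + 2 ^ (n - k) * h : ℕ) : ℤ),
            (intProd (highAmp loc n k a m) k (y / 2 ^ (n - k))).1,
            (intProd (highAmp loc n k a m) k (y / 2 ^ (n - k))).2,
            (intProd (highAmp loc n k a m) k h).1, (intProd (highAmp loc n k a m) k h).2])
        (T' s) := by
  obtain ⟨P, TP, hTP, hP⟩ := exists_pow2
  obtain ⟨Q, TQ, hTQ, hQ⟩ := exists_measureQubit L hT
  -- Registers: 1 the number of qubits still to be measured; 4 the old bits of these qubits; 5 the
  -- new string; 6 the weight of the next bit in it; 7, 8 and 9, 10 the products of the amplitudes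
  -- of the old and of the new bits; 11 the next qubit; 12 its old bit; 13 to 17 the result of its
  -- measurement.
  refine ⟨.seq (blk [(11, var 0 - var 1)]) (.seq (.call P [11] [6])
    (.seq (blk [(5, var 4 - var 6 * (var 4 / var 6)), (4, var 4 / var 6), (7, 1), (9, 1)])
    (.seq (.loop 1 (.seq (blk [(12, var 4 - 2 * (var 4 / 2))])
      (.seq (.call Q [0, 2, 11, 3, 12] [13, 14, 15, 16, 17])
      (blk resampleBlk))))
    (blk [(0, var 5), (1, var 7), (2, var 8), (3, var 9), (4, var 10)])))), ?_⟩
  constructor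
  refine ⟨?_, fun n O B loc hL s k a m y hn hm hk ha hy => ?_⟩
  rotate_left
  · set f := highAmp loc n k a m with hf
    set A := 2 ^ (n - k) with hA
    have hA0 : 0 < A := by positivity
    have hAM : A * 2 ^ k = 2 ^ n := by rw [hA, ← pow_add]; congr 1; omega
    have hAs : A ≤ 2 ^ s := Nat.pow_le_pow_right (by norm_num) (by omega)
    have hns : 2 ^ n ≤ 2 ^ s := Nat.pow_le_pow_right (by norm_num) hn
    have hks : k * (s + 3) + 1 ≤ s * (s + 3) + 1 := by
      have := Nat.mul_le_mul_right (s + 3) (hk.trans hn)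
      omega
    have bf : ∀ i < k, ∀ b, bitLen (f i b).1 ≤ s + 2 ∧ bitLen (f i b).2 ≤ s + 2 := by
      intro i hi b
      have := hL.bitLen_le ha (show n - k + i < n by omega) b m
      exact ⟨this.1.trans (by omega), this.2.trans (by omega)⟩
    have bI : ∀ i ≤ k, ∀ h, bitLen (intProd f i h).1 ≤ s * (s + 3) + 1 ∧
        bitLen (intProd f i h).2 ≤ s * (s + 3) + 1 := by
      intro i hi h
      have h1 := bitLen_intProd (k := i) (fun j hj => bf j (by omega)) h
      have := Nat.mul_le_mul_right (s + 2 + 1) (hi.trans (hk.trans hn))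
      exact ⟨h1.1.trans (Nat.add_le_add_right this 1), h1.2.trans (Nat.add_le_add_right this 1)⟩
    set b : ℕ := s * (s + 3) + s + 2 with hb
    have bnk : ((n - k : ℕ) : ℤ) = n - k := by omega
    have state : ∀ i ≤ k, ∀ h < 2 ^ i, ∀ (t : Bool) (v : Bool) (u u' : ℤ × ℤ),
        (bitLen u.1 ≤ s + 2 ∧ bitLen u.2 ≤ s + 2) → (bitLen u'.1 ≤ s + 2 ∧ bitLen u'.2 ≤ s + 2) →
        (Mem.ofList [(n : ℤ), ((k - i : ℕ) : ℤ), (a : ℤ), (m : ℤ), ((y / A / 2 ^ i : ℕ) : ℤ),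
        ((y % A + A * h : ℕ) : ℤ), ((A * 2 ^ i : ℕ) : ℤ), (intProd f i (y / A)).1,
        (intProd f i (y / A)).2, (intProd f i h).1, (intProd f i h).2, ((n - k + i : ℕ) : ℤ),
        (t.toNat : ℤ), (v.toNat : ℤ), u.1, u.2, u'.1, u'.2]).BitsLE b := by
      intro i hi h hh t v u u' bu bu'
      have c1 := bitLen_natCast_le_of_le hn
      have c2 := bitLen_natCast_le_of_le (show k - i ≤ s by omega)
      have c3 := bitLen_natCast_le_of_lt (ha.trans_le hns)
      have c4 := bitLen_natCast_le_of_le hm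
      have c5 := bitLen_natCast_le_of_lt
        ((((Nat.div_le_self _ (2 ^ i)).trans (Nat.div_le_self y A)).trans_lt hy).trans_le hns)
      have c6 : bitLen ((y % A + A * h : ℕ) : ℤ) ≤ s := bitLen_natCast_le_of_lt (by
        have h1 : h + 1 ≤ 2 ^ k := hh.trans_le (Nat.pow_le_pow_right (by norm_num) hi)
        have h2 := Nat.mul_le_mul_left A h1
        have h3 := Nat.mod_lt y hA0
        rw [hAM] at h2
        refine lt_of_lt_of_le ?_ hns
        linarith)
      have c7 : bitLen ((A * 2 ^ i : ℕ) : ℤ) ≤ s + 1 := bitLen_natCast_le_of_lt (by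
        have h2 := Nat.mul_le_mul_left A (Nat.pow_le_pow_right (show 0 < 2 by norm_num) hi)
        rw [pow_succ]
        have : 0 < 2 ^ s := by positivity
        omega)
      have c8 := bI i hi (y / A)
      have c9 := bI i hi h
      have c10 := bitLen_natCast_le_of_le (show n - k + i ≤ s by omega)
      have c11 := bitLen_bool t
      have c12 := bitLen_bool v
      simp only [bitsLE_cons, bitsLE_nil, and_true]
      clear_value b
      generalize s * (s + 3) = S at *
      omega
    have z0 : bitLen (0 : ℤ × ℤ).1 ≤ s + 2 ∧ bitLen (0 : ℤ × ℤ).2 ≤ s + 2 := by simp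
    have S0 := state 0 (Nat.zero_le _) 0 (by simp) false false 0 0 z0 z0
    have hstep : ∀ i < k, ∀ h, h < 2 ^ i → ∀ h' ∈ (measureStep f m i h).support,
        h' < 2 ^ (i + 1) := fun i _ h hh h' => measureStep_lt hh h'
    have l0 : (Mem.ofList [(n : ℤ), (k : ℤ), (a : ℤ), (m : ℤ), (y : ℤ), 0, 0, 0, 0, 0, 0, 0, 0, 0,
        0, 0, 0, 0]).BitsLE b := by
      have := bitLen_natCast_le_of_lt (hy.trans_le hns)
      simp only [bitsLE_cons, bitsLE_nil, and_true, Nat.sub_zero, bitLen_zero] at S0 ⊢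
      omega
    have l1 : (Mem.ofList [(n : ℤ), (k : ℤ), (a : ℤ), (m : ℤ), (y : ℤ), 0, 0, 0, 0, 0, 0,
        ((n - k : ℕ) : ℤ), 0, 0, 0, 0, 0, 0]).BitsLE b := by
      simp only [bitsLE_cons, bitsLE_nil, and_true, add_zero, bitLen_zero] at S0 l0 ⊢
      omega
    have l2 : (Mem.ofList [(n : ℤ), (k : ℤ), (a : ℤ), (m : ℤ), (y : ℤ), 0, (A : ℤ), 0, 0, 0, 0,
        ((n - k : ℕ) : ℤ), 0, 0, 0, 0, 0, 0]).BitsLE b := by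
      simp only [bitsLE_cons, bitsLE_nil, and_true, pow_zero, mul_one, bitLen_zero] at S0 l1 ⊢
      omega
    have r0 := Runs.listBlk (O := O) (bl := [(11, var 0 - var 1)]) l0 (by simp)
      (l' := [(n : ℤ), (k : ℤ), (a : ℤ), (m : ℤ), (y : ℤ), 0, 0, 0, 0, 0, 0,
        ((n - k : ℕ) : ℤ), 0, 0, 0, 0, 0, 0]) (by rw [bnk]; rfl)
    have r1 := (hP O s (n - k) (by omega)).listCall (args := [11]) (rets := [6]) l1 rfl
      (l' := [(n : ℤ), (k : ℤ), (a : ℤ), (m : ℤ), (y : ℤ), 0, (A : ℤ), 0, 0, 0, 0,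
        ((n - k : ℕ) : ℤ), 0, 0, 0, 0, 0, 0]) (by simp [Mem.write, hA])
    have r2 := Runs.listBlk (O := O) (bl := [(5, var 4 - var 6 * (var 4 / var 6)),
      (4, var 4 / var 6), (7, 1), (9, 1)]) l2 (by simp)
      (l' := [(n : ℤ), ((k - 0 : ℕ) : ℤ), (a : ℤ), (m : ℤ), ((y / A / 2 ^ 0 : ℕ) : ℤ),
        ((y % A + A * 0 : ℕ) : ℤ), ((A * 2 ^ 0 : ℕ) : ℤ), (intProd f 0 (y / A)).1,
        (intProd f 0 (y / A)).2, (intProd f 0 0).1, (intProd f 0 0).2, ((n - k + 0 : ℕ) : ℤ),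
        0, 0, 0, 0, 0, 0]) (by
        simp only [pow_zero, Nat.div_one, mul_one, mul_zero, add_zero, Nat.sub_zero]
        rw [Int.natCast_mod, Int.emod_def, Int.natCast_div]
        rfl)
    have r3 := Runs.loop (σ := ℕ) (O := O) (r := 1) (hk.trans hn) (measureStep f m)
      (fun i h => Mem.ofList [(n : ℤ), ((k - i : ℕ) : ℤ), (a : ℤ), (m : ℤ),
        ((y / A / 2 ^ i : ℕ) : ℤ), ((y % A + A * h : ℕ) : ℤ), ((A * 2 ^ i : ℕ) : ℤ),
        (intProd f i (y / A)).1, (intProd f i (y / A)).2, (intProd f i h).1, (intProd f i h).2,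
        ((n - k + i : ℕ) : ℤ), 0, 0, 0, 0, 0, 0])
      (fun i h => h < 2 ^ i) 0 (by simp) (fun i hi u _ => by simpa using hi) (by simp)
      (fun i hi u hu => state i hi u hu false false 0 0 z0 z0 1) hstep fun i hi h hh => by
        set t := (y / A).testBit i with ht
        have q0 := Runs.listBlk (O := O) (bl := [(12, var 4 - 2 * (var 4 / 2))])
          (state i hi.le h hh false false 0 0 z0 z0) (by simp)
          (l' := [(n : ℤ), ((k - i : ℕ) : ℤ), (a : ℤ), (m : ℤ), ((y / A / 2 ^ i : ℕ) : ℤ),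
            ((y % A + A * h : ℕ) : ℤ), ((A * 2 ^ i : ℕ) : ℤ), (intProd f i (y / A)).1,
            (intProd f i (y / A)).2, (intProd f i h).1, (intProd f i h).2,
            ((n - k + i : ℕ) : ℤ), (t.toNat : ℤ), 0, 0, 0, 0, 0]) (by
            rw [ht, Nat.toNat_testBit, Int.natCast_mod, Int.emod_def]
            rfl)
        have q1 := (hQ n O B loc hL s a (n - k + i) m t hn hm ha (by omega)).listCallMap
          (args := [0, 2, 11, 3, 12]) (rets := [13, 14, 15, 16, 17])
          (state i hi.le h hh t false 0 0 z0 z0) rfl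
          (l' := fun b => [(n : ℤ), ((k - i : ℕ) : ℤ), (a : ℤ), (m : ℤ),
            ((y / A / 2 ^ i : ℕ) : ℤ), ((y % A + A * h : ℕ) : ℤ), ((A * 2 ^ i : ℕ) : ℤ),
            (intProd f i (y / A)).1, (intProd f i (y / A)).2, (intProd f i h).1,
            (intProd f i h).2, ((n - k + i : ℕ) : ℤ), (t.toNat : ℤ), (b.toNat : ℤ), (f i b).1,
            (f i b).2, (f i t).1, (f i t).2]) (by simp [Mem.write, hf, highAmp])
        have q2 := q1.seq_map_pure (c' := blk resampleBlk)
          (f := fun b : Bool => Mem.ofList [(n : ℤ), ((k - (i + 1) : ℕ) : ℤ), (a : ℤ), (m : ℤ),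
            ((y / A / 2 ^ (i + 1) : ℕ) : ℤ), ((y % A + A * (h + b.toNat * 2 ^ i) : ℕ) : ℤ),
            ((A * 2 ^ (i + 1) : ℕ) : ℤ), (intProd f (i + 1) (y / A)).1,
            (intProd f (i + 1) (y / A)).2, (intProd f (i + 1) (h + b.toNat * 2 ^ i)).1,
            (intProd f (i + 1) (h + b.toNat * 2 ^ i)).2, ((n - k + (i + 1) : ℕ) : ℤ),
            0, 0, 0, 0, 0, 0]) fun b _ => Runs.listBlk
            (state i hi.le h hh t b (f i b) (f i t) (bf i hi b) (bf i hi t)) (by simp [resampleBlk]) (by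
            rw [listBlk_resampleBlk, intProd_snoc f hh b, intProd,
              show ((k - (i + 1) : ℕ) : ℤ) = ((k - i : ℕ) : ℤ) - 1 by omega,
              show y / A / 2 ^ (i + 1) = y / A / 2 ^ i / 2 by
                rw [pow_succ, ← Nat.div_div_eq_div_mul],
              show y % A + A * (h + b.toNat * 2 ^ i) = y % A + A * h + A * 2 ^ i * b.toNat by ring,
              show A * 2 ^ (i + 1) = 2 * (A * 2 ^ i) by ring, add_assoc (n - k)])
        rw [measureStep, PMF.map_comp]
        exact q0.seq_pure q2
    have r4 := r3.seq_map_pure (c' := blk [(0, var 5), (1, var 7), (2, var 8), (3, var 9),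
        (4, var 10)]) fun h hh => Runs.listBlk (state k le_rfl h
          (lt_of_mem_chain_measureStep h hh) false false 0 0 z0 z0) (by simp) rfl
    have r5 := (r0.seq_pure (r1.seq_pure (r2.seq_pure r4))).computes (k := 5)
      (ins := [(n : ℤ), (k : ℤ), (a : ℤ), (m : ℤ), (y : ℤ)]) rfl
      (v := fun h : ℕ => [((y % A + A * h : ℕ) : ℤ), (intProd f k (y / A)).1,
        (intProd f k (y / A)).2, (intProd f k h).1, (intProd f k h).2]) fun h => rfl
    exact r5.mono le_rfl
  · fun_prop

theorem gnorm_div (x : ℤ × ℤ) (m : ℕ) :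
    (gnorm x : ℝ) / 2 ^ (2 * m) = ‖dyadic x.1 x.2 m‖ ^ 2 := by
  have h : (gnorm x : ℝ) = x.1 * x.1 + x.2 * x.2 := by exact_mod_cast natCast_gnorm x
  rw [← Complex.normSq_eq_norm_sq, Complex.normSq_apply, dyadic_re, dyadic_im, h, two_mul, pow_add]
  ring

theorem abs_coin_true_sub_le {x : ℤ × ℤ} {m : ℕ} {z : ℂ} (hz : ‖z‖ ≤ 1)
    (h : ‖dyadic x.1 x.2 m - z‖ ≤ 1 / 2 ^ m) :
    |(coin (2 * m) (gnorm x) true).toReal - ‖z‖ ^ 2| ≤ 3 / 2 ^ m := by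
  rw [coin_true, gnorm_div]
  set w := dyadic x.1 x.2 m
  have h1 : |min 1 (‖w‖ ^ 2) - ‖z‖ ^ 2| ≤ |‖w‖ ^ 2 - ‖z‖ ^ 2| := by
    have hz2 : ‖z‖ ^ 2 ≤ 1 := by nlinarith [norm_nonneg z]
    rcases le_total 1 (‖w‖ ^ 2) with h2 | h2
    · rw [min_eq_left h2, abs_of_nonneg (by linarith), abs_of_nonneg (by linarith)]; linarith
    · rw [min_eq_right h2]
  refine h1.trans ?_
  have h2 := (abs_norm_sub_norm_le w z).trans h
  have h3 : (1 : ℝ) / 2 ^ m ≤ 1 := div_le_one_of_le₀ (one_le_pow₀ (by norm_num)) (by positivity)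
  rw [sq_sub_sq, abs_mul, abs_of_nonneg (by positivity)]
  have h4 := (abs_le.1 h2).2
  calc (‖w‖ + ‖z‖) * |‖w‖ - ‖z‖| ≤ 3 * (1 / 2 ^ m) :=
        mul_le_mul (by linarith) h2 (abs_nonneg _) (by norm_num)
    _ = _ := by ring

theorem ev_bool (μ : PMF Bool) (F : Bool → ℝ) :
    ev μ F = F false + (μ true).toReal * (F true - F false) := by
  have h := tsum_toReal μ
  rw [tsum_bool] at h
  rw [ev, tsum_bool]
  linear_combination F false * h

/-- Measuring the qubits of a product vector one after the other produces `h` with probability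
`‖prodAmp g k h‖ ^ 2`, up to the effect of rounding the amplitudes. -/
theorem abs_ev_chain_measureStep_sub_le {f : ℕ → Bool → ℤ × ℤ} {g : ℕ → Bool → ℂ} {m k : ℕ}
    (hg : ∀ i < k, ‖g i false‖ ^ 2 + ‖g i true‖ ^ 2 = 1)
    (hf : ∀ i < k, ‖dyadic (f i true).1 (f i true).2 m - g i true‖ ≤ 1 / 2 ^ m)
    {F : ℕ → ℝ} (hF : ∀ h, |F h| ≤ 1) :
    |ev (chain (measureStep f m) 0 k) F - ∑ h ∈ range (2 ^ k), ‖prodAmp g k h‖ ^ 2 * F h| ≤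
      k * (6 / 2 ^ m) := by
  induction k generalizing F with
  | zero => simp [chain, ev_pure, prodAmp]
  | succ k ih =>
    set G : ℕ → ℝ := fun h => ‖g k false‖ ^ 2 * F h + ‖g k true‖ ^ 2 * F (h + 2 ^ k) with hG
    have hgk := hg k (Nat.lt_succ_self k)
    have hGle : ∀ h, |G h| ≤ 1 := fun h => by
      refine (abs_add_le _ _).trans ?_
      rw [abs_mul, abs_mul, abs_of_nonneg (sq_nonneg ‖g k false‖),
        abs_of_nonneg (sq_nonneg ‖g k true‖), ← hgk]
      exact add_le_add (mul_le_of_le_one_right (sq_nonneg _) (hF _))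
        (mul_le_of_le_one_right (sq_nonneg _) (hF _))
    have h1 := ih (fun i hi => hg i (by omega)) (fun i hi => hf i (by omega)) hGle
    have h2 : ∑ h ∈ range (2 ^ (k + 1)), ‖prodAmp g (k + 1) h‖ ^ 2 * F h =
        ∑ h ∈ range (2 ^ k), ‖prodAmp g k h‖ ^ 2 * G h := by
      rw [pow_succ, sum_range_mul, sum_range_succ, sum_range_one, ← sum_add_distrib]
      refine sum_congr rfl fun h hh => ?_
      have e0 := prodAmp_snoc g (mem_range.1 hh) false
      have e1 := prodAmp_snoc g (mem_range.1 hh) true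
      simp only [Bool.toNat_false, zero_mul, Bool.toNat_true, one_mul] at e0 e1
      rw [mul_zero, mul_one, e0, e1, hG, norm_mul, norm_mul, add_zero]
      ring
    have h3 : ∀ h, |ev (measureStep f m k h) F - G h| ≤ 6 / 2 ^ m := fun h => by
      rw [measureStep, ev_map (B := 1) fun _ _ => hF _, ev_bool]
      have h4 := abs_coin_true_sub_le (z := g k true)
        (by nlinarith [sq_nonneg ‖g k false‖, norm_nonneg (g k true)]) (hf k (Nat.lt_succ_self k))
      set q := (coin (2 * m) (gnorm (f k true)) true).toReal
      have h5 : F (h + false.toNat * 2 ^ k) + q * (F (h + true.toNat * 2 ^ k) -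
          F (h + false.toNat * 2 ^ k)) - G h = (q - ‖g k true‖ ^ 2) * (F (h + 2 ^ k) - F h) := by
        simp only [Bool.toNat_false, zero_mul, Bool.toNat_true, one_mul, add_zero, hG]
        linear_combination F h * hgk.symm
      rw [h5, abs_mul]
      calc _ ≤ 3 / 2 ^ m * 2 := mul_le_mul h4 ((abs_sub _ _).trans
            (by linarith [hF (h + 2 ^ k), hF h])) (abs_nonneg _) (by positivity)
        _ = _ := by ring
    rw [chain, ev_bind (B := 1) fun _ _ => hF _, h2]
    have hE : ∀ h, |ev (measureStep f m k h) F| ≤ 1 := fun h => abs_ev_le fun _ _ => hF _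
    have h4 := ev_sub (μ := chain (measureStep f m) 0 k) (f := fun h => ev (measureStep f m k h) F)
      (fun h _ => hE h) (fun h _ => hGle h)
    have h5 := abs_ev_le (μ := chain (measureStep f m) 0 k) fun h _ => h3 h
    rw [h4] at h5
    push_cast
    calc _ ≤ _ := abs_sub_le _ (ev (chain (measureStep f m) 0 k) G) _
      _ ≤ _ := add_le_add h5 h1
      _ = _ := by ring

/-- The error of a product of amplitudes. -/
theorem norm_prodAmp_sub_le {g g' : ℕ → Bool → ℂ} {k h : ℕ} {e : ℝ} (he : e ≤ 1)
    (hg : ∀ i < k, ∀ b, ‖g i b‖ ≤ 1) (hf : ∀ i < k, ∀ b, ‖g' i b - g i b‖ ≤ e) :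
    ‖prodAmp g' k h - prodAmp g k h‖ ≤ (2 ^ k - 1) * e := by
  induction k with
  | zero => simp [prodAmp]
  | succ k ih =>
    have h1 := ih (fun i hi => hg i (by omega)) (fun i hi => hf i (by omega))
    have h2 := hf k (Nat.lt_succ_self k) (h.testBit k)
    have h3 := hg k (Nat.lt_succ_self k) (h.testBit k)
    have h4 : ‖g' k (h.testBit k)‖ ≤ 2 := by
      have := norm_add_le (g' k (h.testBit k) - g k (h.testBit k)) (g k (h.testBit k))
      rw [sub_add_cancel] at this
      linarith
    have h5 : ‖prodAmp g k h‖ ≤ 1 := by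
      rw [prodAmp, norm_prod]
      exact prod_le_one (fun _ _ => norm_nonneg _) fun i hi => hg i (by
        rw [mem_range] at hi; omega) _
    have e1 : ∀ g : ℕ → Bool → ℂ, prodAmp g (k + 1) h = prodAmp g k h * g k (h.testBit k) :=
      fun g => prod_range_succ _ _
    rw [e1, e1, show prodAmp g' k h * g' k (h.testBit k) - prodAmp g k h * g k (h.testBit k) =
      (prodAmp g' k h - prodAmp g k h) * g' k (h.testBit k) +
      prodAmp g k h * (g' k (h.testBit k) - g k (h.testBit k)) by ring]
    refine (norm_add_le _ _).trans ?_
    rw [norm_mul, norm_mul, pow_succ]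
    have := mul_le_mul h1 h4 (norm_nonneg _) ((norm_nonneg _).trans h1)
    have := mul_le_mul h5 h2 (norm_nonneg _) zero_le_one
    linarith

/-! ### The estimators, computed with integers -/

/-- The quotient `ratio x y` of Gaussian integers, multiplied by `D` and rounded. -/
def intRatio (x y : ℤ × ℤ) (D : ℤ) : ℤ × ℤ :=
  (2 * D * (x.1 * y.1 + x.2 * y.2) / (x.1 * x.1 + x.2 * x.2 + y.1 * y.1 + y.2 * y.2),
    2 * D * (x.1 * y.2 - x.2 * y.1) / (x.1 * x.1 + x.2 * x.2 + y.1 * y.1 + y.2 * y.2))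

theorem abs_mul_ediv_le {D u v : ℤ} (hD : 0 ≤ D) (hu : |u| ≤ v) : |D * u / v| ≤ D := by
  rcases (abs_nonneg u |>.trans hu).eq_or_lt with hv | hv
  · rw [← hv, Int.ediv_zero, abs_zero]; exact hD
  · rw [abs_le] at hu ⊢
    constructor
    · rw [Int.le_ediv_iff_mul_le hv]; nlinarith
    · exact Int.ediv_le_of_le_mul hv (by nlinarith)

theorem abs_intRatio_le (x y : ℤ × ℤ) {D : ℤ} (hD : 0 ≤ D) :
    |(intRatio x y D).1| ≤ D ∧ |(intRatio x y D).2| ≤ D := by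
  have e : ∀ u, 2 * D * u = D * (2 * u) := fun u => by ring
  simp only [intRatio, e]
  constructor
  · refine abs_mul_ediv_le hD (abs_le.2 ⟨?_, ?_⟩)
    · nlinarith [sq_nonneg (x.1 + y.1), sq_nonneg (x.2 + y.2)]
    · nlinarith [sq_nonneg (x.1 - y.1), sq_nonneg (x.2 - y.2)]
  · refine abs_mul_ediv_le hD (abs_le.2 ⟨?_, ?_⟩)
    · nlinarith [sq_nonneg (x.1 + y.2), sq_nonneg (x.2 - y.1)]
    · nlinarith [sq_nonneg (x.1 - y.2), sq_nonneg (x.2 + y.1)]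

theorem abs_ediv_sub_div_le (u v : ℤ) : |((u / v : ℤ) : ℝ) - u / v| ≤ 1 := by
  rcases eq_or_ne v 0 with rfl | hv
  · simp
  · have h1 := Int.emod_nonneg u hv
    have h2 := Int.emod_lt_abs u hv
    have h3 : (u : ℝ) = v * ((u / v : ℤ) : ℝ) + ((u % v : ℤ) : ℝ) := by
      exact_mod_cast (Int.mul_ediv_add_emod u v).symm
    have hv' : (v : ℝ) ≠ 0 := by exact_mod_cast hv
    have h4 : ((u / v : ℤ) : ℝ) - u / v = -(((u % v : ℤ) : ℝ) / v) := by
      rw [eq_neg_iff_add_eq_zero]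
      field_simp
      linarith
    rw [h4, abs_neg, abs_div, div_le_one (abs_pos.2 hv')]
    have h5 : |u % v| ≤ |v| := (abs_of_nonneg h1).trans_le h2.le
    exact_mod_cast h5

theorem ratio_dyadic (x y : ℤ × ℤ) (m : ℕ) : ratio (dyadic x.1 x.2 m) (dyadic y.1 y.2 m) =
    (((2 * (x.1 * y.1 + x.2 * y.2) : ℤ) : ℝ) + ((2 * (x.1 * y.2 - x.2 * y.1) : ℤ) : ℝ) *
      Complex.I) / (((x.1 * x.1 + x.2 * x.2 + y.1 * y.1 + y.2 * y.2 : ℤ) : ℝ) : ℂ) := by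
  have h1 : ∀ z : ℤ × ℤ, dyadic z.1 z.2 m = (((1 / 2 ^ m : ℝ)) : ℂ) * ((z.1 : ℂ) + z.2 * Complex.I) :=
    fun z => by rw [dyadic]; push_cast; ring
  have h2 : ∀ z : ℤ × ℤ, ‖(z.1 : ℂ) + z.2 * Complex.I‖ ^ 2 = z.1 * z.1 + z.2 * z.2 := fun z => by
    rw [← Complex.normSq_eq_norm_sq, Complex.normSq_apply]
    simp
  rw [h1, h1, ratio_smul _ (by positivity), ratio, h2, h2]
  congr 1
  · rw [map_add, map_mul, Complex.conj_I, map_intCast, map_intCast]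
    push_cast
    linear_combination (-2 : ℂ) * x.2 * y.2 * Complex.I_sq
  · push_cast; ring

theorem norm_intRatio_sub_le (x y : ℤ × ℤ) (m d : ℕ) :
    |((intRatio x y (2 ^ d)).1 : ℝ) / 2 ^ d - (ratio (dyadic x.1 x.2 m) (dyadic y.1 y.2 m)).re| ≤
      1 / 2 ^ d ∧
    |((intRatio x y (2 ^ d)).2 : ℝ) / 2 ^ d - (ratio (dyadic x.1 x.2 m) (dyadic y.1 y.2 m)).im| ≤
      1 / 2 ^ d := by
  rw [ratio_dyadic, Complex.div_ofReal_re, Complex.div_ofReal_im]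
  have key : ∀ u v : ℤ, |((2 * 2 ^ d * u / v : ℤ) : ℝ) / 2 ^ d - ((2 * u : ℤ) : ℝ) / v| ≤
      1 / 2 ^ d := by
    intro u v
    have h1 := abs_ediv_sub_div_le (2 * 2 ^ d * u) v
    rw [show ((2 * u : ℤ) : ℝ) / v = (((2 * 2 ^ d * u : ℤ) : ℝ) / v) / 2 ^ d by
      push_cast; field_simp, ← sub_div, abs_div, abs_of_pos (by positivity : (0 : ℝ) < 2 ^ d)]
    gcongr
  constructor
  · simpa [intRatio] using key (x.1 * y.1 + x.2 * y.2) (x.1 * x.1 + x.2 * x.2 + y.1 * y.1 + y.2 * y.2)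
  · simpa [intRatio] using key (x.1 * y.2 - x.2 * y.1) (x.1 * x.1 + x.2 * x.2 + y.1 * y.1 + y.2 * y.2)

/-! ### One round of sampling -/

/-- The result of one round of sampling: the first component is an estimator of the weight of a
node, and the other two are the real and imaginary part of an estimator of a coefficient. Here `w`,
`w'` are amplitudes of a product vector and `x`, `x'` amplitudes of the state; multiplication by `p`
or `q` brings them to the same scale. -/
def sampleValue (p q : ℤ) (w w' x x' : ℤ × ℤ) : ℤ × ℤ × ℤ :=
  ((intRatio (gmul x w') (gmul x' w) p).1,
    (intRatio (p * w.1, p * w.2) (q * x.1, q * x.2) p).1 +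
      (intRatio (p * w'.1, p * w'.2) (q * x'.1, q * x'.2) p).1,
    (intRatio (p * w.1, p * w.2) (q * x.1, q * x.2) p).2 +
      (intRatio (p * w'.1, p * w'.2) (q * x'.1, q * x'.2) p).2)

theorem abs_sampleValue_le {p : ℤ} (hp : 0 ≤ p) (q : ℤ) (w w' x x' : ℤ × ℤ) :
    |(sampleValue p q w w' x x').1| ≤ p ∧ |(sampleValue p q w w' x x').2.1| ≤ 2 * p ∧
    |(sampleValue p q w w' x x').2.2| ≤ 2 * p := by
  refine ⟨(abs_intRatio_le _ _ hp).1, ?_, ?_⟩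
  · exact (abs_add_le _ _).trans
      ((add_le_add (abs_intRatio_le _ _ hp).1 (abs_intRatio_le _ _ hp).1).trans_eq (two_mul p).symm)
  · exact (abs_add_le _ _).trans
      ((add_le_add (abs_intRatio_le _ _ hp).2 (abs_intRatio_le _ _ hp).2).trans_eq (two_mul p).symm)

open Ex Prog in
/-- The program for `intRatio`. -/
theorem exists_intRatio : ∃ (A : Prog) (T : ℕ → ℕ), PolyB T ∧ ∀ (O : Oracle) (s : ℕ) (x y : ℤ × ℤ)
    (D : ℤ), (Mem.ofList [x.1, x.2, y.1, y.2, D]).BitsLE s →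
    Computes O A [x.1, x.2, y.1, y.2, D] 2 (PMF.pure [(intRatio x y D).1, (intRatio x y D).2])
      (T s) := by
  refine ⟨blk [(5, var 0 * var 0 + var 1 * var 1 + var 2 * var 2 + var 3 * var 3),
    (6, 2 * var 4 * (var 0 * var 2 + var 1 * var 3)), (1, 2 * var 4 *
    (var 0 * var 3 - var 1 * var 2) / var 5), (0, var 6 / var 5)], ?_⟩
  constructor
  refine ⟨?_, fun O s x y D hb => ?_⟩
  rotate_left
  · have hb' : (Mem.ofList [x.1, x.2, y.1, y.2, D, 0, 0]).BitsLE s := by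
      simp only [bitsLE_cons, bitsLE_nil, and_true, bitLen_zero] at hb ⊢
      omega
    exact ((Runs.listBlk (O := O) hb' (by simp) rfl).computes_pure rfl rfl).mono le_rfl
  · fun_prop

open Ex Prog in
/-- The program for `sampleValue`. -/
theorem exists_sampleValue : ∃ (A : Prog) (T : ℕ → ℕ), PolyB T ∧ ∀ (O : Oracle) (s : ℕ) (p q : ℤ)
    (w w' x x' : ℤ × ℤ), 0 ≤ p →
    (Mem.ofList [p, q, w.1, w.2, w'.1, w'.2, x.1, x.2, x'.1, x'.2]).BitsLE s →
    Computes O A [p, q, w.1, w.2, w'.1, w'.2, x.1, x.2, x'.1, x'.2] 3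
      (PMF.pure [(sampleValue p q w w' x x').1, (sampleValue p q w w' x x').2.1,
        (sampleValue p q w w' x x').2.2]) (T s) := by
  obtain ⟨R, TR, hTR, hR⟩ := exists_intRatio
  have key : ∃ (A : Prog) (T : ℕ → ℕ), PolyB T ∧ ∀ (O : Oracle) (s : ℕ) (p q : ℤ) (w x : ℤ × ℤ),
      (Mem.ofList [p, q, w.1, w.2, x.1, x.2]).BitsLE s →
      Computes O A [p, q, w.1, w.2, x.1, x.2] 2
        (PMF.pure [(intRatio (p * w.1, p * w.2) (q * x.1, q * x.2) p).1,
          (intRatio (p * w.1, p * w.2) (q * x.1, q * x.2) p).2]) (T s) := by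
    refine ⟨.seq (blk [(2, var 0 * var 2), (3, var 0 * var 3), (4, var 1 * var 4),
      (5, var 1 * var 5)]) (.call R [2, 3, 4, 5, 0] [0, 1]), ?_⟩
    constructor
    refine ⟨?_, fun O s p q w x hb => ?_⟩
    rotate_left
    · have hb' : (Mem.ofList [p, q, p * w.1, p * w.2, q * x.1, q * x.2]).BitsLE (2 * s) := by
        have b1 := bitLen_mul p w.1
        have b2 := bitLen_mul p w.2
        have b3 := bitLen_mul q x.1
        have b4 := bitLen_mul q x.2
        simp only [bitsLE_cons, bitsLE_nil, and_true] at hb ⊢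
        omega
      have r0 := Runs.listBlk (O := O) (bl := [(2, var 0 * var 2), (3, var 0 * var 3),
        (4, var 1 * var 4), (5, var 1 * var 5)]) hb (by simp)
        (l' := [p, q, p * w.1, p * w.2, q * x.1, q * x.2]) rfl
      have r1 := (hR O (2 * s) (p * w.1, p * w.2) (q * x.1, q * x.2) p (by
        simp only [bitsLE_cons, bitsLE_nil, and_true] at hb' ⊢
        omega)).listCall (args := [2, 3, 4, 5, 0]) (rets := [0, 1]) hb' rfl
        (l' := [_, _, p * w.1, p * w.2, q * x.1, q * x.2]) (by simp [Mem.write]; rfl)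
      exact ((r0.seq_pure r1).computes_pure rfl rfl).mono le_rfl
    · fun_prop
  obtain ⟨C, TC, hTC, hC⟩ := key
  refine ⟨.seq (.call C [0, 1, 2, 3, 6, 7] [10, 11]) (.seq (.call C [0, 1, 4, 5, 8, 9] [12, 13])
    (.seq (blk [(14, var 6 * var 4 - var 7 * var 5), (15, var 6 * var 5 + var 7 * var 4),
      (16, var 8 * var 2 - var 9 * var 3), (17, var 8 * var 3 + var 9 * var 2)])
    (.seq (.call R [14, 15, 16, 17, 0] [0, 1]) (blk [(1, var 10 + var 12),
      (2, var 11 + var 13)])))), ?_⟩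
  constructor
  refine ⟨?_, fun O s p q w w' x x' hp hb => ?_⟩
  rotate_left
  · set r := intRatio (p * w.1, p * w.2) (q * x.1, q * x.2) p with hr
    set r' := intRatio (p * w'.1, p * w'.2) (q * x'.1, q * x'.2) p with hr'
    have b1 : bitLen (gmul x w').1 ≤ s + s + 1 ∧ bitLen (gmul x w').2 ≤ s + s + 1 := by
      simp only [bitsLE_cons] at hb
      exact bitLen_gmul (by omega) (by omega) (by omega) (by omega)
    have b2 : bitLen (gmul x' w).1 ≤ s + s + 1 ∧ bitLen (gmul x' w).2 ≤ s + s + 1 := by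
      simp only [bitsLE_cons] at hb
      exact bitLen_gmul (by omega) (by omega) (by omega) (by omega)
    have k1 := hC O s p q w x (by
      simp only [bitsLE_cons, bitsLE_nil, and_true] at hb ⊢
      omega)
    have k2 := hC O s p q w' x' (by
      simp only [bitsLE_cons, bitsLE_nil, and_true] at hb ⊢
      omega)
    have b0 : bitLen p ≤ s := hb 0
    have hrle : ∀ y z : ℤ × ℤ, bitLen (intRatio y z p).1 ≤ s + s + 1 ∧
        bitLen (intRatio y z p).2 ≤ s + s + 1 := by
      intro y z
      have h1 := abs_intRatio_le y z hp
      rw [← abs_of_nonneg hp] at h1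
      have h2 := bitLen_mono h1.1
      have h3 := bitLen_mono h1.2
      rw [abs_of_nonneg hp] at h2 h3
      omega
    have l0 : (Mem.ofList [p, q, w.1, w.2, w'.1, w'.2, x.1, x.2, x'.1, x'.2, 0, 0, 0, 0, 0, 0, 0,
        0]).BitsLE (s + s + 1) := by
      simp only [bitsLE_cons, bitsLE_nil, and_true, bitLen_zero] at hb ⊢
      omega
    have l1 : (Mem.ofList [p, q, w.1, w.2, w'.1, w'.2, x.1, x.2, x'.1, x'.2, r.1, r.2, 0, 0, 0, 0,
        0, 0]).BitsLE (s + s + 1) := by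
      have := hrle (p * w.1, p * w.2) (q * x.1, q * x.2)
      rw [← hr] at this
      simp only [bitsLE_cons, bitsLE_nil, and_true, bitLen_zero] at l0 ⊢
      omega
    have l2 : (Mem.ofList [p, q, w.1, w.2, w'.1, w'.2, x.1, x.2, x'.1, x'.2, r.1, r.2, r'.1, r'.2,
        0, 0, 0, 0]).BitsLE (s + s + 1) := by
      have := hrle (p * w'.1, p * w'.2) (q * x'.1, q * x'.2)
      rw [← hr'] at this
      simp only [bitsLE_cons, bitsLE_nil, and_true, bitLen_zero] at l1 ⊢
      omega
    have l3 : (Mem.ofList [p, q, w.1, w.2, w'.1, w'.2, x.1, x.2, x'.1, x'.2, r.1, r.2, r'.1, r'.2,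
        (gmul x w').1, (gmul x w').2, (gmul x' w).1, (gmul x' w).2]).BitsLE (s + s + 1) := by
      simp only [bitsLE_cons, bitsLE_nil, and_true, bitLen_zero] at l2 ⊢
      omega
    have k3 := hR O (s + s + 1) (gmul x w') (gmul x' w) p (by
      simp only [bitsLE_cons, bitsLE_nil, and_true] at l3 ⊢
      omega)
    set v := intRatio (gmul x w') (gmul x' w) p with hv
    have l4 : (Mem.ofList [v.1, v.2, w.1, w.2, w'.1, w'.2, x.1, x.2, x'.1, x'.2, r.1, r.2, r'.1,
        r'.2, (gmul x w').1, (gmul x w').2, (gmul x' w).1, (gmul x' w).2]).BitsLE (s + s + 1) := by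
      have := hrle (gmul x w') (gmul x' w)
      rw [← hv] at this
      simp only [bitsLE_cons, bitsLE_nil, and_true] at l3 ⊢
      omega
    have r0 := k1.listCall (args := [0, 1, 2, 3, 6, 7]) (rets := [10, 11]) l0 rfl
      (l' := [p, q, w.1, w.2, w'.1, w'.2, x.1, x.2, x'.1, x'.2, r.1, r.2, 0, 0, 0, 0,
        0, 0]) (by simp [Mem.write, hr])
    have r1 := k2.listCall (args := [0, 1, 4, 5, 8, 9]) (rets := [12, 13]) l1 rfl
      (l' := [p, q, w.1, w.2, w'.1, w'.2, x.1, x.2, x'.1, x'.2, r.1, r.2, r'.1, r'.2, 0, 0,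
        0, 0]) (by simp [Mem.write, hr'])
    have r2 := Runs.listBlk (O := O) (bl := [(14, var 6 * var 4 - var 7 * var 5),
      (15, var 6 * var 5 + var 7 * var 4), (16, var 8 * var 2 - var 9 * var 3),
      (17, var 8 * var 3 + var 9 * var 2)]) l2 (by simp) (l' := [p, q, w.1, w.2, w'.1, w'.2, x.1,
        x.2, x'.1, x'.2, r.1, r.2, r'.1, r'.2, (gmul x w').1, (gmul x w').2, (gmul x' w).1,
        (gmul x' w).2]) rfl
    have r3 := k3.listCall (args := [14, 15, 16, 17, 0]) (rets := [0, 1]) l3 rfl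
      (l' := [v.1, v.2, w.1, w.2, w'.1, w'.2, x.1, x.2, x'.1, x'.2, r.1, r.2, r'.1,
        r'.2, (gmul x w').1, (gmul x w').2, (gmul x' w).1, (gmul x' w).2]) (by simp [Mem.write])
    have r4 := Runs.listBlk (O := O) (bl := [(1, var 10 + var 12), (2, var 11 + var 13)]) l4
      (by simp) rfl
    exact ((r0.seq_pure (r1.seq_pure (r2.seq_pure (r3.seq_pure r4)))).computes_pure rfl rfl).mono
      le_rfl
  · fun_prop

/-- The distribution of the results of one round of sampling for the node `a` of level `k`: the
string `y` is drawn from the state, and `h` from the product vector of the node on the last `k`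
qubits. The values of the estimators depend on the amplitudes of `y`, and of `y` with its last `k`
bits replaced by `h`. -/
noncomputable def sampleDist (sd : ℕ → PMF ℕ) (qd : ℕ → ℕ → PMF (ℤ × ℤ))
    (loc : ℕ → ℕ → Bool → ℕ → ℤ × ℤ) (n k a m : ℕ) : PMF (ℤ × ℤ × ℤ) :=
  (sd m).bind fun y => (chain (measureStep (highAmp loc n k a m) m) 0 k).bind fun h =>
    (qd y m).bind fun x => (qd (y % 2 ^ (n - k) + 2 ^ (n - k) * h) m).map fun x' =>
      sampleValue (2 ^ m) (2 ^ (m * k)) (intProd (highAmp loc n k a m) k (y / 2 ^ (n - k)))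
        (intProd (highAmp loc n k a m) k h) x x'

theorem mod_add_mul_lt {n k y h : ℕ} (hk : k ≤ n) (hh : h < 2 ^ k) :
    y % 2 ^ (n - k) + 2 ^ (n - k) * h < 2 ^ n := by
  have h1 : 2 ^ (n - k) * 2 ^ k = 2 ^ n := by rw [← pow_add]; congr 1; omega
  have h2 := Nat.mul_le_mul_left (2 ^ (n - k)) (show h + 1 ≤ 2 ^ k from hh)
  have h3 := Nat.mod_lt y (show 0 < 2 ^ (n - k) by positivity)
  linarith

open Ex Prog in
/-- The program for `sampleDist`. -/
theorem exists_sampleDist (L S Q : Prog) {T TS : ℕ → ℕ} (hT : PolyB T) (hTS : PolyB TS) :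
    ∃ (A : Prog) (T' : ℕ → ℕ), PolyB T' ∧ ∀ (n : ℕ) (O : Oracle) (B : ProductBasis n)
      (loc : ℕ → ℕ → Bool → ℕ → ℤ × ℤ) (φ : ℕ → ℂ) (sd : ℕ → PMF ℕ) (qd : ℕ → ℕ → PMF (ℤ × ℤ)),
      LocalBy L T O B loc → TractableBy S Q TS n φ sd qd →
      ∀ (s k a m : ℕ), n ≤ s → m ≤ s → k ≤ n → a < 2 ^ n →
      Computes O A [(n : ℤ), (k : ℤ), (a : ℤ), (m : ℤ)] 3
        ((sampleDist sd qd loc n k a m).map fun t => [t.1, t.2.1, t.2.2]) (T' s) := by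
  obtain ⟨P, TP, hTP, hP⟩ := exists_pow2
  obtain ⟨R, TR, hTR, hR⟩ := exists_resample L hT
  obtain ⟨V, TV, hTV, hV⟩ := exists_sampleValue
  -- Registers: 4 the sampled string; 5 the string with its last bits replaced; 8, 9 and 10, 11 the
  -- product amplitudes of the old and of the new bits; 12, 13 and 14, 15 the amplitudes of the
  -- state; 6, 7 the scaling factors `2 ^ m` and `2 ^ (m * k)`.
  refine ⟨.seq (.call S [0, 3] [4]) (.seq (.call R [0, 1, 2, 3, 4] [5, 8, 9, 10, 11])
    (.seq (.call Q [0, 4, 3] [12, 13]) (.seq (.call Q [0, 5, 3] [14, 15])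
    (.seq (blk [(7, var 3 * var 1)]) (.seq (.call P [7] [7]) (.seq (.call P [3] [6])
      (.call V [6, 7, 8, 9, 10, 11, 12, 13, 14, 15] [0, 1, 2]))))))), ?_⟩
  constructor
  refine ⟨?_, fun n O B loc φ sd qd hL hTr s k a m hn hm hk ha => ?_⟩
  rotate_left
  · set f := highAmp loc n k a m with hf
    set A := 2 ^ (n - k) with hA
    have hns : 2 ^ n ≤ 2 ^ s := Nat.pow_le_pow_right (by norm_num) hn
    have bf : ∀ i < k, ∀ b, bitLen (f i b).1 ≤ s + 2 ∧ bitLen (f i b).2 ≤ s + 2 := by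
      intro i hi b
      have := hL.bitLen_le ha (show n - k + i < n by omega) b m
      exact ⟨this.1.trans (by omega), this.2.trans (by omega)⟩
    have bI : ∀ h, bitLen (intProd f k h).1 ≤ s * (s + 3) + 1 ∧
        bitLen (intProd f k h).2 ≤ s * (s + 3) + 1 := by
      intro h
      have h1 := bitLen_intProd (k := k) (fun j hj => bf j (by omega)) h
      have := Nat.mul_le_mul_right (s + 2 + 1) (hk.trans hn)
      exact ⟨h1.1.trans (Nat.add_le_add_right this 1), h1.2.trans (Nat.add_le_add_right this 1)⟩
    have hφ : ∀ y < 2 ^ n, ‖φ y‖ ≤ 1 := by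
      intro y hy
      have h1 := single_le_sum (f := fun y => ‖φ y‖ ^ 2) (fun _ _ => by positivity)
        (mem_range.2 hy)
      rw [hTr.sum_sq] at h1
      nlinarith [norm_nonneg (φ y)]
    have bq : ∀ y < 2 ^ n, ∀ x ∈ (qd y m).support, bitLen x.1 ≤ s + 2 ∧ bitLen x.2 ≤ s + 2 := by
      intro y hy x hx
      have := bitLen_of_dyadic_sub_le (hTr.dyadic_sub_le y hy m x hx) (hφ y hy)
      omega
    have hmk : m * k ≤ s * (s + 3) := Nat.mul_le_mul hm (by omega)
    set b : ℕ := s * (s + 3) + s + 2 with hb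
    have c1 := bitLen_natCast_le_of_le hn
    have c2 := bitLen_natCast_le_of_le (hk.trans hn)
    have c3 := bitLen_natCast_le_of_lt (ha.trans_le hns)
    have c4 := bitLen_natCast_le_of_le hm
    have c5 := bitLen_natCast_le_of_le hmk
    have c6 := (bitLen_two_pow (m * k)).trans (Nat.succ_le_succ hmk)
    have c7 := (bitLen_two_pow m).trans (Nat.succ_le_succ hm)
    have state : ∀ (y y' : ℕ) (w w' x x' : ℤ × ℤ) (p q : ℤ), y < 2 ^ n → y' < 2 ^ n →
        (bitLen w.1 ≤ b ∧ bitLen w.2 ≤ b) → (bitLen w'.1 ≤ b ∧ bitLen w'.2 ≤ b) →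
        (bitLen x.1 ≤ b ∧ bitLen x.2 ≤ b) → (bitLen x'.1 ≤ b ∧ bitLen x'.2 ≤ b) →
        bitLen p ≤ b → bitLen q ≤ b →
        (Mem.ofList [(n : ℤ), (k : ℤ), (a : ℤ), (m : ℤ), (y : ℤ), (y' : ℤ), p, q, w.1, w.2,
          w'.1, w'.2, x.1, x.2, x'.1, x'.2]).BitsLE b := by
      intro y y' w w' x x' p q hy hy' bw bw' bx bx' bp bq
      have d1 := bitLen_natCast_le_of_lt (hy.trans_le hns)
      have d2 := bitLen_natCast_le_of_lt (hy'.trans_le hns)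
      simp only [bitsLE_cons, bitsLE_nil, and_true]
      omega
    have z0 : bitLen (0 : ℤ × ℤ).1 ≤ b ∧ bitLen (0 : ℤ × ℤ).2 ≤ b := by simp
    have zb : bitLen 0 ≤ b := by simp
    have hN : 0 < 2 ^ n := by positivity
    have r0 := (hTr.computes_sample O s m hn hm).listCallMap (args := [0, 3]) (rets := [4])
      (state 0 0 0 0 0 0 0 0 hN hN z0 z0 z0 z0 zb zb) rfl (l' := fun y : ℕ => [(n : ℤ), (k : ℤ),
        (a : ℤ), (m : ℤ), (y : ℤ), 0, 0, 0, 0, 0, 0, 0, 0, 0, 0, 0]) (by simp [Mem.write])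
    have r7 := r0.seq_map fun y hy => by
      have hy := hTr.lt_of_mem m y hy
      have r1 := (hR n O B loc hL s k a m y hn hm hk ha hy).listCallMap (args := [0, 1, 2, 3, 4])
        (rets := [5, 8, 9, 10, 11]) (state y 0 0 0 0 0 0 0 hy hN z0 z0 z0 z0 zb zb) rfl
        (l' := fun h => [(n : ℤ), (k : ℤ), (a : ℤ), (m : ℤ), (y : ℤ), ((y % A + A * h : ℕ) : ℤ),
          0, 0, (intProd f k (y / A)).1, (intProd f k (y / A)).2, (intProd f k h).1,
          (intProd f k h).2, 0, 0, 0, 0]) (by simp [Mem.write, hf, hA])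
      exact r1.seq_map fun h hh => by
        have hh := lt_of_mem_chain_measureStep h hh
        have hy' : y % A + A * h < 2 ^ n := mod_add_mul_lt hk hh
        have bw := bI (y / A)
        have bw' := bI h
        replace bw : bitLen (intProd f k (y / A)).1 ≤ b ∧ bitLen (intProd f k (y / A)).2 ≤ b := by
          omega
        replace bw' : bitLen (intProd f k h).1 ≤ b ∧ bitLen (intProd f k h).2 ≤ b := by omega
        have r2 := (hTr.computes_amplitude O s m y hn hm hy).listCallMap (args := [0, 4, 3])
          (rets := [12, 13]) (state y (y % A + A * h) _ _ 0 0 0 0 hy hy' bw bw' z0 z0 zb zb) rfl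
          (l' := fun x => [(n : ℤ), (k : ℤ), (a : ℤ), (m : ℤ), (y : ℤ), ((y % A + A * h : ℕ) : ℤ),
            0, 0, (intProd f k (y / A)).1, (intProd f k (y / A)).2, (intProd f k h).1,
            (intProd f k h).2, x.1, x.2, 0, 0]) (by simp [Mem.write])
        exact r2.seq_map fun x hx => by
          have bx := bq y hy x hx
          replace bx : bitLen x.1 ≤ b ∧ bitLen x.2 ≤ b := by omega
          have r3 := (hTr.computes_amplitude O s m _ hn hm hy').listCallMap (args := [0, 5, 3])
            (rets := [14, 15]) (state y (y % A + A * h) _ _ x 0 0 0 hy hy' bw bw' bx z0 zb zb) rfl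
            (l' := fun x' => [(n : ℤ), (k : ℤ), (a : ℤ), (m : ℤ), (y : ℤ),
              ((y % A + A * h : ℕ) : ℤ), 0, 0, (intProd f k (y / A)).1, (intProd f k (y / A)).2,
              (intProd f k h).1, (intProd f k h).2, x.1, x.2, x'.1, x'.2]) (by simp [Mem.write])
          exact r3.seq_map_pure fun x' hx' => by
            have bx' := bq _ hy' x' hx'
            replace bx' : bitLen x'.1 ≤ b ∧ bitLen x'.2 ≤ b := by omega
            have l4 := fun p q => state y (y % A + A * h) _ _ x x' p q hy hy' bw bw' bx bx'
            have r4 := Runs.listBlk (O := O) (bl := [(7, var 3 * var 1)]) (l4 0 0 zb zb) (by simp)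
              (l' := [(n : ℤ), (k : ℤ), (a : ℤ), (m : ℤ), (y : ℤ),
                ((y % A + A * h : ℕ) : ℤ), 0, ((m * k : ℕ) : ℤ), (intProd f k (y / A)).1,
                (intProd f k (y / A)).2, (intProd f k h).1, (intProd f k h).2, x.1, x.2, x'.1,
                x'.2]) (by push_cast; rfl)
            have r5 := (hP O (s * (s + 3)) (m * k) hmk).listCall (args := [7]) (rets := [7])
              (l4 0 ((m * k : ℕ) : ℤ) zb (by omega)) rfl
              (l' := [(n : ℤ), (k : ℤ), (a : ℤ), (m : ℤ), (y : ℤ),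
                ((y % A + A * h : ℕ) : ℤ), 0, 2 ^ (m * k), (intProd f k (y / A)).1,
                (intProd f k (y / A)).2, (intProd f k h).1, (intProd f k h).2, x.1, x.2, x'.1,
                x'.2]) (by simp [Mem.write])
            have r6 := (hP O s m hm).listCall (args := [3]) (rets := [6])
              (l4 0 (2 ^ (m * k)) zb (by omega)) rfl
              (l' := [(n : ℤ), (k : ℤ), (a : ℤ), (m : ℤ), (y : ℤ),
                ((y % A + A * h : ℕ) : ℤ), 2 ^ m, 2 ^ (m * k), (intProd f k (y / A)).1,
                (intProd f k (y / A)).2, (intProd f k h).1, (intProd f k h).2, x.1, x.2, x'.1,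
                x'.2]) (by simp [Mem.write])
            have l7 := l4 (2 ^ m) (2 ^ (m * k)) (by omega) (by omega)
            have r7 := (hV O b (2 ^ m) (2 ^ (m * k)) (intProd f k (y / A)) (intProd f k h) x x'
              (by positivity) (by
                simp only [bitsLE_cons, bitsLE_nil, and_true] at l7 ⊢
                omega)).listCall (args := [6, 7, 8, 9, 10, 11, 12, 13, 14, 15])
              (rets := [0, 1, 2]) l7 rfl (l' :=
                [(sampleValue (2 ^ m) (2 ^ (m * k)) (intProd f k (y / A)) (intProd f k h) x x').1,
                (sampleValue (2 ^ m) (2 ^ (m * k)) (intProd f k (y / A)) (intProd f k h) x x').2.1,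
                (sampleValue (2 ^ m) (2 ^ (m * k)) (intProd f k (y / A)) (intProd f k h) x x').2.2,
                (m : ℤ), (y : ℤ),
                ((y % A + A * h : ℕ) : ℤ), 2 ^ m, 2 ^ (m * k), (intProd f k (y / A)).1,
                (intProd f k (y / A)).2, (intProd f k h).1, (intProd f k h).2, x.1, x.2, x'.1,
                x'.2]) (by simp [Mem.write])
            exact r4.seq_pure (r5.seq_pure (r6.seq_pure r7))
    refine Computes.mono ⟨_, (by rwa [← Mem.ofList_pad _ 12]), ?_⟩ le_rfl
    simp only [sampleDist, PMF.map_bind, PMF.map_comp]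
    rfl
  · fun_prop

/-! ### The expectations of the estimators -/

theorem mul_abs_ev_sub_le {α : Type*} {μ : PMF α} {g : α → ℝ} {u r c : ℝ} (hu : 0 ≤ u)
    (hg : ∀ a ∈ μ.support, |g a| ≤ 1) (h : ∀ a ∈ μ.support, u * |g a - r| ≤ c) :
    u * |ev μ g - r| ≤ c := by
  have h1 := ev_sub (g := fun _ => r) (B' := |r|) hg (fun _ _ => le_rfl)
  rw [ev_const] at h1
  rw [← h1, ← abs_of_nonneg hu, ← abs_mul, ← ev_const_mul]
  refine abs_ev_le fun a ha => ?_
  rw [abs_mul, abs_of_nonneg hu]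
  exact h a ha

theorem abs_sum_sub_sum_le {s t : ℕ} {p q : ℕ → ℝ} {F f : ℕ → ℕ → ℝ} {c : ℝ}
    (hp : ∀ y, 0 ≤ p y) (hq : ∀ y, 0 ≤ q y)
    (h : ∀ y < s, ∀ z < t, p y * q z * |F y z - f y z| ≤ c) :
    |∑ y ∈ range s, p y * ∑ z ∈ range t, q z * F y z -
      ∑ y ∈ range s, ∑ z ∈ range t, p y * q z * f y z| ≤ s * t * c := by
  simp only [mul_sum]
  rw [← sum_sub_distrib]
  simp only [← sum_sub_distrib]
  refine (abs_sum_le_sum_abs _ _).trans ((sum_le_card_nsmul _ _ (t * c) fun y hy => ?_).trans_eq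
    (by rw [card_range, nsmul_eq_mul, mul_assoc]))
  refine (abs_sum_le_sum_abs _ _).trans ((sum_le_card_nsmul _ _ c fun z hz => ?_).trans_eq
    (by rw [card_range, nsmul_eq_mul]))
  rw [← mul_assoc, ← mul_sub, abs_mul, abs_of_nonneg (mul_nonneg (hp y) (hq z))]
  exact h y (mem_range.1 hy) z (mem_range.1 hz)

section

variable {L S Q : Prog} {T TS : ℕ → ℕ} {n : ℕ} {O : Oracle} {B : ProductBasis n}
  {loc : ℕ → ℕ → Bool → ℕ → ℤ × ℤ} {φ : ℕ → ℂ} {sd : ℕ → PMF ℕ} {qd : ℕ → ℕ → PMF (ℤ × ℤ)}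

/-- The expectation of a bounded quantity `V` for one round of sampling is close to the mean of
an ideal quantity `f` that is close to it where it matters. -/
theorem abs_ev_sampleDist_sub_le (hL : LocalBy L T O B loc) (hTr : TractableBy S Q TS n φ sd qd)
    {k a m : ℕ} (hk : k ≤ n) (ha : a < 2 ^ n) {V : ℤ × ℤ × ℤ → ℝ}
    (hV : ∀ w w' x x', |V (sampleValue (2 ^ m) (2 ^ (m * k)) w w' x x')| ≤ 1) {f : ℕ → ℕ → ℝ} {c : ℝ}
    (hf : ∀ y < 2 ^ n, ∀ h < 2 ^ k, ∀ x ∈ (qd y m).support,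
      ∀ x' ∈ (qd (y % 2 ^ (n - k) + 2 ^ (n - k) * h) m).support,
      ‖φ y‖ ^ 2 * ‖B.amp k a h‖ ^ 2 * |V (sampleValue (2 ^ m) (2 ^ (m * k))
        (intProd (highAmp loc n k a m) k (y / 2 ^ (n - k))) (intProd (highAmp loc n k a m) k h)
        x x') - f y h| ≤ c) :
    |ev (sampleDist sd qd loc n k a m) V - ∑ y ∈ range (2 ^ n), ∑ h ∈ range (2 ^ k),
      ‖φ y‖ ^ 2 * ‖B.amp k a h‖ ^ 2 * f y h| ≤ 2 / 2 ^ m + k * (6 / 2 ^ m) + 2 ^ n * 2 ^ k * c := by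
  set A := 2 ^ (n - k) with hA
  set W := intProd (highAmp loc n k a m) k with hW
  set F : ℕ → ℕ → ℝ := fun y h => ev (qd y m) fun x => ev (qd (y % A + A * h) m) fun x' =>
    V (sampleValue (2 ^ m) (2 ^ (m * k)) (W (y / A)) (W h) x x') with hF
  have hF1 : ∀ y h, |F y h| ≤ 1 := fun y h => abs_ev_le fun x _ => abs_ev_le fun x' _ => hV _ _ _ _
  set G : ℕ → ℝ := fun y => ev (chain (measureStep (highAmp loc n k a m) m) 0 k) (F y) with hG
  have hG1 : ∀ y, |G y| ≤ 1 := fun y => abs_ev_le fun h _ => hF1 y h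
  have e1 : ev (sampleDist sd qd loc n k a m) V = ev (sd m) G := by
    have hb : ∀ t ∈ (sampleDist sd qd loc n k a m).support, |V t| ≤ 1 := by
      intro t ht
      simp only [sampleDist, PMF.mem_support_bind_iff, PMF.mem_support_map_iff] at ht
      obtain ⟨y, -, h, -, x, -, x', -, rfl⟩ := ht
      exact hV _ _ _ _
    have hb' : ∀ y, ∀ t ∈ ((chain (measureStep (highAmp loc n k a m) m) 0 k).bind fun h =>
        (qd y m).bind fun x => (qd (y % A + A * h) m).map fun x' =>
        sampleValue (2 ^ m) (2 ^ (m * k)) (W (y / A)) (W h) x x').support, |V t| ≤ 1 := by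
      intro y t ht
      simp only [PMF.mem_support_bind_iff, PMF.mem_support_map_iff] at ht
      obtain ⟨h, -, x, -, x', -, rfl⟩ := ht
      exact hV _ _ _ _
    rw [sampleDist] at hb ⊢
    rw [ev_bind hb]
    refine ev_congr fun y _ => ?_
    rw [ev_bind (hb' y)]
    refine ev_congr fun h _ => ?_
    rw [ev_bind (B := 1)]
    · refine ev_congr fun x _ => ?_
      rw [ev_map (B := 1) fun _ _ => hV _ _ _ _]
    · intro t ht
      simp only [PMF.mem_support_bind_iff, PMF.mem_support_map_iff] at ht
      obtain ⟨x, -, x', -, rfl⟩ := ht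
      exact hV _ _ _ _
  have h1 := hTr.ev_sub_le m G hG1
  have h2 : ∀ y, |G y - ∑ h ∈ range (2 ^ k), ‖B.amp k a h‖ ^ 2 * F y h| ≤ k * (6 / 2 ^ m) :=
    fun y => abs_ev_chain_measureStep_sub_le (f := highAmp loc n k a m)
      (g := fun i => B.g a (n - k + i)) (F := F y) (fun i _ => B.norm_g _ _)
      (fun i hi => hL.dyadic_sub_le a ha (n - k + i) (by omega) true m) (hF1 y)
  have h3 : |∑ y ∈ range (2 ^ n), ‖φ y‖ ^ 2 * G y - ∑ y ∈ range (2 ^ n), ‖φ y‖ ^ 2 *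
      ∑ h ∈ range (2 ^ k), ‖B.amp k a h‖ ^ 2 * F y h| ≤ k * (6 / 2 ^ m) := by
    rw [← sum_sub_distrib]
    refine (abs_sum_le_sum_abs _ _).trans ?_
    calc _ ≤ ∑ y ∈ range (2 ^ n), ‖φ y‖ ^ 2 * (k * (6 / 2 ^ m)) := by
          refine sum_le_sum fun y _ => ?_
          rw [← mul_sub, abs_mul, abs_of_nonneg (by positivity)]
          exact mul_le_mul_of_nonneg_left (h2 y) (by positivity)
      _ = _ := by rw [← sum_mul, hTr.sum_sq, one_mul]
  have h4 := abs_sum_sub_sum_le (s := 2 ^ n) (t := 2 ^ k) (p := fun y => ‖φ y‖ ^ 2)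
    (q := fun h => ‖B.amp k a h‖ ^ 2) (F := F) (f := f) (c := c) (fun _ => by positivity)
    (fun _ => by positivity) fun y hy h hh => by
      refine mul_abs_ev_sub_le (by positivity) (fun x _ => abs_ev_le fun x' _ => hV _ _ _ _)
        fun x hx => mul_abs_ev_sub_le (by positivity) (fun x' _ => hV _ _ _ _) fun x' hx' =>
        hf y hy h hh x hx x' hx'
  rw [e1]
  rw [Nat.cast_pow, Nat.cast_pow, Nat.cast_ofNat] at h4
  rw [abs_le] at h1 h3 h4 ⊢
  constructor <;> linarith

theorem sum_range_two_pow {E : Type*} [AddCommMonoid E] {k : ℕ} (hk : k ≤ n) (F : ℕ → ℕ → ℕ → E) :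
    ∑ y ∈ range (2 ^ n), F y (y % 2 ^ (n - k)) (y / 2 ^ (n - k)) =
      ∑ z ∈ range (2 ^ (n - k)), ∑ i ∈ range (2 ^ k), F (z + 2 ^ (n - k) * i) z i := by
  have h1 : 2 ^ n = 2 ^ (n - k) * 2 ^ k := by rw [← pow_add]; congr 1; omega
  rw [h1, sum_range_mul, sum_comm]
  refine sum_congr rfl fun z hz => sum_congr rfl fun i _ => ?_
  rw [mem_range] at hz
  rw [Nat.add_mul_mod_self_left, Nat.mod_eq_of_lt hz, Nat.add_mul_div_left _ _ (by positivity),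
    Nat.div_eq_of_lt hz, zero_add]

theorem sum_ratio_eq_wt (B : ProductBasis n) (φ : ℕ → ℂ) {k : ℕ} (hk : k ≤ n) (a : ℕ) :
    ∑ y ∈ range (2 ^ n), ∑ h ∈ range (2 ^ k), ‖φ y‖ ^ 2 * ‖B.amp k a h‖ ^ 2 *
      (ratio (φ y * B.amp k a h) (φ (y % 2 ^ (n - k) + 2 ^ (n - k) * h) *
        B.amp k a (y / 2 ^ (n - k)))).re = B.wt φ k a := by
  rw [sum_range_two_pow hk fun y z i => ∑ h ∈ range (2 ^ k), ‖φ y‖ ^ 2 * ‖B.amp k a h‖ ^ 2 *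
      (ratio (φ y * B.amp k a h) (φ (z + 2 ^ (n - k) * h) * B.amp k a i)).re]
  exact sum_congr rfl fun z _ => sum_ratio_pair (range (2 ^ k)) (fun i => φ (z + 2 ^ (n - k) * i))
    (B.amp k a)

theorem norm_le_one_of_sum_sq {s : Finset ℕ} {f : ℕ → ℂ} (h : ∑ y ∈ s, ‖f y‖ ^ 2 = 1) {y : ℕ}
    (hy : y ∈ s) : ‖f y‖ ≤ 1 := by
  have h1 := single_le_sum (f := fun y => ‖f y‖ ^ 2) (fun _ _ => by positivity) hy
  rw [h] at h1
  nlinarith [norm_nonneg (f y)]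

theorem norm_dyadic_intProd_sub_le (hL : LocalBy L T O B loc) {k a : ℕ} (m : ℕ) (hk : k ≤ n)
    (ha : a < 2 ^ n) (h : ℕ) :
    ‖dyadic (intProd (highAmp loc n k a m) k h).1 (intProd (highAmp loc n k a m) k h).2 (m * k) -
      B.amp k a h‖ ≤ 2 ^ n / 2 ^ m := by
  rw [dyadic_intProd]
  refine (norm_prodAmp_sub_le (e := 1 / 2 ^ m) (div_le_one_of_le₀ (one_le_pow₀ (by norm_num))
    (by positivity)) (fun i _ b => B.norm_g_le _ _ _) fun i hi b =>
    hL.dyadic_sub_le a ha (n - k + i) (by omega) b m).trans ?_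
  rw [mul_one_div]
  gcongr
  have : (2 : ℝ) ^ k ≤ 2 ^ n := pow_le_pow_right₀ (by norm_num) hk
  linarith

theorem norm_mul_sub_mul_le {x y x' y' : ℂ} {d e : ℝ} (hx : ‖x' - x‖ ≤ d) (hy : ‖y' - y‖ ≤ e)
    (hx1 : ‖x‖ ≤ 1) (hy1 : ‖y‖ ≤ 1) (hd : d ≤ 1) : ‖x' * y' - x * y‖ ≤ d + 2 * e := by
  have h1 : ‖x'‖ ≤ 2 := by
    have := norm_add_le (x' - x) x
    rw [sub_add_cancel] at this; linarith
  rw [show x' * y' - x * y = (x' - x) * y + x' * (y' - y) by ring]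
  refine (norm_add_le _ _).trans ?_
  rw [norm_mul, norm_mul]
  have := mul_le_mul hx hy1 (norm_nonneg _) ((norm_nonneg _).trans hx)
  have := mul_le_mul h1 hy (norm_nonneg _) (by norm_num)
  linarith

theorem two_pow_error_le {n k m : ℕ} (hk : k ≤ n) :
    (2 : ℝ) / 2 ^ m + k * (6 / 2 ^ m) + 2 ^ n * 2 ^ k * (13 * (4 * 2 ^ n / 2 ^ m)) ≤
      2 ^ (3 * n + 6) / 2 ^ m := by
  have h1 : (2 : ℝ) ^ k ≤ 2 ^ n := pow_le_pow_right₀ (by norm_num) hk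
  have h0 : (k : ℝ) ≤ n := by exact_mod_cast hk
  have h2 : (n : ℝ) ≤ 2 ^ n := by exact_mod_cast Nat.lt_two_pow_self.le
  have h3 : (1 : ℝ) ≤ 2 ^ n := one_le_pow₀ (by norm_num)
  rw [show (2 : ℝ) / 2 ^ m + k * (6 / 2 ^ m) + 2 ^ n * 2 ^ k * (13 * (4 * 2 ^ n / 2 ^ m)) =
    (2 + k * 6 + 2 ^ n * 2 ^ k * (52 * 2 ^ n)) / 2 ^ m by ring]
  gcongr
  rw [pow_add, mul_comm 3 n, pow_mul]
  set x : ℝ := 2 ^ n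
  have h4 : x ≤ x ^ 3 := by nlinarith [mul_nonneg (sub_nonneg.2 h3) (sub_nonneg.2 h3)]
  have h5 : x * 2 ^ k * (52 * x) ≤ 52 * x ^ 3 := by
    nlinarith [mul_pos (a := x) (b := x) (by linarith) (by linarith)]
  linarith

/-- The estimator of the weight of a node. -/
noncomputable def weightEst (m : ℕ) : ℤ × ℤ × ℤ →+ ℝ where
  toFun t := t.1 / 2 ^ m
  map_zero' := by simp
  map_add' s t := by push_cast [Prod.fst_add]; ring

/-- The estimator of the real part of a coefficient. -/
noncomputable def reEst (m : ℕ) : ℤ × ℤ × ℤ →+ ℝ where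
  toFun t := t.2.1 / 2 ^ (m + 1)
  map_zero' := by simp
  map_add' s t := by push_cast [Prod.fst_add, Prod.snd_add]; ring

/-- The estimator of the imaginary part of a coefficient. -/
noncomputable def imEst (m : ℕ) : ℤ × ℤ × ℤ →+ ℝ where
  toFun t := t.2.2 / 2 ^ (m + 1)
  map_zero' := by simp
  map_add' s t := by push_cast [Prod.snd_add]; ring

theorem abs_weightEst_le (m : ℕ) (q : ℤ) (w w' x x' : ℤ × ℤ) :
    |weightEst m (sampleValue (2 ^ m) q w w' x x')| ≤ 1 := by
  have h := (abs_sampleValue_le (p := 2 ^ m) (by positivity) q w w' x x').1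
  change |(_ : ℝ) / _| ≤ _
  rw [abs_div, abs_of_pos (by positivity : (0 : ℝ) < 2 ^ m), div_le_one (by positivity)]
  exact_mod_cast h

theorem abs_reEst_le (m : ℕ) (q : ℤ) (w w' x x' : ℤ × ℤ) :
    |reEst m (sampleValue (2 ^ m) q w w' x x')| ≤ 1 := by
  have h := (abs_sampleValue_le (p := 2 ^ m) (by positivity) q w w' x x').2.1
  change |(_ : ℝ) / _| ≤ _
  rw [abs_div, abs_of_pos (by positivity : (0 : ℝ) < 2 ^ (m + 1)), div_le_one (by positivity),
    pow_succ']
  exact_mod_cast h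

theorem abs_imEst_le (m : ℕ) (q : ℤ) (w w' x x' : ℤ × ℤ) :
    |imEst m (sampleValue (2 ^ m) q w w' x x')| ≤ 1 := by
  have h := (abs_sampleValue_le (p := 2 ^ m) (by positivity) q w w' x x').2.2
  change |(_ : ℝ) / _| ≤ _
  rw [abs_div, abs_of_pos (by positivity : (0 : ℝ) < 2 ^ (m + 1)), div_le_one (by positivity),
    pow_succ']
  exact_mod_cast h

/-- Rounding errors in `intRatio` are small compared to the denominator. -/
theorem mul_abs_intRatio_sub_le {x y : ℤ × ℤ} {l m n : ℕ} {X Y : ℂ} (hn : n + 2 ≤ m)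
    (hX : ‖dyadic x.1 x.2 l - X‖ ≤ 4 * 2 ^ n / 2 ^ m)
    (hY : ‖dyadic y.1 y.2 l - Y‖ ≤ 4 * 2 ^ n / 2 ^ m) (hX1 : ‖X‖ ≤ 1) (hY1 : ‖Y‖ ≤ 1) {u : ℝ}
    (hu0 : 0 ≤ u) (hu1 : u ≤ 1) (hu : u ≤ ‖X‖ ^ 2 + ‖Y‖ ^ 2) :
    u * |((intRatio x y (2 ^ m)).1 : ℝ) / 2 ^ m - (ratio X Y).re| ≤ 13 * (4 * 2 ^ n / 2 ^ m) ∧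
    u * |((intRatio x y (2 ^ m)).2 : ℝ) / 2 ^ m - (ratio X Y).im| ≤ 13 * (4 * 2 ^ n / 2 ^ m) := by
  have he : (4 * 2 ^ n / 2 ^ m : ℝ) ≤ 1 := by
    rw [div_le_one (by positivity)]
    calc (4 * 2 ^ n : ℝ) = 2 ^ (n + 2) := by rw [pow_add]; ring
      _ ≤ _ := pow_le_pow_right₀ (by norm_num) hn
  have h1 := norm_ratio_sub_le hX hY hX1 hY1 he
  have h2 := norm_intRatio_sub_le x y l m
  set R := ratio (dyadic x.1 x.2 l) (dyadic y.1 y.2 l)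
  have h3 : u * ‖R - ratio X Y‖ ≤ 12 * (4 * 2 ^ n / 2 ^ m) :=
    (mul_le_mul_of_nonneg_right hu (norm_nonneg _)).trans h1
  have h4 : (1 : ℝ) / 2 ^ m ≤ 4 * 2 ^ n / 2 ^ m := by
    gcongr
    have : (1 : ℝ) ≤ 2 ^ n := one_le_pow₀ (by norm_num)
    linarith
  have key : ∀ a b c : ℝ, |a - b| ≤ 1 / 2 ^ m → |b - c| ≤ ‖R - ratio X Y‖ →
      u * |a - c| ≤ 13 * (4 * 2 ^ n / 2 ^ m) := fun a b c hab hbc => by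
    have := mul_le_mul_of_nonneg_left ((abs_sub_le a b c).trans (add_le_add hab hbc)) hu0
    have := mul_le_mul hu1 h4 (by positivity) zero_le_one
    linarith
  refine ⟨key _ _ _ h2.1 ?_, key _ _ _ h2.2 ?_⟩
  · rw [← Complex.sub_re]; exact Complex.abs_re_le_norm _
  · rw [← Complex.sub_im]; exact Complex.abs_im_le_norm _

/-- The estimator of the weight of a node has a bias of at most `2 ^ (3 * n + 6 - m)`. -/
theorem abs_ev_weightEst_sub_le (hL : LocalBy L T O B loc) (hTr : TractableBy S Q TS n φ sd qd)
    {k a m : ℕ} (hk : k ≤ n) (ha : a < 2 ^ n) (hm : n + 2 ≤ m) :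
    |ev (sampleDist sd qd loc n k a m) (weightEst m) - B.wt φ k a| ≤
      2 ^ (3 * n + 6) / 2 ^ m := by
  rw [← sum_ratio_eq_wt B φ hk a]
  refine (abs_ev_sampleDist_sub_le (c := 13 * (4 * 2 ^ n / 2 ^ m)) hL hTr hk ha
    (fun w w' x x' => abs_weightEst_le m _ w w' x x') fun y hy h hh x hx x' hx' => ?_).trans
    (two_pow_error_le hk)
  have hy' := mod_add_mul_lt hk hh (y := y)
  have hi : y / 2 ^ (n - k) < 2 ^ k := by
    rw [Nat.div_lt_iff_lt_mul (by positivity), ← pow_add]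
    exact hy.trans_eq (by congr 1; omega)
  have e1 := hTr.dyadic_sub_le y hy m x hx
  have e2 := hTr.dyadic_sub_le _ hy' m x' hx'
  have e3 := norm_dyadic_intProd_sub_le hL m hk ha h
  have e4 := norm_dyadic_intProd_sub_le hL m hk ha (y / 2 ^ (n - k))
  have b1 := norm_le_one_of_sum_sq hTr.sum_sq (mem_range.2 hy)
  have b2 := norm_le_one_of_sum_sq hTr.sum_sq (mem_range.2 hy')
  have b3 := norm_le_one_of_sum_sq (B.sum_norm_amp k a) (mem_range.2 hh)
  have b4 := norm_le_one_of_sum_sq (B.sum_norm_amp k a) (mem_range.2 hi)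
  have hd : (1 : ℝ) / 2 ^ m ≤ 1 := div_le_one_of_le₀ (one_le_pow₀ (by norm_num)) (by positivity)
  have hle : (1 : ℝ) / 2 ^ m + 2 * (2 ^ n / 2 ^ m) ≤ 4 * 2 ^ n / 2 ^ m := by
    rw [mul_div_assoc', ← add_div]
    gcongr
    have : (1 : ℝ) ≤ 2 ^ n := one_le_pow₀ (by norm_num)
    linarith
  refine (mul_abs_intRatio_sub_le (l := m + m * k) hm ?_ ?_ ?_ ?_ (by positivity) ?_ ?_).1
  · rw [dyadic_gmul]
    exact (norm_mul_sub_mul_le e1 e3 b1 b3 hd).trans hle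
  · rw [dyadic_gmul]
    exact (norm_mul_sub_mul_le e2 e4 b2 b4 hd).trans hle
  · rw [norm_mul]; exact mul_le_one₀ b1 (norm_nonneg _) b3
  · rw [norm_mul]; exact mul_le_one₀ b2 (norm_nonneg _) b4
  · exact mul_le_one₀ (pow_le_one₀ (norm_nonneg _) b1) (by positivity)
      (pow_le_one₀ (norm_nonneg _) b3)
  · rw [norm_mul, mul_pow]
    exact le_add_of_nonneg_right (by positivity)

theorem dyadic_scale (a b : ℤ) (l m : ℕ) : dyadic (2 ^ m * a) (2 ^ m * b) (m + l) = dyadic a b l := by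
  rw [dyadic, dyadic, pow_add]
  push_cast
  rw [mul_assoc, ← mul_add, mul_div_mul_left _ _ (pow_ne_zero _ two_ne_zero)]

/-- The estimators of the real and imaginary parts of a coefficient have a bias of at most
`2 ^ (3 * n + 6 - m)`. -/
theorem abs_ev_coeffEst_sub_le (hL : LocalBy L T O B loc) (hTr : TractableBy S Q TS n φ sd qd)
    {a m : ℕ} (ha : a < 2 ^ n) (hm : n + 2 ≤ m) :
    |ev (sampleDist sd qd loc n n a m) (reEst m) - (B.part φ n a 0).re| ≤
      2 ^ (3 * n + 6) / 2 ^ m ∧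
    |ev (sampleDist sd qd loc n n a m) (imEst m) - (B.part φ n a 0).im| ≤
      2 ^ (3 * n + 6) / 2 ^ m := by
  have hpart : B.part φ n a 0 = ∑ h ∈ range (2 ^ n), conj (B.amp n a h) * φ h := by
    simp [ProductBasis.part]
  have hsum := sum_ratio_single (range (2 ^ n)) φ (B.amp n a) hTr.sum_sq (B.sum_norm_amp n a)
  rw [← hpart] at hsum
  have key : ∀ y < 2 ^ n, ∀ x ∈ (qd y m).support, ∀ u : ℝ, 0 ≤ u → u ≤ 1 →
      u ≤ ‖B.amp n a y‖ ^ 2 + ‖φ y‖ ^ 2 →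
      u * |((intRatio (2 ^ m * (intProd (highAmp loc n n a m) n y).1,
        2 ^ m * (intProd (highAmp loc n n a m) n y).2) (2 ^ (m * n) * x.1, 2 ^ (m * n) * x.2)
        (2 ^ m)).1 : ℝ) / 2 ^ m - (ratio (B.amp n a y) (φ y)).re| ≤ 13 * (4 * 2 ^ n / 2 ^ m) ∧
      u * |((intRatio (2 ^ m * (intProd (highAmp loc n n a m) n y).1,
        2 ^ m * (intProd (highAmp loc n n a m) n y).2) (2 ^ (m * n) * x.1, 2 ^ (m * n) * x.2)
        (2 ^ m)).2 : ℝ) / 2 ^ m - (ratio (B.amp n a y) (φ y)).im| ≤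
        13 * (4 * 2 ^ n / 2 ^ m) := by
    intro y hy x hx u hu0 hu1 hu
    have e1 := hTr.dyadic_sub_le y hy m x hx
    have e3 := norm_dyadic_intProd_sub_le hL m le_rfl ha y
    have h1 : (1 : ℝ) ≤ 2 ^ n := one_le_pow₀ (by norm_num)
    refine mul_abs_intRatio_sub_le (l := m + m * n) hm ?_ ?_
      (norm_le_one_of_sum_sq (B.sum_norm_amp n a) (mem_range.2 hy))
      (norm_le_one_of_sum_sq hTr.sum_sq (mem_range.2 hy)) hu0 hu1 hu
    · rw [dyadic_scale]
      refine e3.trans ?_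
      gcongr
      linarith
    · rw [add_comm m, dyadic_scale]
      refine e1.trans ?_
      gcongr
      linarith
  have hs : ∀ y < 2 ^ n, ∀ h < 2 ^ n, ∀ x ∈ (qd y m).support,
      ∀ x' ∈ (qd (y % 2 ^ (n - n) + 2 ^ (n - n) * h) m).support,
      (‖φ y‖ ^ 2 * ‖B.amp n a h‖ ^ 2 * |reEst m (sampleValue (2 ^ m) (2 ^ (m * n))
        (intProd (highAmp loc n n a m) n (y / 2 ^ (n - n))) (intProd (highAmp loc n n a m) n h)
        x x') - ((ratio (B.amp n a y) (φ y) + ratio (B.amp n a h) (φ h)) / 2).re| ≤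
        13 * (4 * 2 ^ n / 2 ^ m)) ∧
      ‖φ y‖ ^ 2 * ‖B.amp n a h‖ ^ 2 * |imEst m (sampleValue (2 ^ m) (2 ^ (m * n))
        (intProd (highAmp loc n n a m) n (y / 2 ^ (n - n))) (intProd (highAmp loc n n a m) n h)
        x x') - ((ratio (B.amp n a y) (φ y) + ratio (B.amp n a h) (φ h)) / 2).im| ≤
        13 * (4 * 2 ^ n / 2 ^ m) := by
    intro y hy h hh x hx x' hx'
    simp only [Nat.sub_self, pow_zero, Nat.mod_one, zero_add, one_mul, Nat.div_one] at hx' ⊢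
    have b1 : ‖φ y‖ ^ 2 ≤ 1 := pow_le_one₀ (norm_nonneg _)
      (norm_le_one_of_sum_sq hTr.sum_sq (mem_range.2 hy))
    have b2 : ‖B.amp n a h‖ ^ 2 ≤ 1 := pow_le_one₀ (norm_nonneg _)
      (norm_le_one_of_sum_sq (B.sum_norm_amp n a) (mem_range.2 hh))
    have hu : 0 ≤ ‖φ y‖ ^ 2 * ‖B.amp n a h‖ ^ 2 := by positivity
    have hu1 : ‖φ y‖ ^ 2 * ‖B.amp n a h‖ ^ 2 ≤ 1 := mul_le_one₀ b1 (by positivity) b2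
    have k1 := key y hy x hx _ hu hu1 ((mul_le_of_le_one_right (by positivity) b2).trans
      (le_add_of_nonneg_left (by positivity)))
    have k2 := key h hh x' hx' _ hu hu1 ((mul_le_of_le_one_left (by positivity) b1).trans
      (le_add_of_nonneg_right (by positivity)))
    set u := ‖φ y‖ ^ 2 * ‖B.amp n a h‖ ^ 2
    have avg : ∀ (i j : ℤ) (r r' c : ℝ), u * |(i : ℝ) / 2 ^ m - r| ≤ c →
        u * |(j : ℝ) / 2 ^ m - r'| ≤ c → u * |((i + j : ℤ) : ℝ) / 2 ^ (m + 1) - (r + r') / 2| ≤ c := by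
      intro i j r r' c h1 h2
      rw [show ((i + j : ℤ) : ℝ) / 2 ^ (m + 1) - (r + r') / 2 =
        (((i : ℝ) / 2 ^ m - r) + ((j : ℝ) / 2 ^ m - r')) / 2 by push_cast; rw [pow_succ]; ring,
        abs_div, abs_two]
      have := mul_le_mul_of_nonneg_left (abs_add_le ((i : ℝ) / 2 ^ m - r) ((j : ℝ) / 2 ^ m - r')) hu
      linarith
    constructor
    · have := avg _ _ _ _ _ k1.1 k2.1
      rw [← Complex.add_re] at this
      rw [Complex.div_ofNat_re]
      exact this
    · have := avg _ _ _ _ _ k1.2 k2.2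
      rw [← Complex.add_im] at this
      rw [Complex.div_ofNat_im]
      exact this
  constructor
  · rw [← hsum, Complex.re_sum]
    simp only [Complex.re_sum, Complex.re_ofReal_mul]
    exact (abs_ev_sampleDist_sub_le hL hTr le_rfl ha (fun w w' x x' => abs_reEst_le m _ w w' x x')
      fun y hy h hh x hx x' hx' => (hs y hy h hh x hx x' hx').1).trans (two_pow_error_le le_rfl)
  · rw [← hsum, Complex.im_sum]
    simp only [Complex.im_sum, Complex.im_ofReal_mul]
    exact (abs_ev_sampleDist_sub_le hL hTr le_rfl ha (fun w w' x x' => abs_imEst_le m _ w w' x x')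
      fun y hy h hh x hx x' hx' => (hs y hy h hh x hx x' hx').2).trans (two_pow_error_le le_rfl)

end

theorem abs_le_of_mem_sampleDist {sd : ℕ → PMF ℕ} {qd : ℕ → ℕ → PMF (ℤ × ℤ)}
    {loc : ℕ → ℕ → Bool → ℕ → ℤ × ℤ} {n k a m : ℕ} :
    ∀ t ∈ (sampleDist sd qd loc n k a m).support,
      |t.1| ≤ 2 * 2 ^ m ∧ |t.2.1| ≤ 2 * 2 ^ m ∧ |t.2.2| ≤ 2 * 2 ^ m := by
  intro t ht
  simp only [sampleDist, PMF.mem_support_bind_iff, PMF.mem_support_map_iff] at ht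
  obtain ⟨y, -, h, -, x, -, x', -, rfl⟩ := ht
  have hp : (0 : ℤ) ≤ 2 ^ m := by positivity
  have h1 := abs_sampleValue_le hp (2 ^ (m * k)) (intProd (highAmp loc n k a m) k (y / 2 ^ (n - k)))
    (intProd (highAmp loc n k a m) k h) x x'
  exact ⟨h1.1.trans (by linarith), h1.2.1, h1.2.2⟩

theorem abs_le_of_mem_sumDist {sd : ℕ → PMF ℕ} {qd : ℕ → ℕ → PMF (ℤ × ℤ)}
    {loc : ℕ → ℕ → Bool → ℕ → ℤ × ℤ} {n k a m N : ℕ} :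
    ∀ t ∈ (sumDist (sampleDist sd qd loc n k a m) N).support,
      |t.1| ≤ N * (2 * 2 ^ m) ∧ |t.2.1| ≤ N * (2 * 2 ^ m) ∧ |t.2.2| ≤ N * (2 * 2 ^ m) := by
  refine chain_support (I := fun (i : ℕ) (u : ℤ × ℤ × ℤ) => |u.1| ≤ i * (2 * 2 ^ m) ∧
    |u.2.1| ≤ i * (2 * 2 ^ m) ∧ |u.2.2| ≤ i * (2 * 2 ^ m)) (by simp) fun i _ u hu v hv => ?_
  rw [PMF.mem_support_map_iff] at hv
  obtain ⟨x, hx, rfl⟩ := hv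
  have h1 := abs_le_of_mem_sampleDist x hx
  simp only [Nat.cast_succ, add_mul, one_mul, Prod.fst_add, Prod.snd_add] at hu ⊢
  exact ⟨(abs_add_le _ _).trans (add_le_add hu.1 h1.1),
    (abs_add_le _ _).trans (add_le_add hu.2.1 h1.2.1),
    (abs_add_le _ _).trans (add_le_add hu.2.2 h1.2.2)⟩

theorem bitLen_le_of_abs_le {z : ℤ} {N m s : ℕ} (h : |z| ≤ N * (2 * 2 ^ m)) (hN : N ≤ s)
    (hm : m ≤ s) : bitLen z ≤ 2 * s + 1 := by
  rw [bitLen_le_iff]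
  have h1 : (N : ℤ) < 2 ^ s := by exact_mod_cast hN.trans_lt Nat.lt_two_pow_self
  have h2 : (2 : ℤ) ^ m ≤ 2 ^ s := pow_le_pow_right₀ (by norm_num) hm
  have h3 : (0 : ℤ) < 2 ^ m := by positivity
  calc |z| ≤ N * (2 * 2 ^ m) := h
    _ < 2 ^ s * (2 * 2 ^ m) := mul_lt_mul_of_pos_right h1 (by linarith)
    _ ≤ 2 ^ s * (2 * 2 ^ s) := by gcongr
    _ = 2 ^ (2 * s + 1) := by rw [pow_succ, mul_comm 2 s, pow_mul]; ring

open Ex Prog in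
/-- Summing up the results of `N` rounds of sampling. -/
theorem exists_sumDist (L S Q : Prog) {T TS : ℕ → ℕ} (hT : PolyB T) (hTS : PolyB TS) :
    ∃ (A : Prog) (T' : ℕ → ℕ), PolyB T' ∧ ∀ (n : ℕ) (O : Oracle) (B : ProductBasis n)
      (loc : ℕ → ℕ → Bool → ℕ → ℤ × ℤ) (φ : ℕ → ℂ) (sd : ℕ → PMF ℕ) (qd : ℕ → ℕ → PMF (ℤ × ℤ)),
      LocalBy L T O B loc → TractableBy S Q TS n φ sd qd →
      ∀ (s k a m N : ℕ), n ≤ s → m ≤ s → N ≤ s → k ≤ n → a < 2 ^ n →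
      Computes O A [(n : ℤ), (k : ℤ), (a : ℤ), (m : ℤ), (N : ℤ)] 3
        ((sumDist (sampleDist sd qd loc n k a m) N).map fun t => [t.1, t.2.1, t.2.2]) (T' s) := by
  obtain ⟨R, TR, hTR, hR⟩ := exists_sampleDist L S Q hT hTS
  refine ⟨.seq (.loop 4 (.seq (.call R [0, 1, 2, 3] [8, 9, 10]) (blk [(5, var 5 + var 8),
    (6, var 6 + var 9), (7, var 7 + var 10), (4, var 4 - 1), (8, 0), (9, 0), (10, 0)])))
    (blk [(0, var 5), (1, var 6), (2, var 7)]), ?_⟩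
  constructor
  refine ⟨?_, fun n O B loc φ sd qd hL hTr s k a m N hn hm hN hk ha => ?_⟩
  rotate_left
  · set D := sampleDist sd qd loc n k a m with hD
    set I : ℕ → ℤ × ℤ × ℤ → Prop := fun i u => |u.1| ≤ i * (2 * 2 ^ m) ∧
      |u.2.1| ≤ i * (2 * 2 ^ m) ∧ |u.2.2| ≤ i * (2 * 2 ^ m) with hI
    have hns : 2 ^ n ≤ 2 ^ s := Nat.pow_le_pow_right (by norm_num) hn
    have state : ∀ i ≤ N, ∀ u, I i u → ∀ v, I 1 v → (Mem.ofList [(n : ℤ), (k : ℤ), (a : ℤ), (m : ℤ),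
        ((N - i : ℕ) : ℤ), u.1, u.2.1, u.2.2, v.1, v.2.1, v.2.2]).BitsLE (2 * s + 3) := by
      intro i hi u hu v hv
      have c1 := bitLen_natCast_le_of_le hn
      have c2 := bitLen_natCast_le_of_le (hk.trans hn)
      have c3 := bitLen_natCast_le_of_lt (ha.trans_le hns)
      have c4 := bitLen_natCast_le_of_le hm
      have c5 := bitLen_natCast_le_of_le (show N - i ≤ s by omega)
      have c6 := bitLen_le_of_abs_le hu.1 (hi.trans hN) hm
      have c7 := bitLen_le_of_abs_le hu.2.1 (hi.trans hN) hm
      have c8 := bitLen_le_of_abs_le hu.2.2 (hi.trans hN) hm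
      have c9 := bitLen_le_of_abs_le hv.1 (show 1 ≤ s + 1 by omega) (hm.trans (Nat.le_succ s))
      have c10 := bitLen_le_of_abs_le hv.2.1 (show 1 ≤ s + 1 by omega) (hm.trans (Nat.le_succ s))
      have c11 := bitLen_le_of_abs_le hv.2.2 (show 1 ≤ s + 1 by omega) (hm.trans (Nat.le_succ s))
      simp only [bitsLE_cons, bitsLE_nil, and_true]
      omega
    have z0 : ∀ i, I i 0 := fun i => by
      simp only [hI, Prod.fst_zero, Prod.snd_zero, abs_zero]
      have : (0 : ℤ) ≤ i * (2 * 2 ^ m) := by positivity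
      exact ⟨this, this, this⟩
    have hstep : ∀ i < N, ∀ u, I i u → ∀ v ∈ (D.map fun x => u + x).support, I (i + 1) v := by
      intro i _ u hu v hv
      rw [PMF.mem_support_map_iff] at hv
      obtain ⟨x, hx, rfl⟩ := hv
      have h1 := abs_le_of_mem_sampleDist x hx
      simp only [hI, Nat.cast_succ, add_mul, one_mul, Prod.fst_add, Prod.snd_add] at hu ⊢
      exact ⟨(abs_add_le _ _).trans (add_le_add hu.1 h1.1),
        (abs_add_le _ _).trans (add_le_add hu.2.1 h1.2.1),
        (abs_add_le _ _).trans (add_le_add hu.2.2 h1.2.2)⟩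
    have r1 := Runs.loop (σ := ℤ × ℤ × ℤ) (O := O) (r := 4) hN (fun _ u => D.map fun x => u + x)
      (fun i u => Mem.ofList [(n : ℤ), (k : ℤ), (a : ℤ), (m : ℤ), ((N - i : ℕ) : ℤ), u.1, u.2.1,
        u.2.2, 0, 0, 0]) I 0 (z0 0) (fun i hi u _ => by simpa using hi) (by simp)
      (fun i hi u hu => state i hi u hu 0 (z0 1) 4) hstep fun i hi u hu => by
        have q1 := (hR n O B loc φ sd qd hL hTr s k a m hn hm hk ha).listCallMap
          (args := [0, 1, 2, 3]) (rets := [8, 9, 10]) (state i hi.le u hu 0 (z0 1)) rfl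
          (l' := fun v => [(n : ℤ), (k : ℤ), (a : ℤ), (m : ℤ), ((N - i : ℕ) : ℤ), u.1, u.2.1,
            u.2.2, v.1, v.2.1, v.2.2]) (by simp [Mem.write])
        rw [PMF.map_comp]
        exact q1.seq_map_pure fun v hv => Runs.listBlk (bl := [(5, var 5 + var 8),
          (6, var 6 + var 9), (7, var 7 + var 10), (4, var 4 - 1), (8, 0), (9, 0), (10, 0)])
          (state i hi.le u hu v (by simpa [hI] using abs_le_of_mem_sampleDist v hv)) (by simp) (by
            rw [show ((N - (i + 1) : ℕ) : ℤ) = ((N - i : ℕ) : ℤ) - 1 by omega]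
            rfl)
    have r2 := r1.seq_map_pure (c' := blk [(0, var 5), (1, var 6), (2, var 7)])
      fun u hu => Runs.listBlk (state N le_rfl u (chain_support (z0 0) hstep u hu) 0 (z0 1))
        (by simp) rfl
    exact (r2.computes (k := 3) (ins := [(n : ℤ), (k : ℤ), (a : ℤ), (m : ℤ), (N : ℤ)]) rfl
      (v := fun t => [t.1, t.2.1, t.2.2]) fun t => rfl).mono le_rfl
  · fun_prop

/-! ### Reading the accuracy parameters -/

theorem exp_neg_natCast_le (l : ℕ) : Real.exp (-(l : ℝ)) ≤ 1 / 2 ^ l := by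
  rw [Real.exp_neg, ← one_div, ← Real.exp_one_pow l]
  have : (2 : ℝ) ≤ Real.exp 1 := by linarith [Real.add_one_le_exp 1]
  gcongr

theorem size_le_of_log_le {b s : ℕ} {v : ℝ} (hv : 1 ≤ v) (hb : (b : ℝ) ≤ 3 * v)
    (hs : Real.log v ≤ s) : Nat.size b ≤ 2 * s + 2 := by
  rw [Nat.size_le]
  have h1 : v ≤ Real.exp s := (Real.log_le_iff_le_exp (by linarith)).1 hs
  have h2 : Real.exp s ≤ 3 ^ s := by
    rw [← Real.exp_one_pow s]
    exact pow_le_pow_left₀ (Real.exp_pos 1).le (by linarith [Real.exp_one_lt_d9]) s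
  have h3 : (3 : ℝ) ^ s ≤ 2 ^ (2 * s) := by
    rw [pow_mul]; exact pow_le_pow_left₀ (by norm_num) (by norm_num) s
  have h4 : (b : ℝ) < 2 ^ (2 * s + 2) := by
    rw [pow_add]
    have : (0 : ℝ) < 2 ^ (2 * s) := by positivity
    linarith
  exact_mod_cast h4

theorem Runs.query {O : Oracle} {l l' : List ℤ} {r t i p : ℕ} {z : ℤ} {d : ℕ} {A : ℤ × ℤ} {b : ℕ}
    (hi : Mem.ofList l i = z) (hp : Mem.ofList l p = d) (hA : O [z] d = A) (hr : r < l.length)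
    (ht : t < l.length) (hl : (l.set r A.1).set t A.2 = l')
    (hb : 1 + bitLen z + bitLen (d : ℤ) + d + bitLen A.1 + bitLen A.2 ≤ b) :
    Runs O (.instr (.query r t [i] p)) (Mem.ofList l) (PMF.pure (Mem.ofList l')) b := by
  have h := Runs.instr (O := O) (M := Mem.ofList l) (.query r t [i] p) le_rfl
  have h1 : Instr.run O (Mem.ofList l) (.query r t [i] p) = Mem.ofList l' := by
    simp only [Instr.run, List.map_cons, List.map_nil, hi, hp, Int.toNat_natCast, hA]
    rw [Mem.update_ofList hr, Mem.update_ofList (by rwa [List.length_set]), hl]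
  rw [h1] at h
  refine h.mono (le_trans (le_of_eq ?_) hb)
  simp only [Instr.cost, List.map_cons, List.map_nil, hi, hp, Int.toNat_natCast, hA, bitLens,
    List.sum_cons, List.sum_nil, add_zero]

theorem abs_sub_le_of_dyadic_real {a b : ℤ} {m : ℕ} {u : ℝ} (h : ‖dyadic a b m - u‖ ≤ 1 / 2 ^ m) :
    |(a : ℝ) - 2 ^ m * u| ≤ 1 ∧ |b| ≤ 1 := by
  have hp : (0 : ℝ) < 2 ^ m := by positivity
  have key : ∀ x y : ℝ, |x / 2 ^ m - y| ≤ 1 / 2 ^ m → |x - 2 ^ m * y| ≤ 1 := fun x y hxy => by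
    have : x - 2 ^ m * y = 2 ^ m * (x / 2 ^ m - y) := by field_simp
    rw [this, abs_mul, abs_of_pos hp]
    calc 2 ^ m * |x / 2 ^ m - y| ≤ 2 ^ m * (1 / 2 ^ m) := by gcongr
      _ = 1 := by field_simp
  constructor
  · refine key _ _ (le_trans ?_ h)
    have := Complex.abs_re_le_norm (dyadic a b m - u)
    rwa [Complex.sub_re, dyadic_re, Complex.ofReal_re] at this
  · have h1 := key b 0 (le_trans (by
      have := Complex.abs_im_le_norm (dyadic a b m - u)
      rwa [Complex.sub_im, dyadic_im, Complex.ofReal_im] at this) h)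
    rw [mul_zero, sub_zero] at h1
    exact_mod_cast h1

theorem bitLen_le_natAbs (z : ℤ) : bitLen z ≤ z.natAbs := by
  rw [bitLen, Nat.size_le]; exact Nat.lt_two_pow_self

open Ex Prog in
/-- Reading the parameters `u = 1 / θ` (or `1 / ε`) and `v = 1 / π` (or `1 / δ`): an approximation
`a / 64` of `u`, an upper bound `K` of `u`, and an upper bound `2 ^ l` of `v`. -/
theorem exists_readParams : ∃ (A : Prog) (T : ℕ → ℕ), PolyB T ∧ ∀ (O : Oracle) (u v : ℝ), 0 < u →
    1 ≤ v → (∀ m, ‖dyadic (O [0] m).1 (O [0] m).2 m - u‖ ≤ 1 / 2 ^ m) →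
    (∀ m, ‖dyadic (O [1] m).1 (O [1] m).2 m - v‖ ≤ 1 / 2 ^ m) →
    ∀ s : ℕ, u ≤ s → Real.log v ≤ s → ∃ (a : ℤ) (K l : ℕ), |(a : ℝ) - 64 * u| ≤ 1 ∧ u ≤ K ∧ 1 ≤ K ∧
      K ≤ s + 3 ∧ v ≤ 2 ^ l ∧ l ≤ 2 * s + 2 ∧
      Computes O A [] 3 (PMF.pure [a, (K : ℤ), (l : ℤ)]) (T s) := by
  obtain ⟨P, TP, hTP, hP⟩ := exists_bitLen
  -- Six digits of `u` and no digits of `v` suffice; `l` is a bit length.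
  refine ⟨.seq (blk [(1, 6)]) (.seq (.instr (.query 4 5 [0] 1))
    (.seq (blk [(0, 1), (1, 0)]) (.seq (.instr (.query 2 3 [0] 1)) (.seq (blk [(2, var 2 + 1)])
    (.seq (.call P [2] [2]) (blk [(0, var 4), (1, var 4 / 64 + 2)])))))), ?_⟩
  constructor
  refine ⟨?_, fun O u v hu hv hOu hOv s hus hvs => ?_⟩
  rotate_left
  · obtain ⟨ha, ha'⟩ := abs_sub_le_of_dyadic_real (hOu 6)
    obtain ⟨hc, hc'⟩ := abs_sub_le_of_dyadic_real (hOv 0)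
    set a := O [0] 6 with hea
    set c := O [1] 0 with hec
    rw [pow_zero, one_mul] at hc
    norm_num at ha
    rw [abs_le] at ha hc
    have hc0 : 0 ≤ c.1 := by
      have h1 : (-1 : ℝ) < c.1 := by linarith
      have h2 : (-1 : ℤ) < c.1 := by exact_mod_cast h1
      omega
    obtain ⟨b, hb⟩ := Int.eq_ofNat_of_zero_le (show 0 ≤ c.1 + 1 by omega)
    have hbR : (c.1 : ℝ) + 1 = b := by exact_mod_cast congrArg (Int.cast (R := ℝ)) hb
    have ha0 : -1 ≤ a.1 := by
      have h1 : (-2 : ℝ) < a.1 := by linarith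
      have h2 : (-2 : ℤ) < a.1 := by exact_mod_cast h1
      omega
    have has : a.1 ≤ 64 * s + 1 := by
      have h1 : (a.1 : ℝ) ≤ 64 * s + 1 := by linarith
      exact_mod_cast h1
    obtain ⟨K, hK⟩ := Int.eq_ofNat_of_zero_le (show 0 ≤ a.1 / 64 + 2 by omega)
    have hK1 : a.1 + 64 < 64 * K := by omega
    have hKR : (a.1 : ℝ) + 64 < 64 * K := by exact_mod_cast hK1
    have hsize : Nat.size b ≤ 2 * s + 2 := size_le_of_log_le hv (by linarith) hvs
    have hvb : v ≤ 2 ^ Nat.size b := by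
      have h1 : (b : ℝ) ≤ 2 ^ Nat.size b := by exact_mod_cast (Nat.lt_size_self b).le
      linarith
    refine ⟨a.1, K, Nat.size b, by rw [abs_le]; constructor <;> linarith, by linarith, by omega,
      by omega, hvb, hsize, ?_⟩
    have b1 : bitLen a.1 ≤ 64 * s + 2 := (bitLen_le_natAbs _).trans (by omega)
    have b2 : bitLen a.2 ≤ 1 := (bitLen_le_natAbs _).trans (by rw [abs_le] at ha'; omega)
    have b4 : bitLen c.2 ≤ 1 := (bitLen_le_natAbs _).trans (by rw [abs_le] at hc'; omega)
    have b5 : bitLen (b : ℤ) ≤ 2 * s + 2 := by rwa [bitLen, Int.natAbs_natCast]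
    have b3 : bitLen c.1 ≤ 2 * s + 2 := (bitLen_mono (by
      rw [abs_of_nonneg hc0, abs_of_nonneg (by omega)]; omega)).trans b5
    have b6 : bitLen 6 ≤ 3 := by decide
    have b7 : bitLen (Nat.size b : ℤ) ≤ 2 * s + 2 := bitLen_natCast_le_of_le hsize
    have l0 : (Mem.ofList [0, 0, 0, 0, 0, 0]).BitsLE (64 * s + 3) := by
      simp only [bitsLE_cons, bitsLE_nil, bitLen_zero, and_true]; omega
    have l1 : (Mem.ofList [0, 6, 0, 0, a.1, a.2]).BitsLE (64 * s + 3) := by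
      simp only [bitsLE_cons, bitsLE_nil, bitLen_zero, and_true]; omega
    have l2 : (Mem.ofList [1, 0, c.1, c.2, a.1, a.2]).BitsLE (64 * s + 3) := by
      simp only [bitsLE_cons, bitsLE_nil, bitLen_zero, bitLen_one, and_true]; omega
    have l3 : (Mem.ofList [1, 0, (b : ℤ), c.2, a.1, a.2]).BitsLE (64 * s + 3) := by
      simp only [bitsLE_cons, bitsLE_nil, bitLen_zero, bitLen_one, and_true]; omega
    have l4 : (Mem.ofList [1, 0, (Nat.size b : ℤ), c.2, a.1, a.2]).BitsLE (64 * s + 3) := by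
      simp only [bitsLE_cons, bitsLE_nil, bitLen_zero, bitLen_one, and_true]; omega
    have r0 := Runs.listBlk (O := O) (bl := [(1, 6)]) l0 (by simp) (l' := [0, 6, 0, 0, 0, 0]) rfl
    have r1 := Runs.query (O := O) (l := [0, 6, 0, 0, 0, 0]) (r := 4) (t := 5) (i := 0) (p := 1)
      (z := 0) (d := 6) (b := 64 * s + 20) rfl rfl rfl (by simp) (by simp)
      (l' := [0, 6, 0, 0, a.1, a.2]) rfl (by
        rw [bitLen_zero, show bitLen ((6 : ℕ) : ℤ) = bitLen 6 from rfl, ← hea]; omega)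
    have r2 := Runs.listBlk (O := O) (bl := [(0, 1), (1, 0)]) l1 (by simp)
      (l' := [1, 0, 0, 0, a.1, a.2]) rfl
    have r3 := Runs.query (O := O) (l := [1, 0, 0, 0, a.1, a.2]) (r := 2) (t := 3) (i := 0) (p := 1)
      (z := 1) (d := 0) (b := 64 * s + 20) rfl rfl rfl (by simp) (by simp)
      (l' := [1, 0, c.1, c.2, a.1, a.2]) rfl (by
        rw [bitLen_one, show bitLen ((0 : ℕ) : ℤ) = bitLen 0 from rfl, bitLen_zero, ← hec]; omega)
    have r4 := Runs.listBlk (O := O) (bl := [(2, var 2 + 1)]) l2 (by simp)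
      (l' := [1, 0, (b : ℤ), c.2, a.1, a.2]) (by rw [← hb]; rfl)
    have r5 := (hP O (2 * s + 2) b hsize).listCall (args := [2]) (rets := [2]) l3 rfl
      (l' := [1, 0, (Nat.size b : ℤ), c.2, a.1, a.2]) (by simp [Mem.write])
    have r6 := Runs.listBlk (O := O) (bl := [(0, var 4), (1, var 4 / 64 + 2)]) l4 (by simp)
      (l' := [a.1, (K : ℤ), (Nat.size b : ℤ), c.2, a.1, a.2]) (by
        rw [← hK]; rfl)
    exact ((r0.seq_pure (r1.seq_pure (r2.seq_pure (r3.seq_pure (r4.seq_pure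
      (r5.seq_pure r6)))))).computes_pure rfl rfl).mono le_rfl
  · fun_prop

/-! ### Estimating a coefficient -/

/-- The number of samples in terms of the parameters: with `N = 1024 * K ^ 2 * l` samples, the
probability of an error `1 / (16 * K)` of a mean is at most `2 / 2 ^ l`. -/
theorem two_mul_exp_le {K l : ℕ} (hK : 1 ≤ K) :
    2 * Real.exp (-(((1024 * K * K * l : ℕ) : ℝ) * (1 / (16 * K)) ^ 2 / 4)) ≤ 2 / 2 ^ l := by
  have hK' : (0 : ℝ) < K := by exact_mod_cast hK
  have h : ((1024 * K * K * l : ℕ) : ℝ) * (1 / (16 * K)) ^ 2 / 4 = l := by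
    push_cast; field_simp; ring
  rw [h]
  have := exp_neg_natCast_le l
  rw [show (2 : ℝ) / 2 ^ l = 2 * (1 / 2 ^ l) by ring]
  linarith

theorem two_pow_div_le {n K : ℕ} (hK : 1 ≤ K) :
    (2 : ℝ) ^ (3 * n + 6) / 2 ^ (3 * n + 11 + K) ≤ 1 / (32 * K) := by
  have hK' : (0 : ℝ) < K := by exact_mod_cast hK
  have h1 : (K : ℝ) ≤ 2 ^ K := by exact_mod_cast Nat.lt_two_pow_self.le
  rw [show 3 * n + 11 + K = (3 * n + 6) + (5 + K) by ring, pow_add (2 : ℝ) (3 * n + 6),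
    div_mul_eq_div_div, div_self (by positivity), pow_add]
  gcongr
  norm_num

theorem abs_le_one_of_mem_sampleDist {sd : ℕ → PMF ℕ} {qd : ℕ → ℕ → PMF (ℤ × ℤ)}
    {loc : ℕ → ℕ → Bool → ℕ → ℤ × ℤ} {n k a m : ℕ} {X : ℤ × ℤ × ℤ → ℝ}
    (hX : ∀ q w w' x x', |X (sampleValue (2 ^ m) q w w' x x')| ≤ 1) :
    ∀ t ∈ (sampleDist sd qd loc n k a m).support, |X t| ≤ 1 := by
  intro t ht
  simp only [sampleDist, PMF.mem_support_bind_iff, PMF.mem_support_map_iff] at ht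
  obtain ⟨y, -, h, -, x, -, x', -, rfl⟩ := ht
  exact hX _ _ _ _ _

/-- Rounding a mean to `m + 1` binary digits. -/
theorem abs_round_sub_le {s : ℤ} {N m K : ℕ} {r η : ℝ} (hN : 1 ≤ N) (hK : 1 ≤ K) (hm : 11 + K ≤ m)
    (h : |(s : ℝ) / 2 ^ (m + 1) - N * r| ≤ N * η) :
    |((s / (N : ℤ) : ℤ) : ℝ) / 2 ^ (m + 1) - r| ≤ η + 1 / (32 * K) := by
  have hN' : (0 : ℝ) < N := by exact_mod_cast hN
  have hK' : (0 : ℝ) < K := by exact_mod_cast hK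
  have h1 := abs_ediv_sub_div_le s N
  rw [Int.cast_natCast] at h1
  have hp : (0 : ℝ) < 2 ^ (m + 1) := by positivity
  have h2 : |((s / (N : ℤ) : ℤ) : ℝ) / 2 ^ (m + 1) - s / N / 2 ^ (m + 1)| ≤ 1 / (32 * K) := by
    rw [← sub_div, abs_div, abs_of_pos hp]
    have h3 : (32 * K : ℝ) ≤ 2 ^ (m + 1) := by
      have h4 : (K : ℝ) ≤ 2 ^ K := by exact_mod_cast Nat.lt_two_pow_self.le
      calc (32 * K : ℝ) ≤ 2 ^ 5 * 2 ^ K := by norm_num; exact h4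
        _ = 2 ^ (5 + K) := by rw [pow_add]
        _ ≤ _ := pow_le_pow_right₀ (by norm_num) (by omega)
    exact div_le_div₀ zero_le_one h1 (by positivity) h3
  have h3 : |(s : ℝ) / N / 2 ^ (m + 1) - r| ≤ η := by
    rw [show (s : ℝ) / N / 2 ^ (m + 1) - r = (s / 2 ^ (m + 1) - N * r) / N by field_simp,
      abs_div, abs_of_pos hN', div_le_iff₀ hN', mul_comm η]
    exact h
  exact (abs_sub_le _ _ _).trans ((add_le_add h2 h3).trans_eq (add_comm _ _))

open Ex Prog in
/-- The coefficient `B.part φ n x 0` is estimated by the mean of `N` samples. -/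
theorem exists_estimateCoeff (L S Q : Prog) {T TS : ℕ → ℕ} (hT : PolyB T) (hTS : PolyB TS) :
    ∃ (A : Prog) (T' : ℕ → ℕ), PolyB T' ∧ ∀ (n : ℕ) (O : Oracle) (B : ProductBasis n)
      (loc : ℕ → ℕ → Bool → ℕ → ℤ × ℤ) (φ : ℕ → ℂ) (sd : ℕ → PMF ℕ) (qd : ℕ → ℕ → PMF (ℤ × ℤ)),
      LocalBy L T O B loc → TractableBy S Q TS n φ sd qd →
      ∀ ε δ : ℝ, 0 < ε → 0 < δ → δ ≤ 1 →
      (∀ m, ‖dyadic (O [0] m).1 (O [0] m).2 m - (1 / ε : ℝ)‖ ≤ 1 / 2 ^ m) →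
      (∀ m, ‖dyadic (O [1] m).1 (O [1] m).2 m - (1 / δ : ℝ)‖ ≤ 1 / 2 ^ m) →
      ∀ s x : ℕ, n ≤ s → 1 / ε ≤ s → Real.log (1 / δ) ≤ s → x < 2 ^ n →
      ∃ ν, Runs O A (Mem.ofList [(n : ℤ), (x : ℤ)]) ν (T' s) ∧
        pr ν (fun M => ¬ ‖dyadic (M 0) (M 1) (M 2).toNat - B.part φ n x 0‖ ≤ ε) ≤ δ := by
  obtain ⟨G, TG, hTG, hG⟩ := exists_readParams
  obtain ⟨E, TE, hTE, hE⟩ := exists_sumDist L S Q hT hTS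
  -- Registers: 2, 3, 4 the numbers `a`, `K`, `l`; 5 the number `m` of digits; 6 the number `N` of
  -- samples; 7, 8, 9 the sums. With `l + 2` in place of `l` in `N`, the four tails of the real and
  -- the imaginary part have a total probability of at most `1 / 2 ^ l`.
  refine ⟨.seq (.call G [] [2, 3, 4]) (.seq (blk [(5, 3 * var 0 + 11 + var 3),
    (6, 1024 * var 3 * var 3 * (var 4 + 2))]) (.seq (.call E [0, 0, 1, 5, 6] [7, 8, 9])
    (blk [(0, var 8 / var 6), (1, var 9 / var 6), (2, var 5 + 1)]))), ?_⟩
  constructor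
  refine ⟨?_, fun n O B loc φ sd qd hL hTr ε δ hε hδ hδ1 hO0 hO1 s x hn hεs hδs hx => ?_⟩
  rotate_left
  · obtain ⟨a, K, l, ha, hK, hK1, hKs, hl, hls, hG⟩ := hG O (1 / ε) (1 / δ) (by positivity)
      ((one_le_div hδ).2 hδ1) hO0 hO1 s hεs hδs
    obtain ⟨m, hm⟩ : ∃ m, m = 3 * n + 11 + K := ⟨_, rfl⟩
    obtain ⟨N, hN⟩ : ∃ N, N = 1024 * K * K * (l + 2) := ⟨_, rfl⟩
    set D := sampleDist sd qd loc n n x m with hD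
    have hms : m ≤ 4 * s + 14 := by omega
    have hNs : N ≤ 1024 * (s + 3) * (s + 3) * (2 * s + 4) := by
      rw [hN]
      exact Nat.mul_le_mul (Nat.mul_le_mul (Nat.mul_le_mul_left _ hKs) hKs) (by omega)
    obtain ⟨s', hs'⟩ : ∃ s', s' = 4 * s + 14 + 1024 * (s + 3) * (s + 3) * (2 * s + 4) + 64 * s :=
      ⟨_, rfl⟩
    obtain ⟨b, hb⟩ : ∃ b, b = 2 * s' + 1 := ⟨_, rfl⟩
    have hns : 2 ^ n ≤ 2 ^ s := Nat.pow_le_pow_right (by norm_num) hn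
    have hN1 : 1 ≤ N := by
      rw [hN]; exact Nat.one_le_iff_ne_zero.2 (by positivity)
    have c1 := bitLen_natCast_le_of_le hn
    have c2 := bitLen_natCast_le_of_lt (hx.trans_le hns)
    have c3 : bitLen a ≤ 64 * s + 2 := (bitLen_le_natAbs _).trans (by
      have h1 : |(a : ℝ)| ≤ 64 * s + 2 := by
        have : (0 : ℝ) < 1 / ε := by positivity
        generalize 1 / ε = u at *
        rw [abs_le] at ha ⊢
        constructor <;> linarith
      have h2 : |a| ≤ 64 * (s : ℤ) + 2 := by exact_mod_cast h1
      rw [← Int.natCast_natAbs] at h2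
      omega)
    have c4 := bitLen_natCast_le_of_le hKs
    have c5 := bitLen_natCast_le_of_le hls
    have c6 := bitLen_natCast_le_of_le hms
    have c7 := bitLen_natCast_le_of_le hNs
    have state : ∀ (a : ℤ) (K l m N : ℤ) (t : ℤ × ℤ × ℤ), bitLen a ≤ 64 * s + 2 →
        bitLen K ≤ s + 3 → bitLen l ≤ 2 * s + 2 → bitLen m ≤ 4 * s + 14 →
        bitLen N ≤ 1024 * (s + 3) * (s + 3) * (2 * s + 4) →
        (bitLen t.1 ≤ b ∧ bitLen t.2.1 ≤ b ∧ bitLen t.2.2 ≤ b) →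
        (Mem.ofList [(n : ℤ), (x : ℤ), a, K, l, m, N, t.1, t.2.1, t.2.2]).BitsLE b := by
      intro a K l m N t h1 h2 h3 h4 h5 h6
      simp only [bitsLE_cons, bitsLE_nil, and_true]
      omega
    have z0 : bitLen (0 : ℤ × ℤ × ℤ).1 ≤ b ∧ bitLen (0 : ℤ × ℤ × ℤ).2.1 ≤ b ∧
        bitLen (0 : ℤ × ℤ × ℤ).2.2 ≤ b := by simp
    have zb : ∀ b', bitLen 0 ≤ b' := by simp
    have r0 := hG.listCall (args := []) (rets := [2, 3, 4]) (state 0 0 0 0 0 0 (zb _) (zb _) (zb _)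
      (zb _) (zb _) z0) rfl (l' := [(n : ℤ), (x : ℤ), a, (K : ℤ), (l : ℤ), 0, 0, 0, 0, 0])
      (by simp [Mem.write])
    have r1 := Runs.listBlk (O := O) (bl := [(5, 3 * var 0 + 11 + var 3),
      (6, 1024 * var 3 * var 3 * (var 4 + 2))]) (state a K l 0 0 0 c3 c4 c5 (zb _) (zb _) z0)
      (by simp) (l' := [(n : ℤ), (x : ℤ), a, (K : ℤ), (l : ℤ), (m : ℤ), (N : ℤ), 0, 0, 0]) (by
        rw [hm, hN]; push_cast; rfl)
    have r2 := (hE n O B loc φ sd qd hL hTr s' n x m N (by omega) (by omega) (by omega) le_rfl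
      hx).listCallMap (args := [0, 0, 1, 5, 6]) (rets := [7, 8, 9])
      (state a K l m N 0 c3 c4 c5 c6 c7 z0) rfl (l' := fun t => [(n : ℤ), (x : ℤ), a, (K : ℤ),
        (l : ℤ), (m : ℤ), (N : ℤ), t.1, t.2.1, t.2.2]) (by simp [Mem.write])
    have hsupp : ∀ t ∈ (sumDist D N).support, bitLen t.1 ≤ b ∧ bitLen t.2.1 ≤ b ∧
        bitLen t.2.2 ≤ b := by
      intro t ht
      have := abs_le_of_mem_sumDist t ht
      have hNs' : N ≤ s' := by omega
      have hms' : m ≤ s' := by omega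
      rw [hb]
      exact ⟨bitLen_le_of_abs_le this.1 hNs' hms', bitLen_le_of_abs_le this.2.1 hNs' hms',
        bitLen_le_of_abs_le this.2.2 hNs' hms'⟩
    have r3 := r2.seq_map_pure (c' := blk [(0, var 8 / var 6), (1, var 9 / var 6), (2, var 5 + 1)])
      (f := fun t : ℤ × ℤ × ℤ => Mem.ofList [t.2.1 / (N : ℤ), t.2.2 / (N : ℤ), (m : ℤ) + 1, (K : ℤ),
        (l : ℤ), (m : ℤ), (N : ℤ), t.1, t.2.1, t.2.2])
      fun t ht => Runs.listBlk (state a K l m N t c3 c4 c5 c6 c7 (hsupp t ht)) (by simp) rfl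
    have r4 := r0.seq_pure (r1.seq_pure r3)
    rw [hb, hs'] at r4
    refine ⟨_, Runs.mono (by rwa [← Mem.ofList_pad _ 8]) le_rfl, ?_⟩
    rw [pr_map]
    have hK' : (0 : ℝ) < K := by exact_mod_cast hK1
    have ht : (1 / (16 * K) : ℝ) ≤ 2 := by
      rw [div_le_iff₀ (by positivity)]
      have : (1 : ℝ) ≤ K := by exact_mod_cast hK1
      linarith
    have hη : (2 : ℝ) ^ (3 * n + 6) / 2 ^ m ≤ 1 / (32 * K) := hm ▸ two_pow_div_le hK1
    have e1 := abs_ev_coeffEst_sub_le hL hTr hx (m := m) (by omega)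
    have p1 := pr_sumDist_le (t := 1 / (16 * K)) (abs_le_one_of_mem_sampleDist (abs_reEst_le m))
      (by positivity) ht (e1.1.trans hη) N
    have p2 := pr_sumDist_le (t := 1 / (16 * K)) (abs_le_one_of_mem_sampleDist (abs_imEst_le m))
      (by positivity) ht (e1.2.trans hη) N
    have hfail := two_mul_exp_le (K := K) (l := l + 2) hK1
    rw [← hN] at hfail
    refine le_trans (pr_mono (F := fun u => (¬ |reEst m u - N * (B.part φ n x 0).re| ≤
      N * (1 / (32 * K) + 1 / (16 * K))) ∨ ¬ |imEst m u - N * (B.part φ n x 0).im| ≤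
      N * (1 / (32 * K) + 1 / (16 * K))) fun u _ hu => ?_) ((pr_or _ _ _).trans
      ((add_le_add (p1.trans hfail) (p2.trans hfail)).trans ?_))
    · by_contra hcon
      rw [not_or, not_not, not_not] at hcon
      refine hu ?_
      have k1 := abs_round_sub_le (s := u.2.1) hN1 hK1 (by omega) hcon.1
      have k2 := abs_round_sub_le (s := u.2.2) hN1 hK1 (by omega) hcon.2
      refine (Complex.norm_le_abs_re_add_abs_im _).trans ?_
      rw [Complex.sub_re, Complex.sub_im, dyadic_re, dyadic_im]
      have hm2 : (Mem.ofList [u.2.1 / (N : ℤ), u.2.2 / (N : ℤ), (m : ℤ) + 1, (K : ℤ),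
        (l : ℤ), (m : ℤ), (N : ℤ), u.1, u.2.1, u.2.2] 2).toNat = m + 1 := by
        change ((m : ℤ) + 1).toNat = m + 1
        omega
      rw [hm2]
      refine (add_le_add k1 k2).trans ?_
      have h3 : 1 / (K : ℝ) ≤ ε := (div_le_comm₀ hK' hε).2 hK
      have h4 : 1 / (32 * K) + 1 / (16 * K) + 1 / (32 * K) + (1 / (32 * K) + 1 / (16 * K) +
          1 / (32 * K)) = 1 / (K : ℝ) / 4 := by
        field_simp
        norm_num
      rw [h4]
      exact (div_le_self (by positivity) (by norm_num)).trans h3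
    · rw [pow_add]
      have h1 : 1 / (2 : ℝ) ^ l ≤ δ := (div_le_comm₀ (by positivity) hδ).2 hl
      calc (2 / (2 ^ l * 2 ^ 2) + 2 / (2 ^ l * 2 ^ 2) : ℝ) = 1 / 2 ^ l := by field_simp; norm_num
        _ ≤ δ := h1
  · fun_prop

/-! ### Searching the tree for large weights -/

/-- Put `b` in front of the list `R` if the random test says `true` and `R` has fewer than `cap`
elements. -/
noncomputable def tryDist (test : PMF Bool) (cap b : ℕ) (R : List ℕ) : PMF (List ℕ) :=
  test.map fun t => if t = true ∧ R.length < cap then b :: R else R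

/-- Test the children `a` and `a + step`. -/
noncomputable def tryChildren (test : ℕ → PMF Bool) (cap step a : ℕ) (R : List ℕ) : PMF (List ℕ) :=
  (tryDist (test a) cap a R).bind (tryDist (test (a + step)) cap (a + step))

/-- Test all children of the nodes in `L`. -/
noncomputable def levelDist (test : ℕ → PMF Bool) (cap step : ℕ) (L : List ℕ) : PMF (List ℕ) :=
  chain (fun i => tryChildren test cap step (L.getD i 0)) [] L.length

/-- The nodes of level `n` which are found when the search descends only into nodes that pass
their test. -/
noncomputable def treeDist (test : ℕ → ℕ → PMF Bool) (cap : ℕ) (step : ℕ → ℕ) (n : ℕ) :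
    PMF (List ℕ) :=
  (tryDist (test 0 0) cap 0 []).bind fun L =>
    chain (fun k => levelDist (test (k + 1)) cap (step k)) L n

section Support

variable {P : ℕ → Prop} {cap b : ℕ} {R : List ℕ}

theorem of_mem_tryDist {test : PMF Bool} (hb : P b) (hR : R.length ≤ cap ∧ ∀ b ∈ R, P b) :
    ∀ R' ∈ (tryDist test cap b R).support, R'.length ≤ cap ∧ ∀ b ∈ R', P b := by
  intro R' h
  rw [tryDist, PMF.mem_support_map_iff] at h
  obtain ⟨t, -, rfl⟩ := h
  split_ifs with h
  · exact ⟨h.2, by simpa [hb] using hR.2⟩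
  · exact hR

theorem of_mem_tryChildren {test : ℕ → PMF Bool} {step a : ℕ} (ha : P a) (ha' : P (a + step))
    (hR : R.length ≤ cap ∧ ∀ b ∈ R, P b) :
    ∀ R' ∈ (tryChildren test cap step a R).support, R'.length ≤ cap ∧ ∀ b ∈ R', P b := by
  intro R' h
  rw [tryChildren, PMF.mem_support_bind_iff] at h
  obtain ⟨R₁, h1, h⟩ := h
  exact of_mem_tryDist ha' (of_mem_tryDist ha hR R₁ h1) R' h

theorem getD_mem {α : Type*} {L : List α} {i : ℕ} {d : α} (h : i < L.length) :
    L.getD i d ∈ L := by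
  rw [List.getD_eq_getElem _ _ h]; exact List.getElem_mem h

theorem of_mem_chain_tryChildren {test : ℕ → PMF Bool} {step : ℕ} {L : List ℕ}
    (hL : ∀ a ∈ L, P a ∧ P (a + step)) {i : ℕ} (hi : i ≤ L.length) :
    ∀ R' ∈ (chain (fun i => tryChildren test cap step (L.getD i 0)) [] i).support,
      R'.length ≤ cap ∧ ∀ b ∈ R', P b :=
  chain_support (I := fun _ (R : List ℕ) => R.length ≤ cap ∧ ∀ b ∈ R, P b) (by simp) fun j hj R hR =>
    have h := hL _ (getD_mem (d := 0) (hj.trans_le hi))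
    of_mem_tryChildren h.1 h.2 hR

end Support

namespace ProductBasis

variable {n : ℕ} {B : ProductBasis n} {φ : ℕ → ℂ} {θ q : ℝ} {cap : ℕ} {H : ℕ → Set ℕ}

theorem mem_chain_levelDist {test : ℕ → ℕ → PMF Bool} {L : List ℕ}
    (hL : L.length ≤ cap ∧ ∀ b ∈ L, B.node 0 b) {k : ℕ} (hk : k ≤ n) :
    ∀ R ∈ (chain (fun k => levelDist (test (k + 1)) cap (B.step k)) L k).support,
      R.length ≤ cap ∧ ∀ b ∈ R, B.node k b :=
  chain_support (I := fun k R => R.length ≤ cap ∧ ∀ b ∈ R, B.node k b) hL fun _ hj _ hR =>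
    of_mem_chain_tryChildren (fun a ha => ⟨B.node_left (hj.trans_le hk) (hR.2 a ha),
      B.node_right (hj.trans_le hk) (hR.2 a ha)⟩) le_rfl

theorem mem_treeDist {test : ℕ → ℕ → PMF Bool} :
    ∀ R ∈ (treeDist test cap B.step n).support, R.length ≤ cap ∧ ∀ b ∈ R, b < 2 ^ n := by
  intro R h
  rw [treeDist, PMF.mem_support_bind_iff] at h
  obtain ⟨L, hL, h⟩ := h
  have := mem_chain_levelDist (of_mem_tryDist B.node_zero (by simp) L hL) le_rfl R h
  exact ⟨this.1, fun b hb => B.node_lt le_rfl (this.2 b hb)⟩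

variable (B φ θ H) in
/-- The state of a correct search, on level `k`, with the candidates `C` still to be tested and
the nodes `R` already accepted: the accepted nodes have large weights, no weight is counted twice,
and each node in the set `H k`, which has to be found, is a candidate or accepted. -/
structure IsFrontier (k : ℕ) (C R : List ℕ) : Prop where
  node_of_mem : ∀ b ∈ R, B.node k b
  le_wt : ∀ b ∈ R, 5 / 8 * θ ≤ B.wt φ k b
  sum_le : (C.map (B.wt φ k)).sum + (R.map (B.wt φ k)).sum ≤ 1
  mem_or_mem : ∀ b ∈ H k, b ∈ C ∨ b ∈ R

theorem IsFrontier.length_le {k : ℕ} {C R : List ℕ} (h : B.IsFrontier φ θ H k C R) :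
    (C.map (B.wt φ k)).sum + 5 / 8 * θ * R.length ≤ 1 := by
  have := List.card_nsmul_le_sum (R.map (B.wt φ k)) (5 / 8 * θ) (by simpa using h.le_wt)
  rw [nsmul_eq_mul, List.length_map] at this
  linarith [h.sum_le]

/-- A test that is correct for the node `b` preserves the correctness of the search. The hypothesis
on `cap` says that the list is never full when a node of weight `θ` is accepted. -/
theorem pr_tryDist_le {k b : ℕ} {C R : List ℕ} {test : PMF Bool} (hb : B.node k b)
    (hH : ∀ b ∈ H k, θ ≤ B.wt φ k b)
    (hcap : ∀ l : ℕ, θ + 5 / 8 * θ * l ≤ 1 → l < cap)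
    (htest : B.wt φ k b ≤ 1 → pr test (fun t => ¬ ((t = true → 0 < cap → 5 / 8 * θ ≤ B.wt φ k b) ∧
      (θ ≤ B.wt φ k b → t = true))) ≤ q)
    (h : B.IsFrontier φ θ H k (b :: C) R) :
    pr (tryDist test cap b R) (fun R' => ¬ B.IsFrontier φ θ H k C R') ≤ q := by
  have h4 := h.sum_le
  rw [List.map_cons, List.sum_cons] at h4
  have h0 := B.wt_nonneg φ k b
  have hnn : ∀ C : List ℕ, 0 ≤ (C.map (B.wt φ k)).sum := fun C =>
    List.sum_nonneg (by simpa using fun a _ => B.wt_nonneg φ k a)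
  rw [tryDist, pr_map]
  refine (pr_mono fun t _ ht => ?_).trans (htest (by linarith [hnn C, hnn R]))
  contrapose! ht
  split_ifs with hif
  · refine ⟨?_, ?_, ?_, fun x hx => ?_⟩
    · simpa [hb] using h.node_of_mem
    · simpa [ht.1 hif.1 (by omega)] using h.le_wt
    · rw [List.map_cons, List.sum_cons]; linarith
    · have := h.mem_or_mem x hx
      simp only [List.mem_cons] at this ⊢
      tauto
  · refine ⟨h.node_of_mem, h.le_wt, by linarith, fun x hx => ?_⟩
    rcases h.mem_or_mem x hx with h1 | h1
    · rcases List.mem_cons.1 h1 with rfl | h1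
      · have h5 := h.length_le
        rw [List.map_cons, List.sum_cons] at h5
        have h6 := hH x hx
        exact absurd ⟨ht.2 h6, hcap R.length (by linarith [hnn C])⟩ hif
      · exact Or.inl h1
    · exact Or.inr h1

theorem pr_levelDist_le {k : ℕ} {L : List ℕ} {test : ℕ → PMF Bool} (hk : k < n) (hq : 0 ≤ q)
    (hH : ∀ b ∈ H (k + 1), θ ≤ B.wt φ (k + 1) b)
    (hH' : ∀ b ∈ H (k + 1), ∃ a ∈ H k, b = a ∨ b = a + B.step k)
    (hcap : ∀ l : ℕ, θ + 5 / 8 * θ * l ≤ 1 → l < cap)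
    (htest : ∀ b, B.node (k + 1) b → B.wt φ (k + 1) b ≤ 1 →
      pr (test b) (fun t => ¬ ((t = true → 0 < cap →
      5 / 8 * θ ≤ B.wt φ (k + 1) b) ∧ (θ ≤ B.wt φ (k + 1) b → t = true))) ≤ q)
    (hL : L.length ≤ cap) (h : B.IsFrontier φ θ H k [] L) :
    pr (levelDist test cap (B.step k) L) (fun R => ¬ B.IsFrontier φ θ H (k + 1) [] R) ≤
      cap * (q + q) := by
  set ch : List ℕ → List ℕ := fun L => L.flatMap fun a => [a, a + B.step k] with hch
  have h1 := chain_pr_le (K := fun i => tryChildren test cap (B.step k) (L.getD i 0)) (s := [])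
    (I := fun i R => B.IsFrontier φ θ H (k + 1) (ch (L.drop i)) R) (k := L.length)
    (add_nonneg hq hq) ?_ ?_
  · simp only [List.drop_length, hch, List.flatMap_nil] at h1
    refine h1.trans ?_
    gcongr
  · refine ⟨by simp, by simp, ?_, fun b hb => ?_⟩
    · have h2 : ∀ L : List ℕ, (∀ a ∈ L, B.node k a) →
          ((ch L).map (B.wt φ (k + 1))).sum = (L.map (B.wt φ k)).sum := by
        intro L hL
        induction L with
        | nil => rfl
        | cons a L ih =>
          simp only [hch, List.flatMap_cons, List.map_append, List.sum_append] at ih ⊢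
          rw [ih fun x hx => hL x (by simp [hx])]
          simp only [List.map_cons, List.map_nil, List.sum_cons, List.sum_nil, add_zero]
          rw [B.wt_children φ hk (hL a (by simp))]
      have := h.sum_le
      rw [List.drop_zero, h2 L h.node_of_mem]
      simpa using this
    · obtain ⟨a, ha, hab⟩ := hH' b hb
      have haL : a ∈ L := by simpa using h.mem_or_mem a ha
      left
      simp only [hch, List.drop_zero, List.mem_flatMap, List.mem_cons, List.not_mem_nil, or_false]
      exact ⟨a, haL, hab⟩
  · intro i hi R _ hR
    have ha := h.node_of_mem _ (getD_mem (d := 0) hi)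
    have hd : L.drop i = L.getD i 0 :: L.drop (i + 1) := by
      rw [List.getD_eq_getElem _ _ hi]; exact List.drop_eq_getElem_cons hi
    rw [hd] at hR
    set a := L.getD i 0
    have hl := B.node_left hk ha
    have hr := B.node_right hk ha
    exact pr_bind_le (pr_tryDist_le hl hH hcap (htest _ hl) hR) hq fun R' _ hR' =>
      pr_tryDist_le hr hH hcap (htest _ hr) hR'

theorem wt_le_of_node {k a b : ℕ} (hk : k < n) (ha : B.node k a) (hb : b = a ∨ b = a + B.step k) :
    B.wt φ (k + 1) b ≤ B.wt φ k a := by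
  rw [← B.wt_children φ hk ha]
  rcases hb with rfl | rfl
  · linarith [B.wt_nonneg φ (k + 1) (b + B.step k)]
  · linarith [B.wt_nonneg φ (k + 1) a]

/-- If each test is correct with probability at least `1 - q`, then, but for a probability of
`(1 + 2 * n * cap) * q`, the search returns a list of labels with weight at least `5 / 8 * θ`
which contains all labels with weight at least `θ`. -/
theorem pr_treeDist_le {test : ℕ → ℕ → PMF Bool} (hq : 0 ≤ q)
    (hφ : ∑ y ∈ range (2 ^ n), ‖φ y‖ ^ 2 = 1)
    (hcap : ∀ l : ℕ, θ + 5 / 8 * θ * l ≤ 1 → l < cap)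
    (htest : ∀ k ≤ n, ∀ b, B.node k b → B.wt φ k b ≤ 1 →
      pr (test k b) (fun t => ¬ ((t = true → 0 < cap →
      5 / 8 * θ ≤ B.wt φ k b) ∧ (θ ≤ B.wt φ k b → t = true))) ≤ q) :
    pr (treeDist test cap B.step n) (fun R => ¬ ((∀ b ∈ R, 5 / 8 * θ ≤ B.wt φ n b) ∧
      ∀ b < 2 ^ n, θ ≤ B.wt φ n b → b ∈ R)) ≤ q + n * (cap * (q + q)) := by
  have hpath : ∀ x : ℕ, ∃ p : ℕ → ℕ, x < 2 ^ n → p 0 = 0 ∧ p n = x ∧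
      ∀ k < n, p (k + 1) = p k ∨ p (k + 1) = p k + B.step k := fun x => by
    by_cases hx : x < 2 ^ n
    · obtain ⟨p, hp⟩ := B.exists_path hx
      exact ⟨p, fun _ => hp⟩
    · exact ⟨fun _ => 0, fun h => absurd h hx⟩
  choose p hp using hpath
  -- The nodes that have to be found are those on the paths to the labels with large weight.
  set H : ℕ → Set ℕ := fun k => {b | ∃ x < 2 ^ n, θ ≤ B.wt φ n x ∧ p x k = b} with hHdef
  have hnode : ∀ x < 2 ^ n, ∀ k ≤ n, B.node k (p x k) := by
    intro x hx k
    induction k with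
    | zero => intro _; rw [(hp x hx).1]; exact B.node_zero
    | succ k ih =>
      intro hk
      rcases (hp x hx).2.2 k hk with h | h <;> rw [h]
      · exact B.node_left hk (ih (by omega))
      · exact B.node_right hk (ih (by omega))
  have hmono : ∀ x < 2 ^ n, ∀ j k, k + j = n → B.wt φ n x ≤ B.wt φ k (p x k) := by
    intro x hx j
    induction j with
    | zero =>
      intro k hk
      rw [add_zero] at hk
      rw [hk, (hp x hx).2.1]
    | succ j ih =>
      intro k hk
      exact (ih (k + 1) (by omega)).trans (wt_le_of_node (by omega) (hnode x hx k (by omega))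
        ((hp x hx).2.2 k (by omega)))
  have hH : ∀ k ≤ n, ∀ b ∈ H k, θ ≤ B.wt φ k b := by
    rintro k hk b ⟨x, hx, hxθ, rfl⟩
    exact hxθ.trans (hmono x hx (n - k) k (by omega))
  have hH' : ∀ k < n, ∀ b ∈ H (k + 1), ∃ a ∈ H k, b = a ∨ b = a + B.step k := by
    rintro k hk b ⟨x, hx, hxθ, rfl⟩
    exact ⟨p x k, ⟨x, hx, hxθ, rfl⟩, (hp x hx).2.2 k hk⟩
  have h0 : B.IsFrontier φ θ H 0 [0] [] := by
    refine ⟨by simp, by simp, ?_, ?_⟩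
    · simp [B.wt_zero φ, hφ]
    · rintro b ⟨x, hx, -, rfl⟩
      simp [(hp x hx).1]
  have h1 := pr_tryDist_le B.node_zero (hH 0 (Nat.zero_le _)) hcap
    (htest 0 (Nat.zero_le _) 0 B.node_zero) h0
  have h2 : pr (treeDist test cap B.step n) (fun R => ¬ B.IsFrontier φ θ H n [] R) ≤
      q + n * (cap * (q + q)) := by
    refine pr_bind_le h1 (by positivity) fun L hL hLf => ?_
    have hL' := of_mem_tryDist B.node_zero (by simp) L hL
    refine chain_pr_le (I := fun k R => B.IsFrontier φ θ H k [] R) (by positivity) hLf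
      fun k hk R hR hRf => ?_
    exact pr_levelDist_le hk hq (hH (k + 1) hk) (hH' k hk) hcap (htest (k + 1) hk)
      (mem_chain_levelDist hL' hk.le R hR).1 hRf
  refine (pr_mono fun R _ hR => ?_).trans h2
  contrapose! hR
  refine ⟨hR.le_wt, fun b hb hbθ => ?_⟩
  have := hR.mem_or_mem b ⟨b, hb, hbθ, (hp b hb).2.1⟩
  simpa using this

end ProductBasis

/-! ### Testing the weight of a node -/

/-- The test for a large weight compares `a / 64` times the estimated weight with `48 / 64`, where
`a / 64` is an approximation of `1 / θ`, and the estimate is the mean of `N` samples. -/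
noncomputable def weightTest (sd : ℕ → PMF ℕ) (qd : ℕ → ℕ → PMF (ℤ × ℤ))
    (loc : ℕ → ℕ → Bool → ℕ → ℤ × ℤ) (n m N : ℕ) (a : ℤ) (k b : ℕ) : PMF Bool :=
  (sumDist (sampleDist sd qd loc n k b m) N).map fun t => decide (48 * N * 2 ^ m ≤ t.1 * a)

section Correctness

variable {L S Q : Prog} {T TS : ℕ → ℕ} {n m N K cap : ℕ} {O : Oracle} {B : ProductBasis n}
  {loc : ℕ → ℕ → Bool → ℕ → ℤ × ℤ} {φ : ℕ → ℂ} {sd : ℕ → PMF ℕ} {qd : ℕ → ℕ → PMF (ℤ × ℤ)}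
  {a : ℤ} {θ : ℝ}

/-- The bound `cap` for the number of nodes on a level leaves room for a node of weight at least
`θ`, next to `l` nodes of weight at least `5 / 8 * θ`. -/
theorem lt_cap (hθ : 0 < θ) (ha : |(a : ℝ) - 64 * (1 / θ)| ≤ 1)
    (hcap : (cap : ℤ) = max ((a - 1) / 32) 0) {l : ℕ} (hl : θ + 5 / 8 * θ * l ≤ 1) : l < cap := by
  have h1 : (1 : ℝ) + 5 / 8 * l ≤ 1 / θ := by
    rw [le_div_iff₀ hθ]; linarith
  generalize 1 / θ = u at *
  rw [abs_le] at ha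
  have h2 : a - 1 ≤ 32 * cap + 31 := by omega
  have h3 : (a : ℝ) - 1 ≤ 32 * cap + 31 := by exact_mod_cast h2
  have h4 : (l : ℝ) < cap := by
    have : (0 : ℝ) ≤ l := Nat.cast_nonneg l
    linarith
  exact_mod_cast h4

theorem cap_le (hθ : 0 < θ) (ha : |(a : ℝ) - 64 * (1 / θ)| ≤ 1)
    (hcap : (cap : ℤ) = max ((a - 1) / 32) 0) : (cap : ℝ) ≤ 2 / θ := by
  have h0 : (0 : ℝ) < 1 / θ := by positivity
  rw [show 2 / θ = 2 * (1 / θ) by ring]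
  generalize 1 / θ = u at *
  rw [abs_le] at ha
  rcases le_total ((a - 1) / 32) 0 with h | h
  · rw [max_eq_right h] at hcap
    have : cap = 0 := by omega
    rw [this]; push_cast; linarith
  · rw [max_eq_left h] at hcap
    have h2 : 32 * (cap : ℤ) ≤ a - 1 := by omega
    have h3 : 32 * (cap : ℝ) ≤ a - 1 := by exact_mod_cast h2
    linarith

/-- Exact arithmetic behind the test: an estimate `v` of the weight `w ≤ 1` with an error of at most
`3 / 32 * θ` decides correctly. -/
theorem weightTest_correct {v w : ℝ} (hθ : 0 < θ) (ha : |(a : ℝ) - 64 * (1 / θ)| ≤ 1)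
    (hv : |v - w| ≤ 3 / 32 * θ) (hw : w ≤ 1) :
    (48 ≤ v * a → 33 ≤ a → 5 / 8 * θ ≤ w) ∧ (θ ≤ w → 48 ≤ v * a) := by
  obtain ⟨u, hu⟩ : ∃ u, u = 1 / θ := ⟨_, rfl⟩
  have hθu : θ * u = 1 := by rw [hu]; field_simp
  rw [← hu] at ha
  rw [abs_le] at ha hv
  have hu0 : 0 < u := by rw [hu]; positivity
  constructor
  · intro h1 h2
    have h3 : (33 : ℝ) ≤ a := by exact_mod_cast h2
    have h4 : 0 < v := by
      by_contra h; push Not at h; nlinarith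
    have h5 : (a : ℝ) ≤ 66 * u := by linarith
    have h6 : 48 * θ ≤ 66 * v := by
      have : 48 ≤ v * (66 * u) := h1.trans (by gcongr)
      calc 48 * θ ≤ v * (66 * u) * θ := by gcongr
        _ = 66 * v * (θ * u) := by ring
        _ = 66 * v := by rw [hθu, mul_one]
    linarith
  · intro h1
    have h2 : 1 ≤ u := by rw [hu, le_div_iff₀ hθ]; linarith
    have h3 : 63 * u ≤ a := by linarith
    have h4 : 29 / 32 * θ ≤ v := by linarith
    have h5 : 0 ≤ v := by linarith
    calc (48 : ℝ) ≤ 29 / 32 * 63 * (θ * u) := by rw [hθu]; norm_num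
      _ = 29 / 32 * θ * (63 * u) := by ring
      _ ≤ v * a := by gcongr

/-- A test with `1024 * K ^ 2 * l` samples decides correctly with probability at least
`1 - 2 / 2 ^ l`. -/
theorem pr_weightTest_le (hL : LocalBy L T O B loc) (hTr : TractableBy S Q TS n φ sd qd)
    (hθ : 0 < θ) (ha : |(a : ℝ) - 64 * (1 / θ)| ≤ 1) (hK : 1 / θ ≤ K) (hK1 : 1 ≤ K)
    (hcap : (cap : ℤ) = max ((a - 1) / 32) 0) {l : ℕ} (hl : 1 ≤ l) (hm : m = 3 * n + 11 + K)
    (hN : N = 1024 * K * K * l) {k b : ℕ} (hk : k ≤ n) (hb : B.node k b) (hw : B.wt φ k b ≤ 1) :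
    pr (weightTest sd qd loc n m N a k b) (fun t => ¬ ((t = true → 0 < cap →
      5 / 8 * θ ≤ B.wt φ k b) ∧ (θ ≤ B.wt φ k b → t = true))) ≤ 2 / 2 ^ l := by
  have hK' : (0 : ℝ) < K := by exact_mod_cast hK1
  have hN1 : 1 ≤ N := by
    rw [hN]; exact Nat.one_le_iff_ne_zero.2 (by positivity)
  have hN' : (0 : ℝ) < N := by exact_mod_cast hN1
  have ht : (1 / (16 * K) : ℝ) ≤ 2 := by
    rw [div_le_iff₀ (by positivity)]
    have : (1 : ℝ) ≤ K := by exact_mod_cast hK1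
    linarith
  have hη : (2 : ℝ) ^ (3 * n + 6) / 2 ^ m ≤ 1 / (32 * K) := hm ▸ two_pow_div_le hK1
  have p1 := pr_sumDist_le (t := 1 / (16 * K)) (abs_le_one_of_mem_sampleDist (abs_weightEst_le m))
    (by positivity) ht ((abs_ev_weightEst_sub_le hL hTr hk (B.node_lt hk hb) (m := m)
      (by omega)).trans hη) N
  have hfail := two_mul_exp_le (K := K) (l := l) hK1
  rw [← hN] at hfail
  rw [weightTest, pr_map]
  refine (pr_mono fun t _ ht => ?_).trans (p1.trans hfail)
  contrapose! ht
  have h1 : |(t.1 : ℝ) / 2 ^ m / N - B.wt φ k b| ≤ 3 / 32 * θ := by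
    have h2 : (t.1 : ℝ) / 2 ^ m / N - B.wt φ k b = (weightEst m t - N * B.wt φ k b) / N := by
      rw [show weightEst m t = (t.1 : ℝ) / 2 ^ m from rfl]
      field_simp
    rw [h2, abs_div, abs_of_pos hN', div_le_iff₀ hN', mul_comm _ (N : ℝ)]
    refine ht.trans (mul_le_mul_of_nonneg_left ?_ hN'.le)
    have h3 : 1 / (K : ℝ) ≤ θ := (div_le_comm₀ hK' hθ).2 hK
    calc (1 / (32 * K) + 1 / (16 * K) : ℝ) = 3 / 32 * (1 / K) := by field_simp; norm_num
      _ ≤ _ := by gcongr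
  obtain ⟨g1, g2⟩ := weightTest_correct hθ ha h1 hw
  have h3 : (48 * N * 2 ^ m ≤ t.1 * a) ↔ (48 : ℝ) ≤ (t.1 : ℝ) / 2 ^ m / N * a := by
    rw [div_div, div_mul_eq_mul_div, le_div_iff₀ (by positivity), ← Int.cast_le (R := ℝ)]
    push_cast
    rw [show (48 : ℝ) * (2 ^ m * N) = 48 * N * 2 ^ m by ring]
  rw [decide_eq_true_eq, h3]
  refine ⟨fun h4 h5 => g1 h4 ?_, g2⟩
  rcases le_total ((a - 1) / 32) 0 with h | h
  · rw [max_eq_right h] at hcap; omega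
  · rw [max_eq_left h] at hcap; omega

end Correctness

/-! ### The search program -/

/-- A list of numbers below `D`, encoded as one number. -/
def listCode (D : ℕ) : List ℕ → ℕ
  | [] => 0
  | a :: L => a + D * listCode D L

theorem listCode_lt {D : ℕ} : ∀ {L : List ℕ}, (∀ a ∈ L, a < D) → listCode D L < D ^ L.length
  | [], _ => by simp [listCode]
  | a :: L, h => by
    have h1 := h a (by simp)
    have h2 := listCode_lt (L := L) fun x hx => h x (by simp [hx])
    calc listCode D (a :: L) < D * (listCode D L + 1) := by rw [listCode]; linarith
      _ ≤ D * D ^ L.length := Nat.mul_le_mul_left _ h2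
      _ = _ := by rw [List.length_cons, pow_succ']

theorem listCode_cons_mod {D a : ℕ} (L : List ℕ) (h : a < D) : listCode D (a :: L) % D = a := by
  rw [listCode, Nat.add_mul_mod_self_left, Nat.mod_eq_of_lt h]

theorem listCode_cons_div {D a : ℕ} (L : List ℕ) (h : a < D) :
    listCode D (a :: L) / D = listCode D L := by
  rw [listCode, Nat.add_mul_div_left _ _ (by omega), Nat.div_eq_of_lt h, zero_add]

theorem bitLen_listCode {n s cap : ℕ} (hn : n ≤ s) (hcap : cap ≤ s) {L : List ℕ}
    (h : L.length ≤ cap ∧ ∀ a ∈ L, a < 2 ^ n) : bitLen (listCode (2 ^ n) L : ℤ) ≤ s * s := by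
  refine bitLen_natCast_le_of_lt ((listCode_lt h.2).trans_le ?_)
  rw [← pow_mul]
  exact Nat.pow_le_pow_right (by norm_num) (Nat.mul_le_mul hn (h.1.trans hcap))

open Ex in
/-- The assignments that put the number in register 2 in front of a list, if it passes its test. -/
def tryBlk : List (ℕ × Ex) :=
  [(14, ite (var 11 * var 5 - var 7 + 1) (ite (var 6 - var 9) 1 0) 0), (0, var 9 + var 14),
    (1, ite (var 14) (var 2 + var 8 * var 10) (var 10))]

theorem listBlk_tryBlk (n k m N a W t u v : ℤ) (b cap D : ℕ) (R : List ℕ) :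
    listBlk [n, k, (b : ℤ), m, N, a, (cap : ℤ), W, (D : ℤ), (R.length : ℤ), (listCode D R : ℤ), t,
      u, v, 0] tryBlk = (fun R' : List ℕ => [(R'.length : ℤ), (listCode D R' : ℤ), (b : ℤ), m, N, a,
        (cap : ℤ), W, (D : ℤ), (R.length : ℤ), (listCode D R : ℤ), t, u, v,
        if W ≤ t * a ∧ R.length < cap then 1 else 0])
      (if decide (W ≤ t * a) = true ∧ R.length < cap then b :: R else R) := by
  have hf : (if 0 < t * a - W + 1 then if 0 < (cap : ℤ) - R.length then (1 : ℤ) else 0 else 0) =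
      if W ≤ t * a ∧ R.length < cap then 1 else 0 := by
    by_cases h1 : W ≤ t * a
    · rw [if_pos (by omega)]
      by_cases h2 : R.length < cap
      · rw [if_pos (by omega), if_pos ⟨h1, h2⟩]
      · rw [if_neg (by omega), if_neg fun h => h2 h.2]
    · rw [if_neg (by omega), if_neg fun h => h1 h.1]
  have h1 : listBlk [n, k, (b : ℤ), m, N, a, (cap : ℤ), W, (D : ℤ), (R.length : ℤ),
      (listCode D R : ℤ), t, u, v, 0] tryBlk = (fun f : ℤ => [(R.length : ℤ) + f,
        if 0 < f then (b : ℤ) + D * listCode D R else listCode D R, (b : ℤ), m, N, a,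
        (cap : ℤ), W, (D : ℤ), (R.length : ℤ), (listCode D R : ℤ), t, u, v, f])
      (if 0 < t * a - W + 1 then if 0 < (cap : ℤ) - R.length then (1 : ℤ) else 0 else 0) := rfl
  rw [h1, hf]
  by_cases h : W ≤ t * a ∧ R.length < cap
  · simp [h, listCode]
  · simp [h]

open Ex Prog in
/-- Testing one node. The procedures of the search have the same arguments: the number `n` of
qubits, the level `k`, a node (or the difference of children), the accuracy `m`, the number `N` of
samples, the approximation `a / 64` of `1 / θ`, the bound `cap`, the threshold of the test, the base
`2 ^ n` of the encoding of lists, and a list, as its length and its encoding. -/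
theorem exists_tryDist (L S Q : Prog) {T TS : ℕ → ℕ} (hT : PolyB T) (hTS : PolyB TS) :
    ∃ (A : Prog) (T' : ℕ → ℕ), PolyB T' ∧ ∀ (n : ℕ) (O : Oracle) (B : ProductBasis n)
      (loc : ℕ → ℕ → Bool → ℕ → ℤ × ℤ) (φ : ℕ → ℂ) (sd : ℕ → PMF ℕ) (qd : ℕ → ℕ → PMF (ℤ × ℤ)),
      LocalBy L T O B loc → TractableBy S Q TS n φ sd qd →
      ∀ (s k b m N cap : ℕ) (a : ℤ) (R : List ℕ), n ≤ s → m ≤ s → N ≤ s → cap ≤ s → bitLen a ≤ s →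
      k ≤ n → b < 2 ^ n → (R.length ≤ cap ∧ ∀ b ∈ R, b < 2 ^ n) →
      Computes O A [(n : ℤ), (k : ℤ), (b : ℤ), (m : ℤ), (N : ℤ), a, (cap : ℤ), 48 * N * 2 ^ m,
          ((2 ^ n : ℕ) : ℤ), (R.length : ℤ), (listCode (2 ^ n) R : ℤ)] 2
        ((tryDist (weightTest sd qd loc n m N a k b) cap b R).map fun R' =>
          [(R'.length : ℤ), (listCode (2 ^ n) R' : ℤ)]) (T' s) := by
  obtain ⟨E, TE, hTE, hE⟩ := exists_sumDist L S Q hT hTS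
  refine ⟨.seq (.call E [0, 1, 2, 3, 4] [11, 12, 13]) (blk tryBlk), ?_⟩
  constructor
  refine ⟨?_, fun n O B loc φ sd qd hL hTr s k b m N cap a R hn hm hN hcap ha hk hb hR => ?_⟩
  rotate_left
  · obtain ⟨c, hc⟩ : ∃ c, c = s * s + 2 * s + 8 := ⟨_, rfl⟩
    have hns : 2 ^ n ≤ 2 ^ s := Nat.pow_le_pow_right (by norm_num) hn
    have c1 := bitLen_natCast_le_of_le hn
    have c2 := bitLen_natCast_le_of_le (hk.trans hn)
    have c3 := bitLen_natCast_le_of_lt (hb.trans_le hns)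
    have c4 := bitLen_natCast_le_of_le hm
    have c5 := bitLen_natCast_le_of_le hN
    have c6 := bitLen_natCast_le_of_le hcap
    have c7 : bitLen (48 * N * 2 ^ m : ℤ) ≤ 2 * s + 7 := by
      have h1 := bitLen_mul (48 * N) (2 ^ m)
      have h2 := bitLen_mul 48 N
      have h3 := bitLen_two_pow m
      have h4 : bitLen 48 ≤ 6 := by decide
      omega
    have c8 : bitLen ((2 ^ n : ℕ) : ℤ) ≤ s + 1 := by
      push_cast; exact (bitLen_two_pow n).trans (by omega)
    have c9 := bitLen_natCast_le_of_le (hR.1.trans hcap)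
    have c10 := bitLen_listCode hn hcap hR
    have state : ∀ t : ℤ × ℤ × ℤ, bitLen t.1 ≤ 2 * s + 1 → bitLen t.2.1 ≤ 2 * s + 1 →
        bitLen t.2.2 ≤ 2 * s + 1 → (Mem.ofList [(n : ℤ), (k : ℤ), (b : ℤ), (m : ℤ), (N : ℤ), a,
          (cap : ℤ), 48 * N * 2 ^ m, ((2 ^ n : ℕ) : ℤ), (R.length : ℤ), (listCode (2 ^ n) R : ℤ),
          t.1, t.2.1, t.2.2, 0]).BitsLE c := by
      intro t h1 h2 h3
      simp only [bitsLE_cons, bitsLE_nil, bitLen_zero, and_true]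
      omega
    have r1 := (hE n O B loc φ sd qd hL hTr s k b m N hn hm hN hk hb).listCallMap
      (args := [0, 1, 2, 3, 4]) (rets := [11, 12, 13]) (state 0 (by simp) (by simp) (by simp)) rfl
      (l' := fun t => [(n : ℤ), (k : ℤ), (b : ℤ), (m : ℤ), (N : ℤ), a,
          (cap : ℤ), 48 * N * 2 ^ m, ((2 ^ n : ℕ) : ℤ), (R.length : ℤ), (listCode (2 ^ n) R : ℤ),
          t.1, t.2.1, t.2.2, 0]) (by simp [Mem.write])
    have r2 := r1.seq_map_pure (c' := blk tryBlk) fun t ht => by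
      have h := abs_le_of_mem_sumDist t ht
      exact Runs.listBlk (state t (bitLen_le_of_abs_le h.1 hN hm) (bitLen_le_of_abs_le h.2.1 hN hm)
        (bitLen_le_of_abs_le h.2.2 hN hm)) (by simp [tryBlk])
        (listBlk_tryBlk n k m N a (48 * N * 2 ^ m) t.1 t.2.1 t.2.2 b cap (2 ^ n) R)
    rw [hc] at r2
    have r3 := (r2.computes (k := 2) (ins := [(n : ℤ), (k : ℤ), (b : ℤ), (m : ℤ), (N : ℤ), a,
      (cap : ℤ), 48 * N * 2 ^ m, ((2 ^ n : ℕ) : ℤ), (R.length : ℤ), (listCode (2 ^ n) R : ℤ)]) rfl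
      (v := fun t => (fun R' : List ℕ => [(R'.length : ℤ), (listCode (2 ^ n) R' : ℤ)])
        (if decide (48 * N * 2 ^ m ≤ t.1 * a) = true ∧ R.length < cap then b :: R else R))
      fun t => rfl).mono le_rfl
    rw [tryDist, weightTest, PMF.map_comp, PMF.map_comp]
    exact r3
  · fun_prop

open Ex Prog in
/-- Testing all children of a list of nodes. -/
theorem exists_levelDist (L S Q : Prog) {T TS : ℕ → ℕ} (hT : PolyB T) (hTS : PolyB TS) :
    ∃ (A : Prog) (T' : ℕ → ℕ), PolyB T' ∧ ∀ (n : ℕ) (O : Oracle) (B : ProductBasis n)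
      (loc : ℕ → ℕ → Bool → ℕ → ℤ × ℤ) (φ : ℕ → ℂ) (sd : ℕ → PMF ℕ) (qd : ℕ → ℕ → PMF (ℤ × ℤ)),
      LocalBy L T O B loc → TractableBy S Q TS n φ sd qd →
      ∀ (s k step m N cap : ℕ) (a : ℤ) (R : List ℕ), n ≤ s → m ≤ s → N ≤ s → cap ≤ s →
      bitLen a ≤ s → k ≤ n → step < 2 ^ n → R.length ≤ cap →
      (∀ b ∈ R, b < 2 ^ n ∧ b + step < 2 ^ n) →
      Computes O A [(n : ℤ), (k : ℤ), (step : ℤ), (m : ℤ), (N : ℤ), a, (cap : ℤ), 48 * N * 2 ^ m,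
          ((2 ^ n : ℕ) : ℤ), (R.length : ℤ), (listCode (2 ^ n) R : ℤ)] 2
        ((levelDist (weightTest sd qd loc n m N a k) cap step R).map fun R' =>
          [(R'.length : ℤ), (listCode (2 ^ n) R' : ℤ)]) (T' s) := by
  obtain ⟨E, TE, hTE, hE⟩ := exists_tryDist L S Q hT hTS
  -- Registers: 9, 10 the list of nodes whose children are still to be tested; 11, 12 the list of
  -- accepted children; 13 the current child.
  refine ⟨.seq (.loop 9 (.seq (blk [(13, var 10 - var 10 / var 8 * var 8)])
    (.seq (.call E [0, 1, 13, 3, 4, 5, 6, 7, 8, 11, 12] [11, 12]) (.seq (blk [(13, var 13 + var 2)])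
    (.seq (.call E [0, 1, 13, 3, 4, 5, 6, 7, 8, 11, 12] [11, 12])
    (blk [(10, var 10 / var 8), (9, var 9 - 1), (13, 0)]))))))
    (blk [(0, var 11), (1, var 12)]), ?_⟩
  constructor
  refine ⟨?_, fun n O B loc φ sd qd hL hTr s k step m N cap a R hn hm hN hcap ha hk hst hR1 hR2 => ?_⟩
  rotate_left
  · obtain ⟨c, hc⟩ : ∃ c, c = s * s + 2 * s + 8 := ⟨_, rfl⟩
    have hns : 2 ^ n ≤ 2 ^ s := Nat.pow_le_pow_right (by norm_num) hn
    have c1 := bitLen_natCast_le_of_le hn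
    have c2 := bitLen_natCast_le_of_le (hk.trans hn)
    have c3 := bitLen_natCast_le_of_lt (hst.trans_le hns)
    have c4 := bitLen_natCast_le_of_le hm
    have c5 := bitLen_natCast_le_of_le hN
    have c6 := bitLen_natCast_le_of_le hcap
    have c7 : bitLen (48 * N * 2 ^ m : ℤ) ≤ 2 * s + 7 := by
      have h1 := bitLen_mul (48 * N) (2 ^ m)
      have h2 := bitLen_mul 48 N
      have h3 := bitLen_two_pow m
      have h4 : bitLen 48 ≤ 6 := by decide
      omega
    have c8 : bitLen ((2 ^ n : ℕ) : ℤ) ≤ s + 1 := by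
      push_cast; exact (bitLen_two_pow n).trans (by omega)
    set V : List ℕ → Prop := fun X => X.length ≤ cap ∧ ∀ b ∈ X, b < 2 ^ n with hV
    set e : List ℕ → List ℕ → ℕ → List ℤ := fun X Y v => [(n : ℤ), (k : ℤ), (step : ℤ), (m : ℤ),
      (N : ℤ), a, (cap : ℤ), 48 * N * 2 ^ m, ((2 ^ n : ℕ) : ℤ), (X.length : ℤ),
      (listCode (2 ^ n) X : ℤ), (Y.length : ℤ), (listCode (2 ^ n) Y : ℤ), (v : ℤ)] with he
    have state : ∀ X Y v, V X → V Y → v < 2 ^ n → (Mem.ofList (e X Y v)).BitsLE c := by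
      intro X Y v hX hY hv
      have d1 := bitLen_natCast_le_of_le (hX.1.trans hcap)
      have d2 := bitLen_natCast_le_of_le (hY.1.trans hcap)
      have d3 := bitLen_listCode hn hcap hX
      have d4 := bitLen_listCode hn hcap hY
      have d5 := bitLen_natCast_le_of_lt (hv.trans_le hns)
      simp only [he, bitsLE_cons, bitsLE_nil, and_true]
      omega
    have hVR : ∀ i, V (R.drop i) := fun i =>
      ⟨(by rw [List.length_drop]; omega), fun b hb => (hR2 b (List.mem_of_mem_drop hb)).1⟩
    have hget : ∀ i < R.length, R.getD i 0 < 2 ^ n ∧ R.getD i 0 + step < 2 ^ n :=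
      fun i hi => hR2 _ (getD_mem hi)
    have h0 : 0 < 2 ^ n := by positivity
    set test := weightTest sd qd loc n m N a k with htest
    have call : ∀ X Y v, V X → V Y → v < 2 ^ n →
        Runs O (.call E [0, 1, 13, 3, 4, 5, 6, 7, 8, 11, 12] [11, 12]) (Mem.ofList (e X Y v))
          ((tryDist (test v) cap v Y).map fun Y' => Mem.ofList (e X Y' v))
          ((1 + 11 + 2) * (1 + c + TE s)) := fun X Y v hX hY hv =>
      (hE n O B loc φ sd qd hL hTr s k v m N cap a Y hn hm hN hcap ha hk hv hY).listCallMap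
        (args := [0, 1, 13, 3, 4, 5, 6, 7, 8, 11, 12]) (rets := [11, 12]) (state X Y v hX hY hv)
        rfl (fun Y' => by simp [he, Mem.write])
    have hstep : ∀ i < R.length, ∀ Y, V Y →
        ∀ Y' ∈ (tryChildren test cap step (R.getD i 0) Y).support, V Y' := fun i hi Y hY =>
      of_mem_tryChildren (P := fun b => b < 2 ^ n) (hget i hi).1 (hget i hi).2 hY
    have r1 := Runs.loop (σ := List ℕ) (O := O) (r := 9) (hR1.trans hcap)
      (fun i => tryChildren test cap step (R.getD i 0))
      (fun i Y => Mem.ofList (e (R.drop i) Y 0)) (fun _ Y => V Y) [] (by simp [hV])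
      (fun i hi Y _ => by
        change (0 : ℤ) < ((R.drop i).length : ℤ)
        rw [List.length_drop]; omega) (fun Y _ => by
        change ((R.drop R.length).length : ℤ) ≤ 0
        simp) (fun i hi Y hY => state _ Y 0 (hVR i) hY h0 9) hstep fun i hi Y hY => by
        have hd : R.drop i = R.getD i 0 :: R.drop (i + 1) := by
          rw [List.getD_eq_getElem _ _ hi]; exact List.drop_eq_getElem_cons hi
        obtain ⟨g1, g2⟩ := hget i hi
        have hX := hVR i
        rw [hd] at hX ⊢
        set v := R.getD i 0 with hv
        set X := R.drop (i + 1) with hX'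
        have q1 := Runs.listBlk (O := O) (bl := [(13, var 10 - var 10 / var 8 * var 8)])
          (state (v :: X) Y 0 hX hY h0) (by simp [he]) (l' := e (v :: X) Y v) (by
            have h1 : (listCode (2 ^ n) (v :: X) : ℤ) - listCode (2 ^ n) (v :: X) /
                ((2 ^ n : ℕ) : ℤ) * ((2 ^ n : ℕ) : ℤ) = v := by
              rw [← Int.natCast_div, ← Nat.cast_mul, ← Nat.cast_sub (Nat.div_mul_le_self _ _),
                ← Nat.mod_eq_sub_div_mul, listCode_cons_mod X g1]
            change [_, _, _, _, _, _, _, _, _, _, _, _, _, (listCode (2 ^ n) (v :: X) : ℤ) -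
              listCode (2 ^ n) (v :: X) / ((2 ^ n : ℕ) : ℤ) * ((2 ^ n : ℕ) : ℤ)] = _
            rw [h1])
        have q2 := q1.seq_pure ((call (v :: X) Y v hX hY g1).seq_map fun Y' hY' => by
          have hY'' := of_mem_tryDist (P := fun b => b < 2 ^ n) g1 hY Y' hY'
          have q3 := Runs.listBlk (O := O) (bl := [(13, var 13 + var 2)])
            (state (v :: X) Y' v hX hY'' g1) (by simp [he]) (l' := e (v :: X) Y' (v + step))
            (by simp only [he]; push_cast; rfl)
          exact q3.seq_pure ((call (v :: X) Y' (v + step) hX hY'' g2).seq_map_pure fun Z hZ =>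
            Runs.listBlk (bl := [(10, var 10 / var 8), (9, var 9 - 1), (13, 0)])
              (state (v :: X) Z (v + step) hX (of_mem_tryDist (P := fun b => b < 2 ^ n) g2 hY'' Z hZ)
                g2) (by simp [he]) (l' := e X Z 0) (by
              have h1 : ((listCode (2 ^ n) (v :: X) : ℤ)) / ((2 ^ n : ℕ) : ℤ) =
                  listCode (2 ^ n) X := by
                rw [← Int.natCast_div, listCode_cons_div X g1]
              have h2 : ((v :: X).length : ℤ) - 1 = X.length := by simp
              simp only [he]
              rw [← h1, ← h2]
              rfl)))
        rw [tryChildren, PMF.map_bind]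
        exact q2
    have r2 := r1.seq_map_pure (c' := blk [(0, var 11), (1, var 12)])
      fun Y hY => Runs.listBlk (state _ Y 0 (hVR R.length) (chain_support (I := fun _ Y => V Y)
        (by simp [hV]) hstep Y hY) h0) (by simp [he]) rfl
    rw [hc] at r2
    exact (r2.computes (k := 2) (ins := [(n : ℤ), (k : ℤ), (step : ℤ), (m : ℤ), (N : ℤ), a,
      (cap : ℤ), 48 * N * 2 ^ m, ((2 ^ n : ℕ) : ℤ), (R.length : ℤ), (listCode (2 ^ n) R : ℤ)]) rfl
      (v := fun Y => [(Y.length : ℤ), (listCode (2 ^ n) Y : ℤ)]) fun Y => rfl).mono le_rfl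
  · fun_prop

/-- The program `A` computes the differences of the two children of the nodes of `B`. -/
def StepBy (A : Prog) (T : ℕ → ℕ) {n : ℕ} (O : Oracle) (B : ProductBasis n) : Prop :=
  ∀ s k, n ≤ s → k < n → Computes O A [(n : ℤ), (k : ℤ)] 1 (PMF.pure [(B.step k : ℤ)]) (T s)

open Ex Prog in
/-- The search, level by level. -/
theorem exists_treeDist (L S Q P : Prog) {T TS TP : ℕ → ℕ} (hT : PolyB T) (hTS : PolyB TS)
    (hTP : PolyB TP) :
    ∃ (A : Prog) (T' : ℕ → ℕ), PolyB T' ∧ ∀ (n : ℕ) (O : Oracle) (B : ProductBasis n)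
      (loc : ℕ → ℕ → Bool → ℕ → ℤ × ℤ) (φ : ℕ → ℂ) (sd : ℕ → PMF ℕ) (qd : ℕ → ℕ → PMF (ℤ × ℤ)),
      LocalBy L T O B loc → TractableBy S Q TS n φ sd qd → StepBy P TP O B →
      ∀ (s m N cap : ℕ) (a : ℤ), n ≤ s → m ≤ s → N ≤ s → cap ≤ s → bitLen a ≤ s →
      Computes O A [(n : ℤ), 0, 0, (m : ℤ), (N : ℤ), a, (cap : ℤ), 48 * N * 2 ^ m,
          ((2 ^ n : ℕ) : ℤ)] 2
        ((treeDist (weightTest sd qd loc n m N a) cap B.step n).map fun R =>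
          [(R.length : ℤ), (listCode (2 ^ n) R : ℤ)]) (T' s) := by
  obtain ⟨E, TE, hTE, hE⟩ := exists_tryDist L S Q hT hTS
  obtain ⟨F, TF, hTF, hF⟩ := exists_levelDist L S Q hT hTS
  -- Registers: 2 the difference of children; 9, 10 the list of accepted nodes; 11 the number of
  -- levels to go; 12 the current level, whose children are on the level in register 1.
  refine ⟨.seq (.call E [0, 1, 2, 3, 4, 5, 6, 7, 8, 9, 10] [9, 10]) (.seq (blk [(11, var 0),
    (1, 1)]) (.seq (.loop 11 (.seq (.call P [0, 12] [2])
    (.seq (.call F [0, 1, 2, 3, 4, 5, 6, 7, 8, 9, 10] [9, 10])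
    (blk [(12, var 12 + 1), (1, var 1 + 1), (11, var 11 - 1), (2, 0)]))))
    (blk [(0, var 9), (1, var 10)]))), ?_⟩
  constructor
  refine ⟨?_, fun n O B loc φ sd qd hL hTr hP s m N cap a hn hm hN hcap ha => ?_⟩
  rotate_left
  · obtain ⟨c, hc⟩ : ∃ c, c = s * s + 2 * s + 8 := ⟨_, rfl⟩
    have hns : 2 ^ n ≤ 2 ^ s := Nat.pow_le_pow_right (by norm_num) hn
    have c1 := bitLen_natCast_le_of_le hn
    have c4 := bitLen_natCast_le_of_le hm
    have c5 := bitLen_natCast_le_of_le hN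
    have c6 := bitLen_natCast_le_of_le hcap
    have c7 : bitLen (48 * N * 2 ^ m : ℤ) ≤ 2 * s + 7 := by
      have h1 := bitLen_mul (48 * N) (2 ^ m)
      have h2 := bitLen_mul 48 N
      have h3 := bitLen_two_pow m
      have h4 : bitLen 48 ≤ 6 := by decide
      omega
    have c8 : bitLen ((2 ^ n : ℕ) : ℤ) ≤ s + 1 := by
      push_cast; exact (bitLen_two_pow n).trans (by omega)
    set V : List ℕ → Prop := fun X => X.length ≤ cap ∧ ∀ b ∈ X, b < 2 ^ n with hV
    set e : ℕ → ℕ → ℕ → ℕ → List ℕ → List ℤ := fun k k' v r X => [(n : ℤ), (k' : ℤ), (v : ℤ),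
      (m : ℤ), (N : ℤ), a, (cap : ℤ), 48 * N * 2 ^ m, ((2 ^ n : ℕ) : ℤ), (X.length : ℤ),
      (listCode (2 ^ n) X : ℤ), (r : ℤ), (k : ℤ)] with he
    have state : ∀ k k' v r X, k ≤ n → k' ≤ n + 1 → v < 2 ^ n → r ≤ n → V X →
        (Mem.ofList (e k k' v r X)).BitsLE c := by
      intro k k' v r X hk hk' hv hr hX
      have d1 := bitLen_natCast_le_of_le (hX.1.trans hcap)
      have d2 := bitLen_natCast_le_of_le (hk.trans hn)
      have d3 := bitLen_listCode hn hcap hX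
      have d4 := bitLen_natCast_le_of_le hk'
      have d5 := bitLen_natCast_le_of_lt (hv.trans_le hns)
      have d6 := bitLen_natCast_le_of_le (hr.trans hn)
      simp only [he, bitsLE_cons, bitsLE_nil, and_true]
      omega
    have h0 : 0 < 2 ^ n := by positivity
    have hVnil : V [] := by simp [hV]
    set test := weightTest sd qd loc n m N a with htest
    set I : ℕ → List ℕ → Prop := fun k X => X.length ≤ cap ∧ ∀ b ∈ X, B.node k b with hI
    have hIV : ∀ k ≤ n, ∀ X, I k X → V X := fun k hk X hX =>
      ⟨hX.1, fun b hb => B.node_lt hk (hX.2 b hb)⟩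
    have r0 := (hE n O B loc φ sd qd hL hTr s 0 0 m N cap a [] hn hm hN hcap ha (Nat.zero_le _) h0
      hVnil).listCallMap (args := [0, 1, 2, 3, 4, 5, 6, 7, 8, 9, 10]) (rets := [9, 10])
        (state 0 0 0 0 [] (by omega) (by omega) h0 (by omega) hVnil) rfl
        (l' := fun X => e 0 0 0 0 X) (fun Y' => by simp [he, Mem.write])
    have hstep : ∀ k < n, ∀ X, I k X → ∀ X' ∈ (levelDist (test (k + 1)) cap (B.step k) X).support,
        I (k + 1) X' := fun k hk X hX => of_mem_chain_tryChildren (P := B.node (k + 1))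
      (fun a ha => ⟨B.node_left hk (hX.2 a ha), B.node_right hk (hX.2 a ha)⟩) le_rfl
    have r1 : ∀ X ∈ (tryDist (test 0 0) cap 0 []).support, Runs O _ _ _ _ := fun X hX => by
      have hX' : I 0 X := of_mem_tryDist (P := B.node 0) B.node_zero (by simp) X hX
      have q0 := Runs.listBlk (O := O) (bl := [(11, var 0), (1, 1)])
        (state 0 0 0 0 X (by omega) (by omega) h0 (by omega) (hIV 0 (by omega) X hX'))
        (by simp [he]) (l' := e 0 1 0 n X) rfl
      have q1 := Runs.loop (σ := List ℕ) (O := O) (r := 11) hn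
        (fun k => levelDist (test (k + 1)) cap (B.step k))
        (fun k X => Mem.ofList (e k (k + 1) 0 (n - k) X)) I X hX'
        (fun k hk X _ => by
          change (0 : ℤ) < ((n - k : ℕ) : ℤ)
          omega) (fun X _ => by
          change ((n - n : ℕ) : ℤ) ≤ 0
          simp) (fun k hk X hX => state k (k + 1) 0 (n - k) X hk (by omega) h0 (by omega)
            (hIV k hk X hX) 11) hstep fun k hk X hX => by
          have hXV := hIV k hk.le X hX
          have p0 := (hP s k hn hk).listCall (args := [0, 12]) (rets := [2])
            (state k (k + 1) 0 (n - k) X hk.le (by omega) h0 (by omega) hXV) rfl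
            (l' := e k (k + 1) (B.step k) (n - k) X) (by simp [he, Mem.write])
          have p1 := (hF n O B loc φ sd qd hL hTr s (k + 1) (B.step k) m N cap a X hn hm hN hcap ha
            hk (B.step_lt hk) hX.1 fun b hb => ⟨B.node_lt hk.le (hX.2 b hb),
              B.node_lt hk (B.node_right hk (hX.2 b hb))⟩).listCallMap
              (args := [0, 1, 2, 3, 4, 5, 6, 7, 8, 9, 10]) (rets := [9, 10])
              (state k (k + 1) (B.step k) (n - k) X hk.le (by omega) (B.step_lt hk) (by omega) hXV)
              rfl (l' := fun Y => e k (k + 1) (B.step k) (n - k) Y)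
              (fun Y' => by simp [he, Mem.write])
          exact p0.seq_pure (p1.seq_map_pure fun Y hY => Runs.listBlk
            (bl := [(12, var 12 + 1), (1, var 1 + 1), (11, var 11 - 1), (2, 0)])
            (state k (k + 1) (B.step k) (n - k) Y hk.le (by omega) (B.step_lt hk) (by omega)
              (hIV (k + 1) hk Y (hstep k hk X hX Y hY))) (by simp [he])
            (l' := e (k + 1) (k + 1 + 1) 0 (n - (k + 1)) Y) (by
              have h1 : ((n - (k + 1) : ℕ) : ℤ) = ((n - k : ℕ) : ℤ) - 1 := by omega
              simp only [he]
              rw [h1]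
              push_cast
              rfl))
      have q2 := q1.seq_map_pure (c' := blk [(0, var 9), (1, var 10)])
        fun Y hY => Runs.listBlk (state n (n + 1) 0 (n - n) Y le_rfl le_rfl h0 (by omega)
          (hIV n le_rfl Y (chain_support hX' hstep Y hY))) (by simp [he]) rfl
      exact q0.seq_pure q2
    have r2 := r0.seq_map r1
    rw [hc] at r2
    refine Computes.mono ⟨_, Runs.mono (by rwa [← Mem.ofList_pad _ 4]) le_rfl, ?_⟩ le_rfl
    rw [treeDist, PMF.map_bind, PMF.map_bind]
    congr 1
    funext X
    rw [PMF.map_comp]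
    rfl
  · fun_prop

/-- The total probability of failure, with `1 + 2 * n * cap` tests. -/
theorem failure_le {n cap K l : ℕ} {π : ℝ} (hπ : 0 < π) (hcap : cap ≤ 2 * K) (hl : 1 / π ≤ 2 ^ l) :
    (2 : ℝ) / 2 ^ (l + K + n + 4) + n * (cap * (2 / 2 ^ (l + K + n + 4) + 2 / 2 ^ (l + K + n + 4))) ≤
      π := by
  have h1 : (1 : ℝ) ≤ 2 ^ n := one_le_pow₀ (by norm_num)
  have h2 : (1 : ℝ) ≤ 2 ^ K := one_le_pow₀ (by norm_num)
  have h3 : (n : ℝ) ≤ 2 ^ n := by exact_mod_cast Nat.lt_two_pow_self.le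
  have h4 : (cap : ℝ) ≤ 2 * 2 ^ K := by
    have : (cap : ℝ) ≤ 2 * K := by exact_mod_cast hcap
    have : (K : ℝ) ≤ 2 ^ K := by exact_mod_cast Nat.lt_two_pow_self.le
    linarith
  have h5 : 1 / (2 : ℝ) ^ l ≤ π := (div_le_comm₀ (by positivity) hπ).2 hl
  refine le_trans ?_ h5
  have h6 : (n : ℝ) * cap ≤ 2 ^ n * (2 * 2 ^ K) := by gcongr
  have h7 : (1 : ℝ) ≤ 2 ^ n * 2 ^ K := by nlinarith
  calc (2 : ℝ) / 2 ^ (l + K + n + 4) + n * (cap * (2 / 2 ^ (l + K + n + 4) +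
        2 / 2 ^ (l + K + n + 4)))
      = (2 + 4 * (n * cap)) / 2 ^ (l + K + n + 4) := by ring
    _ ≤ (16 * (2 ^ n * 2 ^ K)) / 2 ^ (l + K + n + 4) := by gcongr; linarith
    _ = 1 / 2 ^ l := by rw [pow_add, pow_add, pow_add]; field_simp; norm_num

open Ex Prog in
/-- Finding the labels of large weight. The result is a list, encoded as one number. -/
theorem exists_findLabels (L S Q P : Prog) {T TS TP : ℕ → ℕ} (hT : PolyB T) (hTS : PolyB TS)
    (hTP : PolyB TP) :
    ∃ (A : Prog) (T' : ℕ → ℕ), PolyB T' ∧ ∀ (n : ℕ) (O : Oracle) (B : ProductBasis n)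
      (loc : ℕ → ℕ → Bool → ℕ → ℤ × ℤ) (φ : ℕ → ℂ) (sd : ℕ → PMF ℕ) (qd : ℕ → ℕ → PMF (ℤ × ℤ)),
      LocalBy L T O B loc → TractableBy S Q TS n φ sd qd → StepBy P TP O B →
      ∀ θ π : ℝ, 0 < θ → 0 < π → π ≤ 1 →
      (∀ m, ‖dyadic (O [0] m).1 (O [0] m).2 m - (1 / θ : ℝ)‖ ≤ 1 / 2 ^ m) →
      (∀ m, ‖dyadic (O [1] m).1 (O [1] m).2 m - (1 / π : ℝ)‖ ≤ 1 / 2 ^ m) →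
      ∀ s : ℕ, n ≤ s → 1 / θ ≤ s → Real.log (1 / π) ≤ s →
      ∃ ν : PMF (List ℕ), Computes O A [(n : ℤ)] 3 (ν.map fun R =>
          [(R.length : ℤ), (listCode (2 ^ n) R : ℤ), ((2 ^ n : ℕ) : ℤ)]) (T' s) ∧
        (∀ R ∈ ν.support, (R.length : ℝ) ≤ 2 / θ ∧ ∀ b ∈ R, b < 2 ^ n) ∧
        pr ν (fun R => ¬ ((∀ b ∈ R, 5 / 8 * θ ≤ B.wt φ n b) ∧
          ∀ b < 2 ^ n, θ ≤ B.wt φ n b → b ∈ R)) ≤ π := by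
  obtain ⟨G, TG, hTG, hG⟩ := exists_readParams
  obtain ⟨W, TW, hTW, hW⟩ := exists_pow2
  obtain ⟨E, TE, hTE, hE⟩ := exists_treeDist L S Q P hT hTS hTP
  -- Registers: 5 the number `a`; 9 the number `K`; 3 the number of digits; 10 the logarithm of the
  -- inverse of the probability of failure of one test; 6 the bound `cap`, which is `0` if `θ` is so
  -- large that nothing has to be found; 4 the number of samples; 7 the threshold of the test.
  refine ⟨.seq (.call G [] [5, 9, 10]) (.seq (blk [(3, 3 * var 0 + 11 + var 9),
    (10, var 10 + var 9 + var 0 + 4), (6, ite ((var 5 - 1) / 32) ((var 5 - 1) / 32) 0),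
    (4, 1024 * var 9 * var 9 * var 10)]) (.seq (.call W [0] [8]) (.seq (.call W [3] [11])
    (.seq (blk [(7, 48 * var 4 * var 11)]) (.seq (.call E [0, 1, 2, 3, 4, 5, 6, 7, 8] [0, 1])
    (blk [(2, var 8)])))))), ?_⟩
  constructor
  refine ⟨?_, fun n O B loc φ sd qd hL hTr hP θ π hθ hπ hπ1 hO0 hO1 s hn hθs hπs => ?_⟩
  rotate_left
  · obtain ⟨a, K, l, ha, hK, hK1, hKs, hl, hls, hG⟩ := hG O (1 / θ) (1 / π) (by positivity)
      ((one_le_div hπ).2 hπ1) hO0 hO1 s hθs hπs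
    obtain ⟨m, hm⟩ : ∃ m, m = 3 * n + 11 + K := ⟨_, rfl⟩
    obtain ⟨l', hl'⟩ : ∃ l', l' = l + K + n + 4 := ⟨_, rfl⟩
    obtain ⟨N, hN⟩ : ∃ N, N = 1024 * K * K * l' := ⟨_, rfl⟩
    obtain ⟨cap, hcap⟩ : ∃ cap : ℕ, (cap : ℤ) = max ((a - 1) / 32) 0 :=
      ⟨(max ((a - 1) / 32) 0).toNat, Int.toNat_of_nonneg (le_max_right _ _)⟩
    have hcapR := cap_le hθ ha hcap
    have hcaps : cap ≤ 2 * s := by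
      have h1 : (cap : ℝ) ≤ 2 * s := by
        rw [show 2 / θ = 2 * (1 / θ) by ring] at hcapR; linarith
      exact_mod_cast h1
    have hcapK : cap ≤ 2 * K := by
      have h1 : (cap : ℝ) ≤ 2 * K := by
        rw [show 2 / θ = 2 * (1 / θ) by ring] at hcapR; linarith
      exact_mod_cast h1
    have hms : m ≤ 4 * s + 14 := by omega
    have hls' : l' ≤ 4 * s + 9 := by omega
    have hNs : N ≤ 1024 * (s + 3) * (s + 3) * (4 * s + 9) := by
      rw [hN]
      exact Nat.mul_le_mul (Nat.mul_le_mul (Nat.mul_le_mul_left _ hKs) hKs) hls'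
    obtain ⟨s', hs'⟩ : ∃ s', s' = 4 * s + 14 + 1024 * (s + 3) * (s + 3) * (4 * s + 9) + 64 * s :=
      ⟨_, rfl⟩
    obtain ⟨c, hc⟩ : ∃ c, c = 2 * s' + 7 + s' * s' := ⟨_, rfl⟩
    have e1 : N ≤ s' := by omega
    have e2 : m ≤ s' := by omega
    have e3 : l' ≤ s' := by omega
    have e4 : K ≤ s' := by omega
    have e5 : n ≤ s' := by omega
    have e6 : l ≤ s' := by omega
    have e7 : cap ≤ s' := by omega
    have hab : bitLen a ≤ s' := (bitLen_le_natAbs _).trans (by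
      have h1 : |(a : ℝ)| ≤ 64 * s + 2 := by
        have : (0 : ℝ) < 1 / θ := by positivity
        generalize 1 / θ = u at *
        rw [abs_le] at ha ⊢
        constructor <;> linarith
      have h2 : |a| ≤ 64 * (s : ℤ) + 2 := by exact_mod_cast h1
      rw [← Int.natCast_natAbs] at h2
      omega)
    have c1 := bitLen_natCast_le_of_le e1
    have c2 := bitLen_natCast_le_of_le e2
    have c3 := bitLen_natCast_le_of_le e3
    have c4 := bitLen_natCast_le_of_le e4
    have c5 := bitLen_natCast_le_of_le e5
    have c6 := bitLen_natCast_le_of_le e6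
    have c7 := bitLen_natCast_le_of_le e7
    have hb : ∀ x ∈ [((n : ℕ) : ℤ), 0, 0, (m : ℤ), (N : ℤ), a, (cap : ℤ), 48 * N * 2 ^ m,
        ((2 ^ n : ℕ) : ℤ), (K : ℤ), (l : ℤ), (l' : ℤ), 2 ^ m], bitLen x ≤ 2 * s' + 7 := by
      have d1 : bitLen (48 * N * 2 ^ m : ℤ) ≤ 2 * s' + 7 := by
        have h1 := bitLen_mul (48 * N) (2 ^ m)
        have h2 := bitLen_mul 48 N
        have h3 := bitLen_two_pow m
        have h4 : bitLen 48 ≤ 6 := by decide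
        omega
      have d2 : bitLen ((2 ^ n : ℕ) : ℤ) ≤ s' + 1 := by
        push_cast; exact (bitLen_two_pow n).trans (by omega)
      have d3 := (bitLen_two_pow m).trans (show m + 1 ≤ s' + 1 by omega)
      simp only [List.mem_cons, List.not_mem_nil, or_false, forall_eq_or_imp, forall_eq,
        bitLen_zero]
      omega
    simp only [List.mem_cons, List.not_mem_nil, or_false, forall_eq_or_imp, forall_eq] at hb
    obtain ⟨b1, b2, -, b4, b5, b6, b7, b8, b9, b10, b11, b12, b13⟩ := hb
    have state : ∀ x0 x1 x3 x4 x5 x6 x7 x8 x9 x10 x11 : ℤ, bitLen x0 ≤ 2 * s' + 7 →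
        bitLen x1 ≤ c → bitLen x3 ≤ 2 * s' + 7 → bitLen x4 ≤ 2 * s' + 7 →
        bitLen x5 ≤ 2 * s' + 7 → bitLen x6 ≤ 2 * s' + 7 → bitLen x7 ≤ 2 * s' + 7 →
        bitLen x8 ≤ 2 * s' + 7 → bitLen x9 ≤ 2 * s' + 7 → bitLen x10 ≤ 2 * s' + 7 →
        bitLen x11 ≤ 2 * s' + 7 →
        (Mem.ofList [x0, x1, 0, x3, x4, x5, x6, x7, x8, x9, x10, x11]).BitsLE c := by
      intro x0 x1 x3 x4 x5 x6 x7 x8 x9 x10 x11 h0 h1 h3 h4 h5 h6 h7 h8 h9 h10 h11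
      simp only [bitsLE_cons, bitsLE_nil, bitLen_zero, and_true]
      omega
    have b0 : bitLen 0 ≤ c := by simp
    have r0 := hG.listCall (args := []) (rets := [5, 9, 10])
      (state n 0 0 0 0 0 0 0 0 0 0 b1 b0 b2 b2 b2 b2 b2 b2 b2 b2 b2) rfl
      (l' := [(n : ℤ), 0, 0, 0, 0, a, 0, 0, 0, (K : ℤ), (l : ℤ), 0]) (by simp [Mem.write])
    have r1 := Runs.listBlk (O := O) (bl := [(3, 3 * var 0 + 11 + var 9),
      (10, var 10 + var 9 + var 0 + 4), (6, ite ((var 5 - 1) / 32) ((var 5 - 1) / 32) 0),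
      (4, 1024 * var 9 * var 9 * var 10)])
      (state n 0 0 0 a 0 0 0 K l 0 b1 b0 b2 b2 b6 b2 b2 b2 b10 b11 b2) (by simp)
      (l' := [(n : ℤ), 0, 0, (m : ℤ), (N : ℤ), a, (cap : ℤ), 0, 0, (K : ℤ), (l' : ℤ), 0]) (by
        have h1 : (cap : ℤ) = if 0 < (a - 1) / 32 then (a - 1) / 32 else 0 := by
          rw [hcap]; split_ifs with h
          · exact max_eq_left h.le
          · exact max_eq_right (not_lt.1 h)
        rw [h1, hN, hm, hl']
        push_cast
        rfl)
    have r2 := (hW O s' n e5).listCall (args := [0]) (rets := [8])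
      (state n 0 m N a cap 0 0 K l' 0 b1 b0 b4 b5 b6 b7 b2 b2 b10 b12 b2) rfl
      (l' := [(n : ℤ), 0, 0, (m : ℤ), (N : ℤ), a, (cap : ℤ), 0, ((2 ^ n : ℕ) : ℤ), (K : ℤ), (l' : ℤ),
        0]) (by simp [Mem.write])
    have r3 := (hW O s' m e2).listCall (args := [3]) (rets := [11])
      (state n 0 m N a cap 0 _ K l' 0 b1 b0 b4 b5 b6 b7 b2 b9 b10 b12 b2) rfl
      (l' := [(n : ℤ), 0, 0, (m : ℤ), (N : ℤ), a, (cap : ℤ), 0, ((2 ^ n : ℕ) : ℤ), (K : ℤ), (l' : ℤ),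
        2 ^ m]) (by simp [Mem.write])
    have r4 := Runs.listBlk (O := O) (bl := [(7, 48 * var 4 * var 11)])
      (state n 0 m N a cap 0 _ K l' _ b1 b0 b4 b5 b6 b7 b2 b9 b10 b12 b13) (by simp)
      (l' := [(n : ℤ), 0, 0, (m : ℤ), (N : ℤ), a, (cap : ℤ), 48 * N * 2 ^ m, ((2 ^ n : ℕ) : ℤ),
        (K : ℤ), (l' : ℤ), 2 ^ m]) rfl
    have r5 := (hE n O B loc φ sd qd hL hTr hP s' m N cap a e5 e2 e1 e7 hab).listCallMap
      (args := [0, 1, 2, 3, 4, 5, 6, 7, 8]) (rets := [0, 1])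
      (state n 0 m N a cap _ _ K l' _ b1 b0 b4 b5 b6 b7 b8 b9 b10 b12 b13) rfl
      (l' := fun R => [(R.length : ℤ), (listCode (2 ^ n) R : ℤ), 0, (m : ℤ), (N : ℤ), a, (cap : ℤ),
        48 * N * 2 ^ m, ((2 ^ n : ℕ) : ℤ), (K : ℤ), (l' : ℤ), 2 ^ m]) (fun R => by simp [Mem.write])
    have r6 := r5.seq_map_pure (c' := blk [(2, var 8)]) fun R hR => by
      have hR' := ProductBasis.mem_treeDist R hR
      exact Runs.listBlk (state _ _ m N a cap _ _ K l' _
        ((bitLen_natCast_le_of_le (hR'.1.trans e7)).trans (by omega))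
        ((bitLen_listCode e5 e7 hR').trans (by omega)) b4 b5 b6 b7 b8 b9 b10 b12 b13) (by simp) rfl
    have r7 := r0.seq_pure (r1.seq_pure (r2.seq_pure (r3.seq_pure (r4.seq_pure r6))))
    rw [hc, hs'] at r7
    refine ⟨treeDist (weightTest sd qd loc n m N a) cap B.step n, (r7.computes (k := 3)
      (ins := [(n : ℤ)]) rfl (v := fun R => [(R.length : ℤ), (listCode (2 ^ n) R : ℤ),
        ((2 ^ n : ℕ) : ℤ)]) fun R => rfl).mono le_rfl, fun R hR => ?_, ?_⟩
    · have hR' := ProductBasis.mem_treeDist R hR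
      exact ⟨le_trans (by exact_mod_cast hR'.1) hcapR, hR'.2⟩
    · refine (ProductBasis.pr_treeDist_le (q := 2 / 2 ^ l') (by positivity) hTr.sum_sq
        (fun i hi => lt_cap hθ ha hcap hi) fun k hk b hb hw => pr_weightTest_le hL hTr hθ ha hK hK1
          hcap (by omega) hm hN hk hb hw).trans ?_
      rw [hl']
      exact failure_le hπ hcapK hl
  · fun_prop

/-! ### Writing the output list -/

theorem Mem.update_ofList_length (l : List ℤ) (v : ℤ) :
    Function.update (Mem.ofList l) l.length v = Mem.ofList (l ++ [v]) := by
  have := Mem.update_ofList (l := l ++ [0]) (i := l.length) (by simp) v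
  rw [show l ++ [0] = l ++ List.replicate 1 0 from rfl, Mem.ofList_pad] at this
  rw [this, show l ++ List.replicate 1 0 = l ++ [0] from rfl, List.set_append_right _ _ le_rfl]
  simp

theorem listCode_div {D : ℕ} {L : List ℕ} (h : ∀ a ∈ L, a < D) (i : ℕ) :
    (listCode D (L.drop i) : ℤ) / (D : ℤ) = listCode D (L.drop (i + 1)) := by
  rw [← List.drop_drop, ← Int.natCast_div]
  rcases hL : L.drop i with _ | ⟨a, X⟩
  · simp [listCode]
  · rw [listCode_cons_div X (h a (List.mem_of_mem_drop (hL ▸ List.mem_cons_self)))]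
    rfl

theorem listCode_sub_div_mul {D : ℕ} {L : List ℕ} (h : ∀ a ∈ L, a < D) (i : ℕ) :
    (listCode D (L.drop i) : ℤ) - (listCode D (L.drop i) : ℤ) / (D : ℤ) * D =
      (L.getD i 0 : ℕ) := by
  have h1 : L.getD i 0 = (L.drop i).getD 0 0 := by simp [List.getD_eq_getElem?_getD]
  rw [h1, ← Int.natCast_div, ← Nat.cast_mul, ← Nat.cast_sub (Nat.div_mul_le_self _ _),
    ← Nat.mod_eq_sub_div_mul]
  rcases hL : L.drop i with _ | ⟨a, X⟩
  · simp [listCode]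
  · rw [listCode_cons_mod X (h a (List.mem_of_mem_drop (hL ▸ List.mem_cons_self)))]
    rfl

/-- The memory that holds the length of a list and its elements. Its first six cells are listed
explicitly, with `0` in place of missing elements. -/
def outputMem (L : List ℕ) : Mem :=
  Mem.ofList ([(L.length : ℤ)] ++ (List.range 5).map (fun i => ((L.getD i 0 : ℕ) : ℤ)) ++
    (L.drop 5).map (Nat.cast : ℕ → ℤ))

theorem outputMem_succ {L : List ℕ} {i : ℕ} (h : i < L.length) : outputMem L (i + 1) = L[i] := by
  have h1 : ∀ j < 5, outputMem L (j + 1) = (L.getD j 0 : ℕ) := by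
    intro j hj
    interval_cases j <;> rfl
  by_cases hi : i < 5
  · rw [h1 i hi, List.getD_eq_getElem _ _ h]
  · obtain ⟨j, rfl⟩ := Nat.exists_eq_add_of_le (not_lt.1 hi)
    have : outputMem L (5 + j + 1) = ((L.drop 5).map (Nat.cast : ℕ → ℤ)).getD j 0 := by
      rw [show 5 + j + 1 = j + 6 by ring]; rfl
    rw [this, List.getD_eq_getElem _ _ (by rw [List.length_map, List.length_drop]; omega)]
    simp

theorem outputsList_outputMem {n : ℕ} {L : List ℕ} (h : ∀ b ∈ L, b < 2 ^ n) :
    OutputsList (outputMem L) (L.map (bitsOf n)) := by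
  refine ⟨by rw [List.length_map]; rfl, fun i hi => ?_⟩
  rw [List.length_map] at hi
  rw [outputMem_succ hi, List.getElem_map, toNat_bitsOf (h _ (List.getElem_mem hi))]

open Ex Prog in
/-- Unpacking a list. The elements from the sixth on are stored first, since the addresses up to
`5` serve as registers; the final call overwrites these with the length and the first five
elements. -/
theorem exists_unpack (A : Prog) {TA : ℕ → ℕ} (hTA : PolyB TA) :
    ∃ (A' : Prog) (T : ℕ → ℕ), PolyB T ∧ ∀ (O : Oracle) (n s : ℕ) (ν : PMF (List ℕ)), n ≤ s →
      (∀ R ∈ ν.support, R.length ≤ s ∧ ∀ b ∈ R, b < 2 ^ n) →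
      Computes O A [(n : ℤ)] 3 (ν.map fun R =>
        [(R.length : ℤ), (listCode (2 ^ n) R : ℤ), ((2 ^ n : ℕ) : ℤ)]) (TA s) →
      Runs O A' (Mem.ofList [(n : ℤ)]) (ν.map outputMem) (T s) := by
  refine ⟨.seq (.call A [0] [0, 5, 2]) (.seq (blk [(1, var 5 / var 2 / var 2 / var 2 / var 2 / var 2),
    (0, var 0 - 5), (3, 6)]) (.seq (.loop 0 (.seq (blk [(4, var 1 - var 1 / var 2 * var 2)])
      (.seq (.instr (.store 3 4)) (blk [(1, var 1 / var 2), (0, var 0 - 1), (3, var 3 + 1), (4, 0)]))))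
    (.call (.seq (blk [(4, var 2 / var 3), (5, var 4 / var 3), (6, var 5 / var 3),
      (7, var 6 / var 3)]) (blk [(0, var 0 + var 1 - 1), (1, var 2 - var 2 / var 3 * var 3),
      (2, var 4 - var 4 / var 3 * var 3), (8, var 3), (3, var 5 - var 5 / var 8 * var 8),
      (4, var 6 - var 6 / var 8 * var 8), (5, var 7 - var 7 / var 8 * var 8)]))
      [0, 3, 5, 2] [0, 1, 2, 3, 4, 5]))), ?_⟩
  constructor
  refine ⟨?_, fun O n s ν hn hν hA => ?_⟩
  rotate_left
  · obtain ⟨c, hc⟩ : ∃ c, c = s * s + s + 8 := ⟨_, rfl⟩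
    have hns : 2 ^ n ≤ 2 ^ s := Nat.pow_le_pow_right (by norm_num) hn
    have c1 := bitLen_natCast_le_of_le hn
    have c2 : bitLen ((2 ^ n : ℕ) : ℤ) ≤ s + 1 := by
      push_cast; exact (bitLen_two_pow n).trans (by omega)
    have l0 : (Mem.ofList [(n : ℤ), 0, 0, 0, 0, 0]).BitsLE c := by
      simp only [bitsLE_cons, bitsLE_nil, bitLen_zero, and_true]; omega
    have r0 := hA.listCallMap (args := [0]) (rets := [0, 5, 2]) l0 rfl (l' := fun R =>
      [(R.length : ℤ), 0, ((2 ^ n : ℕ) : ℤ), 0, 0, (listCode (2 ^ n) R : ℤ)])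
      (fun R => by simp [Mem.write])
    have r1 : ∀ R ∈ ν.support, Runs O _ (Mem.ofList [(R.length : ℤ), 0, ((2 ^ n : ℕ) : ℤ), 0, 0,
        (listCode (2 ^ n) R : ℤ)]) (PMF.pure (outputMem R)) _ := fun R hR => by
      obtain ⟨hRs, hRn⟩ := hν R hR
      set D : ℤ := ((2 ^ n : ℕ) : ℤ) with hD
      set E : ℕ → ℤ := fun i => (listCode (2 ^ n) (R.drop i) : ℤ) with hE
      have hdiv : ∀ i, E i / D = E (i + 1) := listCode_div hRn
      have hmod : ∀ i, E i - E i / D * D = (R.getD i 0 : ℕ) := listCode_sub_div_mul hRn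
      have hEb : ∀ i, bitLen (E i) ≤ s * s := fun i => bitLen_listCode hn hRs
        ⟨by rw [List.length_drop]; omega, fun b hb => hRn b (List.mem_of_mem_drop hb)⟩
      have hgetb : ∀ i, bitLen ((R.getD i 0 : ℕ) : ℤ) ≤ s := fun i => by
        refine bitLen_natCast_le_of_lt (lt_of_lt_of_le ?_ hns)
        by_cases hi : i < R.length
        · exact hRn _ (getD_mem hi)
        · rw [List.getD_eq_default _ _ (not_lt.1 hi)]; positivity
      have hE0 : (listCode (2 ^ n) R : ℤ) = E 0 := rfl
      set X := (R.drop 5).map (Nat.cast : ℕ → ℤ) with hX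
      have hXlen : X.length = R.length - 5 := by simp [hX]
      have hXb : ∀ z ∈ X, bitLen z ≤ s := by
        intro z hz
        rw [hX, List.mem_map] at hz
        obtain ⟨b, hb, rfl⟩ := hz
        exact bitLen_natCast_le_of_lt ((hRn b (List.mem_of_mem_drop hb)).trans_le hns)
      have hXget : ∀ i, i < X.length → X.take (i + 1) = X.take i ++ [((R.getD (5 + i) 0 : ℕ) : ℤ)] := by
        intro i hi
        rw [List.take_succ_eq_append_getElem hi]
        congr 2
        rw [hXlen] at hi
        simp only [hX, List.getElem_map, List.getElem_drop]
        rw [List.getD_eq_getElem _ _ (by omega)]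
      have hcnt : ∀ i ≤ X.length, bitLen ((R.length : ℤ) - 5 - i) ≤ s + 5 := fun i hi =>
        (bitLen_le_natAbs _).trans (by omega)
      set e : ℤ → ℤ → ℤ → ℤ → List ℤ → List ℤ := fun x0 x1 x3 x4 Y =>
        x0 :: x1 :: D :: x3 :: x4 :: E 0 :: Y with he
      have state : ∀ x0 x1 x3 x4 : ℤ, ∀ i, bitLen x0 ≤ s + 5 → bitLen x1 ≤ s * s →
          bitLen x3 ≤ s + 6 → bitLen x4 ≤ s → (Mem.ofList (e x0 x1 x3 x4 (X.take i))).BitsLE c := by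
        intro x0 x1 x3 x4 i h0 h1 h3 h4
        have h5 := hEb 0
        have h6 : (Mem.ofList (X.take i)).BitsLE c := Mem.bitsLE_ofList fun z hz =>
          (hXb z (List.mem_of_mem_take hz)).trans (by omega)
        simp only [he, bitsLE_cons]
        refine ⟨?_, ?_, ?_, ?_, ?_, ?_, h6⟩ <;> omega
      have z0 : ∀ b', bitLen 0 ≤ b' := by simp
      have hj : ∀ i ≤ X.length, bitLen (((6 + i : ℕ)) : ℤ) ≤ s + 6 := fun i hi =>
        bitLen_natCast_le_of_le (by omega)
      have q0 := Runs.listBlk (O := O) (bl := [(1, var 5 / var 2 / var 2 / var 2 / var 2 / var 2),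
        (0, var 0 - 5), (3, 6)]) (state R.length 0 0 0 0 ((bitLen_natCast_le_of_le hRs).trans
          (by omega)) (z0 _) (z0 _) (z0 _)) (by simp [he])
        (l' := e ((R.length : ℤ) - 5 - (0 : ℕ)) (E (5 + 0)) ((6 + 0 : ℕ) : ℤ) 0 (X.take 0)) (by
          rw [Nat.cast_zero, sub_zero]
          simp only [he]
          rw [← hdiv 4, ← hdiv 3, ← hdiv 2, ← hdiv 1, ← hdiv 0]
          rfl)
      have q1 := Runs.loop_pure (O := O) (r := 0) (show X.length ≤ s by omega)
        (fun i => Mem.ofList (e ((R.length : ℤ) - 5 - i) (E (5 + i)) ((6 + i : ℕ) : ℤ) 0 (X.take i)))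
        (fun i hi => by
          change (0 : ℤ) < (R.length : ℤ) - 5 - i
          omega) (by
          change (R.length : ℤ) - 5 - X.length ≤ 0
          omega) (fun i hi => state _ _ _ 0 i (hcnt i hi) (hEb _) (hj i hi) (z0 _) 0) fun i hi => by
          have s1 := state _ _ _ 0 i (hcnt i hi.le) (hEb (5 + i)) (hj i hi.le) (z0 _)
          have p1 := Runs.listBlk (O := O) (bl := [(4, var 1 - var 1 / var 2 * var 2)]) s1
            (by simp [he]) (l' := e ((R.length : ℤ) - 5 - i) (E (5 + i)) ((6 + i : ℕ) : ℤ)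
              ((R.getD (5 + i) 0 : ℕ) : ℤ) (X.take i)) (by rw [← hmod]; rfl)
          have s2 := state _ _ _ _ i (hcnt i hi.le) (hEb (5 + i)) (hj i hi.le) (hgetb (5 + i))
          have p2 := Runs.instr (O := O) (M := Mem.ofList (e ((R.length : ℤ) - 5 - i) (E (5 + i))
            ((6 + i : ℕ) : ℤ) ((R.getD (5 + i) 0 : ℕ) : ℤ) (X.take i))) (T := 1 + c + c)
            (.store 3 4) (add_le_add (add_le_add le_rfl (s2 3)) (s2 4))
          have h1 : Instr.run O (Mem.ofList (e ((R.length : ℤ) - 5 - i) (E (5 + i))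
              ((6 + i : ℕ) : ℤ) ((R.getD (5 + i) 0 : ℕ) : ℤ) (X.take i))) (.store 3 4) =
              Mem.ofList (e ((R.length : ℤ) - 5 - i) (E (5 + i))
              ((6 + i : ℕ) : ℤ) ((R.getD (5 + i) 0 : ℕ) : ℤ) (X.take (i + 1))) := by
            rw [hXget i hi]
            have h2 := Mem.update_ofList_length (e ((R.length : ℤ) - 5 - i) (E (5 + i))
              ((6 + i : ℕ) : ℤ) ((R.getD (5 + i) 0 : ℕ) : ℤ) (X.take i)) ((R.getD (5 + i) 0 : ℕ) : ℤ)
            have h3 : (e ((R.length : ℤ) - 5 - i) (E (5 + i))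
              ((6 + i : ℕ) : ℤ) ((R.getD (5 + i) 0 : ℕ) : ℤ) (X.take i)).length = 6 + i := by
              simp only [he, List.length_cons, List.length_take]
              omega
            rw [h3] at h2
            exact h2
          rw [h1] at p2
          have s3 := state _ _ _ _ (i + 1) (hcnt i hi.le) (hEb (5 + i)) (hj i hi.le) (hgetb (5 + i))
          exact p1.seq_pure (p2.seq_pure (Runs.listBlk (bl := [(1, var 1 / var 2), (0, var 0 - 1),
            (3, var 3 + 1), (4, 0)]) s3 (by simp [he]) (by
              rw [show 5 + (i + 1) = 5 + i + 1 by ring, ← hdiv,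
                show (R.length : ℤ) - 5 - ((i + 1 : ℕ) : ℤ) = (R.length : ℤ) - 5 - i - 1 by
                  push_cast; ring,
                show ((6 + (i + 1) : ℕ) : ℤ) = ((6 + i : ℕ) : ℤ) + 1 by push_cast; ring]
              rfl)))
      set f : ℤ := (R.length : ℤ) - 5 - X.length with hf
      set j : ℤ := ((6 + X.length : ℕ) : ℤ) with hj'
      have hfb : bitLen f ≤ s + 5 := hcnt _ le_rfl
      have hjb : bitLen j ≤ s + 6 := hj _ le_rfl
      have t0 : (Mem.ofList [f, j, E 0, D, 0, 0, 0, 0, 0]).BitsLE c := by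
        have := hEb 0
        simp only [bitsLE_cons, bitsLE_nil, bitLen_zero, and_true]; omega
      have t1 : (Mem.ofList [f, j, E 0, D, E 1, E 2, E 3, E 4, 0]).BitsLE c := by
        have := hEb 0; have := hEb 1; have := hEb 2; have := hEb 3; have := hEb 4
        simp only [bitsLE_cons, bitsLE_nil, bitLen_zero, and_true]; omega
      have p0 := Runs.listBlk (O := O) (bl := [(4, var 2 / var 3), (5, var 4 / var 3),
        (6, var 5 / var 3), (7, var 6 / var 3)]) t0 (by simp)
        (l' := [f, j, E 0, D, E 1, E 2, E 3, E 4, 0]) (by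
          rw [← hdiv 3, ← hdiv 2, ← hdiv 1, ← hdiv 0]; rfl)
      have p1 := Runs.listBlk (O := O) (bl := [(0, var 0 + var 1 - 1),
        (1, var 2 - var 2 / var 3 * var 3), (2, var 4 - var 4 / var 3 * var 3), (8, var 3),
        (3, var 5 - var 5 / var 8 * var 8), (4, var 6 - var 6 / var 8 * var 8),
        (5, var 7 - var 7 / var 8 * var 8)]) t1 (by simp)
        (l' := [(R.length : ℤ), ((R.getD 0 0 : ℕ) : ℤ), ((R.getD 1 0 : ℕ) : ℤ),
          ((R.getD 2 0 : ℕ) : ℤ), ((R.getD 3 0 : ℕ) : ℤ), ((R.getD 4 0 : ℕ) : ℤ), E 3, E 4, D]) (by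
          rw [← hmod 0, ← hmod 1, ← hmod 2, ← hmod 3, ← hmod 4,
            show (R.length : ℤ) = f + j - 1 by rw [hf, hj']; push_cast; ring]
          rfl)
      have p2 := ((p0.seq_pure p1).computes_pure (k := 6) (ins := [f, j, E 0, D])
        (v := [(R.length : ℤ), ((R.getD 0 0 : ℕ) : ℤ), ((R.getD 1 0 : ℕ) : ℤ),
          ((R.getD 2 0 : ℕ) : ℤ), ((R.getD 3 0 : ℕ) : ℤ), ((R.getD 4 0 : ℕ) : ℤ)]) rfl rfl).listCall
        (args := [0, 3, 5, 2]) (rets := [0, 1, 2, 3, 4, 5])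
        (state _ _ _ 0 X.length hfb (hEb (5 + X.length)) hjb (z0 _)) rfl
        (l' := [(R.length : ℤ)] ++ (List.range 5).map (fun i => ((R.getD i 0 : ℕ) : ℤ)) ++ X) (by
          rw [List.take_length]
          simp [he, Mem.write, List.range_succ])
      exact q0.seq_pure (q1.seq_pure p2)
    have r2 := r0.seq_map_pure r1
    rw [hc] at r2
    exact Runs.mono (by rwa [← Mem.ofList_pad _ 5]) le_rfl
  · fun_prop

/-! ### The algorithms for a family of product bases -/

/-- Polynomial bounds in a natural number that dominates the real parameters are polynomial
bounds in the parameters. -/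
theorem PolyB.exists_real {T : ℕ → ℕ} (hT : PolyB T) : ∃ C d : ℕ, ∀ (n : ℕ) (u v : ℝ), 0 ≤ u →
    0 ≤ v → (T (n + 2 * ⌈u⌉₊ + ⌈v⌉₊) : ℝ) ≤ C * (1 + n + u + v) ^ d := by
  obtain ⟨C, d, h⟩ := hT
  refine ⟨C * 4 ^ d, d, fun n u v hu hv => ?_⟩
  have h1 : (T (n + 2 * ⌈u⌉₊ + ⌈v⌉₊) : ℝ) ≤ C * (1 + (n + 2 * ⌈u⌉₊ + ⌈v⌉₊ : ℕ)) ^ d := by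
    exact_mod_cast h _
  refine h1.trans ?_
  have h2 := (Nat.ceil_lt_add_one hu).le
  have h3 := (Nat.ceil_lt_add_one hv).le
  have h4 : (0 : ℝ) ≤ n := Nat.cast_nonneg n
  push_cast
  rw [mul_assoc, ← mul_pow]
  gcongr
  linarith

/-- `vec x` is the vector with the label `x.toNat` of the basis `B`. -/
def IsBasisOf {n : ℕ} (B : ProductBasis n) (vec : Bits n → QState n) : Prop :=
  ∀ x y, vec x y = B.amp n x.toNat y.toNat

theorem IsBasisOf.part_eq {n : ℕ} {B : ProductBasis n} {vec : Bits n → QState n}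
    (hB : IsBasisOf B vec) {ψ : QState n} {c : Bits n → ℂ} (hc : ψ = ∑ x, c x • vec x)
    (x : Bits n) : B.part (fun y => ψ (bitsOf n y)) n x.toNat 0 = c x := by
  rw [B.part_eq_coeff (c := fun y => c (bitsOf n y)) _ (fun y hy => ?_) x.toNat_lt, bitsOf_toNat]
  have h : ∑ x ∈ range (2 ^ n), c (bitsOf n x) * B.amp n x y = ∑ x, c x * B.amp n x.toNat y := by
    rw [sum_bits]
    exact sum_congr rfl fun z hz => by rw [toNat_bitsOf (mem_range.1 hz)]
  rw [h, hc]
  simp only [WithLp.ofLp_sum, WithLp.ofLp_smul, Finset.sum_apply, Pi.smul_apply, smul_eq_mul]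
  exact sum_congr rfl fun z _ => by rw [hB, toNat_bitsOf hy]

/-- For bases of product vectors with computable amplitudes, the large weights of a
computationally tractable family can be found. The algorithm depends only on the programs `L` and
`P` for the basis, and not on `n` or `B`. -/
theorem exists_findsLargeWeights {ψ : ∀ n, QState n} (hψ : IsCT ψ) (L P : Prog) {T TP : ℕ → ℕ}
    (hT : PolyB T) (hTP : PolyB TP) : ∃ (A : Prog) (C d : ℕ), ∀ (n : ℕ) (O : Oracle)
      (B : ProductBasis n) (loc : ℕ → ℕ → Bool → ℕ → ℤ × ℤ) (vec : Bits n → QState n),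
      LocalBy L T O B loc → StepBy P TP O B → IsBasisOf B vec →
      ∀ c : Bits n → ℂ, ψ n = ∑ x, c x • vec x → ∀ θ π : ℝ, 0 < θ → 0 < π → π ≤ 1 →
      (∀ m, ‖dyadic (O [0] m).1 (O [0] m).2 m - (1 / θ : ℝ)‖ ≤ 1 / 2 ^ m) →
      (∀ m, ‖dyadic (O [1] m).1 (O [1] m).2 m - (1 / π : ℝ)‖ ≤ 1 / 2 ^ m) →
      FindsLargeWeights O A [(n : ℤ)] c θ π (C * (1 + n + 1 / θ + Real.log (1 / π)) ^ d) := by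
  obtain ⟨S, Q, TS, hTS, hTr⟩ := exists_tractableBy hψ
  obtain ⟨E, TE, hTE, hE⟩ := exists_findLabels L S Q P hT hTS hTP
  obtain ⟨F, TF, hTF, hF⟩ := exists_unpack E hTE
  obtain ⟨C, d, hC⟩ := hTF.exists_real
  refine ⟨F, C, d, fun n O B loc vec hL hP hB c hc θ π hθ hπ hπ1 hO0 hO1 => ?_⟩
  obtain ⟨sd, qd, hTr⟩ := hTr n
  have hu : 0 ≤ 1 / θ := by positivity
  have hv : 0 ≤ Real.log (1 / π) := Real.log_nonneg ((one_le_div hπ).2 hπ1)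
  have hC := hC n _ _ hu hv
  obtain ⟨s, hs⟩ : ∃ s, s = n + 2 * ⌈1 / θ⌉₊ + ⌈Real.log (1 / π)⌉₊ := ⟨_, rfl⟩
  rw [← hs] at hC
  have h1 := Nat.le_ceil (1 / θ)
  have h2 := Nat.le_ceil (Real.log (1 / π))
  have h3 : (s : ℝ) = n + 2 * ⌈1 / θ⌉₊ + ⌈Real.log (1 / π)⌉₊ := by rw [hs]; push_cast; rfl
  have h4 : (0 : ℝ) ≤ n := Nat.cast_nonneg n
  obtain ⟨ν, hν1, hν2, hν3⟩ := hE n O B loc _ sd qd hL hTr hP θ π hθ hπ hπ1 hO0 hO1 s (by omega)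
    (by linarith) (by linarith)
  obtain ⟨μ, hμ1, hμ2, hμ3⟩ := hF O n s ν (by omega) (fun R hR => ⟨by
    have h5 := (hν2 R hR).1
    rw [show 2 / θ = 2 * (1 / θ) by ring] at h5
    have h6 : (R.length : ℝ) ≤ s := by linarith
    exact_mod_cast h6, (hν2 R hR).2⟩) hν1
  have hwt : ∀ x : Bits n, B.wt (fun y => ψ n (bitsOf n y)) n x.toNat = ‖c x‖ ^ 2 := fun x => by
    rw [B.wt_self, hB.part_eq hc]
  refine ⟨μ, hμ1, fun y hy => ⟨le_trans (by exact_mod_cast hμ3 y hy) hC, ?_⟩, ?_⟩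
  · have : y.1 ∈ (ν.map outputMem).support := by
      rw [← hμ2, PMF.mem_support_map_iff]; exact ⟨y, hy, rfl⟩
    rw [PMF.mem_support_map_iff] at this
    obtain ⟨R, hR, hRy⟩ := this
    rw [← hRy]
    exact ⟨R.map (bitsOf n), outputsList_outputMem (hν2 R hR).2, by
      rw [List.length_map]; exact (hν2 R hR).1⟩
  · rw [prob_eq_pr, hμ2, pr_map]
    rw [pr_not] at hν3
    refine le_trans (by linarith) (pr_mono fun R hR hgood => ?_)
    refine ⟨R.map (bitsOf n), outputsList_outputMem (hν2 R hR).2, fun x hx => ?_, fun x hx => ?_⟩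
    · obtain ⟨b, hb, rfl⟩ := List.mem_map.1 hx
      have h5 := hgood.1 b hb
      rw [← hwt, toNat_bitsOf ((hν2 R hR).2 b hb)]
      linarith
    · rw [List.mem_map]
      rw [← hwt] at hx
      exact ⟨x.toNat, hgood.2 _ x.toNat_lt hx, bitsOf_toNat x⟩

/-- For bases of product vectors with computable amplitudes, the coefficients of a computationally
tractable family can be estimated. -/
theorem exists_estimates {ψ : ∀ n, QState n} (hψ : IsCT ψ) (L : Prog) {T : ℕ → ℕ}
    (hT : PolyB T) : ∃ (A : Prog) (C d : ℕ), ∀ (n : ℕ) (O : Oracle)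
      (B : ProductBasis n) (loc : ℕ → ℕ → Bool → ℕ → ℤ × ℤ) (vec : Bits n → QState n),
      LocalBy L T O B loc → IsBasisOf B vec →
      ∀ c : Bits n → ℂ, ψ n = ∑ x, c x • vec x →
      ∀ (x : Bits n) (ε δ : ℝ), 0 < ε → 0 < δ → δ ≤ 1 →
      (∀ m, ‖dyadic (O [0] m).1 (O [0] m).2 m - (1 / ε : ℝ)‖ ≤ 1 / 2 ^ m) →
      (∀ m, ‖dyadic (O [1] m).1 (O [1] m).2 m - (1 / δ : ℝ)‖ ≤ 1 / 2 ^ m) →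
      Estimates O A [(n : ℤ), (x.toNat : ℤ)] (c x) ε δ
        (C * (1 + n + 1 / ε + Real.log (1 / δ)) ^ d) := by
  obtain ⟨S, Q, TS, hTS, hTr⟩ := exists_tractableBy hψ
  obtain ⟨E, TE, hTE, hE⟩ := exists_estimateCoeff L S Q hT hTS
  obtain ⟨C, d, hC⟩ := hTE.exists_real
  refine ⟨E, C, d, fun n O B loc vec hL hB c hc x ε δ hε hδ hδ1 hO0 hO1 => ?_⟩
  obtain ⟨sd, qd, hTr⟩ := hTr n
  have hu : 0 ≤ 1 / ε := by positivity
  have hv : 0 ≤ Real.log (1 / δ) := Real.log_nonneg ((one_le_div hδ).2 hδ1)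
  have hC := hC n _ _ hu hv
  obtain ⟨s, hs⟩ : ∃ s, s = n + 2 * ⌈1 / ε⌉₊ + ⌈Real.log (1 / δ)⌉₊ := ⟨_, rfl⟩
  rw [← hs] at hC
  have h1 := Nat.le_ceil (1 / ε)
  have h2 := Nat.le_ceil (Real.log (1 / δ))
  have h3 : (s : ℝ) = n + 2 * ⌈1 / ε⌉₊ + ⌈Real.log (1 / δ)⌉₊ := by rw [hs]; push_cast; rfl
  have h4 : (0 : ℝ) ≤ n := Nat.cast_nonneg n
  obtain ⟨ν, ⟨μ, hμ1, hμ2, hμ3⟩, hν⟩ := hE n O B loc _ sd qd hL hTr ε δ hε hδ hδ1 hO0 hO1 s x.toNat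
    (by omega) (by linarith) (by linarith) x.toNat_lt
  refine ⟨μ, hμ1, fun y hy => le_trans (by exact_mod_cast hμ3 y hy) hC, ?_⟩
  rw [prob_eq_pr, hμ2]
  rw [pr_not, hB.part_eq hc] at hν
  linarith

/-! ### Product bases -/

theorem mem_unitaryGroup_orth (U : Matrix.unitaryGroup Bool ℂ) (t t' : Bool) :
    conj ((U : Matrix Bool Bool ℂ) false t) * (U : Matrix Bool Bool ℂ) false t' +
      conj ((U : Matrix Bool Bool ℂ) true t) * (U : Matrix Bool Bool ℂ) true t' =
      if t = t' then 1 else 0 := by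
  have h := congrFun (congrFun (Matrix.mem_unitaryGroup_iff'.1 U.2) t) t'
  rw [Matrix.mul_apply, Fintype.sum_bool, Matrix.one_apply, add_comm] at h
  exact h

/-- The nodes of level `k` are the labels with all but the first `k` of their `n` binary digits
equal to zero. -/
noncomputable def productBasis {n : ℕ} (U : Fin n → Matrix.unitaryGroup Bool ℂ) :
    ProductBasis n where
  g a j b := if h : j < n then (U ⟨j, h⟩ : Matrix Bool Bool ℂ) b (a.testBit j) else ind (b = true)
  step k := 2 ^ (n - 1 - k)
  node k a := ∃ q < 2 ^ k, a = q * 2 ^ (n - k)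
  norm_g a j := by
    by_cases h : j < n
    · have := mem_unitaryGroup_orth (U ⟨j, h⟩) (a.testBit j) (a.testBit j)
      rw [if_pos rfl, ← Complex.normSq_eq_conj_mul_self, ← Complex.normSq_eq_conj_mul_self,
        Complex.normSq_eq_norm_sq, Complex.normSq_eq_norm_sq] at this
      simp only [dif_pos h]
      exact_mod_cast this
    · simp [dif_neg h, ind]
  node_zero := ⟨0, by simp⟩
  node_left := by
    rintro k a hk ⟨q, hq, rfl⟩
    refine ⟨2 * q, by rw [pow_succ]; omega, ?_⟩
    rw [show n - k = n - (k + 1) + 1 by omega, pow_succ]; ring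
  node_right := by
    rintro k a hk ⟨q, hq, rfl⟩
    refine ⟨2 * q + 1, by rw [pow_succ]; omega, ?_⟩
    rw [show n - k = n - (k + 1) + 1 by omega, pow_succ, show n - 1 - k = n - (k + 1) by omega]; ring
  node_lt := by
    rintro k a hk ⟨q, hq, rfl⟩
    calc q * 2 ^ (n - k) < 2 ^ k * 2 ^ (n - k) := Nat.mul_lt_mul_of_pos_right hq (by positivity)
      _ = 2 ^ n := by rw [← pow_add]; congr 1; omega
  step_lt hk := Nat.pow_lt_pow_right (by norm_num) (by omega)
  g_right := by
    rintro k a j hk ⟨q, hq, rfl⟩ hj hjn b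
    have h1 := Nat.testBit_two_pow_mul_add q (Nat.pow_lt_pow_right (a := 2) (by norm_num)
      (show n - 1 - k < n - k by omega)) j
    have h2 := Nat.testBit_two_pow_mul_add q (show 0 < 2 ^ (n - k) by positivity) j
    rw [if_neg (by omega), mul_comm] at h1 h2
    simp only [dif_pos hjn, h1]
    rw [← h2, add_zero]
  orth := by
    rintro k a hk ⟨q, hq, rfl⟩
    have hj : n - k - 1 < n := by omega
    have h1 := Nat.testBit_two_pow_mul_add q (Nat.pow_lt_pow_right (a := 2) (by norm_num)
      (show n - 1 - k < n - k by omega)) (n - k - 1)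
    have h2 := Nat.testBit_two_pow_mul_add q (show 0 < 2 ^ (n - k) by positivity) (n - k - 1)
    rw [if_pos (by omega), mul_comm] at h1 h2
    rw [show n - 1 - k = n - k - 1 by omega] at h1 ⊢
    rw [Nat.testBit_two_pow_self] at h1
    rw [add_zero, Nat.zero_testBit] at h2
    simp only [dif_pos hj, h1, h2]
    rw [mem_unitaryGroup_orth, if_neg (by simp)]
  exists_path := by
    intro x hx
    refine ⟨fun k => x / 2 ^ (n - k) * 2 ^ (n - k), ?_, ?_, fun k hk => ?_⟩
    · simp [Nat.div_eq_of_lt hx]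
    · simp
    · have h1 : 2 ^ (n - k) = 2 ^ (n - (k + 1)) * 2 := by rw [← pow_succ]; congr 1; omega
      simp only
      rw [h1, ← Nat.div_div_eq_div_mul, show n - 1 - k = n - (k + 1) by omega]
      set y := x / 2 ^ (n - (k + 1)) with hy
      set D := 2 ^ (n - (k + 1)) with hD
      rw [show y / 2 * (D * 2) = (2 * (y / 2)) * D by ring,
        show 2 * (y / 2) * D + D = (2 * (y / 2) + 1) * D by ring]
      rcases Nat.mod_two_eq_zero_or_one y with h | h
      · left; congr 1; omega
      · right; congr 1; omega
  orth_vec := by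
    intro x y hx hy hxy
    obtain ⟨j, hj⟩ : ∃ j, x.testBit j ≠ y.testBit j := by
      by_contra! h; exact hxy (Nat.eq_of_testBit_eq h)
    have hjn : j < n := by
      by_contra h
      have h3 : 2 ^ n ≤ 2 ^ j := Nat.pow_le_pow_right (by norm_num) (not_lt.1 h)
      rw [Nat.testBit_lt_two_pow (hx.trans_le h3), Nat.testBit_lt_two_pow (hy.trans_le h3)] at hj
      exact hj rfl
    refine ⟨j, hjn, ?_⟩
    simp only [dif_pos hjn]
    rw [mem_unitaryGroup_orth, if_neg hj]

theorem isBasisOf_productVec {n : ℕ} (U : Fin n → Matrix.unitaryGroup Bool ℂ) :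
    IsBasisOf (productBasis U) (productVec U) := by
  intro x y
  change (∏ j : Fin n, (U j : Matrix Bool Bool ℂ) (y j) (x j)) = _
  rw [ProductBasis.amp, prodAmp, prod_range]
  refine prod_congr rfl fun j _ => ?_
  simp only [productBasis, Nat.sub_self, zero_add, dif_pos j.2]
  rw [Bits.testBit_toNat, Bits.testBit_toNat]

open Ex Prog in
theorem exists_stepBy_product : ∃ (P : Prog) (T : ℕ → ℕ), PolyB T ∧ ∀ (n : ℕ) (O : Oracle)
    (U : Fin n → Matrix.unitaryGroup Bool ℂ), StepBy P T O (productBasis U) := by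
  obtain ⟨W, TW, hTW, hW⟩ := exists_pow2
  refine ⟨.seq (blk [(0, var 0 - 1 - var 1), (1, 0)]) (.call W [0] [0]), ?_⟩
  constructor
  refine ⟨?_, fun n O U s k hn hk => ?_⟩
  rotate_left
  · have l0 : (Mem.ofList [(n : ℤ), (k : ℤ)]).BitsLE s := by
      have := bitLen_natCast_le_of_le hn
      have := bitLen_natCast_le_of_le (hk.le.trans hn)
      simp only [bitsLE_cons, bitsLE_nil, and_true]; omega
    have l1 : (Mem.ofList [((n - 1 - k : ℕ) : ℤ), 0]).BitsLE s := by
      have := bitLen_natCast_le_of_le (show n - 1 - k ≤ s by omega)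
      simp only [bitsLE_cons, bitsLE_nil, bitLen_zero, and_true]; omega
    have r0 := Runs.listBlk (O := O) (bl := [(0, var 0 - 1 - var 1), (1, 0)]) l0 (by simp)
      (l' := [((n - 1 - k : ℕ) : ℤ), 0]) (by
        rw [show ((n - 1 - k : ℕ) : ℤ) = n - 1 - k by omega]; rfl)
    have r1 := (hW O s (n - 1 - k) (by omega)).listCall (args := [0]) (rets := [0]) l1 rfl
      (l' := [2 ^ (n - 1 - k), 0]) (by simp [Mem.write])
    exact ((r0.seq_pure r1).computes_pure rfl (by simp [productBasis])).mono le_rfl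
  · fun_prop

/-- The entries of the unitary operators are parameters. -/
def productLoc (O : Oracle) (a j : ℕ) (b : Bool) (m : ℕ) : ℤ × ℤ :=
  O [2, (j : ℤ), (b.toNat : ℤ), ((a.testBit j).toNat : ℤ)] m

theorem dyadic_productLoc_sub_le {n : ℕ} {O : Oracle} {U : Fin n → Matrix.unitaryGroup Bool ℂ}
    {u v : ℝ} (hO : O.Approximates (productParams u v U)) {a j : ℕ} (hj : j < n) (b : Bool) (m : ℕ) :
    ‖dyadic (productLoc O a j b m).1 (productLoc O a j b m).2 m - (productBasis U).g a j b‖ ≤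
      1 / 2 ^ m := by
  have h := hO [2, (j : ℤ), (b.toNat : ℤ), ((a.testBit j).toNat : ℤ)] m
  have h1 : ∀ b : Bool, decide ((b.toNat : ℤ) ≠ 0) = b := by decide
  have h2 : productParams u v U [2, (j : ℤ), (b.toNat : ℤ), ((a.testBit j).toNat : ℤ)] =
      (productBasis U).g a j b := by
    simp only [productParams, h1, productBasis]
    rw [dif_pos (by simpa using hj), dif_pos hj]
    rfl
  rwa [h2] at h

open Ex Prog in
/-- The amplitudes of a product basis are obtained by one query. -/
theorem exists_productLoc : ∃ (L : Prog) (T : ℕ → ℕ), PolyB T ∧ ∀ (n : ℕ) (O : Oracle)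
    (U : Fin n → Matrix.unitaryGroup Bool ℂ) (u v : ℝ), O.Approximates (productParams u v U) →
    ∀ (s a j : ℕ) (b : Bool) (m : ℕ), n ≤ s → m ≤ s → a < 2 ^ n → j < n →
    Computes O L [(n : ℤ), (a : ℤ), (j : ℤ), (b.toNat : ℤ), (m : ℤ)] 2
      (PMF.pure [(productLoc O a j b m).1, (productLoc O a j b m).2]) (T s) := by
  obtain ⟨W, TW, hTW, hW⟩ := exists_pow2
  refine ⟨.seq (.call W [2] [6]) (.seq (blk [(7, var 1 / var 6 - var 1 / var 6 / 2 * 2), (5, 2)])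
    (.instr (.query 0 1 [5, 2, 3, 7] 4))), ?_⟩
  constructor
  refine ⟨?_, fun n O U u v hO s a j b m hn hm ha hj => ?_⟩
  rotate_left
  · have c1 := bitLen_natCast_le_of_le hn
    have c2 := bitLen_natCast_le_of_lt (ha.trans_le (Nat.pow_le_pow_right (by norm_num) hn))
    have c3 := bitLen_natCast_le_of_le (hj.le.trans hn)
    have c4 := bitLen_bool b
    have c5 := bitLen_natCast_le_of_le hm
    have c6 := (bitLen_two_pow j).trans (show j + 1 ≤ s + 1 by omega)
    have c7 := bitLen_bool (a.testBit j)
    have c8 := bitLen_of_dyadic_sub_le (dyadic_productLoc_sub_le hO (a := a) hj b m)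
      ((productBasis U).norm_g_le a j b)
    have l0 : (Mem.ofList [(n : ℤ), (a : ℤ), (j : ℤ), (b.toNat : ℤ), (m : ℤ), 0, 0, 0]).BitsLE
        (s + 1) := by
      simp only [bitsLE_cons, bitsLE_nil, bitLen_zero, and_true]; omega
    have l1 : (Mem.ofList [(n : ℤ), (a : ℤ), (j : ℤ), (b.toNat : ℤ), (m : ℤ), 0, 2 ^ j, 0]).BitsLE
        (s + 1) := by
      simp only [bitsLE_cons, bitsLE_nil, bitLen_zero, and_true]; omega
    have r0 := (hW O s j (by omega)).listCall (args := [2]) (rets := [6]) l0 rfl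
      (l' := [(n : ℤ), (a : ℤ), (j : ℤ), (b.toNat : ℤ), (m : ℤ), 0, 2 ^ j, 0]) (by simp [Mem.write])
    have r1 := Runs.listBlk (O := O) (bl := [(7, var 1 / var 6 - var 1 / var 6 / 2 * 2), (5, 2)]) l1
      (by simp) (l' := [(n : ℤ), (a : ℤ), (j : ℤ), (b.toNat : ℤ), (m : ℤ), 2, 2 ^ j,
        ((a.testBit j).toNat : ℤ)]) (by
        have h : ((a.testBit j).toNat : ℤ) = (a : ℤ) / 2 ^ j - (a : ℤ) / 2 ^ j / 2 * 2 := by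
          rw [Nat.toNat_testBit]
          push_cast
          omega
        rw [h]; rfl)
    have r2 := Runs.instr (O := O) (M := Mem.ofList [(n : ℤ), (a : ℤ), (j : ℤ), (b.toNat : ℤ),
      (m : ℤ), 2, 2 ^ j, ((a.testBit j).toNat : ℤ)]) (T := 10 * s + 20) (.query 0 1 [5, 2, 3, 7] 4) (by
        change 1 + bitLens [2, (j : ℤ), (b.toNat : ℤ), ((a.testBit j).toNat : ℤ)] + bitLen (m : ℤ) +
          ((m : ℕ) : ℤ).toNat + bitLen (productLoc O a j b ((m : ℤ).toNat)).1 +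
          bitLen (productLoc O a j b ((m : ℤ).toNat)).2 ≤ _
        rw [Int.toNat_natCast]
        have : bitLen 2 ≤ 2 := by decide
        simp only [bitLens, List.map_cons, List.map_nil, List.sum_cons, List.sum_nil]
        omega)
    exact ((r0.seq_pure (r1.seq_pure r2)).computes_pure rfl (by
      simp [Instr.run, Mem.ofList, productLoc, List.range_succ])).mono le_rfl
  · fun_prop

theorem exists_localBy_product : ∃ (L : Prog) (T : ℕ → ℕ), PolyB T ∧ ∀ (n : ℕ) (O : Oracle)
    (U : Fin n → Matrix.unitaryGroup Bool ℂ) (u v : ℝ), O.Approximates (productParams u v U) →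
    LocalBy L T O (productBasis U) (productLoc O) := by
  obtain ⟨L, T, hT, hL⟩ := exists_productLoc
  exact ⟨L, T, hT, fun n O U u v hO =>
    ⟨fun a _ j hj b m => dyadic_productLoc_sub_le hO hj b m, hL n O U u v hO⟩⟩

/-! ### The Fourier basis -/

/-- The root of unity `exp (2 π i r / 2 ^ n)`. -/
noncomputable def rootPow (n r : ℕ) : ℂ := Complex.exp (2 * Real.pi * Complex.I * r / 2 ^ n)

theorem rootPow_add (n r r' : ℕ) : rootPow n (r + r') = rootPow n r * rootPow n r' := by
  rw [rootPow, rootPow, rootPow, ← Complex.exp_add]; congr 1; push_cast; ring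

theorem rootPow_zero (n : ℕ) : rootPow n 0 = 1 := by simp [rootPow]

theorem rootPow_two_pow_mul (n q : ℕ) : rootPow n (2 ^ n * q) = 1 := by
  rw [rootPow, Complex.exp_eq_one_iff]
  exact ⟨q, by push_cast; field_simp⟩

theorem rootPow_mul_two (n r : ℕ) : rootPow (n + 1) (2 * r) = rootPow n r := by
  rw [rootPow, rootPow]; congr 1; push_cast; rw [pow_succ]; field_simp

theorem rootPow_half (n : ℕ) : rootPow (n + 1) (2 ^ n) = -1 := by
  rw [rootPow, ← Complex.exp_pi_mul_I]; congr 1; push_cast; rw [pow_succ]; field_simp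

theorem norm_rootPow (n r : ℕ) : ‖rootPow n r‖ = 1 := by
  rw [rootPow, show (2 * Real.pi * Complex.I * r / 2 ^ n : ℂ) =
    ((2 * Real.pi * r / 2 ^ n : ℝ) : ℂ) * Complex.I by push_cast; ring]
  exact Complex.norm_exp_ofReal_mul_I _

theorem rootPow_sum (n : ℕ) {ι : Type*} (s : Finset ι) (f : ι → ℕ) :
    rootPow n (∑ i ∈ s, f i) = ∏ i ∈ s, rootPow n (f i) := by
  induction s using Finset.cons_induction with
  | empty => simp [rootPow_zero]
  | cons a s ha ih => rw [sum_cons, prod_cons, rootPow_add, ih]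

/-- The amplitude of the value `b` of qubit `j` in the Fourier basis vector with the label `a`. -/
noncomputable def fourierAmp (n a j : ℕ) (b : Bool) : ℂ :=
  ((1 / Real.sqrt 2 : ℝ) : ℂ) * rootPow n (b.toNat * a * 2 ^ j)

theorem fourierAmp_false (n a j : ℕ) : fourierAmp n a j false = ((1 / Real.sqrt 2 : ℝ) : ℂ) := by
  simp [fourierAmp, rootPow_zero]

theorem fourierAmp_true (n a j : ℕ) :
    fourierAmp n a j true = ((1 / Real.sqrt 2 : ℝ) : ℂ) * rootPow n (a * 2 ^ j) := by
  simp [fourierAmp]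

theorem norm_fourierAmp (n a j : ℕ) (b : Bool) : ‖fourierAmp n a j b‖ ^ 2 = 1 / 2 := by
  rw [fourierAmp, norm_mul, norm_rootPow, mul_one, Complex.norm_real, Real.norm_eq_abs, sq_abs,
    div_pow, one_pow, Real.sq_sqrt (by norm_num)]

/-- The amplitudes of qubit `j` only depend on the first `n - j` binary digits of the label. -/
theorem fourierAmp_add (n a j q : ℕ) (hj : j ≤ n) (b : Bool) :
    fourierAmp n (a + 2 ^ (n - j) * q) j b = fourierAmp n a j b := by
  rw [fourierAmp, fourierAmp, show b.toNat * (a + 2 ^ (n - j) * q) * 2 ^ j =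
    b.toNat * a * 2 ^ j + (2 ^ (n - j) * 2 ^ j) * (b.toNat * q) by ring, ← pow_add,
    Nat.sub_add_cancel hj, rootPow_add, rootPow_two_pow_mul, mul_one]

theorem fourierAmp_mod (n a j : ℕ) (hj : j ≤ n) (b : Bool) :
    fourierAmp n (a % 2 ^ (n - j)) j b = fourierAmp n a j b := by
  conv_rhs => rw [← Nat.mod_add_div a (2 ^ (n - j)), fourierAmp_add _ _ _ _ hj]

theorem fourierAmp_orth {n k : ℕ} (a : ℕ) (hk : k < n) :
    conj (fourierAmp n a (n - k - 1) false) * fourierAmp n (a + 2 ^ k) (n - k - 1) false +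
    conj (fourierAmp n a (n - k - 1) true) * fourierAmp n (a + 2 ^ k) (n - k - 1) true = 0 := by
  have h1 : fourierAmp n (a + 2 ^ k) (n - k - 1) true = -fourierAmp n a (n - k - 1) true := by
    obtain ⟨N, rfl⟩ := Nat.exists_eq_add_of_lt hk
    rw [fourierAmp_true, fourierAmp_true, add_mul, ← pow_add,
      show k + (k + N + 1 - k - 1) = k + N by omega, rootPow_add, rootPow_half]
    ring
  rw [h1, fourierAmp_false, fourierAmp_false, ← fourierAmp_false n a (n - k - 1), mul_neg,
    ← Complex.normSq_eq_conj_mul_self, ← Complex.normSq_eq_conj_mul_self,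
    Complex.normSq_eq_norm_sq, Complex.normSq_eq_norm_sq, norm_fourierAmp, norm_fourierAmp]
  simp

theorem mod_two_pow_succ_eq (x k : ℕ) :
    x % 2 ^ (k + 1) = x % 2 ^ k ∨ x % 2 ^ (k + 1) = x % 2 ^ k + 2 ^ k := by
  rw [pow_succ, Nat.mod_mul]
  rcases Nat.mod_two_eq_zero_or_one (x / 2 ^ k) with h | h <;> rw [h]
  · left; ring
  · right; ring

/-- Node `a` of level `k` stands for the labels with the same `k` lowest digits as `a < 2 ^ k`. -/
noncomputable def fourierBasis (n : ℕ) : ProductBasis n where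
  g := fourierAmp n
  step k := 2 ^ k
  node k a := a < 2 ^ k
  norm_g a j := by rw [norm_fourierAmp, norm_fourierAmp]; norm_num
  node_zero := by simp
  node_left := fun _ h => h.trans (Nat.pow_lt_pow_right (by norm_num) (Nat.lt_succ_self _))
  node_right := fun _ h => by rw [pow_succ]; omega
  node_lt := fun hk h => h.trans_le (Nat.pow_le_pow_right (by norm_num) hk)
  step_lt := fun hk => Nat.pow_lt_pow_right (by norm_num) hk
  g_right := by
    intro k a j hk _ hj hjn b
    rw [show 2 ^ k = 2 ^ (n - j) * 2 ^ (k - (n - j)) by rw [← pow_add]; congr 1; omega]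
    exact fourierAmp_add _ _ _ _ hjn.le b
  orth := fun hk _ => fourierAmp_orth _ hk
  exists_path := by
    intro x hx
    exact ⟨fun k => x % 2 ^ k, by simp [Nat.mod_one], Nat.mod_eq_of_lt hx,
      fun k _ => mod_two_pow_succ_eq x k⟩
  orth_vec := by
    intro x y hx hy hxy
    -- Take the lowest digit in which `x` and `y` differ.
    have hex : ∃ k, x % 2 ^ k ≠ y % 2 ^ k :=
      ⟨n, by rwa [Nat.mod_eq_of_lt hx, Nat.mod_eq_of_lt hy]⟩
    obtain ⟨k, hk⟩ : ∃ k, Nat.find hex = k + 1 := Nat.exists_eq_succ_of_ne_zero fun h => by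
      have := Nat.find_spec hex
      rw [h] at this
      simp [Nat.mod_one] at this
    have h1 := Nat.find_spec hex
    rw [hk] at h1
    have h2 : x % 2 ^ k = y % 2 ^ k := by
      by_contra h; have := Nat.find_min' hex h; omega
    have hkn : k < n := by
      have := Nat.find_min' hex (m := n) (by rwa [Nat.mod_eq_of_lt hx, Nat.mod_eq_of_lt hy])
      omega
    refine ⟨n - k - 1, by omega, ?_⟩
    have h3 : ∀ z b, fourierAmp n z (n - k - 1) b = fourierAmp n (z % 2 ^ (k + 1)) (n - k - 1) b := by
      intro z b
      rw [← fourierAmp_mod n z _ (by omega), show n - (n - k - 1) = k + 1 by omega]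
    have h4 := fourierAmp_orth (y % 2 ^ k) hkn
    rw [h3 x, h3 y, h3 x, h3 y]
    rcases mod_two_pow_succ_eq x k with hx' | hx' <;> rcases mod_two_pow_succ_eq y k with hy' | hy'
    · exact absurd (by rw [hx', hy', h2]) h1
    · rw [hx', hy', h2]; exact h4
    · have := congrArg conj h4
      simp only [map_add, map_mul, Complex.conj_conj, map_zero] at this
      rw [hx', hy', h2, ← this]
      ring
    · exact absurd (by rw [hx', hy', h2]) h1

theorem isBasisOf_fourierVec (n : ℕ) : IsBasisOf (fourierBasis n) fourierVec := by
  intro x y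
  have h1 : (fourierVec x) y = ((1 / Real.sqrt (2 ^ n) : ℝ) : ℂ) * rootPow n (y.toNat * x.toNat) := by
    change _ * _ = _ * _
    rw [rootPow]
    push_cast
    rfl
  rw [h1, ProductBasis.amp, prodAmp, prod_range]
  simp only [fourierBasis, Nat.sub_self, zero_add, Bits.testBit_toNat, fourierAmp]
  rw [prod_mul_distrib, ← rootPow_sum, prod_const, card_univ, Fintype.card_fin]
  congr 1
  · rw [← Complex.ofReal_pow, div_pow, one_pow, Real.sqrt_eq_rpow, Real.sqrt_eq_rpow,
      ← Real.rpow_natCast, ← Real.rpow_natCast, ← Real.rpow_mul (by norm_num),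
      ← Real.rpow_mul (by norm_num), mul_comm]
  · rw [Bits.toNat_eq y, sum_mul]
    congr 1
    exact sum_congr rfl fun j _ => by ring

/-! ### Approximating roots of unity -/

/-- The half-angle formulas. -/
theorem re_rootPow_succ_sq (i : ℕ) :
    (rootPow (i + 1) 1).re ^ 2 = (1 + (rootPow i 1).re) / 2 ∧
    (rootPow (i + 1) 1).im ^ 2 = (1 - (rootPow i 1).re) / 2 := by
  have h1 : rootPow i 1 = rootPow (i + 1) 1 * rootPow (i + 1) 1 := by
    rw [← rootPow_add, ← rootPow_mul_two]
  have h2 := norm_rootPow (i + 1) 1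
  have h3 : (rootPow (i + 1) 1).re ^ 2 + (rootPow (i + 1) 1).im ^ 2 = 1 := by
    have := Complex.normSq_eq_norm_sq (rootPow (i + 1) 1)
    rw [h2, Complex.normSq_apply] at this
    linarith
  rw [h1, Complex.mul_re]
  constructor <;> linarith

theorem rootPow_one_one : rootPow 1 1 = -1 := by simpa using rootPow_half 0

theorem rootPow_re_im_nonneg (i : ℕ) :
    0 ≤ (rootPow (i + 2) 1).re ∧ 0 ≤ (rootPow (i + 2) 1).im := by
  have h1 : rootPow (i + 2) 1 = Complex.exp ((2 * Real.pi / 2 ^ (i + 2) : ℝ) * Complex.I) := by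
    rw [rootPow]; congr 1; push_cast; ring
  have h2 : 2 * Real.pi / 2 ^ (i + 2) ≤ Real.pi / 2 := by
    rw [div_le_div_iff₀ (by positivity) (by norm_num), pow_add]
    have : (1 : ℝ) ≤ 2 ^ i := one_le_pow₀ (by norm_num)
    nlinarith [Real.pi_pos]
  have h3 : 0 ≤ 2 * Real.pi / 2 ^ (i + 2) := by positivity
  rw [h1, Complex.exp_ofReal_mul_I_re, Complex.exp_ofReal_mul_I_im]
  exact ⟨Real.cos_nonneg_of_neg_pi_div_two_le_of_le (by linarith [Real.pi_pos]) h2,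
    Real.sin_nonneg_of_nonneg_of_le_pi h3 (by linarith [Real.pi_pos])⟩

/-- `cosSin L i` approximates `2 ^ (2 * L + 1)` times the cosine and the sine of
`2 π / 2 ^ (i + 1)`, by the half-angle formulas. -/
def cosSin (L : ℕ) : ℕ → ℤ × ℤ
  | 0 => (-2 ^ (2 * L + 1), 0)
  | i + 1 => (Nat.sqrt (2 ^ (2 * L) * (2 ^ (2 * L + 1) + (cosSin L i).1)).toNat,
      Nat.sqrt (2 ^ (2 * L) * (2 ^ (2 * L + 1) - (cosSin L i).1)).toNat)

theorem sqrt_toNat_le {L : ℕ} {v : ℤ} (h : v ≤ 2 ^ (2 * L) * (2 * 2 ^ (2 * L + 1))) :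
    (Nat.sqrt v.toNat : ℤ) ≤ 2 ^ (2 * L + 1) := by
  have h1 : v.toNat ≤ 2 ^ (2 * L + 1) * 2 ^ (2 * L + 1) := by
    zify
    rw [Int.ofNat_toNat]
    refine max_le (h.trans (le_of_eq ?_)) (by positivity)
    rw [pow_succ]; ring
  have h2 := Nat.sqrt_le_sqrt h1
  rw [Nat.sqrt_eq] at h2
  exact_mod_cast h2

theorem abs_cosSin_le (L i : ℕ) : |(cosSin L i).1| ≤ 2 ^ (2 * L + 1) ∧
    |(cosSin L i).2| ≤ 2 ^ (2 * L + 1) := by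
  induction i with
  | zero => simp [cosSin]
  | succ i ih =>
    have h := abs_le.1 ih.1
    have hp : (0 : ℤ) < 2 ^ (2 * L) := by positivity
    simp only [cosSin, Nat.abs_cast]
    exact ⟨sqrt_toNat_le (mul_le_mul_of_nonneg_left (by linarith) hp.le),
      sqrt_toNat_le (mul_le_mul_of_nonneg_left (by linarith) hp.le)⟩

theorem abs_sqrt_sub_sqrt_le {a b : ℝ} (ha : 0 ≤ a) (hb : 0 ≤ b) :
    |Real.sqrt a - Real.sqrt b| ≤ Real.sqrt |a - b| := by
  refine Real.le_sqrt_of_sq_le ?_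
  have h1 := Real.sq_sqrt ha
  have h2 := Real.sq_sqrt hb
  have h3 : |a - b| = |Real.sqrt a - Real.sqrt b| * (Real.sqrt a + Real.sqrt b) := by
    rw [← abs_of_nonneg (add_nonneg (Real.sqrt_nonneg a) (Real.sqrt_nonneg b)), ← abs_mul]
    congr 1; linarith
  rw [h3, pow_two]
  refine mul_le_mul_of_nonneg_left ?_ (abs_nonneg _)
  rw [abs_le]
  constructor <;> linarith [Real.sqrt_nonneg a, Real.sqrt_nonneg b]

/-- On the scale `2 ^ (2 * L + 1)`, half of a number has as its square root the integer square root
of the product with `2 ^ (2 * L)`, up to one unit. -/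
theorem abs_natSqrt_div_sub_le {L : ℕ} {u : ℤ} (hu : 0 ≤ u) :
    |(Nat.sqrt (2 ^ (2 * L) * u).toNat : ℝ) / 2 ^ (2 * L + 1) -
      Real.sqrt ((u : ℝ) / 2 ^ (2 * L + 1) / 2)| ≤ 1 / 2 ^ (2 * L + 1) := by
  set v := (2 ^ (2 * L) * u).toNat with hv
  have hq : (0 : ℝ) < 2 ^ (2 * L + 1) := by positivity
  have h1 : (v : ℤ) = 2 ^ (2 * L) * u := Int.toNat_of_nonneg (by positivity)
  have h2 : (v : ℝ) = 2 ^ (2 * L) * u := by exact_mod_cast congrArg (Int.cast (R := ℝ)) h1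
  have h3 : Real.sqrt ((u : ℝ) / 2 ^ (2 * L + 1) / 2) = Real.sqrt v / 2 ^ (2 * L + 1) := by
    rw [h2, eq_div_iff hq.ne', ← Real.sqrt_sq hq.le, ← Real.sqrt_mul' _ (by positivity)]
    congr 1
    rw [Real.sqrt_sq hq.le, pow_succ]
    field_simp
  rw [h3, ← sub_div, abs_div, abs_of_pos hq]
  refine div_le_div_of_nonneg_right ?_ hq.le
  have h4 := Real.nat_sqrt_le_real_sqrt (a := v)
  have h5 := Real.real_sqrt_le_nat_sqrt_succ (a := v)
  rw [abs_le]
  constructor <;> linarith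

/-- The errors of the cosines do not accumulate: from the second step on, the cosines
`√((1 + c) / 2)` are at least `√(1 / 2)`, where the square root contracts errors. -/
theorem abs_cosSin_fst_sub_le (L i : ℕ) :
    |((cosSin L i).1 : ℝ) / 2 ^ (2 * L + 1) - (rootPow (i + 1) 1).re| ≤ 4 / 2 ^ (2 * L + 1) := by
  have hq : (0 : ℝ) < 2 ^ (2 * L + 1) := by positivity
  rcases i with _ | i
  · rw [zero_add, rootPow_one_one]
    simp [cosSin]
    positivity
  induction i with
  | zero =>
    have h := (re_rootPow_succ_sq 1).1
    rw [rootPow_one_one] at h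
    simp at h
    have h1 : (cosSin L (0 + 1)).1 = 0 := by simp [cosSin]
    rw [h1, show (0 + 1 + 1) = 1 + 1 by rfl, h]
    simp only [Int.cast_zero, zero_div, sub_self, abs_zero]
    positivity
  | succ i ih =>
    obtain ⟨h1, -⟩ := re_rootPow_succ_sq (i + 1 + 1)
    have h2 := (rootPow_re_im_nonneg i).1
    have h3 := (rootPow_re_im_nonneg (i + 1)).1
    have hC := abs_le.1 (abs_cosSin_le L (i + 1)).1
    set c := (rootPow (i + 1 + 1) 1).re with hc
    set C := (cosSin L (i + 1)).1 with hC'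
    have h4 := abs_natSqrt_div_sub_le (L := L) (u := 2 ^ (2 * L + 1) + C) (by linarith)
    rw [show (cosSin L (i + 1 + 1)).1 = (Nat.sqrt (2 ^ (2 * L) * (2 ^ (2 * L + 1) + C)).toNat : ℤ)
      from rfl, Int.cast_natCast]
    have h5 : ((2 ^ (2 * L + 1) + C : ℤ) : ℝ) / 2 ^ (2 * L + 1) / 2 =
        (1 + C / 2 ^ (2 * L + 1)) / 2 := by
      push_cast; rw [add_div, div_self hq.ne']
    rw [h5] at h4
    have h6 : (rootPow (i + 1 + 1 + 1) 1).re = Real.sqrt ((1 + c) / 2) := by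
      rw [← h1, Real.sqrt_sq h3]
    rw [h6]
    set a := (1 + (C : ℝ) / 2 ^ (2 * L + 1)) / 2 with ha
    set b := (1 + c) / 2 with hb
    have ha0 : 0 ≤ a := by
      have : (0 : ℝ) ≤ ((2 ^ (2 * L + 1) + C : ℤ) : ℝ) :=
        Int.cast_nonneg (by linarith)
      rw [← h5]; positivity
    have hab : |a - b| ≤ 2 / 2 ^ (2 * L + 1) := by
      rw [ha, hb, show (1 + (C : ℝ) / 2 ^ (2 * L + 1)) / 2 - (1 + c) / 2 =
        ((C : ℝ) / 2 ^ (2 * L + 1) - c) / 2 by ring, abs_div, abs_of_pos (by norm_num : (0:ℝ) < 2)]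
      rw [div_le_iff₀ (by norm_num)]
      refine ih.trans (le_of_eq ?_)
      ring
    have hsb : 7 / 10 ≤ Real.sqrt b := Real.le_sqrt_of_sq_le (by rw [hb]; norm_num; linarith)
    have h7 : |Real.sqrt a - Real.sqrt b| ≤ 3 / 2 ^ (2 * L + 1) := by
      have e1 := Real.sq_sqrt ha0
      have e2 := Real.sq_sqrt (show 0 ≤ b by rw [hb]; linarith)
      have e3 : |a - b| = |Real.sqrt a - Real.sqrt b| * (Real.sqrt a + Real.sqrt b) := by
        rw [← abs_of_nonneg (add_nonneg (Real.sqrt_nonneg a) (Real.sqrt_nonneg b)), ← abs_mul]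
        congr 1; linarith
      have e4 : |Real.sqrt a - Real.sqrt b| * (7 / 10) ≤ |a - b| := by
        rw [e3]
        exact mul_le_mul_of_nonneg_left (by linarith [Real.sqrt_nonneg a]) (abs_nonneg _)
      have e5 : (2 : ℝ) / 2 ^ (2 * L + 1) ≤ 3 / 2 ^ (2 * L + 1) * (7 / 10) := by
        rw [div_mul_eq_mul_div]; gcongr; norm_num
      linarith
    calc _ ≤ _ := abs_sub_le _ (Real.sqrt a) _
      _ ≤ 1 / 2 ^ (2 * L + 1) + 3 / 2 ^ (2 * L + 1) := add_le_add h4 h7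
      _ = _ := by ring

/-- A sine is computed from one cosine, by a square root near zero in the worst case, which costs
half of the accuracy. -/
theorem abs_cosSin_snd_sub_le (L i : ℕ) :
    |((cosSin L i).2 : ℝ) / 2 ^ (2 * L + 1) - (rootPow (i + 1) 1).im| ≤
      1 / 2 ^ (2 * L + 1) + 1 / 2 ^ L := by
  have hq : (0 : ℝ) < 2 ^ (2 * L + 1) := by positivity
  rcases i with _ | i
  · rw [zero_add, rootPow_one_one]
    simp [cosSin]
    positivity
  obtain ⟨-, h1⟩ := re_rootPow_succ_sq (i + 1)
  have h3 := (rootPow_re_im_nonneg i).2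
  have hC := abs_le.1 (abs_cosSin_le L i).1
  have ih := abs_cosSin_fst_sub_le L i
  have hc1 : (rootPow (i + 1) 1).re ≤ 1 :=
    (Complex.re_le_norm _).trans_eq (norm_rootPow _ _)
  set c := (rootPow (i + 1) 1).re with hc
  set C := (cosSin L i).1 with hC'
  have h4 := abs_natSqrt_div_sub_le (L := L) (u := 2 ^ (2 * L + 1) - C) (by linarith)
  rw [show (cosSin L (i + 1)).2 = (Nat.sqrt (2 ^ (2 * L) * (2 ^ (2 * L + 1) - C)).toNat : ℤ)
    from rfl, Int.cast_natCast]
  have h5 : ((2 ^ (2 * L + 1) - C : ℤ) : ℝ) / 2 ^ (2 * L + 1) / 2 =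
      (1 - C / 2 ^ (2 * L + 1)) / 2 := by
    push_cast; rw [sub_div, div_self hq.ne']
  rw [h5] at h4
  have h6 : (rootPow (i + 1 + 1) 1).im = Real.sqrt ((1 - c) / 2) := by
    rw [← h1, Real.sqrt_sq h3]
  rw [h6]
  set a := (1 - (C : ℝ) / 2 ^ (2 * L + 1)) / 2 with ha
  set b := (1 - c) / 2 with hb
  have ha0 : 0 ≤ a := by
    have : (0 : ℝ) ≤ ((2 ^ (2 * L + 1) - C : ℤ) : ℝ) :=
      Int.cast_nonneg (by linarith)
    rw [← h5]; positivity
  have hab : |a - b| ≤ (1 / 2 ^ L) ^ 2 := by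
    rw [ha, hb, show (1 - (C : ℝ) / 2 ^ (2 * L + 1)) / 2 - (1 - c) / 2 =
      -(((C : ℝ) / 2 ^ (2 * L + 1) - c) / 2) by ring, abs_neg, abs_div,
      abs_of_pos (by norm_num : (0:ℝ) < 2), div_le_iff₀ (by norm_num)]
    refine ih.trans (le_of_eq ?_)
    rw [div_pow, one_pow, ← pow_mul, pow_succ, mul_comm L 2]
    field_simp
    norm_num
  have h7 : |Real.sqrt a - Real.sqrt b| ≤ 1 / 2 ^ L :=
    (abs_sqrt_sub_sqrt_le ha0 (by rw [hb]; linarith)).trans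
      ((Real.sqrt_le_sqrt hab).trans_eq (Real.sqrt_sq (by positivity)))
  exact (abs_sub_le _ (Real.sqrt a) _).trans (add_le_add h4 h7)

theorem norm_cosSin_sub_le (L i : ℕ) :
    ‖dyadic (cosSin L i).1 (cosSin L i).2 (2 * L + 1) - rootPow (i + 1) 1‖ ≤ 4 / 2 ^ L := by
  refine (Complex.norm_le_abs_re_add_abs_im _).trans ?_
  rw [Complex.sub_re, Complex.sub_im, dyadic_re, dyadic_im]
  refine (add_le_add (abs_cosSin_fst_sub_le L i) (abs_cosSin_snd_sub_le L i)).trans ?_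
  have h1 : (1 : ℝ) / 2 ^ (2 * L + 1) ≤ 1 / 2 ^ L / 2 := by
    rw [div_div, ← pow_succ]
    exact one_div_le_one_div_of_le (by positivity)
      (pow_le_pow_right₀ (by norm_num) (by omega))
  rw [show (4 : ℝ) / 2 ^ (2 * L + 1) = 4 * (1 / 2 ^ (2 * L + 1)) by ring,
    show (4 : ℝ) / 2 ^ L = 4 * (1 / 2 ^ L) by ring]
  have : (0 : ℝ) < 1 / 2 ^ L := by positivity
  linarith

/-! ### Approximating the Fourier amplitudes -/

/-- `phase L n R k` approximates `2 ^ (2 * L + 1)` times `exp (2 π i u / 2 ^ k) / √2`, where `u` is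
the number formed by the highest `k` of the `n` binary digits of `R`. -/
def phase (L n R : ℕ) : ℕ → ℤ × ℤ
  | 0 => (Nat.sqrt (2 ^ (2 * L) * 2 ^ (2 * L + 1)), 0)
  | k + 1 => if R.testBit (n - k - 1) then
      ((gmul (phase L n R k) (cosSin L k)).1 / 2 ^ (2 * L + 1),
        (gmul (phase L n R k) (cosSin L k)).2 / 2 ^ (2 * L + 1))
    else phase L n R k

theorem norm_le_of_abs_re_im_le {z : ℂ} {e : ℝ} (h1 : |z.re| ≤ e) (h2 : |z.im| ≤ e) :
    ‖z‖ ≤ 2 * e := by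
  linarith [Complex.norm_le_abs_re_add_abs_im z]

theorem norm_dyadic_mul_sub_le (a b c d : ℤ) (M : ℕ) :
    ‖dyadic ((a * c - b * d) / 2 ^ M) ((a * d + b * c) / 2 ^ M) M - dyadic a b M * dyadic c d M‖ ≤
      2 * (1 / 2 ^ M) := by
  have hq : (0 : ℝ) < 2 ^ M := by positivity
  have key : ∀ u : ℤ, |((u / 2 ^ M : ℤ) : ℝ) / 2 ^ M - u / 2 ^ M / 2 ^ M| ≤ 1 / 2 ^ M := by
    intro u
    rw [← sub_div, abs_div, abs_of_pos hq]
    refine div_le_div_of_nonneg_right ?_ hq.le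
    have := abs_ediv_sub_div_le u (2 ^ M)
    push_cast at this
    exact this
  apply norm_le_of_abs_re_im_le
  · rw [Complex.sub_re, Complex.mul_re]
    simp only [dyadic_re, dyadic_im]
    convert key (a * c - b * d) using 2
    push_cast; field_simp
  · rw [Complex.sub_im, Complex.mul_im]
    simp only [dyadic_re, dyadic_im]
    convert key (a * d + b * c) using 2
    push_cast; field_simp

theorem one_div_sqrt_two_le_one : 1 / Real.sqrt 2 ≤ 1 := by
  rw [div_le_one (by positivity)]; exact Real.one_le_sqrt.2 (by norm_num)

theorem phase_error_le_one {L n k : ℕ} (hL : n + 7 ≤ L) (hk : k ≤ n) :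
    (1 + 9 * (k : ℝ)) / 2 ^ L ≤ 1 := by
  rw [div_le_one (by positivity)]
  have hk1 : (k : ℝ) ≤ n := by exact_mod_cast hk
  have h1 : (n : ℝ) + 1 ≤ 2 ^ n := by exact_mod_cast Nat.lt_two_pow_self (n := n)
  have h2 : (2 : ℝ) ^ (n + 7) ≤ 2 ^ L := pow_le_pow_right₀ (by norm_num) hL
  rw [pow_add] at h2
  norm_num at h2
  linarith

theorem norm_phase_sub_le {L n : ℕ} (hL : n + 7 ≤ L) (R : ℕ) : ∀ k ≤ n,
    ‖dyadic (phase L n R k).1 (phase L n R k).2 (2 * L + 1) -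
      ((1 / Real.sqrt 2 : ℝ) : ℂ) * rootPow k (R / 2 ^ (n - k))‖ ≤ (1 + 9 * k) / 2 ^ L := by
  have hLL : (2 : ℝ) * (1 / 2 ^ (2 * L + 1)) ≤ 1 / 2 ^ L := by
    rw [pow_succ, mul_one_div, div_mul_eq_div_div_swap, div_self two_ne_zero]
    exact one_div_le_one_div_of_le (by positivity) (pow_le_pow_right₀ (by norm_num) (by omega))
  intro k
  induction k with
  | zero =>
    intro _
    have h := abs_natSqrt_div_sub_le (L := L) (u := 2 ^ (2 * L + 1)) (by positivity)
    have h0 : rootPow 0 (R / 2 ^ (n - 0)) = 1 := by simpa using rootPow_two_pow_mul 0 (R / 2 ^ n)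
    have h1 : (2 ^ (2 * L) * 2 ^ (2 * L + 1) : ℤ).toNat = 2 ^ (2 * L) * 2 ^ (2 * L + 1) := by
      rw [show (2 ^ (2 * L) * 2 ^ (2 * L + 1) : ℤ) = ((2 ^ (2 * L) * 2 ^ (2 * L + 1) : ℕ) : ℤ) by
        push_cast; rfl, Int.toNat_natCast]
    have hp : (0 : ℝ) < 1 / 2 ^ (2 * L + 1) := by positivity
    rw [h1, Int.cast_pow, Int.cast_ofNat, div_self (by positivity),
      Real.sqrt_div zero_le_one, Real.sqrt_one] at h
    refine (Complex.norm_le_abs_re_add_abs_im _).trans ?_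
    rw [h0, mul_one, Complex.sub_re, Complex.sub_im, dyadic_re, dyadic_im, Complex.ofReal_re,
      Complex.ofReal_im]
    simp only [phase, Int.cast_natCast, Int.cast_zero, zero_div, sub_self, abs_zero, add_zero,
      Nat.cast_zero, mul_zero]
    linarith
  | succ k ih =>
    intro hk
    have ih := ih (by omega)
    have hu : R / 2 ^ (n - (k + 1)) = 2 * (R / 2 ^ (n - k)) + (R.testBit (n - k - 1)).toNat := by
      rw [Nat.toNat_testBit, show n - k = n - k - 1 + 1 by omega, pow_succ,
        ← Nat.div_div_eq_div_mul, show n - (k + 1) = n - k - 1 by omega, Nat.add_sub_cancel]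
      omega
    have hd := phase_error_le_one hL (show k ≤ n by omega)
    have hp : (0 : ℝ) ≤ 1 / 2 ^ L := by positivity
    rw [hu, rootPow_add, rootPow_mul_two, phase]
    cases R.testBit (n - k - 1)
    · rw [if_neg (by simp), Bool.toNat_false, rootPow_zero, mul_one]
      refine ih.trans ?_
      push_cast
      gcongr
      linarith
    · rw [if_pos rfl, Bool.toNat_true, ← mul_assoc]
      have h1 := norm_mul_sub_mul_le ih (norm_cosSin_sub_le L k) (by
        rw [norm_mul, norm_rootPow, mul_one, Complex.norm_real, Real.norm_eq_abs,
          abs_of_nonneg (by positivity)]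
        exact one_div_sqrt_two_le_one) (norm_rootPow _ _).le hd
      have h2 := norm_dyadic_mul_sub_le (phase L n R k).1 (phase L n R k).2 (cosSin L k).1
        (cosSin L k).2 (2 * L + 1)
      refine (norm_sub_le_norm_sub_add_norm_sub _ _ _).trans ((add_le_add h2 h1).trans ?_)
      push_cast
      rw [show (1 + 9 * ((k : ℝ) + 1)) / 2 ^ L =
        1 / 2 ^ L + ((1 + 9 * k) / 2 ^ L + 2 * (4 / 2 ^ L)) by ring]
      linarith

theorem bitLen_phase_le {L n : ℕ} (hL : n + 7 ≤ L) (R : ℕ) {k : ℕ} (hk : k ≤ n) :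
    bitLen (phase L n R k).1 ≤ 2 * L + 3 ∧ bitLen (phase L n R k).2 ≤ 2 * L + 3 := by
  have h := norm_phase_sub_le hL R k hk
  set z := ((1 / Real.sqrt 2 : ℝ) : ℂ) * rootPow k (R / 2 ^ (n - k)) with hz
  have hz1 : ‖z‖ ≤ 1 := by
    rw [hz, norm_mul, norm_rootPow, mul_one, Complex.norm_real, Real.norm_eq_abs,
      abs_of_nonneg (by positivity)]
    exact one_div_sqrt_two_le_one
  have h1 := norm_add_le (dyadic (phase L n R k).1 (phase L n R k).2 (2 * L + 1) - z) z
  rw [sub_add_cancel] at h1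
  have h2 := phase_error_le_one hL hk
  have key : ∀ X : ℤ, |(X : ℝ) / 2 ^ (2 * L + 1)| ≤ 2 → bitLen X ≤ 2 * L + 3 := by
    intro X hX
    rw [abs_div, abs_of_pos (by positivity : (0 : ℝ) < 2 ^ (2 * L + 1)),
      div_le_iff₀ (by positivity)] at hX
    rw [bitLen_le_iff]
    have h3 : |X| ≤ 2 * 2 ^ (2 * L + 1) := by exact_mod_cast hX
    have h4 : (0 : ℤ) < 2 ^ (2 * L + 1) := by positivity
    rw [show 2 * L + 3 = 2 * L + 1 + 2 by rfl, pow_add _ _ 2]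
    linarith
  constructor
  · refine key _ (le_trans ?_ (h1.trans (by linarith)))
    rw [← dyadic_re]; exact Complex.abs_re_le_norm _
  · refine key _ (le_trans ?_ (h1.trans (by linarith)))
    rw [← dyadic_im]; exact Complex.abs_im_le_norm _

/-- Rounding from `m + l` to `m` binary digits. -/
theorem abs_round_two_pow_sub_le (X : ℤ) (m l : ℕ) :
    |(((2 * X + 2 ^ l) / (2 * 2 ^ l) : ℤ) : ℝ) / 2 ^ m - X / 2 ^ (m + l)| ≤ 1 / 2 / 2 ^ m := by
  have h1 := Int.mul_ediv_add_emod (2 * X + 2 ^ l) (2 * 2 ^ l)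
  have h2 := Int.emod_nonneg (2 * X + 2 ^ l) (b := 2 * 2 ^ l) (by positivity)
  have h3 := Int.emod_lt_of_pos (2 * X + 2 ^ l) (b := 2 * 2 ^ l) (by positivity)
  set Z := (2 * X + 2 ^ l) / (2 * 2 ^ l : ℤ)
  set r := (2 * X + 2 ^ l) % (2 * 2 ^ l : ℤ)
  have h1' : (2 * 2 ^ l : ℝ) * Z + r = 2 * X + 2 ^ l := by exact_mod_cast h1
  have h2' : (0 : ℝ) ≤ r := by exact_mod_cast h2
  have h3' : (r : ℝ) < 2 * 2 ^ l := by exact_mod_cast h3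
  have hp : (0 : ℝ) < 2 ^ l := by positivity
  rw [pow_add, mul_comm, ← div_div, ← sub_div, abs_div, abs_of_pos (by positivity : (0 : ℝ) < 2 ^ m)]
  refine div_le_div_of_nonneg_right ?_ (by positivity)
  rw [abs_le]
  constructor
  · rw [le_sub_iff_add_le, ← le_sub_iff_add_le', div_le_iff₀ hp]; nlinarith
  · rw [sub_le_iff_le_add, ← sub_le_iff_le_add', le_div_iff₀ hp]; nlinarith

/-- The approximation to `m` binary digits of the amplitude of the value `b` of qubit `j` in the
Fourier basis vector with the label `a`. -/
def fourierLoc (n a j : ℕ) (b : Bool) (m : ℕ) : ℤ × ℤ :=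
  ((2 * (phase (m + n + 7) n (b.toNat * a * 2 ^ j) n).1 + 2 ^ (m + 2 * n + 15)) /
      (2 * 2 ^ (m + 2 * n + 15)),
    (2 * (phase (m + n + 7) n (b.toNat * a * 2 ^ j) n).2 + 2 ^ (m + 2 * n + 15)) /
      (2 * 2 ^ (m + 2 * n + 15)))

theorem dyadic_fourierLoc_sub_le (n a j : ℕ) (b : Bool) (m : ℕ) :
    ‖dyadic (fourierLoc n a j b m).1 (fourierLoc n a j b m).2 m - fourierAmp n a j b‖ ≤
      1 / 2 ^ m := by
  have h := norm_phase_sub_le (L := m + n + 7) (by omega) (b.toNat * a * 2 ^ j) n le_rfl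
  rw [Nat.sub_self, pow_zero, Nat.div_one, show 2 * (m + n + 7) + 1 = m + (m + 2 * n + 15) by ring]
    at h
  rw [fourierLoc, fourierAmp]
  set P := phase (m + n + 7) n (b.toNat * a * 2 ^ j) n
  set z := ((1 / Real.sqrt 2 : ℝ) : ℂ) * rootPow n (b.toNat * a * 2 ^ j)
  have h8 : (1 + 9 * (n : ℝ)) / 2 ^ (m + n + 7) ≤ 1 / 8 / 2 ^ m := by
    rw [div_div, div_le_div_iff₀ (by positivity) (by positivity), pow_add, pow_add]
    have h1 : (n : ℝ) + 1 ≤ 2 ^ n := by exact_mod_cast Nat.lt_two_pow_self (n := n)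
    have h2 : (0 : ℝ) < 2 ^ m := by positivity
    nlinarith
  have hre := (Complex.abs_re_le_norm _).trans (h.trans h8)
  have him := (Complex.abs_im_le_norm _).trans (h.trans h8)
  rw [Complex.sub_re, dyadic_re] at hre
  rw [Complex.sub_im, dyadic_im] at him
  have key : ∀ (X : ℤ) (t : ℝ), |X / 2 ^ (m + (m + 2 * n + 15)) - t| ≤ 1 / 8 / 2 ^ m →
      |(((2 * X + 2 ^ (m + 2 * n + 15)) / (2 * 2 ^ (m + 2 * n + 15)) : ℤ) : ℝ) / 2 ^ m - t| ≤
        5 / 8 * (1 / 2 ^ m) := by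
    intro X t ht
    refine (abs_sub_le _ _ _).trans ((add_le_add (abs_round_two_pow_sub_le X m (m + 2 * n + 15)) ht).trans
      (le_of_eq ?_))
    ring
  have hre := key _ _ hre
  have him := key _ _ him
  refine (Complex.norm_le_sqrt_two_mul_max _).trans ?_
  rw [Complex.sub_re, Complex.sub_im, dyadic_re, dyadic_im]
  have hs : Real.sqrt 2 ≤ 3 / 2 := by rw [Real.sqrt_le_left (by norm_num)]; norm_num
  have hp : (0 : ℝ) < 1 / 2 ^ m := by positivity
  calc _ ≤ 3 / 2 * (5 / 8 * (1 / 2 ^ m)) :=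
        mul_le_mul hs (max_le hre him) (le_max_of_le_left (abs_nonneg _)) (by norm_num)
    _ ≤ _ := by linarith

/-! ### Computing the Fourier amplitudes -/

open Ex Prog in
/-- One half-angle step of `cosSin`. -/
theorem exists_halfAngle : ∃ (A : Prog) (T : ℕ → ℕ), PolyB T ∧ ∀ (O : Oracle) (s L : ℕ) (C : ℤ),
    L ≤ s → |C| ≤ 2 ^ (2 * L + 1) → Computes O A [(L : ℤ), C] 2 (PMF.pure
      [(Nat.sqrt (2 ^ (2 * L) * (2 ^ (2 * L + 1) + C)).toNat : ℤ),
        (Nat.sqrt (2 ^ (2 * L) * (2 ^ (2 * L + 1) - C)).toNat : ℤ)]) (T s) := by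
  obtain ⟨W, TW, hTW, hW⟩ := exists_pow2
  obtain ⟨Q, TQ, hTQ, hQ⟩ := exists_sqrt
  refine ⟨.seq (blk [(3, 2 * var 0)]) (.seq (.call W [3] [2]) (.seq
    (blk [(3, 2 * var 0 + 2 * var 0 + 3), (4, var 2 * (2 * var 2 + var 1)),
      (5, var 2 * (2 * var 2 - var 1))])
    (.seq (.call Q [4, 3] [0]) (.call Q [5, 3] [1])))), ?_⟩
  constructor
  refine ⟨?_, fun O s L C hL hC => ?_⟩
  rotate_left
  · have hC' := abs_le.1 hC
    have hp : (0 : ℤ) < 2 ^ (2 * L) := by positivity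
    have hpp : (2 : ℤ) ^ (2 * L + 1) = 2 * 2 ^ (2 * L) := pow_succ' _ _
    have hq : (2 : ℤ) ^ (4 * L + 3) = 2 ^ (2 * L) * (8 * 2 ^ (2 * L)) := by
      rw [show 4 * L + 3 = 2 * L + 2 * L + 3 by ring, pow_add, pow_add]; ring
    obtain ⟨u, hu⟩ : ∃ u, u = (2 ^ (2 * L) * (2 ^ (2 * L + 1) + C)).toNat := ⟨_, rfl⟩
    obtain ⟨v, hv⟩ : ∃ v, v = (2 ^ (2 * L) * (2 ^ (2 * L + 1) - C)).toNat := ⟨_, rfl⟩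
    have hu' : (u : ℤ) = 2 ^ (2 * L) * (2 ^ (2 * L + 1) + C) := by
      rw [hu, Int.toNat_of_nonneg (mul_nonneg hp.le (by linarith))]
    have hv' : (v : ℤ) = 2 ^ (2 * L) * (2 ^ (2 * L + 1) - C) := by
      rw [hv, Int.toNat_of_nonneg (mul_nonneg hp.le (by linarith))]
    have hu1 : u < 2 ^ (4 * L + 3) := by
      zify
      rw [hu', hq]
      exact mul_lt_mul_of_pos_left (by linarith) hp
    have hv1 : v < 2 ^ (4 * L + 3) := by
      zify
      rw [hv', hq]
      exact mul_lt_mul_of_pos_left (by linarith) hp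
    have hw1 : Nat.sqrt u < 2 ^ (4 * L + 3) := (Nat.sqrt_le_self _).trans_lt hu1
    have c1 := bitLen_natCast_le_of_le hL
    have c2 : bitLen C ≤ 2 * L + 2 := bitLen_le_iff.2 (by rw [pow_succ]; linarith)
    have c3 := bitLen_two_pow (2 * L)
    have c4 := bitLen_natCast_le_of_lt hu1
    have c5 := bitLen_natCast_le_of_lt hv1
    have c6 := bitLen_natCast_le_of_lt hw1
    have c7 := bitLen_natCast_le_of_le (show 2 * L ≤ 2 * s by omega)
    have c8 := bitLen_natCast_le_of_le (show 4 * L + 3 ≤ 4 * s + 3 by omega)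
    rw [← hu, ← hv]
    have l0 : (Mem.ofList [(L : ℤ), C, 0, 0, 0, 0]).BitsLE (4 * s + 3) := by
      simp only [bitsLE_cons, bitsLE_nil, bitLen_zero, and_true]; omega
    have l1 : (Mem.ofList [(L : ℤ), C, 0, ((2 * L : ℕ) : ℤ), 0, 0]).BitsLE (4 * s + 3) := by
      simp only [bitsLE_cons, bitsLE_nil, bitLen_zero, and_true]; omega
    have l2 : (Mem.ofList [(L : ℤ), C, 2 ^ (2 * L), ((2 * L : ℕ) : ℤ), 0, 0]).BitsLE
        (4 * s + 3) := by
      simp only [bitsLE_cons, bitsLE_nil, bitLen_zero, and_true]; omega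
    have l3 : (Mem.ofList [(L : ℤ), C, 2 ^ (2 * L), ((4 * L + 3 : ℕ) : ℤ), (u : ℤ),
        (v : ℤ)]).BitsLE (4 * s + 3) := by
      simp only [bitsLE_cons, bitsLE_nil, and_true]; omega
    have l4 : (Mem.ofList [(Nat.sqrt u : ℤ), C, 2 ^ (2 * L), ((4 * L + 3 : ℕ) : ℤ), (u : ℤ),
        (v : ℤ)]).BitsLE (4 * s + 3) := by
      simp only [bitsLE_cons, bitsLE_nil, and_true]; omega
    have r0 := Runs.listBlk (O := O) (bl := [(3, 2 * var 0)]) l0 (by simp)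
      (l' := [(L : ℤ), C, 0, ((2 * L : ℕ) : ℤ), 0, 0]) (by push_cast; rfl)
    have r1 := (hW O (2 * s) (2 * L) (by omega)).listCall (args := [3]) (rets := [2]) l1 rfl
      (l' := [(L : ℤ), C, 2 ^ (2 * L), ((2 * L : ℕ) : ℤ), 0, 0]) (by simp [Mem.write])
    have r2 := Runs.listBlk (O := O) (bl := [(3, 2 * var 0 + 2 * var 0 + 3),
      (4, var 2 * (2 * var 2 + var 1)), (5, var 2 * (2 * var 2 - var 1))]) l2 (by simp)
      (l' := [(L : ℤ), C, 2 ^ (2 * L), ((4 * L + 3 : ℕ) : ℤ), (u : ℤ), (v : ℤ)]) (by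
        rw [hu', hv', hpp, show ((4 * L + 3 : ℕ) : ℤ) = 2 * L + 2 * L + 3 by push_cast; ring]; rfl)
    have r3 := (hQ O (4 * s + 3) u (4 * L + 3) (by omega) hu1).listCall (args := [4, 3])
      (rets := [0]) l3 rfl (l' := [(Nat.sqrt u : ℤ), C, 2 ^ (2 * L), ((4 * L + 3 : ℕ) : ℤ),
        (u : ℤ), (v : ℤ)]) (by simp [Mem.write])
    have r4 := (hQ O (4 * s + 3) v (4 * L + 3) (by omega) hv1).listCall (args := [5, 3])
      (rets := [1]) l4 rfl (l' := [(Nat.sqrt u : ℤ), (Nat.sqrt v : ℤ), 2 ^ (2 * L),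
        ((4 * L + 3 : ℕ) : ℤ), (u : ℤ), (v : ℤ)]) (by simp [Mem.write])
    exact ((r0.seq_pure (r1.seq_pure (r2.seq_pure (r3.seq_pure r4)))).computes_pure rfl
      rfl).mono le_rfl
  · fun_prop

open Ex Prog in
/-- The program for `phase`. The digits of `R` are read from the highest one, so that the rotation
angles are halved from one to the next. -/
theorem exists_phase : ∃ (A : Prog) (T : ℕ → ℕ), PolyB T ∧ ∀ (O : Oracle) (s n R L : ℕ),
    L ≤ s → n + 7 ≤ L → R < 2 ^ (2 * n) → Computes O A [(n : ℤ), (R : ℤ), (L : ℤ)] 2 (PMF.pure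
      [(phase L n R n).1, (phase L n R n).2]) (T s) := by
  obtain ⟨W, TW, hTW, hW⟩ := exists_pow2
  obtain ⟨Q, TQ, hTQ, hQ⟩ := exists_sqrt
  obtain ⟨H, TH, hTH, hH⟩ := exists_halfAngle
  -- Registers: 0 the number of digits of `R` that remain; 3 the weight of the last digit used; 4
  -- the scale `2 ^ (2 * L + 1)`; 5, 6 the current value of `cosSin`; 7, 8 the current value of `phase`.
  refine ⟨.seq (blk [(9, 2 * var 2 + 1)]) (.seq (.call W [0] [3]) (.seq (.call W [9] [4]) (.seq
    (blk [(9, var 4 / 2 * var 4), (10, 2 * var 2 + 2 * var 2 + 3), (5, 0 - var 4)]) (.seq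
    (.call Q [9, 10] [7]) (.seq (blk [(9, 0), (10, 0)]) (.seq
    (.loop 0 (.seq (blk [(3, var 3 / 2), (9, var 1 / var 3 - var 1 / var 3 / 2 * 2),
      (10, ite (var 9) ((var 7 * var 5 - var 8 * var 6) / var 4) (var 7)),
      (8, ite (var 9) ((var 7 * var 6 + var 8 * var 5) / var 4) (var 8)),
      (7, var 10), (0, var 0 - 1), (9, 0), (10, 0)]) (.call H [2, 5] [5, 6])))
    (blk [(0, var 7), (1, var 8)]))))))), ?_⟩
  constructor
  refine ⟨?_, fun O s n R L hL hnL hR => ?_⟩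
  rotate_left
  · set e : ℕ → List ℤ := fun i => [((n - i : ℕ) : ℤ), (R : ℤ), (L : ℤ), 2 ^ (n - i),
      2 ^ (2 * L + 1), (cosSin L i).1, (cosSin L i).2, (phase L n R i).1, (phase L n R i).2, 0, 0]
      with he
    set e' : ℕ → List ℤ := fun i => [((n - (i + 1) : ℕ) : ℤ), (R : ℤ), (L : ℤ), 2 ^ (n - (i + 1)),
      2 ^ (2 * L + 1), (cosSin L i).1, (cosSin L i).2, (phase L n R (i + 1)).1,
      (phase L n R (i + 1)).2, 0, 0] with he'
    have cR := bitLen_natCast_le_of_lt (hR.trans_le (Nat.pow_le_pow_right (n := 2) (by norm_num)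
      (show 2 * n ≤ 4 * s + 3 by omega)))
    have cL := bitLen_natCast_le_of_le hL
    have cn := fun i => bitLen_natCast_le_of_le (show n - i ≤ s by omega)
    have cp := fun i => (bitLen_two_pow (n - i)).trans (show _ ≤ 4 * s + 3 by omega)
    have cq := (bitLen_two_pow (2 * L + 1)).trans (show _ ≤ 4 * s + 3 by omega)
    have cc : ∀ i, bitLen (cosSin L i).1 ≤ 4 * s + 3 ∧ bitLen (cosSin L i).2 ≤ 4 * s + 3 := by
      intro i
      have h := abs_cosSin_le L i
      have h1 : (0 : ℤ) < 2 ^ (2 * L + 1) := by positivity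
      have h2 : (2 : ℤ) ^ (2 * L + 2) ≤ 2 ^ (4 * s + 3) :=
        pow_le_pow_right₀ (by norm_num) (by omega)
      rw [pow_succ] at h2
      exact ⟨bitLen_le_iff.2 (by linarith), bitLen_le_iff.2 (by linarith)⟩
    have cx := fun i (hi : i ≤ n) => bitLen_phase_le hnL R hi
    have state : ∀ i ≤ n, (Mem.ofList (e i)).BitsLE (4 * s + 3) := by
      intro i hi
      have := cc i; have := cx i hi; have := cn i; have := cp i
      simp only [he, bitsLE_cons, bitsLE_nil, bitLen_zero, and_true]; omega
    have state' : ∀ i < n, (Mem.ofList (e' i)).BitsLE (4 * s + 3) := by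
      intro i hi
      have := cc i; have := cx (i + 1) hi; have := cn (i + 1); have := cp (i + 1)
      simp only [he', bitsLE_cons, bitsLE_nil, bitLen_zero, and_true]; omega
    have cn0 := cn 0
    have cp0 := cp 0
    rw [Nat.sub_zero] at cn0 cp0
    have c7 := bitLen_natCast_le_of_le (show 2 * L + 1 ≤ 4 * s + 3 by omega)
    have c8 := bitLen_natCast_le_of_le (show 4 * L + 3 ≤ 4 * s + 3 by omega)
    have hv : 2 ^ (2 * L) * 2 ^ (2 * L + 1) < 2 ^ (4 * L + 3) := by
      rw [← pow_add]; exact Nat.pow_lt_pow_right (by norm_num) (by omega)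
    obtain ⟨v, hv0⟩ : ∃ v, v = 2 ^ (2 * L) * 2 ^ (2 * L + 1) := ⟨_, rfl⟩
    rw [← hv0] at hv
    have hv' : (v : ℤ) = 2 ^ (2 * L + 1) / 2 * 2 ^ (2 * L + 1) := by
      rw [hv0, show (2 : ℤ) ^ (2 * L + 1) / 2 = 2 ^ (2 * L) by rw [pow_succ]; omega]
      push_cast; rfl
    have c9 := bitLen_natCast_le_of_lt (hv.trans_le (Nat.pow_le_pow_right (n := 2) (by norm_num)
      (show 4 * L + 3 ≤ 4 * s + 3 by omega)))
    have c10 := bitLen_natCast_le_of_lt (((Nat.sqrt_le_self v).trans_lt hv).trans_le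
      (Nat.pow_le_pow_right (n := 2) (by norm_num) (show 4 * L + 3 ≤ 4 * s + 3 by omega)))
    have c11 := (bitLen_neg (2 ^ (2 * L + 1))).trans_le cq
    have l0 : (Mem.ofList [(n : ℤ), (R : ℤ), (L : ℤ), 0, 0, 0, 0, 0, 0, 0, 0]).BitsLE
        (4 * s + 3) := by
      simp only [bitsLE_cons, bitsLE_nil, bitLen_zero, and_true]; omega
    have l1 : (Mem.ofList [(n : ℤ), (R : ℤ), (L : ℤ), 0, 0, 0, 0, 0, 0, ((2 * L + 1 : ℕ) : ℤ),
        0]).BitsLE (4 * s + 3) := by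
      simp only [bitsLE_cons, bitsLE_nil, bitLen_zero, and_true]; omega
    have l2 : (Mem.ofList [(n : ℤ), (R : ℤ), (L : ℤ), 2 ^ n, 0, 0, 0, 0, 0,
        ((2 * L + 1 : ℕ) : ℤ), 0]).BitsLE (4 * s + 3) := by
      simp only [bitsLE_cons, bitsLE_nil, bitLen_zero, and_true]; omega
    have l3 : (Mem.ofList [(n : ℤ), (R : ℤ), (L : ℤ), 2 ^ n, 2 ^ (2 * L + 1), 0, 0, 0, 0,
        ((2 * L + 1 : ℕ) : ℤ), 0]).BitsLE (4 * s + 3) := by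
      simp only [bitsLE_cons, bitsLE_nil, bitLen_zero, and_true]; omega
    have l4 : (Mem.ofList [(n : ℤ), (R : ℤ), (L : ℤ), 2 ^ n, 2 ^ (2 * L + 1), -2 ^ (2 * L + 1), 0,
        0, 0, (v : ℤ), ((4 * L + 3 : ℕ) : ℤ)]).BitsLE (4 * s + 3) := by
      simp only [bitsLE_cons, bitsLE_nil, bitLen_zero, and_true]; omega
    have l5 : (Mem.ofList [(n : ℤ), (R : ℤ), (L : ℤ), 2 ^ n, 2 ^ (2 * L + 1), -2 ^ (2 * L + 1), 0,
        (Nat.sqrt v : ℤ), 0, (v : ℤ), ((4 * L + 3 : ℕ) : ℤ)]).BitsLE (4 * s + 3) := by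
      simp only [bitsLE_cons, bitsLE_nil, bitLen_zero, and_true]; omega
    have r0 := Runs.listBlk (O := O) (bl := [(9, 2 * var 2 + 1)]) l0 (by simp)
      (l' := [(n : ℤ), (R : ℤ), (L : ℤ), 0, 0, 0, 0, 0, 0, ((2 * L + 1 : ℕ) : ℤ), 0])
      (by push_cast; rfl)
    have r1 := (hW O s n (by omega)).listCall (args := [0]) (rets := [3]) l1 rfl
      (l' := [(n : ℤ), (R : ℤ), (L : ℤ), 2 ^ n, 0, 0, 0, 0, 0, ((2 * L + 1 : ℕ) : ℤ), 0])
      (by simp [Mem.write])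
    have r2 := (hW O (2 * s + 1) (2 * L + 1) (by omega)).listCall (args := [9]) (rets := [4]) l2 rfl
      (l' := [(n : ℤ), (R : ℤ), (L : ℤ), 2 ^ n, 2 ^ (2 * L + 1), 0, 0, 0, 0,
        ((2 * L + 1 : ℕ) : ℤ), 0]) (by simp [Mem.write])
    have r3 := Runs.listBlk (O := O) (bl := [(9, var 4 / 2 * var 4),
      (10, 2 * var 2 + 2 * var 2 + 3), (5, 0 - var 4)]) l3 (by simp)
      (l' := [(n : ℤ), (R : ℤ), (L : ℤ), 2 ^ n, 2 ^ (2 * L + 1), -2 ^ (2 * L + 1), 0,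
        0, 0, (v : ℤ), ((4 * L + 3 : ℕ) : ℤ)]) (by
        rw [hv', show ((4 * L + 3 : ℕ) : ℤ) = 2 * L + 2 * L + 3 by push_cast; ring,
          ← zero_sub ((2 : ℤ) ^ (2 * L + 1))]
        rfl)
    have r4 := (hQ O (4 * s + 3) v (4 * L + 3) (by omega) hv).listCall (args := [9, 10])
      (rets := [7]) l4 rfl (l' := [(n : ℤ), (R : ℤ), (L : ℤ), 2 ^ n, 2 ^ (2 * L + 1),
        -2 ^ (2 * L + 1), 0, (Nat.sqrt v : ℤ), 0, (v : ℤ), ((4 * L + 3 : ℕ) : ℤ)])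
      (by simp [Mem.write])
    have r5 := Runs.listBlk (O := O) (bl := [(9, 0), (10, 0)]) l5 (by simp) (l' := e 0) (by
      rw [he, hv0]; rfl)
    have r6 := Runs.loop_pure (O := O) (r := 0) (show n ≤ s by omega) (fun i => Mem.ofList (e i))
      (B := 4 * s + 3) (fun i hi => by simpa [he] using hi) (by simp [he])
      (fun i hi => state i hi 0)
      fun i hi => (Runs.listBlk (O := O) (bl := [(3, var 3 / 2),
        (9, var 1 / var 3 - var 1 / var 3 / 2 * 2),
        (10, ite (var 9) ((var 7 * var 5 - var 8 * var 6) / var 4) (var 7)),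
        (8, ite (var 9) ((var 7 * var 6 + var 8 * var 5) / var 4) (var 8)),
        (7, var 10), (0, var 0 - 1), (9, 0), (10, 0)]) (state i hi.le) (by simp [he])
        (l' := e' i) (by
          have h1 : ((n - (i + 1) : ℕ) : ℤ) = ((n - i : ℕ) : ℤ) - 1 := by omega
          have h2 : (2 : ℤ) ^ (n - (i + 1)) = 2 ^ (n - i) / 2 := by
            rw [show n - i = n - (i + 1) + 1 by omega, pow_succ]; omega
          have h3 : (((R.testBit (n - i - 1)).toNat : ℕ) : ℤ) = (R : ℤ) / (2 ^ (n - i) / 2) -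
              (R : ℤ) / (2 ^ (n - i) / 2) / 2 * 2 := by
            rw [← h2, Nat.toNat_testBit, show n - i - 1 = n - (i + 1) by omega]
            push_cast
            omega
          simp only [he, he', h1, h2, phase]
          change [((n - i : ℕ) : ℤ) - 1, (R : ℤ), (L : ℤ), 2 ^ (n - i) / 2, 2 ^ (2 * L + 1), _, _,
            if 0 < (R : ℤ) / (2 ^ (n - i) / 2) -
              (R : ℤ) / (2 ^ (n - i) / 2) / 2 * 2 then _ else _,
            if 0 < (R : ℤ) / (2 ^ (n - i) / 2) -
              (R : ℤ) / (2 ^ (n - i) / 2) / 2 * 2 then _ else _, 0, 0] = _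
          rw [← h3]
          cases R.testBit (n - i - 1)
          · rfl
          · rfl)).seq_pure
        ((hH O s L (cosSin L i).1 hL (abs_cosSin_le L i).1).listCall (args := [2, 5])
          (rets := [5, 6]) (state' i hi) rfl (l' := e (i + 1)) (by
            simp [he, he', Mem.write, cosSin]))
    have r7 := Runs.listBlk (O := O) (bl := [(0, var 7), (1, var 8)]) (state n le_rfl) (by simp [he])
      rfl
    exact ((r0.seq_pure (r1.seq_pure (r2.seq_pure (r3.seq_pure (r4.seq_pure (r5.seq_pure
      (r6.seq_pure r7))))))).computes_pure rfl rfl).mono le_rfl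
  · fun_prop

open Ex Prog in
/-- The program for `fourierLoc`. -/
theorem exists_fourierLoc : ∃ (A : Prog) (T : ℕ → ℕ), PolyB T ∧ ∀ (O : Oracle) (s n a j : ℕ)
    (b : Bool) (m : ℕ), n ≤ s → m ≤ s → a < 2 ^ n → j < n →
    Computes O A [(n : ℤ), (a : ℤ), (j : ℤ), (b.toNat : ℤ), (m : ℤ)] 2
      (PMF.pure [(fourierLoc n a j b m).1, (fourierLoc n a j b m).2]) (T s) := by
  obtain ⟨W, TW, hTW, hW⟩ := exists_pow2
  obtain ⟨P, TP, hTP, hP⟩ := exists_phase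
  refine ⟨.seq (.call W [2] [5]) (.seq (blk [(6, var 3 * var 1 * var 5), (7, var 4 + var 0 + 7),
    (10, var 4 + 2 * var 0 + 15)]) (.seq (.call P [0, 6, 7] [8, 9]) (.seq (.call W [10] [11])
    (blk [(0, (2 * var 8 + var 11) / (2 * var 11)), (1, (2 * var 9 + var 11) / (2 * var 11))])))),
    ?_⟩
  constructor
  refine ⟨?_, fun O s n a j b m hn hm ha hj => ?_⟩
  rotate_left
  · obtain ⟨R, hR⟩ : ∃ R, R = b.toNat * a * 2 ^ j := ⟨_, rfl⟩
    have hR' : R < 2 ^ (2 * n) := by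
      rw [hR, two_mul n, pow_add]
      refine Nat.mul_lt_mul'' ((Nat.mul_le_mul_right a (Bool.toNat_le b)).trans_lt ?_)
        (Nat.pow_lt_pow_right (by norm_num) hj)
      rwa [one_mul]
    have c1 := bitLen_natCast_le_of_le hn
    have c2 := bitLen_natCast_le_of_lt (ha.trans_le (Nat.pow_le_pow_right (by norm_num) hn))
    have c3 := bitLen_natCast_le_of_le (hj.le.trans hn)
    have c4 := bitLen_bool b
    have c5 := bitLen_natCast_le_of_le hm
    have c6 := (bitLen_two_pow j).trans (show j + 1 ≤ s + 1 by omega)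
    have c7 := bitLen_natCast_le_of_lt (hR'.trans_le (Nat.pow_le_pow_right (n := 2) (by norm_num)
      (show 2 * n ≤ 2 * s by omega)))
    have c8 := bitLen_natCast_le_of_le (show m + n + 7 ≤ 2 * s + 7 by omega)
    have c9 := bitLen_phase_le (show n + 7 ≤ m + n + 7 by omega) R le_rfl
    have c10 := bitLen_natCast_le_of_le (show m + 2 * n + 15 ≤ 3 * s + 15 by omega)
    have c11 := bitLen_two_pow (m + 2 * n + 15)
    set X := phase (m + n + 7) n R n with hX
    have l0 : (Mem.ofList [(n : ℤ), (a : ℤ), (j : ℤ), (b.toNat : ℤ), (m : ℤ), 0, 0, 0, 0, 0, 0,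
        0]).BitsLE (4 * s + 17) := by
      simp only [bitsLE_cons, bitsLE_nil, bitLen_zero, and_true]; omega
    have l1 : (Mem.ofList [(n : ℤ), (a : ℤ), (j : ℤ), (b.toNat : ℤ), (m : ℤ), 2 ^ j, 0, 0, 0, 0, 0,
        0]).BitsLE (4 * s + 17) := by
      simp only [bitsLE_cons, bitsLE_nil, bitLen_zero, and_true]; omega
    have l2 : (Mem.ofList [(n : ℤ), (a : ℤ), (j : ℤ), (b.toNat : ℤ), (m : ℤ), 2 ^ j, (R : ℤ),
        ((m + n + 7 : ℕ) : ℤ), 0, 0, ((m + 2 * n + 15 : ℕ) : ℤ), 0]).BitsLE (4 * s + 17) := by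
      simp only [bitsLE_cons, bitsLE_nil, bitLen_zero, and_true]; omega
    have l3 : (Mem.ofList [(n : ℤ), (a : ℤ), (j : ℤ), (b.toNat : ℤ), (m : ℤ), 2 ^ j, (R : ℤ),
        ((m + n + 7 : ℕ) : ℤ), X.1, X.2, ((m + 2 * n + 15 : ℕ) : ℤ), 0]).BitsLE (4 * s + 17) := by
      simp only [bitsLE_cons, bitsLE_nil, bitLen_zero, and_true]; omega
    have l4 : (Mem.ofList [(n : ℤ), (a : ℤ), (j : ℤ), (b.toNat : ℤ), (m : ℤ), 2 ^ j, (R : ℤ),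
        ((m + n + 7 : ℕ) : ℤ), X.1, X.2, ((m + 2 * n + 15 : ℕ) : ℤ),
        2 ^ (m + 2 * n + 15)]).BitsLE (4 * s + 17) := by
      simp only [bitsLE_cons, bitsLE_nil, and_true]; omega
    have r0 := (hW O s j (by omega)).listCall (args := [2]) (rets := [5]) l0 rfl
      (l' := [(n : ℤ), (a : ℤ), (j : ℤ), (b.toNat : ℤ), (m : ℤ), 2 ^ j, 0, 0, 0, 0, 0, 0])
      (by simp [Mem.write])
    have r1 := Runs.listBlk (O := O) (bl := [(6, var 3 * var 1 * var 5), (7, var 4 + var 0 + 7),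
      (10, var 4 + 2 * var 0 + 15)]) l1 (by simp) (l' := [(n : ℤ), (a : ℤ), (j : ℤ),
      (b.toNat : ℤ), (m : ℤ), 2 ^ j, (R : ℤ), ((m + n + 7 : ℕ) : ℤ), 0, 0,
      ((m + 2 * n + 15 : ℕ) : ℤ), 0]) (by rw [hR]; push_cast; rfl)
    have r2 := (hP O (2 * s + 7) n R (m + n + 7) (by omega) (by omega) hR').listCall
      (args := [0, 6, 7]) (rets := [8, 9]) l2 rfl (l' := [(n : ℤ), (a : ℤ), (j : ℤ),
      (b.toNat : ℤ), (m : ℤ), 2 ^ j, (R : ℤ), ((m + n + 7 : ℕ) : ℤ), X.1, X.2,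
      ((m + 2 * n + 15 : ℕ) : ℤ), 0]) (by simp [Mem.write, hX])
    have r3 := (hW O (3 * s + 15) (m + 2 * n + 15) (by omega)).listCall (args := [10])
      (rets := [11]) l3 rfl (l' := [(n : ℤ), (a : ℤ), (j : ℤ), (b.toNat : ℤ), (m : ℤ), 2 ^ j,
      (R : ℤ), ((m + n + 7 : ℕ) : ℤ), X.1, X.2, ((m + 2 * n + 15 : ℕ) : ℤ),
      2 ^ (m + 2 * n + 15)]) (by simp [Mem.write])
    have r4 := Runs.listBlk (O := O) (bl := [(0, (2 * var 8 + var 11) / (2 * var 11)),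
      (1, (2 * var 9 + var 11) / (2 * var 11))]) l4 (by simp) rfl
    exact ((r0.seq_pure (r1.seq_pure (r2.seq_pure (r3.seq_pure r4)))).computes_pure rfl (by
      rw [fourierLoc, ← hR]; rfl)).mono le_rfl
  · fun_prop

theorem exists_localBy_fourier : ∃ (L : Prog) (T : ℕ → ℕ), PolyB T ∧ ∀ (n : ℕ) (O : Oracle),
    LocalBy L T O (fourierBasis n) (fourierLoc n) := by
  obtain ⟨L, T, hT, hL⟩ := exists_fourierLoc
  exact ⟨L, T, hT, fun n O =>
    ⟨fun a _ j _ b m => dyadic_fourierLoc_sub_le n a j b m, fun s a j b m => hL O s n a j b m⟩⟩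

open Ex Prog in
theorem exists_stepBy_fourier : ∃ (P : Prog) (T : ℕ → ℕ), PolyB T ∧ ∀ (n : ℕ) (O : Oracle),
    StepBy P T O (fourierBasis n) := by
  obtain ⟨W, TW, hTW, hW⟩ := exists_pow2
  refine ⟨.call W [1] [0], ?_⟩
  constructor
  refine ⟨?_, fun n O s k hn hk => ?_⟩
  rotate_left
  · have l0 : (Mem.ofList [(n : ℤ), (k : ℤ)]).BitsLE s := by
      have := bitLen_natCast_le_of_le hn
      have := bitLen_natCast_le_of_le (hk.le.trans hn)
      simp only [bitsLE_cons, bitsLE_nil, and_true]; omega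
    have r0 := (hW O s k (by omega)).listCall (args := [1]) (rets := [0]) l0 rfl
      (l' := [2 ^ k, (k : ℤ)]) (by simp [Mem.write])
    exact (r0.computes_pure rfl (by simp [fourierBasis])).mono le_rfl
  · fun_prop

end CTState

theorem mainTheorem5 (ψ : ∀ n, CTState.QState n) (hψ : CTState.IsCT ψ) :
    -- large weights in the Fourier basis
    (∃ (A : CTState.Prog) (C d : ℕ),
      ∀ (n : ℕ) (c : CTState.Bits n → ℂ), ψ n = ∑ x, c x • CTState.fourierVec x →
      ∀ θ π : ℝ, 0 < θ → 0 < π → π ≤ 1 →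
      ∀ O : CTState.Oracle, O.Approximates (CTState.realParams (1 / θ) (1 / π)) →
        CTState.FindsLargeWeights O A [(n : ℤ)] c θ π
          (C * (1 + n + 1 / θ + Real.log (1 / π)) ^ d)) ∧
    -- single coefficients in the Fourier basis
    (∃ (A : CTState.Prog) (C d : ℕ),
      ∀ (n : ℕ) (c : CTState.Bits n → ℂ), ψ n = ∑ x, c x • CTState.fourierVec x →
      ∀ (x : CTState.Bits n) (ε δ : ℝ), 0 < ε → 0 < δ → δ ≤ 1 →
      ∀ O : CTState.Oracle, O.Approximates (CTState.realParams (1 / ε) (1 / δ)) →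
        CTState.Estimates O A [(n : ℤ), (x.toNat : ℤ)] (c x) ε δ
          (C * (1 + n + 1 / ε + Real.log (1 / δ)) ^ d)) ∧
    -- large weights in product bases
    (∃ (A : CTState.Prog) (C d : ℕ),
      ∀ (n : ℕ) (U : Fin n → Matrix.unitaryGroup Bool ℂ) (c : CTState.Bits n → ℂ),
      ψ n = ∑ x, c x • CTState.productVec U x →
      ∀ θ π : ℝ, 0 < θ → 0 < π → π ≤ 1 →
      ∀ O : CTState.Oracle, O.Approximates (CTState.productParams (1 / θ) (1 / π) U) →
        CTState.FindsLargeWeights O A [(n : ℤ)] c θ π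
          (C * (1 + n + 1 / θ + Real.log (1 / π)) ^ d)) ∧
    -- single coefficients in product bases
    (∃ (A : CTState.Prog) (C d : ℕ),
      ∀ (n : ℕ) (U : Fin n → Matrix.unitaryGroup Bool ℂ) (c : CTState.Bits n → ℂ),
      ψ n = ∑ x, c x • CTState.productVec U x →
      ∀ (x : CTState.Bits n) (ε δ : ℝ), 0 < ε → 0 < δ → δ ≤ 1 →
      ∀ O : CTState.Oracle, O.Approximates (CTState.productParams (1 / ε) (1 / δ) U) →
        CTState.Estimates O A [(n : ℤ), (x.toNat : ℤ)] (c x) ε δ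
          (C * (1 + n + 1 / ε + Real.log (1 / δ)) ^ d)) := by
  obtain ⟨LF, TLF, hTLF, hLF⟩ := CTState.exists_localBy_fourier
  obtain ⟨PF, TPF, hTPF, hPF⟩ := CTState.exists_stepBy_fourier
  obtain ⟨LU, TLU, hTLU, hLU⟩ := CTState.exists_localBy_product
  obtain ⟨PU, TPU, hTPU, hPU⟩ := CTState.exists_stepBy_product
  obtain ⟨A1, C1, d1, h1⟩ := CTState.exists_findsLargeWeights hψ LF PF hTLF hTPF
  obtain ⟨A2, C2, d2, h2⟩ := CTState.exists_estimates hψ LF hTLF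
  obtain ⟨A3, C3, d3, h3⟩ := CTState.exists_findsLargeWeights hψ LU PU hTLU hTPU
  obtain ⟨A4, C4, d4, h4⟩ := CTState.exists_estimates hψ LU hTLU
  exact ⟨
    ⟨A1, C1, d1, fun n c hc θ π hθ hπ hπ1 O hO => h1 n O _ _ _ (hLF n O) (hPF n O)
      (CTState.isBasisOf_fourierVec n) c hc θ π hθ hπ hπ1 (hO [0]) (hO [1])⟩,
    ⟨A2, C2, d2, fun n c hc x ε δ hε hδ hδ1 O hO => h2 n O _ _ _ (hLF n O)
      (CTState.isBasisOf_fourierVec n) c hc x ε δ hε hδ hδ1 (hO [0]) (hO [1])⟩,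
    ⟨A3, C3, d3, fun n U c hc θ π hθ hπ hπ1 O hO => h3 n O _ _ _ (hLU n O U _ _ hO) (hPU n O U)
      (CTState.isBasisOf_productVec U) c hc θ π hθ hπ hπ1 (hO [0]) (hO [1])⟩,
    ⟨A4, C4, d4, fun n U c hc x ε δ hε hδ hδ1 O hO => h4 n O _ _ _ (hLU n O U _ _ hO)
      (CTState.isBasisOf_productVec U) c hc x ε δ hε hδ hδ1 (hO [0]) (hO [1])⟩⟩
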